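/- Conventions. Let $M$ be a smooth finite-dimensional manifold (Hausdorff, second countable, without boundary), let $\pi : E\to M$ be a smooth real vector bundle of finite rank, $E^*$ its dual, and $L=\wedge^{\mathrm{top}}E\to M$. Let $h_t$ be fibre-wise multiplication by $t\in\mathbb R$ on a vector bundle over $M$, acting by pull-back on functions on the total space and on sections of the pull-back of $L$ to the total space. An operator $D$ between such spaces is homogeneous of degree $k$ if $h_t^*D:=h_t^*\circ D\circ h_{1/t}^*=t^kD$ for all $t\neq0$ (for operators with several arguments, $h_{1/t}^*$ is applied to every argument). Functions on $M$ and sections of $L$ are identified with their pull-backs, and $\ell_\varphi\in C^\infty(E)$ is the fibre-wise linear function of $\varphi\in\Gamma(E^*)$. (a) Let $DO_q$ be the space of scalar differential operators of order $\le q$ on $E$ (all $(q+1)$-fold nested commutators with functions vanish). Put $DO_{q,\mathrm{core}}=\{\Delta\in DO_q$ of degree $-q\}$, $DO_{q,\mathrm{lin}}=\{\Delta\in DO_q$ of degree $1-q\}$, $DO_{\mathrm{core}}(E)=\bigoplus_qDO_{q,\mathrm{core}}$ and $DO_{\mathrm{lin}}(E)=\bigoplus_qDO_{q,\mathrm{lin}}$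 (fibre-wise linear, FWL, operators). (b) Let $L_E=\pi^*L\to E$. A symmetric $k$-multivector on $E$ is a symmetric operator $P(f_1,\dots,f_k)$ on $C^\infty(E)$ which is a derivation in each argument. A symmetric $k$-$L_E$-multivector ($k\ge1$) is an operator $D(f_1,\dots,f_{k-1}|s)$, with $f_i\in C^\infty(E)$ and $s\in\Gamma(L_E)$, valued in $\Gamma(L_E)$, symmetric and a derivation in each $f_i$, together with a symmetric $k$-multivector $L_D$ such that $D(f_1,\dots,f_{k-1}|fs)=f\,D(f_1,\dots,f_{k-1}|s)+L_D(f_1,\dots,f_{k-1},f)\,s$; for $k=0$ it is just a function $L_D$. It is core (FWL) if $D$ and $L_D$ are homogeneous of degree $-k$ (of degree $1-k$); $\mathfrak D_{\mathrm{core}}$ and $\mathfrak D_{\mathrm{lin}}$ are the direct sums over $k$. The product and bracket are $$(D_1\cdot D_2)(\cdots|s)=\sum L_{D_1}(\cdots)D_2(\cdots|s)+\sum L_{D_2}(\cdots)D_1(\cdots|s),\qquad \{D_1,D_2\}=D_1\bullet D_2-D_2\bullet D_1,$$ $$(D_1\bullet D_2)(\cdots|s)=\sum D_1(\cdots|D_2(\cdots|s))+\sum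 D_1(\cdots,L_{D_2}(\cdots)|s),$$ with sums over unshuffles of the arguments, $L_{D_1\cdot D_2}(\cdots)=\sum L_{D_1}(\cdots)L_{D_2}(\cdots)$ and $L_{\{D_1,D_2\}}(\cdots)=\sum L_{D_1}(L_{D_2}(\cdots),\cdots)-\sum L_{D_2}(L_{D_1}(\cdots),\cdots)$. (c) $C^\infty_{\mathrm{poly}}(E^*)=\bigoplus_kC^\infty(E^*)_k$, where $f\in C^\infty(E^*)_k$ means $h_t^*f=t^kf$ for all $t\in\mathbb R$. $\mathfrak D_{\mathrm{poly}}(L_{E^*})$ is the space of finite sums of homogeneous derivations of the line bundle $L_{E^*}=E^*\times_ML\to E^*$, a derivation being an $\mathbb R$-linear $D:\Gamma(L_{E^*})\to\Gamma(L_{E^*})$ with a vector field $X_D$ such that $D(fs)=fD(s)+X_D(f)s$. Theorem. The following are Lie-Rinehart algebras: (1) $DO_{\mathrm{lin}}(E)$ over $DO_{\mathrm{core}}(E)$, with left composition, commutator, and anchor $\Delta\mapsto[\Delta,-]$; (2) $\mathfrak D_{\mathrm{lin}}$ over $\mathfrak D_{\mathrm{core}}$, with the product, the bracket, and anchor $D\mapsto\{D,-\}$;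 (3) $\mathfrak D_{\mathrm{poly}}(L_{E^*})$ over $C^\infty_{\mathrm{poly}}(E^*)$, with multiplication, commutator, and anchor $D\mapsto X_D$. There are isomorphisms of Lie-Rinehart algebras $A$ from (1) to (2) and $B$ from (2) to (3), as follows. On the base algebras, $A$ maps $G\in DO_{p,\mathrm{core}}$ to the core multivector of degree $p$ with $L_{A(G)}(f_1,\dots,f_p)=[\cdots[G,f_1],\dots,f_p](1)$, and $B$ maps a core $P$ of degree $k$ to the function in $C^\infty(E^*)_k$ given by $\varphi(x)\mapsto\frac1{k!}L_P(\ell_\varphi,\dots,\ell_\varphi)(0_x)$, for $\varphi\in\Gamma(E^*)$, $x\in M$. For $\Delta\in DO_{\mathrm{lin}}(E)$, $\Delta\in DO_{q,\mathrm{lin}}$ if and only if $A(\Delta)$ is of multivector degree $q$. For $\Delta\in DO_{q,\mathrm{lin}}$, $A(\Delta)$ is the unique FWL symmetric $q$-$L_E$-multivector $D$ with $L_D=\sigma(\Delta)$ and $D(\ell_{\varphi_1},\dots,\ell_{\varphi_{q-1}}|U)=\Phi_\Delta(\varphi_1,\dots,\varphi_{q-1})(U)$ for all $\varphi_i\in\Gamma(E^*)$,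 $U\in\Gamma(L)$ (when $q\ge1$). Here $\sigma(\Delta)(f_1,\dots,f_q)=[\cdots[\Delta,f_1],\dots,f_q](1)$, and $\Phi_\Delta(\varphi_1,\dots,\varphi_{q-1})$ is the derivation of $L$ $$U\mapsto\sigma(\Delta)(\varphi_1,\dots,\varphi_{q-1},-)\,U+\Psi_\Delta(\varphi_1,\dots,\varphi_{q-1})\,U,\qquad \Psi_\Delta(\varphi_1,\dots,\varphi_{q-1})=[\cdots[\Delta,\ell_{\varphi_1}],\dots,\ell_{\varphi_{q-1}}](1)\in C^\infty(M),$$ where $\delta'=\sigma(\Delta)(\varphi_1,\dots,\varphi_{q-1},-)$ is the derivation of $E^*$ with $\ell_{\delta'\varphi}=\sigma(\Delta)(\ell_{\varphi_1},\dots,\ell_{\varphi_{q-1}},\ell_\varphi)$ and symbol $X(f)=\sigma(\Delta)(\ell_{\varphi_1},\dots,\ell_{\varphi_{q-1}},f)$. It acts on $L$ through the derivation $\delta$ of $E$ given by $\langle\delta'\varphi,e\rangle=X\langle\varphi,e\rangle-\langle\varphi,\delta e\rangle$ and the rule $\delta(e_1\wedge\cdots\wedge e_{\mathrm{top}})=\sum_ie_1\wedge\cdots\wedge\delta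 e_i\wedge\cdots\wedge e_{\mathrm{top}}$. For $D\in\mathfrak D_{\mathrm{lin}}$, $D$ is of multivector degree $k$ if and only if $B(D)$ is homogeneous of degree $k-1$. For $D$ of degree $k\ge1$, $B(D)(U)(\varphi(x))=\frac1{(k-1)!}D(\ell_\varphi,\dots,\ell_\varphi|U)(0_x)$ for $U\in\Gamma(L)$, $\varphi\in\Gamma(E^*)$, $x\in M$; for $k=0$, $B(D)(U)=0$. In particular $B\circ A$ is a degree-inverting isomorphism of Lie-Rinehart algebras from FWL differential operators on $E$ (order $q$, degree $1-q$) to polynomial derivations of $E^*\times_M\wedge^{\mathrm{top}}E\to E^*$ (degree $q-1$). -/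

import Mathlib

open scoped Manifold ContDiff Bundle

noncomputable section

namespace FWL

/-! ## Algebra: Lie-Rinehart algebras -/

/-- A (real) Lie-Rinehart algebra: a vector space `L` which is a module over a commutative
algebra `A` and a Lie algebra acting on `A` by derivations through an `A`-linear anchor, such
that the bracket satisfies the Leibniz rule.  The laws are those of Mathlib's
`LieRinehartAlgebra`, with the operations carried as data, so that it can be used on
subspaces of spaces of operators. -/
structure LieRinehart (A L : Type*) [AddCommGroup A] [Module ℝ A]
    [AddCommGroup L] [Module ℝ L] where
  one : A
  mul : A →ₗ[ℝ] A →ₗ[ℝ] A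
  smul : A →ₗ[ℝ] L →ₗ[ℝ] L
  bracket : L →ₗ[ℝ] L →ₗ[ℝ] L
  anchor : L →ₗ[ℝ] A →ₗ[ℝ] A
  one_mul : ∀ a, mul one a = a
  mul_comm : ∀ a b, mul a b = mul b a
  mul_assoc : ∀ a b c, mul (mul a b) c = mul a (mul b c)
  one_smul : ∀ x, smul one x = x
  mul_smul : ∀ a b x, smul (mul a b) x = smul a (smul b x)
  bracket_self : ∀ x, bracket x x = 0
  jacobi : ∀ x y z, bracket x (bracket y z) = bracket (bracket x y) z + bracket y (bracket x z)
  anchor_mul : ∀ x a b, anchor x (mul a b) = mul (anchor x a) b + mul a (anchor x b)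
  anchor_smul : ∀ a x b, anchor (smul a x) b = mul a (anchor x b)
  anchor_bracket : ∀ x y a, anchor (bracket x y) a = anchor x (anchor y a) - anchor y (anchor x a)
  leibniz : ∀ x a y, bracket x (smul a y) = smul (anchor x a) y + smul a (bracket x y)

/-- An isomorphism of Lie-Rinehart algebras, over an isomorphism of the base algebras. -/
structure LieRinehart.Iso {A L A' L' : Type*} [AddCommGroup A] [Module ℝ A]
    [AddCommGroup L] [Module ℝ L] [AddCommGroup A'] [Module ℝ A']
    [AddCommGroup L'] [Module ℝ L'] (S : LieRinehart A L) (S' : LieRinehart A' L') where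
  base : A ≃ₗ[ℝ] A'
  equiv : L ≃ₗ[ℝ] L'
  map_one : base S.one = S'.one
  map_mul : ∀ a b, base (S.mul a b) = S'.mul (base a) (base b)
  map_smul : ∀ a x, equiv (S.smul a x) = S'.smul (base a) (equiv x)
  map_bracket : ∀ x y, equiv (S.bracket x y) = S'.bracket (equiv x) (equiv y)
  map_anchor : ∀ x a, base (S.anchor x a) = S'.anchor (equiv x) (base a)

/-! ## Algebra: differential operators, derivations, symmetric multivectors

Here `C` plays the role of the algebra of smooth functions on a manifold, and `S` that of the
`C`-module of sections of a vector bundle `V`. -/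

section Algebra

variable (C : Type*) [CommRing C] [Algebra ℝ C]
variable (S : Type*) [AddCommGroup S] [Module ℝ S]

/-- The commutator `[Δ, Δ']` of operators. -/
def opComm {W : Type*} [AddCommGroup W] [Module ℝ W] (Δ Δ' : Module.End ℝ W) : Module.End ℝ W :=
  Δ ∘ₗ Δ' - Δ' ∘ₗ Δ

variable {C} in
/-- The nested commutator `[⋯[[Δ, f₁], f₂], ⋯, fₖ]`, functions acting by multiplication. -/
def nestedComm : Module.End ℝ C → List C → Module.End ℝ C
  | Δ, [] => Δ
  | Δ, f :: l => nestedComm (opComm Δ (LinearMap.mulLeft ℝ f)) l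

variable {C} in
lemma nestedComm_add (l : List C) (Δ Δ' : Module.End ℝ C) :
    nestedComm (Δ + Δ') l = nestedComm Δ l + nestedComm Δ' l := by
  induction l generalizing Δ Δ' with
  | nil => rfl
  | cons f l ih =>
    have h : opComm (Δ + Δ') (LinearMap.mulLeft ℝ f)
        = opComm Δ (LinearMap.mulLeft ℝ f) + opComm Δ' (LinearMap.mulLeft ℝ f) := by
      simp only [opComm, LinearMap.add_comp, LinearMap.comp_add]; abel
    simp only [nestedComm, h, ih]

variable {C} in
lemma nestedComm_smul (l : List C) (c : ℝ) (Δ : Module.End ℝ C) :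
    nestedComm (c • Δ) l = c • nestedComm Δ l := by
  induction l generalizing Δ with
  | nil => rfl
  | cons f l ih =>
    have h : opComm (c • Δ) (LinearMap.mulLeft ℝ f)
        = c • opComm Δ (LinearMap.mulLeft ℝ f) := by
      simp only [opComm, LinearMap.smul_comp, LinearMap.comp_smul, smul_sub]
    simp only [nestedComm, h, ih]

variable {C} in
lemma nestedComm_zero (l : List C) : nestedComm (0 : Module.End ℝ C) l = 0 := by
  simpa using nestedComm_smul l 0 (0 : Module.End ℝ C)

/-- Scalar differential operators of order (at most) `q`. -/
def diffOp (q : ℕ) : Submodule ℝ (Module.End ℝ C) where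
  carrier := {Δ | ∀ l : List C, l.length = q + 1 → nestedComm Δ l = 0}
  zero_mem' := fun l _ => nestedComm_zero l
  add_mem' := fun h h' l hl => by rw [nestedComm_add, h l hl, h' l hl, add_zero]
  smul_mem' := fun c _ h l hl => by rw [nestedComm_smul, h l hl, smul_zero]

variable {C} in
/-- The symbol `σ(Δ)` of an operator of order `q`, as an operator on `q` functions:
`σ(Δ)(f₁, …, f_q) = [⋯[Δ, f₁], ⋯, f_q]`.  The right hand side is a differential operator of
order `0`, i.e. the multiplication by a function, which is its value on `1`.  On fewer than
`q` functions, the expression is the function `[⋯[Δ, f₁], ⋯, fₖ](1)`. -/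
def nestedCommOne (Δ : Module.End ℝ C) (l : List C) : C := nestedComm Δ l 1

/-- Pairs `(X, D)` of a derivation `X` of `C` and an operator `D` on `S`. -/
def DerPair : Type _ := Derivation ℝ C C × Module.End ℝ S

/-- Pairs `(P, D)` of an operator `P` on (multisets of) functions, and an operator `D` which maps
(multisets of) functions to operators on `S`. -/
def MultiPair : Type _ := (Multiset C → C) × (Multiset C → Module.End ℝ S)

instance : AddCommGroup (DerPair C S) :=
  inferInstanceAs (AddCommGroup (Derivation ℝ C C × Module.End ℝ S))
instance : Module ℝ (DerPair C S) :=
  inferInstanceAs (Module ℝ (Derivation ℝ C C × Module.End ℝ S))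
instance : AddCommGroup (MultiPair C S) :=
  inferInstanceAs (AddCommGroup ((Multiset C → C) × (Multiset C → Module.End ℝ S)))
instance : Module ℝ (MultiPair C S) :=
  inferInstanceAs (Module ℝ ((Multiset C → C) × (Multiset C → Module.End ℝ S)))

section Pairs

variable {C S}

/-- The first component of a pair `(X, D)`, the symbol. -/
def DerPair.symb (D : DerPair C S) : Derivation ℝ C C := D.1
/-- The second component of a pair `(X, D)`, the operator. -/
def DerPair.op (D : DerPair C S) : Module.End ℝ S := D.2
/-- The first component of a pair `(P, D)`, the symbol. -/
def MultiPair.symb (D : MultiPair C S) : Multiset C → C := D.1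
/-- The second component of a pair `(P, D)`, the operator. -/
def MultiPair.op (D : MultiPair C S) : Multiset C → Module.End ℝ S := D.2

@[simp] lemma DerPair.symb_add (D D' : DerPair C S) : (D + D').symb = D.symb + D'.symb := rfl
@[simp] lemma DerPair.op_add (D D' : DerPair C S) : (D + D').op = D.op + D'.op := rfl
@[simp] lemma DerPair.symb_smul (c : ℝ) (D : DerPair C S) : (c • D).symb = c • D.symb := rfl
@[simp] lemma DerPair.op_smul (c : ℝ) (D : DerPair C S) : (c • D).op = c • D.op := rfl
@[simp] lemma DerPair.symb_zero : (0 : DerPair C S).symb = 0 := rfl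
@[simp] lemma DerPair.op_zero : (0 : DerPair C S).op = 0 := rfl
@[simp] lemma MultiPair.symb_smul (c : ℝ) (D : MultiPair C S) : (c • D).symb = c • D.symb := rfl
@[simp] lemma MultiPair.op_smul (c : ℝ) (D : MultiPair C S) : (c • D).op = c • D.op := rfl

/-- The product `f D` of a function and a derivation. -/
def DerPair.fsmul [Module C S] [IsScalarTower ℝ C S] (f : C) (D : DerPair C S) : DerPair C S :=
  (f • D.symb, f • D.op)

/-- The commutator of derivations. -/
def DerPair.bracket (D D' : DerPair C S) : DerPair C S :=
  (⁅D.symb, D'.symb⁆, opComm D.op D'.op)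

end Pairs

end Algebra

section PairsAdd

variable {C : Type*} [CommRing C] {S : Type*} [AddCommGroup S] [Module ℝ S]

@[simp] lemma MultiPair.symb_add (D D' : MultiPair C S) : (D + D').symb = D.symb + D'.symb := rfl
@[simp] lemma MultiPair.op_add (D D' : MultiPair C S) : (D + D').op = D.op + D'.op := rfl
@[simp] lemma MultiPair.symb_zero : (0 : MultiPair C S).symb = 0 := rfl
@[simp] lemma MultiPair.op_zero : (0 : MultiPair C S).op = 0 := rfl

end PairsAdd

section Algebra

variable (C : Type*) [CommRing C] [Algebra ℝ C]
variable (S : Type*) [AddCommGroup S] [Module ℝ S] [Module C S] [IsScalarTower ℝ C S]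

/-- Derivations of (the vector bundle with module of sections) `S`: pairs `(X, D)` of a
derivation `X` of `C` (a vector field, the symbol of `D`) and an `ℝ`-linear `D : S → S` with
`D (f v) = f D v + X(f) v`. -/
def modDer : Submodule ℝ (DerPair C S) where
  carrier := {D | ∀ (f : C) (v : S), D.op (f • v) = f • D.op v + D.symb f • v}
  zero_mem' := fun f v => by simp
  add_mem' := fun {D D'} h h' f v => by
    have h1 := h f v
    have h2 := h' f v
    simp only [DerPair.op_add, DerPair.symb_add, LinearMap.add_apply, Derivation.add_apply, h1, h2,
      smul_add, add_smul]
    abel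
  smul_mem' := fun c D h f v => by
    have h1 := h f v
    simp only [DerPair.op_smul, DerPair.symb_smul, LinearMap.smul_apply, Derivation.smul_apply, h1,
      smul_add, smul_assoc, smul_comm c f]

/-- Symmetric multivectors (all degrees together): a symmetric multilinear operator on `k`
functions is a function on multisets of `k` functions, and `P : Multiset C → C` collects the
homogeneous components of `P`, the component of degree `k` being the restriction of `P` to
multisets of cardinality `k`.  Each component is an `ℝ`-linear derivation in each of its
arguments, and only finitely many components are non-zero. -/
def symMultivector : Submodule ℝ (Multiset C → C) where
  carrier := {P | (∀ m f g, P ((f + g) ::ₘ m) = P (f ::ₘ m) + P (g ::ₘ m)) ∧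
    (∀ m (c : ℝ) f, P ((c • f) ::ₘ m) = c • P (f ::ₘ m)) ∧
    (∀ m f g, P ((f * g) ::ₘ m) = f * P (g ::ₘ m) + g * P (f ::ₘ m)) ∧
    ∃ N : ℕ, ∀ m, N < m.card → P m = 0}
  zero_mem' := by simp
  add_mem' := by
    rintro P Q ⟨h1, h2, h3, N, h4⟩ ⟨k1, k2, k3, N', k4⟩
    refine ⟨fun m f g => ?_, fun m c f => ?_, fun m f g => ?_, max N N', fun m hm => ?_⟩
    · simp only [Pi.add_apply, h1, k1]; abel
    · simp only [Pi.add_apply, h2, k2, smul_add]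
    · simp only [Pi.add_apply, h3, k3]; ring
    · simp only [Pi.add_apply, h4 m (lt_of_le_of_lt (le_max_left _ _) hm),
        k4 m (lt_of_le_of_lt (le_max_right _ _) hm), add_zero]
  smul_mem' := by
    rintro c P ⟨h1, h2, h3, N, h4⟩
    refine ⟨fun m f g => ?_, fun m d f => ?_, fun m f g => ?_, N, fun m hm => ?_⟩
    · simp only [Pi.smul_apply, h1, smul_add]
    · simp only [Pi.smul_apply, h2, smul_comm c d]
    · simp only [Pi.smul_apply, h3, smul_add, mul_smul_comm]
    · simp only [Pi.smul_apply, h4 m hm, smul_zero]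

/-- Symmetric `V`-multivectors (all degrees together).  A `V`-multivector of degree `k` is an
operator `D(f₁, …, f_{k-1} | v)` with values in sections of `V`, which is symmetric and a
derivation in the `fᵢ`, together with its projection `L_D`, a symmetric `k`-multivector, such
that `D(f₁, …, f_{k-1} | f v) = f D(f₁, …, f_{k-1} | v) + L_D(f₁, …, f_{k-1}, f) v`.
It is encoded as the pair `(L_D, D)`.  In degree `0` there is only `L_D`, a function. -/
def derMultivector :
    Submodule ℝ (MultiPair C S) where
  carrier := {D | D.symb ∈ symMultivector C ∧
    (∀ m f g v, D.op ((f + g) ::ₘ m) v = D.op (f ::ₘ m) v + D.op (g ::ₘ m) v) ∧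
    (∀ m (c : ℝ) f v, D.op ((c • f) ::ₘ m) v = c • D.op (f ::ₘ m) v) ∧
    (∀ m f g v, D.op ((f * g) ::ₘ m) v = f • D.op (g ::ₘ m) v + g • D.op (f ::ₘ m) v) ∧
    (∀ m f v, D.op m (f • v) = f • D.op m v + D.symb (f ::ₘ m) • v) ∧
    ∃ N : ℕ, ∀ m, N < m.card → D.op m = 0}
  zero_mem' := by simp
  add_mem' := by
    rintro D D' ⟨h0, h1, h2, h3, h5, N, h4⟩ ⟨k0, k1, k2, k3, k5, N', k4⟩
    refine ⟨add_mem h0 k0, fun m f g v => ?_, fun m c f v => ?_, fun m f g v => ?_,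
      fun m f v => ?_, max N N', fun m hm => ?_⟩
    · simp only [MultiPair.op_add, Pi.add_apply, LinearMap.add_apply, h1, k1]; abel
    · simp only [MultiPair.op_add, Pi.add_apply, LinearMap.add_apply, h2, k2, smul_add]
    · simp only [MultiPair.op_add, Pi.add_apply, LinearMap.add_apply, h3, k3, smul_add]; abel
    · simp only [MultiPair.op_add, MultiPair.symb_add, Pi.add_apply, LinearMap.add_apply, h5, k5, smul_add,
        add_smul]; abel
    · simp only [MultiPair.op_add, Pi.add_apply, h4 m (lt_of_le_of_lt (le_max_left _ _) hm),
        k4 m (lt_of_le_of_lt (le_max_right _ _) hm), add_zero]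
  smul_mem' := by
    rintro c D ⟨h0, h1, h2, h3, h5, N, h4⟩
    refine ⟨Submodule.smul_mem _ c h0, fun m f g v => ?_, fun m d f v => ?_, fun m f g v => ?_,
      fun m f v => ?_, N, fun m hm => ?_⟩
    · simp only [MultiPair.op_smul, Pi.smul_apply, LinearMap.smul_apply, h1, smul_add]
    · simp only [MultiPair.op_smul, Pi.smul_apply, LinearMap.smul_apply, h2, smul_comm c d]
    · simp only [MultiPair.op_smul, Pi.smul_apply, LinearMap.smul_apply, h3, smul_add,
        smul_comm c f, smul_comm c g]
    · simp only [MultiPair.op_smul, MultiPair.symb_smul, Pi.smul_apply, LinearMap.smul_apply, h5, smul_add,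
        smul_comm c f, smul_assoc]
    · simp only [MultiPair.op_smul, Pi.smul_apply, h4 m hm, smul_zero]

/-- The homogeneous `V`-multivectors of degree `k`. -/
def derMultivectorDeg (k : ℕ) :
    Submodule ℝ (MultiPair C S) where
  carrier := {D | D ∈ derMultivector C S ∧ (∀ m, m.card ≠ k → D.symb m = 0) ∧
    ∀ m, m.card + 1 ≠ k → D.op m = 0}
  zero_mem' := ⟨zero_mem _, by simp, by simp⟩
  add_mem' := by
    rintro D D' ⟨h0, h1, h2⟩ ⟨k0, k1, k2⟩
    exact ⟨add_mem h0 k0, fun m hm => by simp [h1 m hm, k1 m hm],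
      fun m hm => by simp [h2 m hm, k2 m hm]⟩
  smul_mem' := by
    rintro c D ⟨h0, h1, h2⟩
    exact ⟨Submodule.smul_mem _ c h0, fun m hm => by simp [h1 m hm],
      fun m hm => by simp [h2 m hm]⟩

variable {C S}

/-- Symmetric product of multivectors.  The sum over the ways of splitting the multiset of
arguments in two is the sum over unshuffles (terms in which the numbers of arguments do not
match the degrees vanish). -/
def mulFun (P Q : Multiset C → C) (m : Multiset C) : C :=
  (m.antidiagonal.map fun s => P s.1 * Q s.2).sum

/-- Poisson bracket of symmetric multivectors (sum over unshuffles, as above). -/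
def poissonFun (P Q : Multiset C → C) (m : Multiset C) : C :=
  (m.antidiagonal.map fun s => P (Q s.1 ::ₘ s.2) - Q (P s.1 ::ₘ s.2)).sum

/-- The associative product of `V`-multivectors
`(D₁ · D₂)(⋯|v) = ∑ L_{D₁}(⋯) D₂(⋯|v) + ∑ L_{D₂}(⋯) D₁(⋯|v)`. -/
def derMul (D D' : MultiPair C S) :
    MultiPair C S :=
  (mulFun D.symb D'.symb, fun m =>
    (m.antidiagonal.map fun s => D.symb s.1 • D'.op s.2 + D'.symb s.1 • D.op s.2).sum)

/-- The operator
`(D₁ • D₂)(⋯|v) = ∑ D₁(⋯ | D₂(⋯|v)) + ∑ D₁(⋯, L_{D₂}(⋯) | v)`. -/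
def derBullet (D D' : MultiPair C S) (m : Multiset C) :
    Module.End ℝ S :=
  (m.antidiagonal.map fun s => D.op s.1 ∘ₗ D'.op s.2 + D.op (D'.symb s.2 ::ₘ s.1)).sum

/-- The Lie bracket of `V`-multivectors `{D₁, D₂} = D₁ • D₂ - D₂ • D₁`, with projection the
Poisson bracket of the projections. -/
def derBracket (D D' : MultiPair C S) :
    MultiPair C S :=
  (poissonFun D.symb D'.symb, fun m => derBullet D D' m - derBullet D' D m)

end Algebra

/-! ## Geometry -/

section Geometry

variable {EM : Type*} [NormedAddCommGroup EM] [NormedSpace ℝ EM]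
  {M : Type*} [TopologicalSpace M] [ChartedSpace EM M]

/-- Smooth real functions on a manifold. -/
abbrev Smooth {EN : Type*} [NormedAddCommGroup EN] [NormedSpace ℝ EN] {HN : Type*}
    [TopologicalSpace HN] (J : ModelWithCorners ℝ EN HN) (N : Type*) [TopologicalSpace N]
    [ChartedSpace HN N] : Type _ := C^∞⟮J, N; 𝓘(ℝ, ℝ), ℝ⟯

section Pull

variable {EN : Type*} [NormedAddCommGroup EN] [NormedSpace ℝ EN] {HN : Type*}
    [TopologicalSpace HN] {J : ModelWithCorners ℝ EN HN} {N : Type*} [TopologicalSpace N]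
    [ChartedSpace HN N]
  {EN' : Type*} [NormedAddCommGroup EN'] [NormedSpace ℝ EN'] {HN' : Type*}
    [TopologicalSpace HN'] {J' : ModelWithCorners ℝ EN' HN'} {N' : Type*} [TopologicalSpace N']
    [ChartedSpace HN' N']

/-- Pull-back of functions. -/
def pullFun (a : C^∞⟮J', N'; J, N⟯) : Smooth J N →ₗ[ℝ] Smooth J' N' where
  toFun f := ContMDiffMap.comp f a
  map_add' _ _ := rfl
  map_smul' _ _ := rfl

end Pull

section Bundle

variable (F : Type*) [NormedAddCommGroup F] [NormedSpace ℝ F] (E : M → Type*)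
  [∀ x, AddCommGroup (E x)] [∀ x, Module ℝ (E x)] [∀ x, TopologicalSpace (E x)]
  [TopologicalSpace (Bundle.TotalSpace F E)] [FiberBundle F E]

/-- The algebra `C^∞(E)` of smooth functions on the total space of `E`. -/
abbrev TotFun : Type _ := Smooth (𝓘(ℝ, EM).prod 𝓘(ℝ, F)) (Bundle.TotalSpace F E)

/-- The space `Γ(E)` of smooth sections of `E`. -/
abbrev Sec : Type _ := Cₛ^∞⟮𝓘(ℝ, EM); F, E⟯

variable {F E} in
instance secSMul [VectorBundle ℝ F E] : SMul (Smooth 𝓘(ℝ, EM) M) (Sec (EM := EM) F E) where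
  smul f s := ⟨fun x => f x • s x, f.contMDiff.smul_section s.contMDiff⟩

/-- `Γ(E)` is a `C^∞(M)`-module. -/
instance secModule [VectorBundle ℝ F E] :
    Module (Smooth 𝓘(ℝ, EM) M) (Sec (EM := EM) F E) where
  one_smul s := by ext x; exact one_smul ℝ (s x)
  mul_smul f g s := by ext x; exact mul_smul (f x) (g x) (s x)
  smul_zero f := by ext x; exact smul_zero (f x)
  smul_add f s t := by ext x; exact smul_add (f x) (s x) (t x)
  add_smul f g s := by ext x; exact add_smul (f x) (g x) (s x)
  zero_smul s := by ext x; exact zero_smul ℝ (s x)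

instance secTower [VectorBundle ℝ F E] :
    IsScalarTower ℝ (Smooth 𝓘(ℝ, EM) M) (Sec (EM := EM) F E) where
  smul_assoc c f s := by ext x; exact smul_assoc c (f x) (s x)

/-- The bundle projection, as a smooth map. -/
def projMap [VectorBundle ℝ F E] [ContMDiffVectorBundle ∞ F E 𝓘(ℝ, EM)] :
    C^∞⟮𝓘(ℝ, EM).prod 𝓘(ℝ, F), Bundle.TotalSpace F E; 𝓘(ℝ, EM), M⟯ :=
  ⟨fun e => e.proj, Bundle.contMDiff_proj E⟩

/-- The fibre-wise scalar multiplication `h_t`, as a smooth map of the total space. -/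
def scaleMap [VectorBundle ℝ F E] [ContMDiffVectorBundle ∞ F E 𝓘(ℝ, EM)] (t : ℝ) :
    C^∞⟮𝓘(ℝ, EM).prod 𝓘(ℝ, F), Bundle.TotalSpace F E;
      𝓘(ℝ, EM).prod 𝓘(ℝ, F), Bundle.TotalSpace F E⟯ :=
  ⟨fun e => ⟨e.proj, t • e.2⟩, by
    intro e
    have h := (Bundle.contMDiffAt_totalSpace (IB := 𝓘(ℝ, EM)) (F := F) (E := E) (n := ∞)
      (f := fun e : Bundle.TotalSpace F E => e) (x₀ := e)).1 contMDiffAt_id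
    refine Bundle.contMDiffAt_totalSpace.2 ⟨h.1, ?_⟩
    have h2 := contMDiffAt_const (I := 𝓘(ℝ, EM).prod 𝓘(ℝ, F)) (I' := 𝓘(ℝ, ℝ)) (n := ∞)
      (x := e) (c := t) |>.smul h.2
    refine h2.congr_of_eventuallyEq ?_
    have hb : ∀ᶠ y : Bundle.TotalSpace F E in nhds e,
        y.proj ∈ (trivializationAt F E e.proj).baseSet :=
      (FiberBundle.continuous_proj F E).continuousAt.eventually
        ((trivializationAt F E e.proj).open_baseSet.mem_nhds
          (FiberBundle.mem_baseSet_trivializationAt' e.proj))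
    filter_upwards [hb] with y hy
    exact ((trivializationAt F E e.proj).linear ℝ hy).map_smul t y.2⟩

/-- The pull-back `h_t^* f` of functions on the total space. -/
def scaleFun [VectorBundle ℝ F E] [ContMDiffVectorBundle ∞ F E 𝓘(ℝ, EM)] (t : ℝ) :
    TotFun (EM := EM) F E →ₗ[ℝ] TotFun (EM := EM) F E :=
  pullFun (scaleMap F E t)

/-- The pull-back `π^* f` of functions on the base. -/
def projFun [VectorBundle ℝ F E] [ContMDiffVectorBundle ∞ F E 𝓘(ℝ, EM)] :
    Smooth 𝓘(ℝ, EM) M →ₗ[ℝ] TotFun (EM := EM) F E :=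
  pullFun (projMap F E)

/-- Fibre-wise homogeneous polynomial functions of degree `k`. -/
def polyFunDeg [VectorBundle ℝ F E] [ContMDiffVectorBundle ∞ F E 𝓘(ℝ, EM)] (k : ℕ) :
    Submodule ℝ (TotFun (EM := EM) F E) where
  carrier := {f | ∀ t : ℝ, scaleFun F E t f = t ^ k • f}
  zero_mem' := by simp
  add_mem' := fun hf hg t => by rw [map_add, hf t, hg t, smul_add]
  smul_mem' := fun c f hf t => by rw [map_smul, hf t, smul_comm]

/-- Fibre-wise polynomial functions. -/
def polyFun [VectorBundle ℝ F E] [ContMDiffVectorBundle ∞ F E 𝓘(ℝ, EM)] :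
    Submodule ℝ (TotFun (EM := EM) F E) := ⨆ k, polyFunDeg F E k

/-- Scalar differential operators on `E`, of order `q` and of degree `w` with respect to
fibre-wise scaling: `h_t^* Δ = t^w Δ` for all `t ≠ 0`, where `h_t^* Δ = h_t^* ∘ Δ ∘ h_{1/t}^*`. -/
def diffOpDeg [VectorBundle ℝ F E] [ContMDiffVectorBundle ∞ F E 𝓘(ℝ, EM)] (q : ℕ) (w : ℤ) :
    Submodule ℝ (Module.End ℝ (TotFun (EM := EM) F E)) where
  carrier := {Δ | Δ ∈ diffOp (TotFun (EM := EM) F E) q ∧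
    ∀ t : ℝ, t ≠ 0 → scaleFun F E t ∘ₗ Δ ∘ₗ scaleFun F E t⁻¹ = t ^ w • Δ}
  zero_mem' := ⟨zero_mem _, by simp⟩
  add_mem' := fun h h' => ⟨add_mem h.1 h'.1, fun t ht => by
    rw [LinearMap.add_comp, LinearMap.comp_add, h.2 t ht, h'.2 t ht, smul_add]⟩
  smul_mem' := fun c Δ h => ⟨Submodule.smul_mem _ c h.1, fun t ht => by
    rw [LinearMap.smul_comp, LinearMap.comp_smul, h.2 t ht, smul_comm]⟩

/-- Core differential operators of order `q`. -/
def coreDODeg [VectorBundle ℝ F E] [ContMDiffVectorBundle ∞ F E 𝓘(ℝ, EM)] (q : ℕ) :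
    Submodule ℝ (Module.End ℝ (TotFun (EM := EM) F E)) := diffOpDeg F E q (-(q : ℤ))

/-- Core differential operators. -/
def coreDO [VectorBundle ℝ F E] [ContMDiffVectorBundle ∞ F E 𝓘(ℝ, EM)] :
    Submodule ℝ (Module.End ℝ (TotFun (EM := EM) F E)) := ⨆ q, coreDODeg F E q

/-- Fibre-wise linear differential operators of order `q`. -/
def linDODeg [VectorBundle ℝ F E] [ContMDiffVectorBundle ∞ F E 𝓘(ℝ, EM)] (q : ℕ) :
    Submodule ℝ (Module.End ℝ (TotFun (EM := EM) F E)) := diffOpDeg F E q (1 - (q : ℤ))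

/-- Fibre-wise linear differential operators. -/
def linDO [VectorBundle ℝ F E] [ContMDiffVectorBundle ∞ F E 𝓘(ℝ, EM)] :
    Submodule ℝ (Module.End ℝ (TotFun (EM := EM) F E)) := ⨆ q, linDODeg F E q

end Bundle

/-! ### The dual bundle -/

section Dual

variable (F : Type*) [NormedAddCommGroup F] [NormedSpace ℝ F] (E : M → Type*)
  [∀ x, AddCommGroup (E x)] [∀ x, Module ℝ (E x)] [∀ x, TopologicalSpace (E x)]

/-- The fibres of the dual bundle `E^*`. -/
abbrev Dual (x : M) : Type _ := E x →L[ℝ] Bundle.Trivial M ℝ x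

/-- The model fibre of the dual bundle `E^*`. -/
abbrev DualModel : Type _ := F →L[ℝ] ℝ

variable [TopologicalSpace (Bundle.TotalSpace F E)] [FiberBundle F E] [VectorBundle ℝ F E]
  [∀ x, IsTopologicalAddGroup (E x)] [∀ x, ContinuousSMul ℝ (E x)]
variable {F E}

/-- The pairing `⟨φ, e⟩ ∈ C^∞(M)` of a section of `E^*` and a section of `E`. -/
def pairing (φ : Sec (EM := EM) (DualModel F) (Dual E)) (e : Sec (EM := EM) F E) :
    Smooth 𝓘(ℝ, EM) M :=
  ⟨fun x => φ x (e x), by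
    have h := ContMDiff.clm_bundle_apply (F₁ := F) (F₂ := ℝ) (E₁ := E) (E₂ := Bundle.Trivial M ℝ)
      φ.contMDiff e.contMDiff
    intro x
    exact (Bundle.contMDiffAt_section (F := ℝ) (E := Bundle.Trivial M ℝ) x).1 (h x)⟩

/-- The fibre-wise linear function `ℓ_φ` on `E` corresponding to a section `φ` of `E^*`. -/
def ell [ContMDiffVectorBundle ∞ F E 𝓘(ℝ, EM)]
    (φ : Sec (EM := EM) (DualModel F) (Dual E)) : TotFun (EM := EM) F E :=
  ⟨fun e => φ e.proj e.2, by
    have h := ContMDiff.clm_bundle_apply (F₁ := F) (F₂ := ℝ) (E₁ := E) (E₂ := Bundle.Trivial M ℝ)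
      (b := fun e : Bundle.TotalSpace F E => e.proj) (v := fun e => e.2)
      (ϕ := fun e => φ e.proj)
      (φ.contMDiff.comp (Bundle.contMDiff_proj (IB := 𝓘(ℝ, EM)) (n := ∞) E)) contMDiff_id
    intro x
    exact ((Bundle.contMDiffAt_totalSpace (F := ℝ) (E := Bundle.Trivial M ℝ)).1 (h x)).2⟩

end Dual

/-! ### The line bundle `L = ∧^top E` and its pull-backs -/

section Top

variable (F : Type*) [NormedAddCommGroup F] [NormedSpace ℝ F] (E : M → Type*)
  [∀ x, AddCommGroup (E x)] [∀ x, Module ℝ (E x)] [∀ x, TopologicalSpace (E x)]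
  [TopologicalSpace (Bundle.TotalSpace F E)] [FiberBundle F E] [VectorBundle ℝ F E]
variable {EN : Type*} [NormedAddCommGroup EN] [NormedSpace ℝ EN] {HN : Type*}
    [TopologicalSpace HN] (J : ModelWithCorners ℝ EN HN) {N : Type*} [TopologicalSpace N]
    [ChartedSpace HN N]
variable {EN' : Type*} [NormedAddCommGroup EN'] [NormedSpace ℝ EN'] {HN' : Type*}
    [TopologicalSpace HN'] (J' : ModelWithCorners ℝ EN' HN') {N' : Type*} [TopologicalSpace N']
    [ChartedSpace HN' N']

/-- The fibre `∧^top E_x` of `L` at `x`; the top degree is the rank of `E`. -/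
abbrev TopFib (x : M) : Type _ := ⋀[ℝ]^(Module.finrank ℝ F) (E x)

/-- The linear map `∧^top E_x → ∧^top F` induced by the trivialization of `E` around `x₀`. -/
def topTriv (x₀ x : M) : TopFib F E x →ₗ[ℝ] ⋀[ℝ]^(Module.finrank ℝ F) F :=
  exteriorPower.map _ ((trivializationAt F E x₀).linearMapAt ℝ x)

/-- Smooth sections of the pull-back `g^* L` of `L = ∧^top E` along a map `g : N → M`.
Smoothness means smoothness in the local trivializations of `L` induced by those of `E`; a map
with values in the finite dimensional vector space `∧^top F` is smooth if its composition with
every linear functional is smooth. -/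
def topSecSubmodule (g : N → M) : Submodule ℝ (∀ p, TopFib F E (g p)) where
  carrier := {s | ∀ (p₀ : N) (ξ : (⋀[ℝ]^(Module.finrank ℝ F) F) →ₗ[ℝ] ℝ),
    ContMDiffAt J 𝓘(ℝ, ℝ) ∞ (fun p => ξ (topTriv F E (g p₀) (g p) (s p))) p₀}
  zero_mem' := fun p₀ ξ => by
    simp only [Pi.zero_apply, map_zero]; exact contMDiffAt_const
  add_mem' := fun h h' p₀ ξ => by
    simp only [Pi.add_apply, map_add]; exact (h p₀ ξ).add (h' p₀ ξ)
  smul_mem' := fun c s h p₀ ξ => by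
    simp only [Pi.smul_apply, map_smul]
    exact ContMDiffAt.smul (contMDiffAt_const (I := J) (I' := 𝓘(ℝ, ℝ)) (c := c)) (h p₀ ξ)

/-- The space of smooth sections of `g^* L`. -/
def TopSec (g : N → M) : Type _ := topSecSubmodule F E J g

instance (g : N → M) : AddCommGroup (TopSec F E J g) :=
  inferInstanceAs (AddCommGroup (topSecSubmodule F E J g))
instance (g : N → M) : Module ℝ (TopSec F E J g) :=
  inferInstanceAs (Module ℝ (topSecSubmodule F E J g))

variable {F E J}

instance topSecSMul (g : N → M) : SMul (Smooth J N) (TopSec F E J g) where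
  smul f s := ⟨fun p => f p • s.1 p, fun p₀ ξ => by
    simp only [map_smul]; exact f.contMDiff.contMDiffAt.smul (s.2 p₀ ξ)⟩

/-- Sections of `g^* L` form a `C^∞(N)`-module. -/
instance topSecModule (g : N → M) : Module (Smooth J N) (TopSec F E J g) where
  one_smul s := by apply Subtype.ext; funext p; exact one_smul ℝ (s.1 p)
  mul_smul f h s := by apply Subtype.ext; funext p; exact mul_smul (f p) (h p) (s.1 p)
  smul_zero f := by apply Subtype.ext; funext p; exact smul_zero (f p)
  smul_add f s t := by apply Subtype.ext; funext p; exact smul_add (f p) (s.1 p) (t.1 p)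
  add_smul f h s := by apply Subtype.ext; funext p; exact add_smul (f p) (h p) (s.1 p)
  zero_smul s := by apply Subtype.ext; funext p; exact zero_smul ℝ (s.1 p)

instance topSecTower (g : N → M) : IsScalarTower ℝ (Smooth J N) (TopSec F E J g) where
  smul_assoc c f s := by apply Subtype.ext; funext p; exact smul_assoc c (f p) (s.1 p)

variable {J'}

/-- Pull-back of sections of `g^* L` along a smooth map `a : N' → N`. -/
def pullTop (g : N → M) (a : C^∞⟮J', N'; J, N⟯) :
    TopSec F E J g →ₗ[ℝ] TopSec F E J' (fun p => g (a p)) where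
  toFun s := ⟨fun p => s.1 (a p), fun p₀ ξ => (s.2 (a p₀) ξ).comp p₀ a.contMDiff.contMDiffAt⟩
  map_add' _ _ := rfl
  map_smul' _ _ := rfl

/-- An alternating map composed with smooth functions is smooth. -/
lemma contMDiffAt_alternating [FiniteDimensional ℝ F] {n : ℕ} (w : F [⋀^Fin n]→ₗ[ℝ] ℝ)
    (v : Fin n → N → F) (p : N) (hv : ∀ i, ContMDiffAt J 𝓘(ℝ, F) ∞ (v i) p) :
    ContMDiffAt J 𝓘(ℝ, ℝ) ∞ (fun q => w fun i => v i q) p := by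
  classical
  let b := Module.finBasis ℝ F
  have h : (fun q => w fun i => v i q) = fun q => ∑ r : Fin n → Fin (Module.finrank ℝ F),
      (∏ i, b.coord (r i) (v i q)) * w fun i => b (r i) := by
    funext q
    have h1 : (fun i => v i q) = fun i => ∑ j, b.coord j (v i q) • b j := by
      funext i; exact (b.sum_repr (v i q)).symm
    rw [h1]
    change w.toMultilinearMap _ = _
    rw [MultilinearMap.map_sum]
    refine Finset.sum_congr rfl fun r _ => ?_
    rw [MultilinearMap.map_smul_univ, smul_eq_mul]
    simp
  rw [h]
  refine contMDiffAt_finsetSum fun r _ => ContMDiffAt.mul ?_ contMDiffAt_const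
  refine contMDiffAt_finsetProd fun i _ => ?_
  exact (LinearMap.toContinuousLinearMap (b.coord (r i))).contMDiff.contMDiffAt.comp p (hv i)

/-- The section `e₁ ∧ ⋯ ∧ e_top` of `L`. -/
def wedge [FiniteDimensional ℝ F] (e : Fin (Module.finrank ℝ F) → Sec (EM := EM) F E) :
    TopSec F E 𝓘(ℝ, EM) (fun x : M => x) :=
  ⟨fun x => exteriorPower.ιMulti ℝ _ fun i => e i x, fun p₀ ξ => by
    have h := contMDiffAt_alternating (J := 𝓘(ℝ, EM))
      (exteriorPower.alternatingMapLinearEquiv.symm ξ)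
      (fun i x => (trivializationAt F E p₀).linearMapAt ℝ x (e i x)) p₀ (fun i => by
        have h1 := (Bundle.contMDiffAt_section (F := F) (E := E) p₀).1 ((e i).contMDiff p₀)
        refine h1.congr_of_eventuallyEq ?_
        have hb := (trivializationAt F E p₀).open_baseSet.mem_nhds
          (FiberBundle.mem_baseSet_trivializationAt' p₀)
        filter_upwards [hb] with y hy
        exact congrFun ((trivializationAt F E p₀).coe_linearMapAt_of_mem hy) _)
    refine h.congr_of_eventuallyEq (Filter.Eventually.of_forall fun x => ?_)
    simp [topTriv, exteriorPower.map_apply_ιMulti, Function.comp_def]⟩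

end Top

/-! ### Fibre-wise linear `L_E`-multivectors and polynomial derivations of `L_{E^*}` -/

section Scaling

variable (F : Type*) [NormedAddCommGroup F] [NormedSpace ℝ F] (E : M → Type*)
  [∀ x, AddCommGroup (E x)] [∀ x, Module ℝ (E x)] [∀ x, TopologicalSpace (E x)]
  [TopologicalSpace (Bundle.TotalSpace F E)] [FiberBundle F E] [VectorBundle ℝ F E]
  (G : Type*) [NormedAddCommGroup G] [NormedSpace ℝ G] (W : M → Type*)
  [∀ x, AddCommGroup (W x)] [∀ x, Module ℝ (W x)] [∀ x, TopologicalSpace (W x)]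
  [TopologicalSpace (Bundle.TotalSpace G W)] [FiberBundle G W] [VectorBundle ℝ G W]
  [ContMDiffVectorBundle ∞ G W 𝓘(ℝ, EM)]

/-- Sections of `L = ∧^top E`. -/
abbrev SecL : Type _ := TopSec F E 𝓘(ℝ, EM) (fun x : M => x)

/-- Sections of the pull-back `L_W` of `L = ∧^top E` to the total space of a bundle `W`. -/
abbrev SecLOn : Type _ :=
  TopSec F E (𝓘(ℝ, EM).prod 𝓘(ℝ, G)) (fun w : Bundle.TotalSpace G W => w.proj)

/-- The action `h_t^*` on sections of `L_W`. -/
def scaleSec (t : ℝ) : SecLOn (EM := EM) F E G W →ₗ[ℝ] SecLOn (EM := EM) F E G W :=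
  pullTop (fun w : Bundle.TotalSpace G W => w.proj) (scaleMap G W t)

/-- The pull-back of sections of `L` to sections of `L_W`. -/
def projSec : SecL (EM := EM) F E →ₗ[ℝ] SecLOn (EM := EM) F E G W :=
  pullTop (fun x : M => x) (projMap G W)

/-- Derivations `D` of `L_W` which are homogeneous of degree `k`: `h_t^* D = t^k D` for all
`t ≠ 0`, where `h_t^* D = h_t^* ∘ D ∘ h_{1/t}^*` (and similarly for the symbol of `D`). -/
def polyDerDeg (k : ℤ) :
    Submodule ℝ (DerPair (TotFun (EM := EM) G W) (SecLOn (EM := EM) F E G W)) where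
  carrier := {D | D ∈ modDer (TotFun (EM := EM) G W) (SecLOn (EM := EM) F E G W) ∧
    ∀ t : ℝ, t ≠ 0 →
      (∀ f, scaleFun G W t (D.symb (scaleFun G W t⁻¹ f)) = t ^ k • D.symb f) ∧
      ∀ s, scaleSec F E G W t (D.op (scaleSec F E G W t⁻¹ s)) = t ^ k • D.op s}
  zero_mem' := ⟨zero_mem _, by simp⟩
  add_mem' := fun {D D'} h h' => ⟨add_mem h.1 h'.1, fun t ht =>
    ⟨fun f => by
      have h1 := (h.2 t ht).1 f
      have h2 := (h'.2 t ht).1 f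
      simp only [DerPair.symb_add, Derivation.add_apply, map_add, h1, h2, smul_add],
    fun s => by
      have h1 := (h.2 t ht).2 s
      have h2 := (h'.2 t ht).2 s
      simp only [DerPair.op_add, LinearMap.add_apply, map_add, h1, h2, smul_add]⟩⟩
  smul_mem' := fun c D h => ⟨Submodule.smul_mem _ c h.1, fun t ht =>
    ⟨fun f => by
      have h1 := (h.2 t ht).1 f
      simp only [DerPair.symb_smul, Derivation.smul_apply, map_smul, h1, smul_comm c],
    fun s => by
      have h1 := (h.2 t ht).2 s
      simp only [DerPair.op_smul, LinearMap.smul_apply, map_smul, h1, smul_comm c]⟩⟩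

/-- Polynomial derivations of `L_W`: finite sums of homogeneous ones. -/
def polyDer :
    Submodule ℝ (DerPair (TotFun (EM := EM) G W) (SecLOn (EM := EM) F E G W)) := ⨆ k, polyDerDeg F E G W k

/-- Symmetric `L_W`-multivectors whose component of degree `k` has degree `w - k` with respect
to fibre-wise scaling, for all `k`: `h_t^* D = t^{w-k} D` for all `t ≠ 0`, where
`(h_t^* D)(f₁, …, f_{k-1} | s) = h_t^* (D(h_{1/t}^* f₁, …, h_{1/t}^* f_{k-1} | h_{1/t}^* s))`
(and similarly for the projection `L_D`). -/
def scaledMultivector (w : ℤ) :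
    Submodule ℝ (MultiPair (TotFun (EM := EM) G W) (SecLOn (EM := EM) F E G W)) where
  carrier := {D | D ∈ derMultivector (TotFun (EM := EM) G W) (SecLOn (EM := EM) F E G W) ∧
    ∀ t : ℝ, t ≠ 0 →
      (∀ m, scaleFun G W t (D.symb (m.map (scaleFun G W t⁻¹)))
        = t ^ (w - (m.card : ℤ)) • D.symb m) ∧
      ∀ m s, scaleSec F E G W t (D.op (m.map (scaleFun G W t⁻¹)) (scaleSec F E G W t⁻¹ s))
        = t ^ (w - ((m.card : ℤ) + 1)) • D.op m s}
  zero_mem' := ⟨zero_mem _, by simp⟩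
  add_mem' := fun {D D'} h h' => ⟨add_mem h.1 h'.1, fun t ht =>
    ⟨fun m => by
      have h1 := (h.2 t ht).1 m
      have h2 := (h'.2 t ht).1 m
      simp only [MultiPair.symb_add, Pi.add_apply, map_add, h1, h2, smul_add],
    fun m s => by
      have h1 := (h.2 t ht).2 m s
      have h2 := (h'.2 t ht).2 m s
      simp only [MultiPair.op_add, Pi.add_apply, LinearMap.add_apply, map_add, h1, h2, smul_add]⟩⟩
  smul_mem' := fun c D h => ⟨Submodule.smul_mem _ c h.1, fun t ht =>
    ⟨fun m => by
      have h1 := (h.2 t ht).1 m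
      simp only [MultiPair.symb_smul, Pi.smul_apply, map_smul, h1, smul_comm c],
    fun m s => by
      have h1 := (h.2 t ht).2 m s
      simp only [MultiPair.op_smul, Pi.smul_apply, LinearMap.smul_apply, map_smul, h1, smul_comm c]⟩⟩

end Scaling

section Main

variable (F : Type*) [NormedAddCommGroup F] [NormedSpace ℝ F] (E : M → Type*)
  [∀ x, AddCommGroup (E x)] [∀ x, Module ℝ (E x)] [∀ x, TopologicalSpace (E x)]
  [TopologicalSpace (Bundle.TotalSpace F E)] [FiberBundle F E] [VectorBundle ℝ F E]
  [ContMDiffVectorBundle ∞ F E 𝓘(ℝ, EM)]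

/-- Core symmetric `L_E`-multivectors: those of degree `k` satisfy `h_t^* D = t^{-k} D`. -/
abbrev coreMultivector :
    Submodule ℝ (MultiPair (TotFun (EM := EM) F E) (SecLOn (EM := EM) F E F E)) :=
  scaledMultivector F E F E 0

/-- Fibre-wise linear symmetric `L_E`-multivectors: those of degree `k` satisfy
`h_t^* D = t^{1-k} D`. -/
abbrev linMultivector :
    Submodule ℝ (MultiPair (TotFun (EM := EM) F E) (SecLOn (EM := EM) F E F E)) :=
  scaledMultivector F E F E 1

/-- The homogeneous `L_E`-multivectors of degree `k`. -/
abbrev multivectorDeg (k : ℕ) :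
    Submodule ℝ (MultiPair (TotFun (EM := EM) F E) (SecLOn (EM := EM) F E F E)) :=
  derMultivectorDeg (TotFun (EM := EM) F E) (SecLOn (EM := EM) F E F E) k

variable [∀ x, IsTopologicalAddGroup (E x)] [∀ x, ContinuousSMul ℝ (E x)]

/-- Polynomial functions on the total space of `E^*`. -/
abbrev dualPolyFun : Submodule ℝ (TotFun (EM := EM) (DualModel F) (Dual E)) :=
  polyFun (DualModel F) (Dual E)

/-- Polynomial derivations of the line bundle `L_{E^*} = E^* ×_M ∧^top E → E^*`. -/
abbrev dualPolyDer :
    Submodule ℝ (DerPair (TotFun (EM := EM) (DualModel F) (Dual E))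
      (SecLOn (EM := EM) F E (DualModel F) (Dual E))) :=
  polyDer F E (DualModel F) (Dual E)

variable {F E}

/-- A derivation `δ'` of `E^*` and a derivation `δ` of `E` correspond to each other: they have the
same symbol and `⟨δ' φ, e⟩ = l_δ ⟨φ, e⟩ - ⟨φ, δ e⟩`. -/
def IsDualDer (δ' : modDer (Smooth 𝓘(ℝ, EM) M) (Sec (EM := EM) (DualModel F) (Dual E)))
    (δ : modDer (Smooth 𝓘(ℝ, EM) M) (Sec (EM := EM) F E)) : Prop :=
  δ'.1.symb = δ.1.symb ∧
  ∀ φ e, pairing (δ'.1.op φ) e = δ.1.symb (pairing φ e) - pairing φ (δ.1.op e)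

/-- `δL` is the derivation of `L = ∧^top E` induced by the derivation `δ` of `E`: it has the same
symbol and `δL (e₁ ∧ ⋯ ∧ e_top) = ∑ᵢ e₁ ∧ ⋯ ∧ δ eᵢ ∧ ⋯ ∧ e_top`. -/
def IsTopDer [FiniteDimensional ℝ F] (δ : modDer (Smooth 𝓘(ℝ, EM) M) (Sec (EM := EM) F E))
    (δL : modDer (Smooth 𝓘(ℝ, EM) M) (SecL (EM := EM) F E)) : Prop :=
  δL.1.symb = δ.1.symb ∧
  ∀ e : Fin (Module.finrank ℝ F) → Sec (EM := EM) F E,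
    δL.1.op (wedge e) = ∑ i, wedge (Function.update e i (δ.1.op (e i)))

/-- `Φ` is the derivation `Φ_Δ(φ₁, …, φ_{q-1})` of `L`, where `φs` is the list of the `φᵢ` and `Δ`
is a fibre-wise linear differential operator of order `q`:
`Φ(U) = σ(Δ)(φ₁, …, φ_{q-1}, -) U + Ψ_Δ(φ₁, …, φ_{q-1}) U`.
Here `δ' = σ(Δ)(φ₁, …, φ_{q-1}, -)` is the derivation of `E^*` with
`ℓ_{δ' φ} = σ(Δ)(ℓ_{φ₁}, …, ℓ_{φ_{q-1}}, ℓ_φ)` and symbol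
`f ↦ σ(Δ)(ℓ_{φ₁}, …, ℓ_{φ_{q-1}}, f)`, acting on `L` through the corresponding derivation `δ`
of `E`, and `ψ = Ψ_Δ(φ₁, …, φ_{q-1}) = [⋯[Δ, ℓ_{φ₁}], ⋯, ℓ_{φ_{q-1}}](1)` (functions on `M`
being identified with their pull-backs to `E`). -/
def IsPhi [FiniteDimensional ℝ F] (Δ : Module.End ℝ (TotFun (EM := EM) F E))
    (φs : List (Sec (EM := EM) (DualModel F) (Dual E)))
    (Φ : modDer (Smooth 𝓘(ℝ, EM) M) (SecL (EM := EM) F E)) : Prop :=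
  ∃ (δ' : modDer (Smooth 𝓘(ℝ, EM) M) (Sec (EM := EM) (DualModel F) (Dual E)))
    (δ : modDer (Smooth 𝓘(ℝ, EM) M) (Sec (EM := EM) F E))
    (δL : modDer (Smooth 𝓘(ℝ, EM) M) (SecL (EM := EM) F E)) (ψ : Smooth 𝓘(ℝ, EM) M),
    (∀ φ, ell (δ'.1.op φ) = nestedCommOne Δ (φs.map ell ++ [ell φ])) ∧
    (∀ f, projFun F E (δ'.1.symb f) = nestedCommOne Δ (φs.map ell ++ [projFun F E f])) ∧
    IsDualDer δ' δ ∧ IsTopDer δ δL ∧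
    projFun F E ψ = nestedCommOne Δ (φs.map ell) ∧
    Φ.1.symb = δL.1.symb ∧ ∀ U, Φ.1.op U = δL.1.op U + ψ • U

/-- The `L_E`-multivector `D` of degree `q` is the one given by the pair `(σ(Δ), Φ_Δ)`: its
projection is `L_D = σ(Δ)`, and `D(ℓ_{φ₁}, …, ℓ_{φ_{q-1}} | U) = Φ_Δ(φ₁, …, φ_{q-1})(U)` for all
sections `φᵢ` of `E^*` and `U` of `L` (sections of `L` being identified with their pull-backs). -/
def IsSymbolPair [FiniteDimensional ℝ F] (q : ℕ) (Δ : Module.End ℝ (TotFun (EM := EM) F E))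
    (D : MultiPair (TotFun (EM := EM) F E) (SecLOn (EM := EM) F E F E)) : Prop :=
  (∀ l : List (TotFun (EM := EM) F E), l.length = q → D.symb l = nestedCommOne Δ l) ∧
  ∀ φs : List (Sec (EM := EM) (DualModel F) (Dual E)), φs.length + 1 = q →
    ∃ Φ : modDer (Smooth 𝓘(ℝ, EM) M) (SecL (EM := EM) F E), IsPhi Δ φs Φ ∧
      ∀ U, D.op ((φs.map ell : List (TotFun (EM := EM) F E)) : Multiset _) (projSec F E F E U)
        = projSec F E F E (Φ.1.op U)

/-- The point `φ(x)` of the total space of `E^*`. -/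
def dualPt (φ : Sec (EM := EM) (DualModel F) (Dual E)) (x : M) :
    Bundle.TotalSpace (DualModel F) (Dual E) := ⟨x, φ x⟩

/-- The point `0_x` of the total space of `E`. -/
def zeroPt (x : M) : Bundle.TotalSpace F E := ⟨x, 0⟩

/-- The operations of the Lie-Rinehart algebra of fibre-wise linear differential operators over
core differential operators: compositions and commutators. -/
def IsDOStructure (S : LieRinehart (coreDO (EM := EM) F E) (linDO (EM := EM) F E)) : Prop :=
  (S.one : Module.End ℝ (TotFun (EM := EM) F E)) = LinearMap.id ∧
  (∀ G G', (S.mul G G' : Module.End ℝ (TotFun (EM := EM) F E)) = G.1 ∘ₗ G'.1) ∧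
  (∀ G Δ, (S.smul G Δ : Module.End ℝ (TotFun (EM := EM) F E)) = G.1 ∘ₗ Δ.1) ∧
  (∀ Δ Δ', (S.bracket Δ Δ' : Module.End ℝ (TotFun (EM := EM) F E)) = opComm Δ.1 Δ'.1) ∧
  ∀ Δ G, (S.anchor Δ G : Module.End ℝ (TotFun (EM := EM) F E)) = opComm Δ.1 G.1

open Classical in
/-- The operations of the Lie-Rinehart algebra of fibre-wise linear `L_E`-multivectors over core
ones: product and Lie bracket of `L_E`-multivectors. -/
def IsMultivectorStructure
    (S : LieRinehart (coreMultivector (EM := EM) F E) (linMultivector (EM := EM) F E)) : Prop :=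
  S.one.1.symb = (fun m => if m = 0 then 1 else 0) ∧ S.one.1.op = 0 ∧
  (∀ G G', (S.mul G G').1 = derMul G.1 G'.1) ∧
  (∀ G D, (S.smul G D).1 = derMul G.1 D.1) ∧
  (∀ D D', (S.bracket D D').1 = derBracket D.1 D'.1) ∧
  ∀ D G, (S.anchor D G).1 = derBracket D.1 G.1

/-- The operations of the Lie-Rinehart algebra of polynomial derivations of `L_{E^*}` over
polynomial functions on `E^*`: the module structure over functions, the commutator, and the action
of the symbol on functions. -/
def IsDerStructure
    (S : LieRinehart (dualPolyFun (EM := EM) F E) (dualPolyDer (EM := EM) F E)) : Prop :=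
  S.one.1 = 1 ∧
  (∀ f g, (S.mul f g).1 = f.1 * g.1) ∧
  (∀ f D, (S.smul f D).1 = DerPair.fsmul f.1 D.1) ∧
  (∀ D D', (S.bracket D D').1 = DerPair.bracket D.1 D'.1) ∧
  ∀ D f, (S.anchor D f).1 = D.1.symb f.1

end Main

end Geometry

end FWL

end

open scoped Manifold ContDiff Bundle

noncomputable section

set_option linter.unusedSectionVars false

namespace FWL

section Algebra

open LinearMap (mulLeft comp_apply map_smul_of_tower flip_apply)
open Module (End finrank finBasis)
open Submodule (subset_span mem_iSup_of_mem)
open Derivation (commutator_apply)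

variable {M R C S Λ V W : Type*} [CommRing R] [Algebra ℝ R] [CommRing C] [Algebra ℝ C]
  [AddCommGroup S] [Module ℝ S] [Module C S] [IsScalarTower ℝ C S]
  [AddCommGroup Λ] [Module ℝ Λ] [Module R Λ] [IsScalarTower ℝ R Λ]
  [AddCommGroup V] [Module ℝ V] [Module R V] [IsScalarTower ℝ R V]
  [AddCommGroup W] [Module ℝ W] [Module R W] [IsScalarTower ℝ R W]
  {ev : M → R →ₐ[ℝ] ℝ} {ρ : R →ₗ[ℝ] C} {h : ℝ → C →ₗ[ℝ] C} {ρL : Λ →ₗ[ℝ] S} {hS : ℝ → S →ₗ[ℝ] S}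

section Abstract

variable (M R V W) in
/-- A pair of modules over `R` (functions on `M`) in duality, with local dual frames and local
coordinates: the algebraic data of a vector bundle. -/
structure DualPair where
  ev : M → R →ₐ[ℝ] ℝ
  pair : V →ₗ[R] W →ₗ[R] R
  refl : ∀ f : V →ₗ[R] R, ∃ e, ∀ φ, f φ = pair φ e
  refl' : ∀ f : W →ₗ[R] R, ∃ φ, ∀ e, f e = pair φ e
  nondeg : ∀ e, (∀ φ, pair φ e = 0) → e = 0
  nondeg' : ∀ φ, (∀ e, pair φ e = 0) → φ = 0
  loc : ∀ x, ∃ χ, ev x χ = 1 ∧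
    (∃ (n : ℕ) (e : Fin n → W) (ε : Fin n → V), ∀ φ, χ • φ = ∑ i, pair φ (e i) • ε i) ∧
    ∃ (n : ℕ) (y : Fin n → R) (δ : Fin n → modDer R W),
      ∀ (Y : Derivation ℝ R R) (g : R), χ * Y g = ∑ a, Y (y a) * (δ a).1.symb g

/-- `φ'` is the image of `φ` under the derivation dual to `δ`. -/
def DualPair.DualTo (b : DualPair M R V W) (δ : modDer R W) (φ φ' : V) : Prop :=
  ∀ e, b.pair φ' e = δ.1.symb (b.pair φ e) - b.pair φ (δ.1.op e)

lemma DualPair.exists_dualTo (b : DualPair M R V W) (δ : modDer R W) (φ : V) :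
    ∃ φ', b.DualTo δ φ φ' := by
  obtain ⟨φ', h⟩ := b.refl' (
    { toFun := fun e => δ.1.symb (b.pair φ e) - b.pair φ (δ.1.op e)
      map_add' := fun e e' => by simp only [map_add]; ring
      map_smul' := fun g e => by
        rw [δ.2 g e]
        simp only [map_smul, map_add, smul_eq_mul, Derivation.leibniz, RingHom.id_apply]; ring } :
      W →ₗ[R] R)
  exact ⟨φ', fun e => (h e).symm⟩

/-- A graded Lie-Rinehart algebra generated, locally, by functions and sections of `W` in the base
algebra, and by sections of `V`, derivations of `W` and a unit in the Lie algebra. -/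
structure GradedModel (b : DualPair M R V W) (A L : Type*) [AddCommGroup A] [Module ℝ A]
    [AddCommGroup L] [Module ℝ L] extends LieRinehart A L where
  Adeg : ℕ → Submodule ℝ A
  Ldeg : ℕ → Submodule ℝ L
  ofR : R →ₗ[ℝ] A
  ofW : W →ₗ[ℝ] A
  ofV : V →ₗ[ℝ] L
  ofDer : modDer R W →ₗ[ℝ] L
  unit : L
  ofR_one : ofR 1 = one
  ofR_mul : ∀ g h, ofR (g * h) = mul (ofR g) (ofR h)
  ofR_inj : ∀ g, ofR g = 0 → g = 0
  Adeg_zero : Adeg 0 = LinearMap.range ofR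
  ofV_inj : ∀ φ, ofV φ = 0 → φ = 0
  ofV_smul : ∀ g φ, ofV (g • φ) = smul (ofR g) (ofV φ)
  Ldeg_zero : Ldeg 0 = LinearMap.range ofV
  mul_mem : ∀ {p q a b}, a ∈ Adeg p → b ∈ Adeg q → mul a b ∈ Adeg (p + q)
  smul_mem : ∀ {p q a x}, a ∈ Adeg p → x ∈ Ldeg q → smul a x ∈ Ldeg (p + q)
  bracket_mem : ∀ {n q q' x y}, n + 1 = q + q' → x ∈ Ldeg q → y ∈ Ldeg q' → bracket x y ∈ Ldeg n
  anchor_mem : ∀ {n q p x a}, n + 1 = q + p → x ∈ Ldeg q → a ∈ Adeg p → anchor x a ∈ Adeg n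
  anchor_ofV_ofR : ∀ φ g, anchor (ofV φ) (ofR g) = 0
  bracket_ofV : ∀ φ ψ, bracket (ofV φ) (ofV ψ) = 0
  ofW_mem : ∀ e, ofW e ∈ Adeg 1
  anchor_ofW : ∀ φ e, anchor (ofV φ) (ofW e) = - ofR (b.pair φ e)
  ofDer_mem : ∀ δ, ofDer δ ∈ Ldeg 1
  ofDer_ofV : ∀ δ φ φ', b.DualTo δ φ φ' → bracket (ofDer δ) (ofV φ) = ofV φ'
  anchor_ofDer : ∀ δ g, anchor (ofDer δ) (ofR g) = ofR (δ.1.symb g)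
  ofDer_bracket : ∀ δ₁ δ₂ δ₃ : modDer R W, δ₃.1 = DerPair.bracket δ₁.1 δ₂.1 →
    bracket (ofDer δ₁) (ofDer δ₂) = ofDer δ₃
  ofDer_smul : ∀ (g : R) (δ δ' : modDer R W), δ'.1 = DerPair.fsmul g δ.1 →
    ofDer δ' = smul (ofR g) (ofDer δ)
  ofDer_rank_one : ∀ (φ : V) (e : W) (δ : modDer R W), δ.1.symb = 0 →
    (∀ e', δ.1.op e' = b.pair φ e' • e) →
    ofDer δ = smul (ofR (b.pair φ e)) unit - smul (ofW e) (ofV φ)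
  unit_mem : unit ∈ Ldeg 1
  anchor_unit : ∀ a, anchor unit a = 0
  bracket_unit_ofV : ∀ φ, bracket unit (ofV φ) = 0
  bracket_unit_ofDer : ∀ δ, bracket unit (ofDer δ) = 0
  unit_inj : ∀ g, smul (ofR g) unit = 0 → g = 0
  faithful_A : ∀ p, ∀ a ∈ Adeg (p + 1), (∀ φ, anchor (ofV φ) a = 0) → a = 0
  faithful_one : ∀ x ∈ Ldeg 1, (∀ φ, bracket x (ofV φ) = 0) → (∀ g, anchor x (ofR g) = 0) →
    ∃ g, x = smul (ofR g) unit
  faithful_L : ∀ q, ∀ x ∈ Ldeg (q + 2), (∀ φ, bracket x (ofV φ) = 0) →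
    (∀ g, anchor x (ofR g) = 0) → x = 0
  sep_A : ∀ χ : M → R, (∀ x, b.ev x (χ x) = 1) → ∀ a, (∀ x, mul (ofR (χ x)) a = 0) → a = 0
  sep_L : ∀ χ : M → R, (∀ x, b.ev x (χ x) = 1) → ∀ a, (∀ x, smul (ofR (χ x)) a = 0) → a = 0
  glue_A : ∀ p, ∀ χ : M → R, (∀ x, b.ev x (χ x) = 1) → ∀ a : M → A, (∀ x, a x ∈ Adeg p) →
    (∀ x y, mul (ofR (χ y)) (a x) = mul (ofR (χ x)) (a y)) →
    ∃ c ∈ Adeg p, ∀ x, mul (ofR (χ x)) c = a x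
  glue_L : ∀ p, ∀ χ : M → R, (∀ x, b.ev x (χ x) = 1) → ∀ a : M → L, (∀ x, a x ∈ Ldeg p) →
    (∀ x y, smul (ofR (χ y)) (a x) = smul (ofR (χ x)) (a y)) →
    ∃ c ∈ Ldeg p, ∀ x, smul (ofR (χ x)) c = a x
  iSup_A : ⨆ p, Adeg p = ⊤
  iSup_L : ⨆ q, Ldeg q = ⊤
  indep_A : iSupIndep Adeg
  indep_L : iSupIndep Ldeg

namespace GradedModel

variable {b : DualPair M R V W} {A L : Type*} [AddCommGroup A] [Module ℝ A]
    [AddCommGroup L] [Module ℝ L] (X : GradedModel b A L)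

lemma bracket_anti (x y : L) : X.bracket x y = - X.bracket y x := by
  have h := X.bracket_self (x + y)
  simp only [map_add, LinearMap.add_apply, X.bracket_self, zero_add, add_zero] at h
  exact eq_neg_of_add_eq_zero_right h

/-- The derivation of the base algebra given by a section of `V`. -/
def D (φ : V) : A →ₗ[ℝ] A := X.anchor (X.ofV φ)

/-- The bracket with a section of `V`. -/
def ad (φ : V) : L →ₗ[ℝ] L := X.bracket.flip (X.ofV φ)

lemma D_ofR (φ : V) (g : R) : X.D φ (X.ofR g) = 0 := X.anchor_ofV_ofR φ g

lemma D_mul (φ : V) (a c : A) : X.D φ (X.mul a c) = X.mul (X.D φ a) c + X.mul a (X.D φ c) :=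
  X.anchor_mul _ _ _

lemma D_ofR_mul (φ : V) (g : R) (c : A) :
    X.D φ (X.mul (X.ofR g) c) = X.mul (X.ofR g) (X.D φ c) := by
  rw [D_mul, D_ofR]; simp

lemma D_smul (g : R) (φ : V) (a : A) : X.D (g • φ) a = X.mul (X.ofR g) (X.D φ a) := by
  simp only [D, X.ofV_smul, X.anchor_smul]

lemma D_comm (φ ψ : V) (a : A) : X.D φ (X.D ψ a) = X.D ψ (X.D φ a) := by
  have h := X.anchor_bracket (X.ofV φ) (X.ofV ψ) a
  rw [X.bracket_ofV] at h
  rw [map_zero, LinearMap.zero_apply] at h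
  exact sub_eq_zero.1 h.symm

lemma ad_smul (φ : V) (a : A) (x : L) :
    X.ad φ (X.smul a x) = X.smul a (X.ad φ x) - X.smul (X.D φ a) x := by
  simp only [ad, flip_apply, D]
  rw [X.bracket_anti, X.leibniz, X.bracket_anti (X.ofV φ) x, map_neg]; abel

lemma ad_ofR_smul (φ : V) (g : R) (x : L) :
    X.ad φ (X.smul (X.ofR g) x) = X.smul (X.ofR g) (X.ad φ x) := by
  rw [ad_smul, D_ofR]; simp

lemma ad_smulV (φ : V) (g : R) (x : L) :
    X.ad (g • φ) x = X.smul (X.anchor x (X.ofR g)) (X.ofV φ)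
      + X.smul (X.ofR g) (X.ad φ x) := by
  simp only [ad, flip_apply, X.ofV_smul, X.leibniz]

lemma ad_bracket (φ : V) (x y : L) :
    X.ad φ (X.bracket x y) = X.bracket (X.ad φ x) y + X.bracket x (X.ad φ y) := by
  simp only [ad, flip_apply]
  rw [X.jacobi x y, X.bracket_anti (X.bracket x (X.ofV φ)) y]; abel

lemma anchor_ad (φ : V) (x : L) (a : A) :
    X.anchor (X.ad φ x) a = X.anchor x (X.D φ a) - X.D φ (X.anchor x a) := by
  simp only [ad, flip_apply, D, X.anchor_bracket]

lemma D_anchor (φ : V) (x : L) (a : A) :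
    X.D φ (X.anchor x a) = X.anchor x (X.D φ a) - X.anchor (X.ad φ x) a := by
  rw [anchor_ad]; abel

lemma ad_comm (φ ψ : V) (x : L) : X.ad φ (X.ad ψ x) = X.ad ψ (X.ad φ x) := by
  have h := X.ad_bracket φ x (X.ofV ψ)
  have h2 : X.ad φ (X.ofV ψ) = 0 := by simp [ad, X.bracket_ofV]
  rw [h2, map_zero, add_zero] at h
  exact h

lemma ad_unit (φ : V) : X.ad φ X.unit = 0 := X.bracket_unit_ofV φ

lemma ad_ofV (φ ψ : V) : X.ad φ (X.ofV ψ) = 0 := X.bracket_ofV _ _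

lemma ofR_mem (g : R) : X.ofR g ∈ X.Adeg 0 := by rw [X.Adeg_zero]; exact ⟨g, rfl⟩

lemma ofV_mem (φ : V) : X.ofV φ ∈ X.Ldeg 0 := by rw [X.Ldeg_zero]; exact ⟨φ, rfl⟩

lemma ofR_mul_mem {p : ℕ} (g : R) {a : A} (h : a ∈ X.Adeg p) :
    X.mul (X.ofR g) a ∈ X.Adeg p := by
  have := X.mul_mem (X.ofR_mem g) h
  rwa [zero_add] at this

lemma ofR_smul_mem {p : ℕ} (g : R) {a : L} (h : a ∈ X.Ldeg p) :
    X.smul (X.ofR g) a ∈ X.Ldeg p := by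
  have := X.smul_mem (X.ofR_mem g) h
  rwa [zero_add] at this

lemma D_mem {p : ℕ} (φ : V) {a : A} (h : a ∈ X.Adeg (p + 1)) : X.D φ a ∈ X.Adeg p :=
  X.anchor_mem (by omega) (X.ofV_mem φ) h

lemma ad_mem {p : ℕ} (φ : V) {a : L} (h : a ∈ X.Ldeg (p + 1)) : X.ad φ a ∈ X.Ldeg p :=
  X.bracket_mem (by omega) h (X.ofV_mem φ)

lemma D_zero {a : A} (h : a ∈ X.Adeg 0) (φ : V) : X.D φ a = 0 := by
  rw [X.Adeg_zero] at h; obtain ⟨g, rfl⟩ := h; exact X.D_ofR φ g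

lemma ad_zero {a : L} (h : a ∈ X.Ldeg 0) (φ : V) : X.ad φ a = 0 := by
  rw [X.Ldeg_zero] at h; obtain ⟨g, rfl⟩ := h; exact X.ad_ofV φ g

lemma anchor_zero {a : L} (h : a ∈ X.Ldeg 0) (g : R) : X.anchor a (X.ofR g) = 0 := by
  rw [X.Ldeg_zero] at h; obtain ⟨φ, rfl⟩ := h; exact X.D_ofR φ g

lemma ofR_eq {g h : R} (hg : X.ofR g = X.ofR h) : g = h := by
  have := X.ofR_inj (g - h) (by rw [map_sub, hg, sub_self])
  exact sub_eq_zero.1 this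

lemma ofV_eq {g h : V} (hg : X.ofV g = X.ofV h) : g = h := by
  have := X.ofV_inj (g - h) (by rw [map_sub, hg, sub_self])
  exact sub_eq_zero.1 this

lemma exists_ofW {a : A} (h : a ∈ X.Adeg 1) : ∃ e, a = X.ofW e := by
  have h1 : ∀ φ, ∃ g, X.ofR g = - X.D φ a := fun φ => by
    have := X.D_mem φ h
    rw [X.Adeg_zero] at this
    obtain ⟨g, hg⟩ := this
    exact ⟨-g, by rw [map_neg, hg]⟩
  choose f hf using h1
  obtain ⟨e, he⟩ := b.refl
    { toFun := f
      map_add' := fun φ ψ => X.ofR_eq (by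
        rw [map_add, hf, hf, hf, D, D, D, map_add, map_add, LinearMap.add_apply]; abel)
      map_smul' := fun g φ => X.ofR_eq (by
        rw [hf, D_smul, RingHom.id_apply, smul_eq_mul, X.ofR_mul, hf, map_neg]) }
  refine ⟨e, ?_⟩
  refine sub_eq_zero.1 (X.faithful_A 0 _ (sub_mem h (X.ofW_mem e)) fun φ => ?_)
  rw [map_sub, X.anchor_ofW, ← he φ]
  simp only [LinearMap.coe_mk, AddHom.coe_mk, hf, D]; abel

lemma exists_ofDer {x : L} (h : x ∈ X.Ldeg 1) :
    ∃ δ g, x = X.ofDer δ + X.smul (X.ofR g) X.unit := by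
  have h1 : ∀ φ, ∃ ψ, X.ofV ψ = X.ad φ x := fun φ => by
    have := X.ad_mem φ h
    rw [X.Ldeg_zero] at this
    exact this
  choose θ hθ using h1
  have h2 : ∀ g, ∃ y, X.ofR y = X.anchor x (X.ofR g) := fun g => by
    have := X.anchor_mem (n := 0) (by omega) h (X.ofR_mem g)
    rw [X.Adeg_zero] at this
    exact this
  choose y hy using h2
  have ysmul : ∀ (c : ℝ) g, y (c • g) = c • y g := fun c g => X.ofR_eq (by
    rw [hy, map_smul, map_smul, map_smul, hy])
  have yadd : ∀ g g', y (g + g') = y g + y g' := fun c g => X.ofR_eq (by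
    rw [hy, map_add, map_add, map_add, hy, hy])
  have ymul : ∀ g g', y (g * g') = g * y g' + g' * y g := fun g g' => X.ofR_eq (by
    rw [hy, X.ofR_mul, X.anchor_mul, map_add, X.ofR_mul, X.ofR_mul, hy, hy, X.mul_comm, add_comm,
      X.mul_comm (X.ofR g')])
  let Y : Derivation ℝ R R := Derivation.mk'
    { toFun := y, map_add' := yadd, map_smul' := ysmul } (fun g g' => ymul g g')
  have hY : ∀ g, Y g = y g := fun g => rfl
  have θadd : ∀ φ ψ, θ (φ + ψ) = θ φ + θ ψ := fun φ ψ => X.ofV_eq (by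
    rw [map_add, hθ, hθ, hθ]; simp only [ad, map_add, flip_apply, LinearMap.add_apply])
  have θsmul : ∀ (g : R) φ, θ (g • φ) = y g • φ + g • θ φ := fun g φ => X.ofV_eq (by
    rw [map_add, hθ, ad_smulV, X.ofV_smul, X.ofV_smul, hy, hθ])
  have h3 : ∀ e, ∃ e', ∀ φ, y (b.pair φ e) - b.pair (θ φ) e = b.pair φ e' := fun e => by
    obtain ⟨e', he'⟩ := b.refl
      { toFun := fun φ => y (b.pair φ e) - b.pair (θ φ) e
        map_add' := fun φ ψ => by
          simp only [map_add, LinearMap.add_apply, yadd, θadd]; abel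
        map_smul' := fun g φ => by
          simp only [map_smul, map_add, LinearMap.add_apply, LinearMap.smul_apply, smul_eq_mul,
            ymul, θsmul, RingHom.id_apply]; ring }
    exact ⟨e', he'⟩
  choose d hd using h3
  have eqW : ∀ e e', (∀ φ, b.pair φ e = b.pair φ e') → e = e' := fun e e' hh =>
    sub_eq_zero.1 (b.nondeg _ fun φ => by rw [map_sub, hh, sub_self])
  have rs : ∀ (c : ℝ) (e : W) φ, b.pair φ (c • e) = c • b.pair φ e := fun c e φ => by
    rw [← algebraMap_smul R c e, map_smul, algebraMap_smul]
  let op : End ℝ W :=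
    { toFun := d
      map_add' := fun e e' => eqW _ _ fun φ => by
        simp only [map_add, ← hd, yadd]; abel
      map_smul' := fun c e => eqW _ _ fun φ => by
        simp only [rs, ← hd, ysmul, RingHom.id_apply, smul_sub] }
  let δ : modDer R W := ⟨(Y, op), fun g e => eqW _ _ fun φ => by
    change b.pair φ (d (g • e)) = b.pair φ (g • d e + y g • e)
    simp only [map_add, map_smul, ← hd, smul_eq_mul, ymul]; ring⟩
  have hsub : x - X.ofDer δ ∈ X.Ldeg 1 := sub_mem h (X.ofDer_mem δ)
  obtain ⟨g, hg⟩ := X.faithful_one _ hsub (fun φ => by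
    rw [map_sub, LinearMap.sub_apply, X.ofDer_ofV δ φ (θ φ) (fun e => ?_), hθ]
    · exact sub_self _
    · change _ = y (b.pair φ e) - b.pair φ (d e)
      rw [← hd]; abel) (fun g => by
    rw [map_sub, LinearMap.sub_apply, X.anchor_ofDer, ← hy]
    exact sub_self _)
  exact ⟨δ, g, by rw [← hg]; abel⟩

end GradedModel

end Abstract

section Abstract

namespace GradedModel

variable {b : DualPair M R V W} {A L : Type*} [AddCommGroup A] [Module ℝ A]
    [AddCommGroup L] [Module ℝ L] (X : GradedModel b A L)
    {A' L' : Type*} [AddCommGroup A'] [Module ℝ A']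
    [AddCommGroup L'] [Module ℝ L'] (Y : GradedModel b A' L')

/-- The canonical correspondence of the base algebras of two models. -/
def relA : ℕ → Submodule ℝ (A × A')
  | 0 => LinearMap.range (X.ofR.prod Y.ofR)
  | p + 1 => (X.Adeg (p + 1)).prod (Y.Adeg (p + 1)) ⊓
      ⨅ φ, (relA p).comap ((X.D φ).prodMap (Y.D φ))

/-- The multiples of the unit. -/
def unitMap : R →ₗ[ℝ] L := (X.smul.flip X.unit) ∘ₗ X.ofR

/-- The canonical correspondence of the Lie algebras of two models. -/
def relL : ℕ → Submodule ℝ (L × L')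
  | 0 => LinearMap.range (X.ofV.prod Y.ofV)
  | 1 => LinearMap.range (X.ofDer.prod Y.ofDer) ⊔ LinearMap.range (X.unitMap.prod Y.unitMap)
  | q + 2 => (X.Ldeg (q + 2)).prod (Y.Ldeg (q + 2)) ⊓
      (⨅ φ, (relL (q + 1)).comap ((X.ad φ).prodMap (Y.ad φ))) ⊓
      ⨅ g, (relA X Y (q + 1)).comap
        ((X.anchor.flip (X.ofR g)).prodMap (Y.anchor.flip (Y.ofR g)))

variable {X Y}

lemma mem_relA_zero {a : A} {a' : A'} :
    (a, a') ∈ relA X Y 0 ↔ ∃ g, X.ofR g = a ∧ Y.ofR g = a' := by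
  simp [relA]

lemma mem_relA_succ {p : ℕ} {a : A} {a' : A'} :
    (a, a') ∈ relA X Y (p + 1) ↔ (a ∈ X.Adeg (p + 1) ∧ a' ∈ Y.Adeg (p + 1)) ∧
      ∀ φ, (X.D φ a, Y.D φ a') ∈ relA X Y p := by
  simp [relA, Submodule.mem_iInf]

lemma mem_relL_zero {a : L} {a' : L'} :
    (a, a') ∈ relL X Y 0 ↔ ∃ g, X.ofV g = a ∧ Y.ofV g = a' := by
  simp [relL]

lemma mem_relL_one {a : L} {a' : L'} :
    (a, a') ∈ relL X Y 1 ↔ ∃ δ g, X.ofDer δ + X.smul (X.ofR g) X.unit = a ∧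
      Y.ofDer δ + Y.smul (Y.ofR g) Y.unit = a' := by
  simp only [relL, Submodule.mem_sup, LinearMap.mem_range]
  constructor
  · rintro ⟨_, ⟨δ, rfl⟩, _, ⟨g, rfl⟩, h⟩
    exact ⟨δ, g, (Prod.ext_iff.1 h).1, (Prod.ext_iff.1 h).2⟩
  · rintro ⟨δ, g, h, h'⟩
    exact ⟨_, ⟨δ, rfl⟩, _, ⟨g, rfl⟩, Prod.ext h h'⟩

lemma mem_relL_add_two {q : ℕ} {a : L} {a' : L'} :
    (a, a') ∈ relL X Y (q + 2) ↔ ((a ∈ X.Ldeg (q + 2) ∧ a' ∈ Y.Ldeg (q + 2)) ∧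
      ∀ φ, (X.ad φ a, Y.ad φ a') ∈ relL X Y (q + 1)) ∧
      ∀ g, (X.anchor a (X.ofR g), Y.anchor a' (Y.ofR g)) ∈ relA X Y (q + 1) := by
  simp [relL, Submodule.mem_iInf]

lemma relA_mem {p : ℕ} {a : A} {a' : A'} (h : (a, a') ∈ relA X Y p) :
    a ∈ X.Adeg p ∧ a' ∈ Y.Adeg p := by
  cases p with
  | zero => obtain ⟨g, rfl, rfl⟩ := mem_relA_zero.1 h; exact ⟨X.ofR_mem g, Y.ofR_mem g⟩
  | succ p => exact (mem_relA_succ.1 h).1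

lemma relL_mem {p : ℕ} {a : L} {a' : L'} (h : (a, a') ∈ relL X Y p) :
    a ∈ X.Ldeg p ∧ a' ∈ Y.Ldeg p := by
  match p, h with
  | 0, h => obtain ⟨g, rfl, rfl⟩ := mem_relL_zero.1 h; exact ⟨X.ofV_mem g, Y.ofV_mem g⟩
  | 1, h =>
    obtain ⟨δ, g, rfl, rfl⟩ := mem_relL_one.1 h
    exact ⟨add_mem (X.ofDer_mem δ) (X.ofR_smul_mem g X.unit_mem),
      add_mem (Y.ofDer_mem δ) (Y.ofR_smul_mem g Y.unit_mem)⟩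
  | q + 2, h => exact (mem_relL_add_two.1 h).1.1

lemma relA_swap {p : ℕ} {a : A} {a' : A'} (h : (a, a') ∈ relA X Y p) :
    (a', a) ∈ relA Y X p := by
  induction p generalizing a a' with
  | zero => obtain ⟨g, rfl, rfl⟩ := mem_relA_zero.1 h; exact mem_relA_zero.2 ⟨g, rfl, rfl⟩
  | succ p ih =>
    obtain ⟨h1, h2⟩ := mem_relA_succ.1 h
    exact mem_relA_succ.2 ⟨h1.symm, fun φ => ih (h2 φ)⟩

lemma relL_swap {p : ℕ} {a : L} {a' : L'} (h : (a, a') ∈ relL X Y p) :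
    (a', a) ∈ relL Y X p := by
  match p, h with
  | 0, h => obtain ⟨g, rfl, rfl⟩ := mem_relL_zero.1 h; exact mem_relL_zero.2 ⟨g, rfl, rfl⟩
  | 1, h =>
    obtain ⟨δ, g, rfl, rfl⟩ := mem_relL_one.1 h; exact mem_relL_one.2 ⟨δ, g, rfl, rfl⟩
  | q + 2, h =>
    obtain ⟨⟨h1, h2⟩, h3⟩ := mem_relL_add_two.1 h
    exact mem_relL_add_two.2 ⟨⟨h1.symm, fun φ => relL_swap (h2 φ)⟩, fun g => relA_swap (h3 g)⟩

lemma relA_D {p : ℕ} {a : A} {a' : A'} (h : (a, a') ∈ relA X Y (p + 1)) (φ : V) :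
    (X.D φ a, Y.D φ a') ∈ relA X Y p := (mem_relA_succ.1 h).2 φ

lemma ad_ofDer_add (δ : modDer R W) (g : R) {φ φ' : V} (h : b.DualTo δ φ φ') :
    X.ad φ (X.ofDer δ + X.smul (X.ofR g) X.unit) = X.ofV φ' := by
  rw [map_add, ad_ofR_smul, ad_unit, map_zero, add_zero]
  exact X.ofDer_ofV δ φ φ' h

lemma anchor_ofDer_add (δ : modDer R W) (g h : R) :
    X.anchor (X.ofDer δ + X.smul (X.ofR g) X.unit) (X.ofR h) = X.ofR (δ.1.symb h) := by
  rw [map_add, LinearMap.add_apply, X.anchor_smul, X.anchor_unit, map_zero, add_zero,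
    X.anchor_ofDer]

lemma relL_ad {q : ℕ} {a : L} {a' : L'} (h : (a, a') ∈ relL X Y (q + 1)) (φ : V) :
    (X.ad φ a, Y.ad φ a') ∈ relL X Y q := by
  cases q with
  | zero =>
    obtain ⟨δ, g, rfl, rfl⟩ := mem_relL_one.1 h
    obtain ⟨φ', hφ⟩ := b.exists_dualTo δ φ
    rw [ad_ofDer_add δ g hφ, ad_ofDer_add δ g hφ]
    exact mem_relL_zero.2 ⟨φ', rfl, rfl⟩
  | succ q => exact (mem_relL_add_two.1 h).1.2 φ

lemma relL_anchor_ofR {q : ℕ} {a : L} {a' : L'} (h : (a, a') ∈ relL X Y (q + 1)) (g : R) :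
    (X.anchor a (X.ofR g), Y.anchor a' (Y.ofR g)) ∈ relA X Y q := by
  cases q with
  | zero =>
    obtain ⟨δ, g, rfl, rfl⟩ := mem_relL_one.1 h
    rw [anchor_ofDer_add, anchor_ofDer_add]
    exact mem_relA_zero.2 ⟨_, rfl, rfl⟩
  | succ q => exact (mem_relL_add_two.1 h).2 g

lemma relA_inj {p : ℕ} {a' : A'} (h : ((0 : A), a') ∈ relA X Y p) : a' = 0 := by
  induction p generalizing a' with
  | zero =>
    obtain ⟨g, h0, rfl⟩ := mem_relA_zero.1 h
    rw [X.ofR_inj g h0, map_zero]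
  | succ p ih =>
    obtain ⟨h1, h2⟩ := mem_relA_succ.1 h
    exact Y.faithful_A p a' h1.2 fun φ => ih (a' := Y.D φ a') (by simpa using h2 φ)

lemma relA_unique {p : ℕ} {a : A} {a' a'' : A'} (h : (a, a') ∈ relA X Y p)
    (h' : (a, a'') ∈ relA X Y p) : a' = a'' :=
  sub_eq_zero.1 (relA_inj (X := X) (p := p) (by simpa using sub_mem h h'))

lemma relL_inj {q : ℕ} {a' : L'} (h : ((0 : L), a') ∈ relL X Y q) : a' = 0 := by
  induction q generalizing a' with
  | zero =>
    obtain ⟨g, h0, rfl⟩ := mem_relL_zero.1 h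
    rw [X.ofV_inj g h0, map_zero]
  | succ q ih =>
    cases q with
    | zero =>
      obtain ⟨δ, g, h1, rfl⟩ := mem_relL_one.1 h
      have had : ∀ φ φ', b.DualTo δ φ φ' → φ' = 0 := fun φ φ' hφ => by
        have := X.ad_ofDer_add δ g hφ
        rw [h1, map_zero] at this
        exact X.ofV_inj _ this.symm
      have hs : ∀ h, δ.1.symb h = 0 := fun h => by
        have := X.anchor_ofDer_add δ g h
        rw [h1, map_zero, LinearMap.zero_apply] at this
        exact X.ofR_inj _ this.symm
      have hop : ∀ e, δ.1.op e = 0 := fun e => b.nondeg _ fun φ => by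
        obtain ⟨φ', hφ⟩ := b.exists_dualTo δ φ
        have h2 := hφ e
        rw [had φ φ' hφ, hs] at h2
        simpa using h2
      have hδ : δ = 0 := Subtype.ext (Prod.ext (Derivation.ext hs) (LinearMap.ext hop))
      subst hδ
      rw [map_zero, zero_add] at h1
      rw [X.unit_inj g h1]; simp
    | succ q =>
      obtain ⟨⟨h1, h2⟩, h3⟩ := mem_relL_add_two.1 h
      refine Y.faithful_L q a' h1.2 (fun φ => ih (a' := Y.ad φ a') (by simpa using h2 φ)) fun g => ?_
      exact relA_inj (X := X) (p := q + 1) (by simpa using h3 g)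

lemma relL_unique {p : ℕ} {a : L} {a' a'' : L'} (h : (a, a') ∈ relL X Y p)
    (h' : (a, a'') ∈ relL X Y p) : a' = a'' :=
  sub_eq_zero.1 (relL_inj (X := X) (q := p) (by simpa using sub_mem h h'))

lemma relA_mul {n p q : ℕ} (hn : p + q = n) {a c : A} {a' c' : A'}
    (h : (a, a') ∈ relA X Y p) (k : (c, c') ∈ relA X Y q) :
    (X.mul a c, Y.mul a' c') ∈ relA X Y n := by
  induction n generalizing p q a a' c c' with
  | zero =>
    obtain ⟨rfl, rfl⟩ : p = 0 ∧ q = 0 := by omega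
    obtain ⟨g, rfl, rfl⟩ := mem_relA_zero.1 h
    obtain ⟨g', rfl, rfl⟩ := mem_relA_zero.1 k
    exact mem_relA_zero.2 ⟨g * g', X.ofR_mul g g', Y.ofR_mul g g'⟩
  | succ n ih =>
    refine mem_relA_succ.2 ⟨⟨?_, ?_⟩, fun φ => ?_⟩
    · rw [← hn]; exact X.mul_mem (relA_mem h).1 (relA_mem k).1
    · rw [← hn]; exact Y.mul_mem (relA_mem h).2 (relA_mem k).2
    · rw [D_mul, D_mul]
      refine add_mem (a := (X.mul (X.D φ a) c, Y.mul (Y.D φ a') c'))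
        (b := (X.mul a (X.D φ c), Y.mul a' (Y.D φ c'))) ?_ ?_
      · cases p with
        | zero =>
          rw [X.D_zero (relA_mem h).1, Y.D_zero (relA_mem h).2]
          simp only [map_zero, LinearMap.zero_apply]; exact zero_mem _
        | succ p => exact ih (by omega) (relA_D h φ) k
      · cases q with
        | zero =>
          rw [X.D_zero (relA_mem k).1, Y.D_zero (relA_mem k).2]
          simp only [map_zero]; exact zero_mem _
        | succ p => exact ih (by omega) h (relA_D k φ)

lemma relA_ofR_mul (g : R) {p : ℕ} {c : A} {c' : A'} (k : (c, c') ∈ relA X Y p) :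
    (X.mul (X.ofR g) c, Y.mul (Y.ofR g) c') ∈ relA X Y p :=
  relA_mul (zero_add p) (mem_relA_zero.2 ⟨g, rfl, rfl⟩) k

lemma exists_of_relA_one {a : A} {a' : A'} (h : (a, a') ∈ relA X Y 1) :
    ∃ e, a = X.ofW e ∧ a' = Y.ofW e := by
  obtain ⟨e, rfl⟩ := X.exists_ofW (relA_mem h).1
  obtain ⟨e', rfl⟩ := Y.exists_ofW (relA_mem h).2
  have : e = e' := by
    refine sub_eq_zero.1 (b.nondeg _ fun φ => ?_)
    have h1 := relA_D h φ
    simp only [D, X.anchor_ofW, Y.anchor_ofW] at h1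
    obtain ⟨g, hg, hg'⟩ := mem_relA_zero.1 h1
    rw [← map_neg] at hg hg'
    rw [map_sub, ← neg_inj, neg_zero, neg_sub, sub_eq_zero, ← neg_inj, ← X.ofR_eq hg,
      ← Y.ofR_eq hg']
  subst this
  exact ⟨e, rfl, rfl⟩

lemma relA_ofW (e : W) : (X.ofW e, Y.ofW e) ∈ relA X Y 1 :=
  mem_relA_succ.2 ⟨⟨X.ofW_mem e, Y.ofW_mem e⟩, fun φ => by
    rw [D, D, X.anchor_ofW, Y.anchor_ofW]
    exact mem_relA_zero.2 ⟨- b.pair φ e, by simp, by simp⟩⟩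

/-- The rank one derivation `e' ↦ ⟨φ, e'⟩ e`. -/
def rankOne (b : DualPair M R V W) (φ : V) (e : W) : modDer R W :=
  ⟨((0 : Derivation ℝ R R),
    { toFun := fun e' => b.pair φ e' • e
      map_add' := fun x y => by rw [map_add, add_smul]
      map_smul' := fun c x => by
        rw [← algebraMap_smul R c x, map_smul, smul_assoc, RingHom.id_apply, algebraMap_smul] }),
    fun g v => by
      change b.pair φ (g • v) • e = g • b.pair φ v • e + (0 : R) • v
      rw [map_smul, smul_assoc, zero_smul, add_zero]⟩

lemma smul_ofW_ofV (φ : V) (e : W) : X.smul (X.ofW e) (X.ofV φ)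
    = - X.ofDer (rankOne b φ e) + X.smul (X.ofR (b.pair φ e)) X.unit := by
  rw [X.ofDer_rank_one φ e (rankOne b φ e) rfl (fun _ => rfl)]; abel

lemma relL_smul {n p q : ℕ} (hn : p + q = n) {a : A} {c : L} {a' : A'} {c' : L'}
    (h : (a, a') ∈ relA X Y p) (k : (c, c') ∈ relL X Y q) :
    (X.smul a c, Y.smul a' c') ∈ relL X Y n := by
  induction n generalizing p q a a' c c' with
  | zero =>
    obtain ⟨rfl, rfl⟩ : p = 0 ∧ q = 0 := by omega
    obtain ⟨g, rfl, rfl⟩ := mem_relA_zero.1 h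
    obtain ⟨φ, rfl, rfl⟩ := mem_relL_zero.1 k
    exact mem_relL_zero.2 ⟨g • φ, X.ofV_smul g φ, Y.ofV_smul g φ⟩
  | succ n ih =>
    cases n with
    | zero =>
      obtain ⟨rfl, rfl⟩ | ⟨rfl, rfl⟩ : (p = 1 ∧ q = 0) ∨ (p = 0 ∧ q = 1) := by omega
      · obtain ⟨e, rfl, rfl⟩ := exists_of_relA_one h
        obtain ⟨φ, rfl, rfl⟩ := mem_relL_zero.1 k
        exact mem_relL_one.2 ⟨- rankOne b φ e, b.pair φ e, by rw [map_neg, smul_ofW_ofV],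
          by rw [map_neg, smul_ofW_ofV]⟩
      · obtain ⟨g, rfl, rfl⟩ := mem_relA_zero.1 h
        obtain ⟨δ, f, rfl, rfl⟩ := mem_relL_one.1 k
        let δ' : modDer R W := ⟨DerPair.fsmul g δ.1, fun f v => by
          change g • δ.1.op (f • v) = f • g • δ.1.op v + (g * δ.1.symb f) • v
          rw [δ.2 f v, smul_add, smul_comm g f, mul_smul]⟩
        refine mem_relL_one.2 ⟨δ', g * f, ?_, ?_⟩
        · rw [X.ofDer_smul g δ δ' rfl, X.ofR_mul, X.mul_smul, map_add]
        · rw [Y.ofDer_smul g δ δ' rfl, Y.ofR_mul, Y.mul_smul, map_add]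
    | succ n =>
      refine mem_relL_add_two.2 ⟨⟨⟨?_, ?_⟩, fun φ => ?_⟩, fun g => ?_⟩
      · rw [← hn]; exact X.smul_mem (relA_mem h).1 (relL_mem k).1
      · rw [← hn]; exact Y.smul_mem (relA_mem h).2 (relL_mem k).2
      · rw [ad_smul, ad_smul]
        refine sub_mem (x := (X.smul a (X.ad φ c), Y.smul a' (Y.ad φ c')))
          (y := (X.smul (X.D φ a) c, Y.smul (Y.D φ a') c')) ?_ ?_
        · cases q with
          | zero =>
            rw [X.ad_zero (relL_mem k).1, Y.ad_zero (relL_mem k).2]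
            simp only [map_zero]; exact zero_mem _
          | succ p => exact ih (by omega) h (relL_ad k φ)
        · cases p with
          | zero =>
            rw [X.D_zero (relA_mem h).1, Y.D_zero (relA_mem h).2]
            simp only [map_zero, LinearMap.zero_apply]; exact zero_mem _
          | succ p => exact ih (by omega) (relA_D h φ) k
      · rw [X.anchor_smul, Y.anchor_smul]
        cases q with
        | zero =>
          rw [X.anchor_zero (relL_mem k).1, Y.anchor_zero (relL_mem k).2]
          simp only [map_zero]; exact zero_mem _
        | succ p => exact relA_mul (by omega) h (relL_anchor_ofR k g)

lemma relL_ofR_smul (g : R) {p : ℕ} {c : L} {c' : L'} (k : (c, c') ∈ relL X Y p) :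
    (X.smul (X.ofR g) c, Y.smul (Y.ofR g) c') ∈ relL X Y p :=
  relL_smul (zero_add p) (mem_relA_zero.2 ⟨g, rfl, rfl⟩) k

lemma relA_anchor {n p q : ℕ} (hn : n + 1 = q + p) {a : A} {c : L} {a' : A'} {c' : L'}
    (k : (c, c') ∈ relL X Y q) (h : (a, a') ∈ relA X Y p) :
    (X.anchor c a, Y.anchor c' a') ∈ relA X Y n := by
  induction n generalizing p q a a' c c' with
  | zero =>
    obtain ⟨rfl, rfl⟩ | ⟨rfl, rfl⟩ : (p = 1 ∧ q = 0) ∨ (p = 0 ∧ q = 1) := by omega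
    · obtain ⟨φ, rfl, rfl⟩ := mem_relL_zero.1 k
      exact relA_D h φ
    · obtain ⟨g, rfl, rfl⟩ := mem_relA_zero.1 h
      exact relL_anchor_ofR k g
  | succ n ih =>
    refine mem_relA_succ.2 ⟨⟨X.anchor_mem hn (relL_mem k).1 (relA_mem h).1,
      Y.anchor_mem hn (relL_mem k).2 (relA_mem h).2⟩, fun φ => ?_⟩
    rw [D_anchor, D_anchor]
    refine sub_mem (x := (X.anchor c (X.D φ a), Y.anchor c' (Y.D φ a')))
          (y := (X.anchor (X.ad φ c) a, Y.anchor (Y.ad φ c') a')) ?_ ?_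
    · cases p with
      | zero =>
        rw [X.D_zero (relA_mem h).1, Y.D_zero (relA_mem h).2]
        simp only [map_zero]; exact zero_mem _
      | succ p => exact ih (by omega) k (relA_D h φ)
    · cases q with
      | zero =>
        rw [X.ad_zero (relL_mem k).1, Y.ad_zero (relL_mem k).2]
        simp only [map_zero, LinearMap.zero_apply]; exact zero_mem _
      | succ p => exact ih (by omega) (relL_ad k φ) h

lemma relA_anchor_zero {a : A} {c : L} (k : c ∈ X.Ldeg 0) (h : a ∈ X.Adeg 0) :
    X.anchor c a = 0 := by
  rw [X.Adeg_zero] at h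
  obtain ⟨g, rfl⟩ := h
  exact X.anchor_zero k g

lemma bracket_zero {a c : L} (k : a ∈ X.Ldeg 0) (h : c ∈ X.Ldeg 0) : X.bracket a c = 0 := by
  rw [X.Ldeg_zero] at h
  obtain ⟨g, rfl⟩ := h
  exact X.ad_zero k g

lemma bracket_ofDer_add (δ δ' δ'' : modDer R W) (g g' : R)
    (h : δ''.1 = DerPair.bracket δ.1 δ'.1) :
    X.bracket (X.ofDer δ + X.smul (X.ofR g) X.unit) (X.ofDer δ' + X.smul (X.ofR g') X.unit)
      = X.ofDer δ'' + X.smul (X.ofR (δ.1.symb g' - δ'.1.symb g)) X.unit := by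
  have h0 : X.bracket (X.smul (X.ofR g) X.unit) (X.ofDer δ')
      = - X.smul (X.ofR (δ'.1.symb g)) X.unit := by
    rw [X.bracket_anti, X.leibniz, X.anchor_ofDer, X.bracket_anti _ X.unit, X.bracket_unit_ofDer]
    simp
  have h1 : X.bracket (X.smul (X.ofR g) X.unit) (X.smul (X.ofR g') X.unit) = 0 := by
    rw [X.leibniz, X.anchor_smul, X.anchor_unit, X.bracket_anti _ X.unit, X.leibniz,
      X.anchor_unit, X.bracket_self]
    simp
  rw [map_add, map_add, LinearMap.add_apply, LinearMap.add_apply, X.ofDer_bracket δ δ' δ'' h, h0,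
    h1, X.leibniz, X.anchor_ofDer, X.bracket_anti _ X.unit, X.bracket_unit_ofDer, map_sub, map_sub,
    LinearMap.sub_apply]
  simp only [neg_zero, map_zero, add_zero]; abel

lemma exists_bracket (δ δ' : modDer R W) : ∃ δ'' : modDer R W,
    δ''.1 = DerPair.bracket δ.1 δ'.1 := by
  refine ⟨⟨DerPair.bracket δ.1 δ'.1, fun f v => ?_⟩, rfl⟩
  change δ.1.op (δ'.1.op (f • v)) - δ'.1.op (δ.1.op (f • v)) =
    f • (δ.1.op (δ'.1.op v) - δ'.1.op (δ.1.op v)) + (⁅δ.1.symb, δ'.1.symb⁆ : Derivation ℝ R R) f • v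
  rw [δ'.2 f v, δ.2 f v, map_add, map_add, δ.2 f, δ'.2 f, δ.2, δ'.2, commutator_apply,
    smul_sub, sub_smul]
  abel

lemma relL_bracket {n q q' : ℕ} (hn : n + 1 = q + q') {a c : L} {a' c' : L'}
    (h : (a, a') ∈ relL X Y q) (k : (c, c') ∈ relL X Y q') :
    (X.bracket a c, Y.bracket a' c') ∈ relL X Y n := by
  induction n using Nat.strong_induction_on generalizing q q' a a' c c' with
  | _ n ih =>
  match n, hn, ih with
  | 0, hn, ih =>
    obtain ⟨rfl, rfl⟩ | ⟨rfl, rfl⟩ : (q = 1 ∧ q' = 0) ∨ (q = 0 ∧ q' = 1) := by omega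
    · obtain ⟨φ, rfl, rfl⟩ := mem_relL_zero.1 k
      exact relL_ad h φ
    · obtain ⟨φ, rfl, rfl⟩ := mem_relL_zero.1 h
      rw [X.bracket_anti, Y.bracket_anti]
      exact neg_mem (relL_ad k φ)
  | 1, hn, ih =>
    obtain ⟨rfl, rfl⟩ | ⟨rfl, rfl⟩ | ⟨rfl, rfl⟩ :
      (q = 1 ∧ q' = 1) ∨ (q = 0 ∧ q' = 2) ∨ (q = 2 ∧ q' = 0) := by omega
    · obtain ⟨δ, g, rfl, rfl⟩ := mem_relL_one.1 h
      obtain ⟨δ', g', rfl, rfl⟩ := mem_relL_one.1 k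
      obtain ⟨δ'', h''⟩ := exists_bracket δ δ'
      rw [bracket_ofDer_add δ δ' δ'' g g' h'', bracket_ofDer_add δ δ' δ'' g g' h'']
      exact mem_relL_one.2 ⟨_, _, rfl, rfl⟩
    · obtain ⟨φ, rfl, rfl⟩ := mem_relL_zero.1 h
      rw [X.bracket_anti, Y.bracket_anti]
      exact neg_mem (relL_ad k φ)
    · obtain ⟨φ, rfl, rfl⟩ := mem_relL_zero.1 k
      exact relL_ad h φ
  | n + 2, hn, ih =>
    refine mem_relL_add_two.2 ⟨⟨⟨X.bracket_mem hn (relL_mem h).1 (relL_mem k).1,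
      Y.bracket_mem hn (relL_mem h).2 (relL_mem k).2⟩, fun φ => ?_⟩, fun g => ?_⟩
    · rw [ad_bracket, ad_bracket]
      refine add_mem (a := (X.bracket (X.ad φ a) c, Y.bracket (Y.ad φ a') c'))
        (b := (X.bracket a (X.ad φ c), Y.bracket a' (Y.ad φ c'))) ?_ ?_
      · cases q with
        | zero =>
          rw [X.ad_zero (relL_mem h).1, Y.ad_zero (relL_mem h).2]
          simp only [map_zero, LinearMap.zero_apply]; exact zero_mem _
        | succ p => exact ih (n + 1) (by omega) (by omega) (relL_ad h φ) k
      · cases q' with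
        | zero =>
          rw [X.ad_zero (relL_mem k).1, Y.ad_zero (relL_mem k).2]
          simp only [map_zero]; exact zero_mem _
        | succ p => exact ih (n + 1) (by omega) (by omega) h (relL_ad k φ)
    · rw [X.anchor_bracket, Y.anchor_bracket]
      refine sub_mem (x := (X.anchor a (X.anchor c (X.ofR g)), Y.anchor a' (Y.anchor c' (Y.ofR g))))
        (y := (X.anchor c (X.anchor a (X.ofR g)), Y.anchor c' (Y.anchor a' (Y.ofR g)))) ?_ ?_
      · cases q' with
        | zero =>
          rw [X.anchor_zero (relL_mem k).1, Y.anchor_zero (relL_mem k).2]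
          simp only [map_zero]; exact zero_mem _
        | succ p => exact relA_anchor (by omega) h (relL_anchor_ofR k g)
      · cases q with
        | zero =>
          rw [X.anchor_zero (relL_mem h).1, Y.anchor_zero (relL_mem h).2]
          simp only [map_zero]; exact zero_mem _
        | succ p => exact relA_anchor (by omega) k (relL_anchor_ofR h g)

end GradedModel

end Abstract

section Abstract

namespace GradedModel

variable {b : DualPair M R V W} {A L : Type*} [AddCommGroup A] [Module ℝ A]
    [AddCommGroup L] [Module ℝ L] {X : GradedModel b A L}
    {A' L' : Type*} [AddCommGroup A'] [Module ℝ A']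
    [AddCommGroup L'] [Module ℝ L'] {Y : GradedModel b A' L'}

lemma ofR_smul_smul_comm (g : R) (a : A) (x : L) :
    X.smul a (X.smul (X.ofR g) x) = X.smul (X.ofR g) (X.smul a x) := by
  rw [← X.mul_smul, X.mul_comm, X.mul_smul]

lemma ofR_mul_mul_comm (g : R) (a x : A) :
    X.mul a (X.mul (X.ofR g) x) = X.mul (X.ofR g) (X.mul a x) := by
  rw [← X.mul_assoc, X.mul_comm a, X.mul_assoc]

/-- An element of the base algebra which has a partner locally has a partner. -/
lemma relA_of_local {p : ℕ} {a : A} (ha : a ∈ X.Adeg p)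
    (ih : ∀ φ, ∃ c, (X.D φ a, c) ∈ relA X Y (p - 1))
    (h : ∀ x, ∃ χ, b.ev x χ = 1 ∧ ∃ c, (X.mul (X.ofR χ) a, c) ∈ relA X Y p) :
    ∃ c, (a, c) ∈ relA X Y p := by
  cases p with
  | zero =>
    rw [X.Adeg_zero] at ha
    obtain ⟨g, rfl⟩ := ha
    exact ⟨_, mem_relA_zero.2 ⟨g, rfl, rfl⟩⟩
  | succ p =>
  choose χ hχ c hc using h
  obtain ⟨d, hd, hdc⟩ := Y.glue_A (p + 1) χ hχ c (fun x => (relA_mem (hc x)).2) fun x y => by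
    refine relA_unique (X := X) (relA_ofR_mul (χ y) (hc x)) ?_
    rw [ofR_mul_mul_comm]
    exact relA_ofR_mul (χ x) (hc y)
  refine ⟨d, mem_relA_succ.2 ⟨⟨ha, hd⟩, fun φ => ?_⟩⟩
  obtain ⟨c', hc'⟩ := ih φ
  have : Y.D φ d = c' := by
    refine sub_eq_zero.1 (Y.sep_A χ hχ _ fun x => ?_)
    rw [map_sub, sub_eq_zero, ← D_ofR_mul, hdc]
    refine relA_unique (X := X) (relA_D (hc x) φ) ?_
    rw [D_ofR_mul]
    exact relA_ofR_mul (χ x) hc'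
  rw [this]
  exact hc'

lemma euler_A {χ : R} {n : ℕ} {e : Fin n → W} {ε : Fin n → V}
    (hχ : ∀ φ, χ • φ = ∑ i, b.pair φ (e i) • ε i) (p : ℕ) {a : A} (ha : a ∈ X.Adeg p) :
    (p : ℝ) • X.mul (X.ofR χ) a + ∑ i, X.mul (X.ofW (e i)) (X.D (ε i) a) = 0 := by
  induction p generalizing a with
  | zero => simp [X.D_zero ha]
  | succ p ih =>
    refine X.faithful_A p _ (add_mem (Submodule.smul_mem _ _ (X.ofR_mul_mem χ ha))
      (Submodule.sum_mem _ fun i _ => ?_)) fun φ => ?_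
    · rw [add_comm]; exact X.mul_mem (X.ofW_mem _) (X.D_mem _ ha)
    · have h1 := ih (X.D_mem φ ha)
      have h2 : X.D (χ • φ) a = ∑ i, X.mul (X.ofR (b.pair φ (e i))) (X.D (ε i) a) := by
        rw [hχ]
        simp only [← D_smul]
        simp only [D, map_sum, LinearMap.sum_apply]
      rw [D_smul] at h2
      change X.D φ _ = 0
      rw [map_add, map_smul, map_sum, D_ofR_mul, ← h1, Nat.cast_add, add_smul, Nat.cast_one,
        one_smul, h2, add_assoc, ← Finset.sum_add_distrib]
      congr 1
      refine Finset.sum_congr rfl fun i _ => ?_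
      rw [D_mul, X.D_comm (ε i) φ, show X.D φ (X.ofW (e i)) = _ from X.anchor_ofW φ (e i), map_neg,
        LinearMap.neg_apply]
      abel

variable (Y) in
lemma relA_exists {p : ℕ} {a : A} (ha : a ∈ X.Adeg p) : ∃ c, (a, c) ∈ relA X Y p := by
  induction p generalizing a with
  | zero =>
    rw [X.Adeg_zero] at ha
    obtain ⟨g, rfl⟩ := ha
    exact ⟨_, mem_relA_zero.2 ⟨g, rfl, rfl⟩⟩
  | succ p ih =>
    refine relA_of_local ha (fun φ => ih (X.D_mem φ ha)) fun x => ?_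
    obtain ⟨χ, hχ, ⟨n, e, ε, h⟩, -⟩ := b.loc x
    refine ⟨χ, hχ, ?_⟩
    choose c hc using fun i => ih (X.D_mem (ε i) ha)
    have h1 := X.euler_A h (p + 1) ha
    have h2 : X.mul (X.ofR χ) a
        = - (((p + 1 : ℕ) : ℝ)⁻¹ • ∑ i, X.mul (X.ofW (e i)) (X.D (ε i) a)) := by
      rw [← smul_neg, ← eq_neg_of_add_eq_zero_left h1, smul_smul, inv_mul_cancel₀ (by positivity),
        one_smul]
    have h3 := Submodule.sum_mem (relA X Y (p + 1)) (t := Finset.univ)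
      fun i _ => relA_mul (add_comm 1 p) (relA_ofW (X := X) (Y := Y) (e i)) (hc i)
    have h4 := neg_mem (Submodule.smul_mem _ (((p + 1 : ℕ) : ℝ)⁻¹) h3)
    rw [h2]
    exact ⟨- (((p + 1 : ℕ) : ℝ)⁻¹ • ∑ i, Y.mul (Y.ofW (e i)) (c i)), by
      convert h4 using 1
      simp only [Prod.ext_iff, Prod.fst_neg, Prod.snd_neg, Prod.smul_fst, Prod.smul_snd,
        Prod.fst_sum, Prod.snd_sum, and_self]⟩

/-- Derivations on the base with values in the base algebra, in local coordinates. -/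
lemma derivation_loc {χ : R} {n : ℕ} {y : Fin n → R} {δ : Fin n → modDer R W}
    (h : ∀ (Y : Derivation ℝ R R) (g : R), χ * Y g = ∑ a, Y (y a) * (δ a).1.symb g) {p : ℕ}
    (Y : R →ₗ[ℝ] A) (hY : ∀ g, Y g ∈ X.Adeg p)
    (hl : ∀ g g', Y (g * g') = X.mul (X.ofR g) (Y g') + X.mul (X.ofR g') (Y g)) (g : R) :
    X.mul (X.ofR χ) (Y g) = ∑ a, X.mul (Y (y a)) (X.ofR ((δ a).1.symb g)) := by
  induction p generalizing Y with
  | zero =>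
    rw [X.Adeg_zero] at hY
    choose f hf using hY
    let Y' : Derivation ℝ R R := Derivation.mk'
      { toFun := f
        map_add' := fun g g' => X.ofR_eq (by rw [map_add, hf, hf, hf, map_add])
        map_smul' := fun c g => X.ofR_eq (by rw [map_smul, hf, hf, map_smul]; rfl) }
      fun g g' => X.ofR_eq (by
        simp only [LinearMap.coe_mk, AddHom.coe_mk, smul_eq_mul, map_add, X.ofR_mul, hf, hl])
    have hY' : ∀ g, Y g = X.ofR (Y' g) := fun g => (hf g).symm
    rw [hY', ← X.ofR_mul, h Y' g, map_sum]
    simp only [X.ofR_mul, hY']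
  | succ p ih =>
    refine sub_eq_zero.1 (X.faithful_A p _ (sub_mem (X.ofR_mul_mem χ (hY g))
      (Submodule.sum_mem _ fun i _ => by
        rw [X.mul_comm]; exact X.ofR_mul_mem _ (hY _))) fun φ => ?_)
    change X.D φ _ = 0
    rw [map_sub, D_ofR_mul, map_sum, sub_eq_zero]
    have := ih (X.D φ ∘ₗ Y) (fun g => X.D_mem φ (hY g)) fun g g' => by
      simp only [comp_apply, hl, map_add, D_ofR_mul]
    simp only [comp_apply] at this
    rw [this]
    refine Finset.sum_congr rfl fun i _ => ?_
    rw [D_mul, D_ofR, map_zero, add_zero]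

lemma relL_of_local {q : ℕ} {a : L} (ha : a ∈ X.Ldeg (q + 2))
    (ih : ∀ φ, ∃ c, (X.ad φ a, c) ∈ relL X Y (q + 1))
    (h : ∀ x, ∃ χ, b.ev x χ = 1 ∧ ∃ c, (X.smul (X.ofR χ) a, c) ∈ relL X Y (q + 2)) :
    ∃ c, (a, c) ∈ relL X Y (q + 2) := by
  choose χ hχ c hc using h
  obtain ⟨d, hd, hdc⟩ := Y.glue_L (q + 2) χ hχ c (fun x => (relL_mem (hc x)).2) fun x y => by
    refine relL_unique (X := X) (relL_ofR_smul (χ y) (hc x)) ?_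
    rw [ofR_smul_smul_comm]
    exact relL_ofR_smul (χ x) (hc y)
  refine ⟨d, mem_relL_add_two.2 ⟨⟨⟨ha, hd⟩, fun φ => ?_⟩, fun g => ?_⟩⟩
  · obtain ⟨c', hc'⟩ := ih φ
    have : Y.ad φ d = c' := by
      refine sub_eq_zero.1 (Y.sep_L χ hχ _ fun x => ?_)
      rw [map_sub, sub_eq_zero, ← ad_ofR_smul, hdc]
      refine relL_unique (X := X) (relL_ad (hc x) φ) ?_
      rw [ad_ofR_smul]
      exact relL_ofR_smul (χ x) hc'
    rw [this]
    exact hc'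
  · obtain ⟨c', hc'⟩ := relA_exists Y (X.anchor_mem (n := q + 1) (by omega) ha (X.ofR_mem g))
    have : Y.anchor d (Y.ofR g) = c' := by
      refine sub_eq_zero.1 (Y.sep_A χ hχ _ fun x => ?_)
      rw [map_sub, sub_eq_zero, ← Y.anchor_smul, hdc]
      refine relA_unique (X := X) (relL_anchor_ofR (hc x) g) ?_
      rw [X.anchor_smul]
      exact relA_ofR_mul (χ x) hc'
    rw [this]
    exact hc'

section Euler

variable (X)

/-- Minus the Euler operator of a local frame. -/
def eulerOp {n : ℕ} (e : Fin n → W) (ε : Fin n → V) : L →ₗ[ℝ] L :=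
  - ∑ i, X.smul (X.ofW (e i)) ∘ₗ X.ad (ε i)

variable {X} {χ : R} {n : ℕ} {e : Fin n → W} {ε : Fin n → V}

lemma eulerOp_apply (a : L) :
    X.eulerOp e ε a = - ∑ i, X.smul (X.ofW (e i)) (X.ad (ε i) a) := by
  simp [eulerOp]

lemma eulerOp_mem {q : ℕ} {a : L} (ha : a ∈ X.Ldeg (q + 1)) :
    X.eulerOp e ε a ∈ X.Ldeg (q + 1) := by
  rw [eulerOp_apply]
  refine neg_mem (Submodule.sum_mem _ fun i _ => ?_)
  rw [add_comm]
  exact X.smul_mem (X.ofW_mem _) (X.ad_mem _ ha)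

lemma eulerOp_anchor {a : L} (hR : ∀ g, X.anchor a (X.ofR g) = 0) (g : R) :
    X.anchor (X.eulerOp e ε a) (X.ofR g) = 0 := by
  simp [eulerOp_apply, X.anchor_smul, anchor_ad, D_ofR, hR]

lemma ad_anchor_ofR {a : L} (hR : ∀ g, X.anchor a (X.ofR g) = 0) (φ : V) (g : R) :
    X.anchor (X.ad φ a) (X.ofR g) = 0 := by
  simp [anchor_ad, D_ofR, hR]

lemma ad_eulerOp (hχ : ∀ φ, χ • φ = ∑ i, b.pair φ (e i) • ε i) {a : L}
    (hR : ∀ g, X.anchor a (X.ofR g) = 0) (φ : V) :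
    X.ad φ (X.eulerOp e ε a) = X.eulerOp e ε (X.ad φ a) - X.smul (X.ofR χ) (X.ad φ a) := by
  have h2 : X.ad (χ • φ) a = ∑ i, X.smul (X.ofR (b.pair φ (e i))) (X.ad (ε i) a) := by
    rw [hχ]
    have : ∀ g ψ, X.smul (X.ofR g) (X.ad ψ a) = X.ad (g • ψ) a := fun g ψ => by
      rw [ad_smulV, hR]; simp
    simp only [this]
    simp only [ad, map_sum, flip_apply, LinearMap.sum_apply]
  rw [ad_smulV, hR, map_zero, LinearMap.zero_apply, zero_add] at h2
  rw [eulerOp_apply, eulerOp_apply, h2, map_neg, map_sum, ← neg_add', ← Finset.sum_add_distrib]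
  congr 1
  refine Finset.sum_congr rfl fun i _ => ?_
  rw [ad_smul, D, X.anchor_ofW, map_neg, LinearMap.neg_apply, sub_neg_eq_add, X.ad_comm φ]

lemma eulerOp_eq (hχ : ∀ φ, χ • φ = ∑ i, b.pair φ (e i) • ε i) (q : ℕ) {a : L}
    (ha : a ∈ X.Ldeg q) (hR : ∀ g, X.anchor a (X.ofR g) = 0) {y z : L}
    (hy : y = (q : ℝ) • X.smul (X.ofR χ) a + X.eulerOp e ε a)
    (hz : z = ((q : ℝ) - 1) • X.smul (X.ofR χ) y + X.eulerOp e ε y) : z = 0 := by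
  induction q generalizing a y z with
  | zero =>
    have : y = 0 := by rw [hy, eulerOp_apply]; simp [X.ad_zero ha]
    rw [hz, this]; simp
  | succ q ih =>
    have hyR : ∀ g, X.anchor y (X.ofR g) = 0 := fun g => by
      simp [hy, X.anchor_smul, eulerOp_anchor hR, hR]
    have hzR : ∀ g, X.anchor z (X.ofR g) = 0 := fun g => by
      simp [hz, X.anchor_smul, eulerOp_anchor hyR, hyR]
    have hym : y ∈ X.Ldeg (q + 1) := by
      rw [hy]; exact add_mem (Submodule.smul_mem _ _ (X.ofR_smul_mem _ ha)) (eulerOp_mem ha)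
    have hzm : z ∈ X.Ldeg (q + 1) := by
      rw [hz]; exact add_mem (Submodule.smul_mem _ _ (X.ofR_smul_mem _ hym)) (eulerOp_mem hym)
    have hady : ∀ φ, X.ad φ y = (q : ℝ) • X.smul (X.ofR χ) (X.ad φ a)
        + X.eulerOp e ε (X.ad φ a) := fun φ => by
      rw [hy, map_add, ad_eulerOp hχ hR, map_smul, ad_ofR_smul, Nat.cast_add, Nat.cast_one,
        add_smul, one_smul]; abel
    have hadz : ∀ φ, X.ad φ z = ((q : ℝ) - 1) • X.smul (X.ofR χ) (X.ad φ y)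
        + X.eulerOp e ε (X.ad φ y) := fun φ => by
      rw [hz, map_add, ad_eulerOp hχ hyR, map_smul, ad_ofR_smul, Nat.cast_add, Nat.cast_one,
        add_sub_cancel_right, sub_smul, one_smul]; abel
    have h0 : ∀ φ, X.ad φ z = 0 := fun φ =>
      ih (X.ad_mem φ ha) (ad_anchor_ofR hR φ) (hady φ) (hadz φ)
    cases q with
    | zero =>
      have hy0 : ∀ φ, X.ad φ y = 0 := fun φ => by
        rw [hady, eulerOp_apply]
        simp [X.ad_zero (X.ad_mem φ ha)]
      rw [hz, eulerOp_apply]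
      simp [hy0]
    | succ q => exact X.faithful_L q z hzm h0 hzR

end Euler

lemma relL_exists {q : ℕ} {a : L} (ha : a ∈ X.Ldeg q) : ∃ c, (a, c) ∈ relL X Y q := by
  induction q generalizing a with
  | zero =>
    rw [X.Ldeg_zero] at ha
    obtain ⟨φ, rfl⟩ := ha
    exact ⟨_, mem_relL_zero.2 ⟨φ, rfl, rfl⟩⟩
  | succ q ih =>
    cases q with
    | zero =>
      obtain ⟨δ, g, rfl⟩ := X.exists_ofDer ha
      exact ⟨_, mem_relL_one.2 ⟨δ, g, rfl, rfl⟩⟩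
    | succ q =>
    refine relL_of_local ha (fun φ => ih (X.ad_mem φ ha)) fun x => ?_
    obtain ⟨χ, hχ, ⟨n, e, ε, h⟩, ⟨m, y, δ, h'⟩⟩ := b.loc x
    let dom : Submodule ℝ L := (relL X Y (q + 2)).map (LinearMap.fst ℝ L L')
    have hdom : ∀ z, z ∈ dom ↔ ∃ c, (z, c) ∈ relL X Y (q + 2) := fun z => by simp [dom]
    have dom_smul : ∀ g z, z ∈ dom → X.smul (X.ofR g) z ∈ dom := fun g z hz => by
      obtain ⟨c, hc⟩ := (hdom z).1 hz
      exact (hdom _).2 ⟨_, relL_ofR_smul g hc⟩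
    have dom_euler : ∀ z ∈ X.Ldeg (q + 2), X.eulerOp e ε z ∈ dom := fun z hz => by
      rw [eulerOp_apply]
      refine neg_mem (Submodule.sum_mem _ fun i _ => ?_)
      obtain ⟨c, hc⟩ := ih (X.ad_mem (ε i) hz)
      exact (hdom _).2 ⟨_, relL_smul (by omega) (relA_ofW (e i)) hc⟩
    -- the part which does not commute with functions
    let a₀ : L := ∑ i, X.smul (X.anchor a (X.ofR (y i))) (X.ofDer (δ i))
    have ha₀ : a₀ ∈ dom := by
      refine Submodule.sum_mem _ fun i _ => ?_
      obtain ⟨c, hc⟩ := relA_exists Y (X.anchor_mem (n := q + 1) (by omega) ha (X.ofR_mem (y i)))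
      refine (hdom _).2 ⟨_, relL_smul (by omega) hc
        (mem_relL_one.2 ⟨δ i, 0, ?_, rfl⟩)⟩
      simp
    let a₁ : L := X.smul (X.ofR χ) a - a₀
    have hm : a₁ ∈ X.Ldeg (q + 2) := by
      obtain ⟨c, hc⟩ := (hdom _).1 ha₀
      exact sub_mem (X.ofR_smul_mem χ ha) (relL_mem hc).1
    have hR : ∀ g, X.anchor a₁ (X.ofR g) = 0 := fun g => by
      have := X.derivation_loc h' (p := q + 1) (X.anchor a ∘ₗ X.ofR)
        (fun g => X.anchor_mem (by omega) ha (X.ofR_mem g))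
        (fun g g' => by
          simp only [comp_apply, X.ofR_mul, X.anchor_mul]
          rw [X.mul_comm, add_comm]) g
      simp only [comp_apply] at this
      simp only [a₁, a₀, map_sub, LinearMap.sub_apply, X.anchor_smul, this, map_sum,
        LinearMap.sum_apply, X.anchor_ofDer, sub_self]
    have key := X.eulerOp_eq h (q + 2) hm hR rfl rfl
    have h1 : X.smul (X.ofR χ) (X.smul (X.ofR χ) a₁) ∈ dom := by
      set T := X.eulerOp e ε
      set c : ℝ := ((q + 2 : ℕ) : ℝ) with hc
      have e1 : (c * (c - 1)) • X.smul (X.ofR χ) (X.smul (X.ofR χ) a₁)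
          = - ((c - 1) • X.smul (X.ofR χ) (T a₁) + T (c • X.smul (X.ofR χ) a₁ + T a₁)) := by
        rw [map_add (X.smul (X.ofR χ)), smul_add, map_smul (X.smul (X.ofR χ)), smul_smul,
          add_assoc] at key
        rw [← eq_neg_of_add_eq_zero_left key, mul_comm]
      have hc0 : c * (c - 1) ≠ 0 := by
        rw [hc]; push_cast
        have : (0 : ℝ) ≤ q := by positivity
        exact mul_ne_zero (by linarith) (by linarith)
      rw [← one_smul ℝ (X.smul (X.ofR χ) (X.smul (X.ofR χ) a₁)), ← inv_mul_cancel₀ hc0,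
        ← smul_smul, e1]
      refine Submodule.smul_mem _ _ (neg_mem (add_mem (Submodule.smul_mem _ _
        (dom_smul _ _ (dom_euler _ hm))) (dom_euler _ (add_mem (Submodule.smul_mem _ _
          (X.ofR_smul_mem _ hm)) (eulerOp_mem hm)))))
    refine ⟨χ * χ * χ, by simp [hχ], (hdom _).1 ?_⟩
    have h2 : X.smul (X.ofR (χ * χ * χ)) a = X.smul (X.ofR χ) (X.smul (X.ofR χ) a₁)
        + X.smul (X.ofR χ) (X.smul (X.ofR χ) a₀) := by
      simp only [a₁, X.ofR_mul, X.mul_smul, map_sub]; abel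
    rw [h2]
    exact add_mem h1 (dom_smul _ _ (dom_smul _ _ ha₀))

end GradedModel

end Abstract

section Correspondence

variable {A A' : Type*} [AddCommGroup A] [Module ℝ A] [AddCommGroup A'] [Module ℝ A']

/-- If graded correspondences are functional, then so is their sum. -/
lemma iSup_rel_inj {Adeg : ℕ → Submodule ℝ A} (hA : iSupIndep Adeg)
    {rel : ℕ → Submodule ℝ (A × A')} (hrel : ∀ p a a', (a, a') ∈ rel p → a ∈ Adeg p)
    (hinj : ∀ p a', ((0 : A), a') ∈ rel p → a' = 0) {a' : A'}
    (h : ((0 : A), a') ∈ ⨆ p, rel p) : a' = 0 := by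
  classical
  rw [Submodule.mem_iSup_iff_exists_dfinsupp'] at h
  obtain ⟨f, hf⟩ := h
  have h1 : (f.sum fun i x => (x : A × A').1) = 0 := by
    have := congrArg (LinearMap.fst ℝ A A') hf
    simpa [DFinsupp.sum, map_sum] using this
  have h2 : (f.sum fun i x => (x : A × A').2) = a' := by
    have := congrArg (LinearMap.snd ℝ A A') hf
    simpa [DFinsupp.sum, map_sum] using this
  have h3 : ∀ p ∈ f.support, (f p : A × A').1 = 0 :=
    (iSupIndep_iff_finsetSum_eq_zero_imp_eq_zero Adeg).1 hA f.support
      (fun p => (f p : A × A').1) (fun p _ => hrel p _ _ (f p).2) h1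
  rw [← h2]
  refine Finset.sum_eq_zero fun p hp => ?_
  refine hinj p _ ?_
  rw [← h3 p hp]
  exact (f p).2

lemma exists_linearEquiv_of_rel {Adeg : ℕ → Submodule ℝ A} (hA : iSupIndep Adeg)
    (hA1 : ⨆ p, Adeg p = ⊤) {Adeg' : ℕ → Submodule ℝ A'} (hA' : iSupIndep Adeg')
    (hA1' : ⨆ p, Adeg' p = ⊤) {rel : ℕ → Submodule ℝ (A × A')}
    (hrel : ∀ p a a', (a, a') ∈ rel p → a ∈ Adeg p ∧ a' ∈ Adeg' p)
    (hinj : ∀ p a', ((0 : A), a') ∈ rel p → a' = 0)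
    (hinj' : ∀ p a, (a, (0 : A')) ∈ rel p → a = 0)
    (hex : ∀ p, ∀ a ∈ Adeg p, ∃ a', (a, a') ∈ rel p)
    (hex' : ∀ p, ∀ a' ∈ Adeg' p, ∃ a, (a, a') ∈ rel p) :
    ∃ e : A ≃ₗ[ℝ] A', (∀ a, (a, e a) ∈ ⨆ p, rel p) ∧ (∀ p a, a ∈ Adeg p → (a, e a) ∈ rel p) ∧
      ∀ p a, e a ∈ Adeg' p → a ∈ Adeg p := by
  let swap : (A × A') ≃ₗ[ℝ] (A' × A) := LinearEquiv.prodComm ℝ A A'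
  have inj : ∀ a', ((0 : A), a') ∈ ⨆ p, rel p → a' = 0 := fun a' h =>
    iSup_rel_inj hA (fun p a a' h => (hrel p a a' h).1) hinj h
  have inj' : ∀ a, (a, (0 : A')) ∈ ⨆ p, rel p → a = 0 := fun a h => by
    refine iSup_rel_inj (rel := fun p => (rel p).map swap.toLinearMap) hA' ?_ ?_
      (a' := a) ?_
    · rintro p a a' ⟨⟨x, y⟩, hx, h⟩
      obtain ⟨rfl, rfl⟩ := Prod.ext_iff.1 h
      exact (hrel p _ _ hx).2
    · rintro p a' ⟨⟨x, y⟩, hx, h⟩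
      obtain ⟨h1, h2⟩ := Prod.ext_iff.1 h
      change y = 0 at h1; change x = a' at h2
      subst h1; subst h2
      exact hinj' p _ hx
    · rw [← Submodule.map_iSup]
      exact ⟨(a, 0), h, rfl⟩
  have ex : ∀ a, ∃ a', (a, a') ∈ ⨆ p, rel p := fun a => by
    have : a ∈ ⨆ p, Adeg p := hA1 ▸ Submodule.mem_top
    have hle : ⨆ p, Adeg p ≤ (⨆ p, rel p).map (LinearMap.fst ℝ A A') :=
      iSup_le fun p a ha => by
        obtain ⟨a', h⟩ := hex p a ha
        exact ⟨(a, a'), mem_iSup_of_mem p h, rfl⟩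
    obtain ⟨⟨x, y⟩, h, rfl⟩ := hle this
    exact ⟨y, h⟩
  have ex' : ∀ a', ∃ a, (a, a') ∈ ⨆ p, rel p := fun a' => by
    have : a' ∈ ⨆ p, Adeg' p := hA1' ▸ Submodule.mem_top
    have hle : ⨆ p, Adeg' p ≤ (⨆ p, rel p).map (LinearMap.snd ℝ A A') :=
      iSup_le fun p a ha => by
        obtain ⟨a', h⟩ := hex' p a ha
        exact ⟨(a', a), mem_iSup_of_mem p h, rfl⟩
    obtain ⟨⟨x, y⟩, h, rfl⟩ := hle this
    exact ⟨x, h⟩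
  let e₁ : (⨆ p, rel p : Submodule ℝ (A × A')) ≃ₗ[ℝ] A := LinearEquiv.ofBijective
    ((LinearMap.fst ℝ A A') ∘ₗ (⨆ p, rel p).subtype)
    ⟨by
      rw [← LinearMap.ker_eq_bot, LinearMap.ker_eq_bot']
      rintro ⟨⟨x, y⟩, h⟩ hx
      change x = 0 at hx
      subst hx
      exact Subtype.ext (Prod.ext rfl (inj y h)), fun a => by
      obtain ⟨a', h⟩ := ex a
      exact ⟨⟨(a, a'), h⟩, rfl⟩⟩
  let e₂ : (⨆ p, rel p : Submodule ℝ (A × A')) ≃ₗ[ℝ] A' := LinearEquiv.ofBijective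
    ((LinearMap.snd ℝ A A') ∘ₗ (⨆ p, rel p).subtype)
    ⟨by
      rw [← LinearMap.ker_eq_bot, LinearMap.ker_eq_bot']
      rintro ⟨⟨x, y⟩, h⟩ hx
      change y = 0 at hx
      subst hx
      exact Subtype.ext (Prod.ext (inj' x h) rfl), fun a => by
      obtain ⟨a', h⟩ := ex' a
      exact ⟨⟨(a', a), h⟩, rfl⟩⟩
  have he : ∀ a, (a, (e₁.symm.trans e₂) a) ∈ ⨆ p, rel p := fun a => by
    have h1 : (e₁.symm a : A × A').1 = a := e₁.apply_symm_apply a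
    have h2 := (e₁.symm a).2
    have h3 : (e₁.symm a : A × A') = (a, (e₁.symm.trans e₂) a) := Prod.ext h1 rfl
    rwa [← h3]
  refine ⟨e₁.symm.trans e₂, he, fun p a ha => ?_, fun p a ha => ?_⟩
  · obtain ⟨a', h⟩ := hex p a ha
    have := sub_mem (he a) (mem_iSup_of_mem p h)
    rw [Prod.mk_sub_mk, sub_self] at this
    rwa [sub_eq_zero.1 (inj _ this)]
  · obtain ⟨a', h⟩ := hex' p _ ha
    have := sub_mem (he a) (mem_iSup_of_mem p h)
    rw [Prod.mk_sub_mk, sub_self] at this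
    rw [sub_eq_zero.1 (inj' _ this)]
    exact (hrel p _ _ h).1

end Correspondence

section Abstract

namespace GradedModel

variable {b : DualPair M R V W} {A L : Type*} [AddCommGroup A] [Module ℝ A]
    [AddCommGroup L] [Module ℝ L] (X : GradedModel b A L)
    {A' L' : Type*} [AddCommGroup A'] [Module ℝ A']
    [AddCommGroup L'] [Module ℝ L'] (Y : GradedModel b A' L')

/-- Bilinear operations compatible with graded correspondences are compatible with their sums. -/
lemma iSup_rel_bilin {A B C A' B' C' : Type*} [AddCommGroup A] [Module ℝ A]
    [AddCommGroup B] [Module ℝ B] [AddCommGroup C] [Module ℝ C]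
    [AddCommGroup A'] [Module ℝ A'] [AddCommGroup B'] [Module ℝ B'] [AddCommGroup C'] [Module ℝ C']
    {r : ℕ → Submodule ℝ (A × A')} {s : ℕ → Submodule ℝ (B × B')} {t : Submodule ℝ (C × C')}
    (f : A →ₗ[ℝ] B →ₗ[ℝ] C) (f' : A' →ₗ[ℝ] B' →ₗ[ℝ] C')
    (h : ∀ p q a a' c c', (a, a') ∈ r p → (c, c') ∈ s q → (f a c, f' a' c') ∈ t)
    {a : A} {a' : A'} {c : B} {c' : B'} (ha : (a, a') ∈ ⨆ p, r p) (hc : (c, c') ∈ ⨆ p, s p) :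
    (f a c, f' a' c') ∈ t := by
  refine Submodule.iSup_induction (motive := fun x => (f x.1 c, f' x.2 c') ∈ t) r ha
    (fun p x hx => ?_) (by simp only [Prod.fst_zero, Prod.snd_zero, map_zero, LinearMap.zero_apply]; exact zero_mem t) fun x y hx hy => ?_
  · refine Submodule.iSup_induction (motive := fun y => (f x.1 y.1, f' x.2 y.2) ∈ t) s hc
      (fun q y hy => h p q _ _ _ _ hx hy) (by simp only [Prod.fst_zero, Prod.snd_zero, map_zero]; exact zero_mem t) fun y z hy hz => ?_
    simp only [Prod.fst_add, Prod.snd_add, map_add]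
    exact add_mem hy hz
  · simp only [Prod.fst_add, Prod.snd_add, map_add, LinearMap.add_apply]
    exact add_mem hx hy

/-- Two graded models of the same dual pair are isomorphic, compatibly with the canonical
correspondences. -/
theorem exists_iso : ∃ I : X.toLieRinehart.Iso Y.toLieRinehart,
    (∀ p a, a ∈ X.Adeg p → (a, I.base a) ∈ relA X Y p) ∧
    (∀ q x, x ∈ X.Ldeg q → (x, I.equiv x) ∈ relL X Y q) ∧
    ∀ q x, I.equiv x ∈ Y.Ldeg q → x ∈ X.Ldeg q := by
  obtain ⟨e, he, he1, -⟩ := exists_linearEquiv_of_rel X.indep_A X.iSup_A Y.indep_A Y.iSup_A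
    (rel := relA X Y) (fun p a a' h => relA_mem h) (fun p a' h => relA_inj h)
    (fun p a h => relA_inj (relA_swap h)) (fun p a ha => relA_exists Y ha)
    (fun p a ha => (relA_exists X ha).imp fun _ h => relA_swap h)
  obtain ⟨f, hf, hf1, hf2⟩ := exists_linearEquiv_of_rel X.indep_L X.iSup_L Y.indep_L Y.iSup_L
    (rel := relL X Y) (fun p a a' h => relL_mem h) (fun p a' h => relL_inj h)
    (fun p a h => relL_inj (relL_swap h)) (fun p a ha => relL_exists ha)
    (fun p a ha => (relL_exists (Y := X) ha).imp fun _ h => relL_swap h)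
  have uA : ∀ a c, (a, c) ∈ ⨆ p, relA X Y p → e a = c := fun a c h => by
    have := sub_mem (he a) h
    rw [Prod.mk_sub_mk, sub_self] at this
    exact sub_eq_zero.1 (iSup_rel_inj X.indep_A (fun p a a' h => (relA_mem h).1)
      (fun p a' h => relA_inj h) this)
  have uL : ∀ a c, (a, c) ∈ ⨆ p, relL X Y p → f a = c := fun a c h => by
    have := sub_mem (hf a) h
    rw [Prod.mk_sub_mk, sub_self] at this
    exact sub_eq_zero.1 (iSup_rel_inj X.indep_L (fun p a a' h => (relL_mem h).1)
      (fun p a' h => relL_inj h) this)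
  refine ⟨⟨e, f, uA _ _ ?_, fun a c => uA _ _ ?_, fun a x => uL _ _ ?_, fun x y => uL _ _ ?_,
    fun x a => uA _ _ ?_⟩, he1, hf1, hf2⟩
  · exact mem_iSup_of_mem 0 (mem_relA_zero.2 ⟨1, X.ofR_one, Y.ofR_one⟩)
  · exact iSup_rel_bilin _ _ (fun p q _ _ _ _ h k =>
      mem_iSup_of_mem (p + q) (relA_mul rfl h k)) (he a) (he c)
  · exact iSup_rel_bilin _ _ (fun p q _ _ _ _ h k =>
      mem_iSup_of_mem (p + q) (relL_smul rfl h k)) (he a) (hf x)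
  · refine iSup_rel_bilin _ _ (fun p q _ _ _ _ h k => ?_) (hf x) (hf y)
    by_cases hpq : p + q = 0
    · obtain ⟨rfl, rfl⟩ : p = 0 ∧ q = 0 := by omega
      rw [bracket_zero (relL_mem h).1 (relL_mem k).1, bracket_zero (relL_mem h).2 (relL_mem k).2]
      exact zero_mem _
    · exact mem_iSup_of_mem (p + q - 1) (relL_bracket (by omega) h k)
  · refine iSup_rel_bilin _ _ (fun p q _ _ _ _ h k => ?_) (hf x) (he a)
    by_cases hpq : p + q = 0
    · obtain ⟨rfl, rfl⟩ : p = 0 ∧ q = 0 := by omega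
      rw [relA_anchor_zero (relL_mem h).1 (relA_mem k).1,
        relA_anchor_zero (relL_mem h).2 (relA_mem k).2]
      exact zero_mem _
    · exact mem_iSup_of_mem (p + q - 1) (relA_anchor (by omega) h k)

end GradedModel

end Abstract

section Scaled

/-- Elements of weight `n` for an action of the non-zero real numbers. -/
def wt {Z : Type*} [AddCommGroup Z] [Module ℝ Z] (h : ℝ → Z →ₗ[ℝ] Z) (n : ℤ) :
    Submodule ℝ Z where
  carrier := {f | ∀ t : ℝ, t ≠ 0 → h t f = t ^ n • f}
  zero_mem' := fun t _ => by simp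
  add_mem' := fun hf hg t ht => by rw [map_add, hf t ht, hg t ht, smul_add]
  smul_mem' := fun c f hf t ht => by rw [map_smul, hf t ht, smul_comm]

/-- The functions on the total space of a vector bundle over `M`, with the scaling of the fibres:
`ρ` is the pull-back of functions on `M`. -/
structure FunModel (ev : M → R →ₐ[ℝ] ℝ) (ρ : R →ₗ[ℝ] C) (h : ℝ → C →ₗ[ℝ] C) : Prop where
  ρ_one : ρ 1 = 1
  ρ_mul : ∀ f g, ρ (f * g) = ρ f * ρ g
  ρ_inj : ∀ g, ρ g = 0 → g = 0
  h_mul : ∀ t f g, h t (f * g) = h t f * h t g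
  h_comp : ∀ s t f, h s (h t f) = h (s * t) f
  h_id : ∀ f, h 1 f = f
  h_ρ : ∀ t g, h t (ρ g) = ρ g
  wt_neg : ∀ n : ℤ, n < 0 → ∀ f ∈ wt h n, f = 0
  wt_zero : ∀ f ∈ wt h 0, ∃ g, f = ρ g
  sep : ∀ χ : M → R, (∀ x, ev x (χ x) = 1) → ∀ f, (∀ x, ρ (χ x) * f = 0) → f = 0
  glue : ∀ χ : M → R, (∀ x, ev x (χ x) = 1) → ∀ a : M → C,
    (∀ x y, ρ (χ y) * a x = ρ (χ x) * a y) → ∃ f, ∀ x, ρ (χ x) * f = a x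
  der_ext : ∀ D : Derivation ℝ C C, (∀ g, D (ρ g) = 0) → (∀ u ∈ wt h 1, D u = 0) → D = 0
  loc : ∀ x, ∃ χ, ev x χ = 1 ∧ ∃ (n m : ℕ) (y : Fin n → R) (D : Fin n → Derivation ℝ C C)
    (u : Fin m → wt h 1) (D' : Fin m → Derivation ℝ C C),
    (∀ i t f, t ≠ 0 → h t (D i f) = D i (h t f)) ∧ (∀ i g, D' i (ρ g) = 0) ∧
    ∀ Y : R →ₗ[ℝ] C, (∀ f g, Y (f * g) = ρ f * Y g + ρ g * Y f) →
      (∀ g, ρ χ * Y g = ∑ a, Y (y a) * D a (ρ g)) ∧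
      ∀ θ : wt h 1 →ₗ[ℝ] C, (∀ (g : R) (v w : wt h 1), (w : C) = ρ g * v →
        θ w = ρ g * θ v + Y g * v) →
        ∀ v, ρ χ * θ v = ∑ a, Y (y a) * D a v + ∑ i, θ (u i) * D' i v

namespace FunModel

variable (H : FunModel ev ρ h)

include H

lemma ρ_mem (g : R) : ρ g ∈ wt h 0 := fun t _ => by rw [H.h_ρ]; simp

lemma mul_mem {n m : ℤ} {f g : C} (hf : f ∈ wt h n) (hg : g ∈ wt h m) : f * g ∈ wt h (n + m) :=
  fun t ht => by
    rw [H.h_mul, hf t ht, hg t ht, zpow_add₀ ht, smul_mul_smul_comm]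

lemma h_inv {t : ℝ} (ht : t ≠ 0) (f : C) : h t (h t⁻¹ f) = f := by
  rw [H.h_comp, mul_inv_cancel₀ ht, H.h_id]

lemma ρ_eq {g g' : R} (hg : ρ g = ρ g') : g = g' :=
  sub_eq_zero.1 (H.ρ_inj _ (by rw [map_sub, hg, sub_self]))

lemma sep_eq {χ : M → R} (hχ : ∀ x, ev x (χ x) = 1) {f g : C}
    (h : ∀ x, ρ (χ x) * f = ρ (χ x) * g) : f = g :=
  sub_eq_zero.1 (H.sep χ hχ _ fun x => by rw [mul_sub, h, sub_self])

lemma der_ext' {D D' : Derivation ℝ C C} (h0 : ∀ g, D (ρ g) = D' (ρ g))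
    (h1 : ∀ u ∈ wt h 1, D u = D' u) : D = D' :=
  sub_eq_zero.1 (H.der_ext _ (fun g => by rw [Derivation.sub_apply, h0, sub_self])
    fun u hu => by rw [Derivation.sub_apply, h1 u hu, sub_self])

/-- Gluing of derivations. -/
lemma glue_der (χ : M → R) (hχ : ∀ x, ev x (χ x) = 1) (D : M → Derivation ℝ C C)
    (hD : ∀ x y f, ρ (χ y) * D x f = ρ (χ x) * D y f) :
    ∃ X : Derivation ℝ C C, ∀ x f, ρ (χ x) * X f = D x f := by
  choose X hX using fun f => H.glue χ hχ (fun x => D x f) (fun x y => hD x y f)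
  refine ⟨Derivation.mk'
    { toFun := X
      map_add' := fun f g => H.sep_eq hχ fun x => by rw [mul_add, hX, hX, hX, map_add]
      map_smul' := fun c f => H.sep_eq hχ fun x => by
        rw [mul_smul_comm, hX, RingHom.id_apply, hX, Derivation.map_smul] } fun f g => H.sep_eq hχ fun x => by
      simp only [LinearMap.coe_mk, AddHom.coe_mk, smul_eq_mul, hX, Derivation.leibniz, mul_add,
        mul_left_comm (ρ (χ x))], fun x f => hX f x⟩

/-- Existence of vector fields with given values on functions of weight `0` and `1`. -/
theorem exists_derivation (Y : R →ₗ[ℝ] C) (hY : ∀ f g, Y (f * g) = ρ f * Y g + ρ g * Y f)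
    (θ : wt h 1 →ₗ[ℝ] C)
    (hθ : ∀ (g : R) (v w : wt h 1), (w : C) = ρ g * v → θ w = ρ g * θ v + Y g * v) :
    ∃ X : Derivation ℝ C C, (∀ g, X (ρ g) = Y g) ∧ ∀ v : wt h 1, X v = θ v := by
  choose χ hχ n m y D u D' hD hD' hloc using H.loc
  let X : M → Derivation ℝ C C := fun x => ∑ a, Y (y x a) • D x a + ∑ i, θ (u x i) • D' x i
  have hX : ∀ x f, X x f = ∑ a, Y (y x a) * D x a f + ∑ i, θ (u x i) * D' x i f := fun x f => by
    have e : ∀ (k : ℕ) (c : Fin k → C) (D : Fin k → Derivation ℝ C C),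
        (∑ a, c a • D a) f = ∑ a, c a * D a f := fun k c D => by
      rw [← Derivation.coeFnAddMonoidHom_apply, map_sum, Finset.sum_apply]; rfl
    rw [Derivation.add_apply, e, e]
  have h0 : ∀ x g, X x (ρ g) = ρ (χ x) * Y g := fun x g => by
    rw [hX, (hloc x Y hY).1 g]; simp [hD']
  have h1 : ∀ x (v : wt h 1), X x v = ρ (χ x) * θ v := fun x v => by
    rw [hX, (hloc x Y hY).2 θ hθ v]
  obtain ⟨Z, hZ⟩ := H.glue_der χ hχ X fun x y f => by
    have : ρ (χ y) • X x = ρ (χ x) • X y := H.der_ext'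
      (fun g => by simp only [Derivation.smul_apply, h0, smul_eq_mul]; ring)
      (fun v hv => by
        have e1 := h1 x ⟨v, hv⟩
        have e2 := h1 y ⟨v, hv⟩
        simp only [Derivation.smul_apply, smul_eq_mul] at e1 e2 ⊢
        rw [e1, e2]; ring)
    exact congrArg (fun D : Derivation ℝ C C => D f) this
  exact ⟨Z, fun g => H.sep_eq hχ fun x => by rw [hZ, h0],
    fun v => H.sep_eq hχ fun x => by rw [hZ, h1]⟩

/-- The weight of a vector field is determined on functions of weight `0` and `1`. -/
lemma derivation_weight {X : Derivation ℝ C C} {w : ℤ} (h0 : ∀ g, X (ρ g) ∈ wt h w)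
    (h1 : ∀ u ∈ wt h 1, X u ∈ wt h (w + 1)) {t : ℝ} (ht : t ≠ 0) (f : C) :
    h t (X (h t⁻¹ f)) = t ^ w • X f := by
  let Xt : Derivation ℝ C C := Derivation.mk' (h t ∘ₗ X.toLinearMap ∘ₗ h t⁻¹) fun f g => by
    simp only [comp_apply, H.h_mul, Derivation.coeFn_coe, Derivation.leibniz, smul_eq_mul,
      map_add, H.h_inv ht]
  have hXt : ∀ f, Xt f = h t (X (h t⁻¹ f)) := fun f => rfl
  have : Xt = t ^ w • X := H.der_ext' (fun g => by
      rw [hXt, H.h_ρ, h0 g t ht, Derivation.smul_apply]) fun u hu => by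
      rw [hXt, hu _ (inv_ne_zero ht), Derivation.map_smul, map_smul, h1 u hu t ht, Derivation.smul_apply,
        smul_smul, zpow_add₀ ht, zpow_one, zpow_one, mul_comm, mul_assoc, mul_inv_cancel₀ ht,
        mul_one]
  rw [← hXt, this, Derivation.smul_apply]

end FunModel

/-- The sections of the pull-back of a line bundle to the total space of a vector bundle. -/
structure SecModel (ev : M → R →ₐ[ℝ] ℝ) (ρ : R →ₗ[ℝ] C) (h : ℝ → C →ₗ[ℝ] C)
    (ρL : Λ →ₗ[ℝ] S) (hS : ℝ → S →ₗ[ℝ] S) : Prop extends FunModel ev ρ h where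
  hS_smul : ∀ t (f : C) s, hS t (f • s) = h t f • hS t s
  hS_comp : ∀ s t f, hS s (hS t f) = hS (s * t) f
  hS_id : ∀ f, hS 1 f = f
  hS_ρL : ∀ t U, hS t (ρL U) = ρL U
  ρL_smul : ∀ (g : R) U, ρL (g • U) = ρ g • ρL U
  ρL_inj : ∀ U, ρL U = 0 → U = 0
  sepS : ∀ χ : M → R, (∀ x, ev x (χ x) = 1) → ∀ s : S, (∀ x, ρ (χ x) • s = 0) → s = 0
  glueS : ∀ χ : M → R, (∀ x, ev x (χ x) = 1) → ∀ a : M → S,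
    (∀ x y, ρ (χ y) • a x = ρ (χ x) • a y) → ∃ s, ∀ x, ρ (χ x) • s = a x
  glueL : ∀ χ : M → R, (∀ x, ev x (χ x) = 1) → ∀ a : M → Λ,
    (∀ x y, χ y • a x = χ x • a y) → ∃ s, ∀ x, χ x • s = a x
  locS : ∀ x, ∃ χ, ev x χ = 1 ∧ ∃ (U₀ : Λ) (κ : S →ₗ[C] C) (κL : Λ →ₗ[R] R),
    (∀ s, ρ χ • s = κ s • ρL U₀) ∧ (∀ U, κ (ρL U) = ρ (κL U)) ∧
    (∀ t s, κ (hS t s) = h t (κ s)) ∧ κL U₀ = χ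

namespace SecModel

variable (H : SecModel ev ρ h ρL hS)

include H

lemma sepS_eq {χ : M → R} (hχ : ∀ x, ev x (χ x) = 1) {f g : S}
    (h : ∀ x, ρ (χ x) • f = ρ (χ x) • g) : f = g :=
  sub_eq_zero.1 (H.sepS χ hχ _ fun x => by rw [smul_sub, h, sub_self])

lemma hS_inv {t : ℝ} (ht : t ≠ 0) (f : S) : hS t (hS t⁻¹ f) = f := by
  rw [H.hS_comp, mul_inv_cancel₀ ht, H.hS_id]

lemma ρL_eq {U U' : Λ} (hU : ρL U = ρL U') : U = U' :=
  sub_eq_zero.1 (H.ρL_inj _ (by rw [map_sub, hU, sub_self]))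

lemma linear_ext {T : S →ₗ[C] S} (hT : ∀ U, T (ρL U) = 0) : T = 0 := by
  choose χ hχ U₀ κ κL h1 h2 h3 h4 using H.locS
  ext s
  refine H.sepS χ hχ _ fun x => ?_
  rw [← map_smul, h1, map_smul, hT, smul_zero]

/-- Derivations with the same symbol which agree on sections on the base agree. -/
lemma modDer_ext {D D' : DerPair C S} (hD : D ∈ modDer C S) (hD' : D' ∈ modDer C S)
    (hs : D.symb = D'.symb) (h : ∀ U, D.op (ρL U) = D'.op (ρL U)) : D = D' := by
  refine Prod.ext hs ?_
  have := H.linear_ext (T :=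
    { toFun := fun s => D.op s - D'.op s
      map_add' := fun s t => by rw [map_add, map_add]; abel
      map_smul' := fun f s => by
        rw [hD f s, hD' f s, hs, RingHom.id_apply, smul_sub]; abel })
    (fun U => by
      change D.op _ - D'.op _ = 0
      rw [h, sub_self])
  exact LinearMap.ext fun s => sub_eq_zero.1 (congrArg (fun T : S →ₗ[C] S => T s) this)

/-- A derivation of functions with values in sections. -/
lemma der_extS {D : Derivation ℝ C S} (h0 : ∀ g, D (ρ g) = 0) (h1 : ∀ u ∈ wt h 1, D u = 0) :
    D = 0 := by
  choose χ hχ U₀ κ κL e1 e2 e3 e4 using H.locS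
  ext f
  refine H.sepS χ hχ _ fun x => ?_
  have := H.der_ext ((κ x).compDer D) (fun g => by
    change κ x (D (ρ g)) = 0
    rw [h0, map_zero]) (fun u hu => by
    change κ x (D u) = 0
    rw [h1 u hu, map_zero])
  have h2 : κ x (D f) = 0 := congrArg (fun D : Derivation ℝ C C => D f) this
  rw [e1, h2, zero_smul]

lemma wtS_neg {n : ℤ} (hn : n < 0) {s : S} (hs : s ∈ wt hS n) : s = 0 := by
  choose χ hχ U₀ κ κL e1 e2 e3 e4 using H.locS
  refine H.sepS χ hχ _ fun x => ?_
  rw [e1, H.wt_neg n hn (κ x s) (fun t ht => by rw [← e3, hs t ht, map_smul_of_tower]),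
    zero_smul]

lemma wtS_zero {s : S} (hs : s ∈ wt hS 0) : ∃ U, s = ρL U := by
  choose χ hχ U₀ κ κL e1 e2 e3 e4 using H.locS
  choose g hg using fun x => H.wt_zero (κ x s)
    (fun t ht => by rw [← e3, hs t ht, map_smul_of_tower])
  have h1 : ∀ x, ρ (χ x) • s = ρL (g x • U₀ x) := fun x => by rw [e1, hg, H.ρL_smul]
  obtain ⟨U, hU⟩ := H.glueL χ hχ (fun x => g x • U₀ x) fun x y => H.ρL_eq (by
    rw [H.ρL_smul, H.ρL_smul (χ x), ← h1, ← h1, smul_comm])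
  exact ⟨U, H.sepS_eq hχ fun x => by rw [h1, ← hU, H.ρL_smul]⟩

lemma ρL_mem (U : Λ) : ρL U ∈ wt hS 0 := fun t _ => by rw [H.hS_ρL]; simp

lemma faithful {g : R} (hg : ∀ U : Λ, g • U = 0) : g = 0 := by
  choose χ hχ U₀ κ κL e1 e2 e3 e4 using H.locS
  refine H.ρ_inj _ (H.sep χ hχ _ fun x => ?_)
  have := congrArg (κL x) (hg (U₀ x))
  rw [map_smul, map_zero, smul_eq_mul, e4] at this
  rw [← H.ρ_mul, mul_comm, this, map_zero]

/-- Endomorphisms of a line bundle are functions. -/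
lemma exists_of_linear (T : Λ →ₗ[R] Λ) : ∃ g : R, ∀ U, T U = g • U := by
  choose χ hχ U₀ κ κL e1 e2 e3 e4 using H.locS
  have f1 : ∀ x U, χ x • U = κL x U • U₀ x := fun x U => H.ρL_eq (by
    rw [H.ρL_smul, e1, e2, H.ρL_smul])
  have f2 : ∀ x U, (χ x * χ x) • T U = (χ x * κL x (T (U₀ x))) • U := fun x U => by
    calc (χ x * χ x) • T U = χ x • T (χ x • U) := by rw [map_smul, smul_smul]
      _ = κL x U • χ x • T (U₀ x) := by rw [f1 x U, map_smul, smul_comm]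
      _ = κL x (T (U₀ x)) • κL x U • U₀ x := by rw [f1 x (T (U₀ x)), smul_comm]
      _ = _ := by rw [← f1, smul_smul, mul_comm]
  have hc : ∀ x, ev x (χ x * χ x) = 1 := fun x => by rw [map_mul, hχ, one_mul]
  have key : ∀ x y, (χ y * χ y) * (χ x * κL x (T (U₀ x)))
      = (χ x * χ x) * (χ y * κL y (T (U₀ y))) := fun x y => by
    refine sub_eq_zero.1 (H.faithful fun U => ?_)
    rw [sub_smul, mul_smul (χ y * χ y), mul_smul (χ x * χ x), ← f2, ← f2, smul_smul, smul_smul,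
      mul_comm, sub_self]
  obtain ⟨f, hf⟩ := H.glue (fun x => χ x * χ x) hc (fun x => ρ (χ x * κL x (T (U₀ x))))
    fun x y => by rw [← H.ρ_mul, ← H.ρ_mul, key]
  obtain ⟨g, rfl⟩ := H.wt_zero f fun t ht => H.sep_eq hc fun x => by
    have : h t (ρ (χ x * χ x) * f) = ρ (χ x * χ x) * f := by rw [hf, H.h_ρ]
    rw [H.h_mul, H.h_ρ] at this
    rw [this]; simp
  refine ⟨g, fun U => H.ρL_eq (H.sepS_eq hc fun x => ?_)⟩
  rw [← H.ρL_smul, f2, H.ρL_smul, ← hf, H.ρL_smul, smul_smul]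

/-- Existence of derivations with a given symbol and given values on sections on the base. -/
theorem exists_modDer (X : Derivation ℝ C C) (D₀ : Λ →ₗ[ℝ] S)
    (hD₀ : ∀ (g : R) U, D₀ (g • U) = ρ g • D₀ U + X (ρ g) • ρL U) :
    ∃ D ∈ modDer C S, D.symb = X ∧ ∀ U, D.op (ρL U) = D₀ U := by
  choose χ hχ U₀ κ κL e1 e2 e3 e4 using H.locS
  let E : M → End ℝ S := fun x =>
    { toFun := fun s => κ x s • D₀ (U₀ x) + X (κ x s) • ρL (U₀ x) - X (ρ (χ x)) • s
      map_add' := fun s t => by simp only [map_add, add_smul, smul_add]; abel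
      map_smul' := fun c s => by
        simp only [map_smul_of_tower, Derivation.map_smul, RingHom.id_apply, smul_sub, smul_add,
          smul_assoc, smul_comm c (X (ρ (χ x)))] }
  have hE : ∀ x s, E x s = κ x s • D₀ (U₀ x) + X (κ x s) • ρL (U₀ x) - X (ρ (χ x)) • s :=
    fun x s => rfl
  have hl : ∀ x (f : C) s, E x (f • s) = f • E x s + (ρ (χ x) * X f) • s := fun x f s => by
    have e := e1 x s
    simp only [hE, map_smul, smul_eq_mul, Derivation.leibniz, add_smul, mul_smul, smul_sub,
      smul_add, smul_comm f (X (ρ (χ x)))]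
    rw [smul_comm (ρ (χ x)), e, smul_comm (κ x s) (X f)]
    abel
  have h0 : ∀ x U, E x (ρL U) = ρ (χ x) • D₀ U := fun x U => by
    have h5 : χ x • U = κL x U • U₀ x := H.ρL_eq (by rw [H.ρL_smul, e1, e2, H.ρL_smul])
    have h6 := hD₀ (χ x) U
    rw [h5, hD₀] at h6
    rw [hE, e2, h6]; abel
  have key : ∀ x y s, ρ (χ y) • E x s = ρ (χ x) • E y s := fun x y s => by
    have := H.modDer_ext (D := ((ρ (χ x) * ρ (χ y)) • X, ρ (χ y) • E x))
      (D' := ((ρ (χ x) * ρ (χ y)) • X, ρ (χ x) • E y))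
      (fun f s => by
        change ρ (χ y) • E x (f • s) = f • ρ (χ y) • E x s + ((ρ (χ x) * ρ (χ y)) * X f) • s
        rw [hl, smul_add, smul_comm f, smul_smul _ (_ * _), mul_left_comm, mul_assoc])
      (fun f s => by
        change ρ (χ x) • E y (f • s) = f • ρ (χ x) • E y s + ((ρ (χ x) * ρ (χ y)) * X f) • s
        rw [hl, smul_add, smul_comm f, smul_smul _ (_ * _), mul_assoc]) rfl
      (fun U => by
        change ρ (χ y) • E x (ρL U) = ρ (χ x) • E y (ρL U)
        rw [h0, h0, smul_comm])
    exact congrArg (fun D : DerPair C S => D.op s) this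
  choose op hop using fun s => H.glueS χ hχ (fun x => E x s) fun x y => key x y s
  let T : End ℝ S :=
    { toFun := op
      map_add' := fun s t => H.sepS_eq hχ fun x => by rw [smul_add, hop, hop, hop, map_add]
      map_smul' := fun c s => H.sepS_eq hχ fun x => by
        rw [hop, RingHom.id_apply, smul_comm, hop, map_smul] }
  refine ⟨(X, T), fun f s => H.sepS_eq hχ fun x => ?_, rfl, fun U => H.sepS_eq hχ fun x => ?_⟩
  · change ρ (χ x) • op (f • s) = ρ (χ x) • (f • op s + X f • s)
    rw [hop, hl, smul_add, smul_comm _ f, hop, smul_smul]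
  · change ρ (χ x) • op (ρL U) = _
    rw [hop, h0]

/-- The weight of a derivation is determined by its symbol and its values on sections on the
base. -/
lemma modDer_weight {D : DerPair C S} (hD : D ∈ modDer C S) {w : ℤ} {t : ℝ} (ht : t ≠ 0)
    (hX : ∀ f, h t (D.symb (h t⁻¹ f)) = t ^ w • D.symb f)
    (h0 : ∀ U, D.op (ρL U) ∈ wt hS w) (s : S) :
    hS t (D.op (hS t⁻¹ s)) = t ^ w • D.op s := by
  have := H.modDer_ext (D := (t ^ w • D.symb, hS t ∘ₗ D.op ∘ₗ hS t⁻¹))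
    (D' := (t ^ w • D.symb, t ^ w • D.op))
    (fun f s => by
      change hS t (D.op (hS t⁻¹ (f • s))) = f • hS t (D.op (hS t⁻¹ s)) + (t ^ w • D.symb f) • s
      rw [H.hS_smul, hD, map_add, H.hS_smul, H.hS_smul, hX, H.h_inv ht, H.hS_inv ht])
    (Submodule.smul_mem _ (t ^ w) hD) rfl
    (fun U => by
      change hS t (D.op (hS t⁻¹ (ρL U))) = t ^ w • D.op (ρL U)
      rw [H.hS_ρL, h0 U t ht])
  exact congrArg (fun D : DerPair C S => D.op s) this

lemma exists_eq_smul {A : S →ₗ[ℝ] S} (hA : ∀ (f : C) s, A (f • s) = f • A s)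
    (h0 : ∀ U, A (ρL U) ∈ wt hS 0) : ∃ g, ∀ U, A (ρL U) = ρ g • ρL U := by
  choose T hT using fun U => H.wtS_zero (h0 U)
  obtain ⟨g, hg⟩ := H.exists_of_linear
    { toFun := T
      map_add' := fun U U' => H.ρL_eq (by rw [map_add, ← hT, ← hT, ← hT, map_add, map_add])
      map_smul' := fun g U => H.ρL_eq (by
        rw [← hT, RingHom.id_apply, H.ρL_smul, H.ρL_smul, hA, hT]) }
  exact ⟨g, fun U => by rw [hT, ← H.ρL_smul, ← hg]; rfl⟩

end SecModel

end Scaled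

section GradedSubmodule

variable {Z Z' Z'' : Type*} [AddCommGroup Z] [Module ℝ Z] [AddCommGroup Z'] [Module ℝ Z']
  [AddCommGroup Z''] [Module ℝ Z'']

lemma wt_iSupIndep (h : ℝ → Z →ₗ[ℝ] Z) : iSupIndep (wt h) := by
  have h1 := (End.eigenspaces_iSupIndep (h 2)).comp (f := fun n : ℤ => (2 : ℝ) ^ n)
    (zpow_right_injective₀ (by norm_num) (by norm_num))
  exact h1.mono fun n f hf => End.mem_eigenspace_iff.2 (hf 2 two_ne_zero)

lemma iSupIndep_comap_subtype {κ : Type*} {U : κ → Submodule ℝ Z} (hU : iSupIndep U)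
    (T : Submodule ℝ Z) : iSupIndep fun p => (U p).comap T.subtype := by
  intro p
  rw [Submodule.disjoint_def]
  intro x hx hx'
  refine Subtype.ext ((Submodule.disjoint_def.1 (hU p)) x.1 hx ?_)
  have : (⨆ j, ⨆ (_ : j ≠ p), (U j).comap T.subtype) ≤ (⨆ j, ⨆ (_ : j ≠ p), U j).comap T.subtype :=
    iSup₂_le fun j hj => Submodule.comap_mono (le_iSup₂_of_le j hj le_rfl)
  exact this hx'

lemma iSup_comap_subtype {κ : Type*} (U : κ → Submodule ℝ Z) :
    ⨆ p, (U p).comap (⨆ p, U p).subtype = ⊤ := by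
  refine Submodule.map_injective_of_injective (⨆ p, U p).injective_subtype ?_
  rw [Submodule.map_iSup, Submodule.map_top, Submodule.range_subtype]
  exact iSup_congr fun p => by
    rw [Submodule.map_comap_subtype, inf_eq_right]; exact le_iSup U p

lemma iSup_bilin_mem {κ κ' : Type*} {U : κ → Submodule ℝ Z} {U' : κ' → Submodule ℝ Z'}
    {T : Submodule ℝ Z''} (B : Z →ₗ[ℝ] Z' →ₗ[ℝ] Z'')
    (hB : ∀ p q x y, x ∈ U p → y ∈ U' q → B x y ∈ T) :
    ∀ x ∈ ⨆ p, U p, ∀ y ∈ ⨆ q, U' q, B x y ∈ T := fun _ hx y hy =>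
  (iSup_le fun p x hx => (iSup_le fun q y => hB p q x y hx : ⨆ q, U' q ≤ T.comap (B x)) hy :
    ⨆ p, U p ≤ T.comap (B.flip y)) hx

end GradedSubmodule

section DualDer

namespace DualPair

variable (b : DualPair M R V W)

lemma eq_of_pair {φ ψ : V} (h : ∀ e, b.pair φ e = b.pair ψ e) : φ = ψ :=
  sub_eq_zero.1 (b.nondeg' _ fun e => by rw [map_sub, LinearMap.sub_apply, h, sub_self])

lemma pair_smul_real (c : ℝ) (φ : V) (e : W) : b.pair (c • φ) e = c • b.pair φ e := by
  rw [map_smul_of_tower, LinearMap.smul_apply]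

/-- The derivation of the dual bundle. -/
def dual : modDer R W →ₗ[ℝ] modDer R V where
  toFun δ :=
    ⟨(δ.1.symb,
      { toFun := fun φ => (b.exists_dualTo δ φ).choose
        map_add' := fun φ ψ => b.eq_of_pair fun e => by
          rw [map_add, LinearMap.add_apply, (b.exists_dualTo δ _).choose_spec,
            (b.exists_dualTo δ φ).choose_spec, (b.exists_dualTo δ ψ).choose_spec]
          simp only [map_add, LinearMap.add_apply]; abel
        map_smul' := fun c φ => b.eq_of_pair fun e => by
          rw [RingHom.id_apply, b.pair_smul_real, (b.exists_dualTo δ _).choose_spec,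
            (b.exists_dualTo δ φ).choose_spec, b.pair_smul_real, b.pair_smul_real,
            Derivation.map_smul, smul_sub] }), fun g φ => b.eq_of_pair fun e => by
        change b.pair (b.exists_dualTo δ (g • φ)).choose e
          = b.pair (g • (b.exists_dualTo δ φ).choose + δ.1.symb g • φ) e
        rw [(b.exists_dualTo δ (g • φ)).choose_spec]
        simp only [map_add, map_smul, LinearMap.add_apply, LinearMap.smul_apply,
          (b.exists_dualTo δ φ).choose_spec e, smul_eq_mul, Derivation.leibniz]; ring⟩
  map_add' δ δ' := Subtype.ext (Prod.ext rfl (LinearMap.ext fun φ => b.eq_of_pair fun e => by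
    change b.pair (b.exists_dualTo (δ + δ') φ).choose e
      = b.pair ((b.exists_dualTo δ φ).choose + (b.exists_dualTo δ' φ).choose) e
    rw [map_add, LinearMap.add_apply, (b.exists_dualTo _ φ).choose_spec,
      (b.exists_dualTo δ φ).choose_spec, (b.exists_dualTo δ' φ).choose_spec]
    simp only [Submodule.coe_add, DerPair.symb_add, DerPair.op_add, Derivation.add_apply,
      LinearMap.add_apply, map_add]; abel))
  map_smul' c δ := Subtype.ext (Prod.ext rfl (LinearMap.ext fun φ => b.eq_of_pair fun e => by
    change b.pair (b.exists_dualTo (c • δ) φ).choose e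
      = b.pair (c • (b.exists_dualTo δ φ).choose) e
    rw [b.pair_smul_real, (b.exists_dualTo _ φ).choose_spec, (b.exists_dualTo δ φ).choose_spec]
    simp only [Submodule.coe_smul, DerPair.symb_smul, DerPair.op_smul, Derivation.smul_apply,
      LinearMap.smul_apply, map_smul_of_tower, smul_sub]))

@[simp] lemma dual_symb (δ : modDer R W) : (b.dual δ).1.symb = δ.1.symb := rfl

lemma pair_dual (δ : modDer R W) (φ : V) (e : W) :
    b.pair ((b.dual δ).1.op φ) e = δ.1.symb (b.pair φ e) - b.pair φ (δ.1.op e) :=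
  (b.exists_dualTo δ φ).choose_spec e

lemma dual_op_eq {δ : modDer R W} {φ φ' : V} (h : b.DualTo δ φ φ') : (b.dual δ).1.op φ = φ' :=
  b.eq_of_pair fun e => by rw [pair_dual, h e]

lemma dual_bracket {δ₁ δ₂ δ₃ : modDer R W} (h : δ₃.1 = DerPair.bracket δ₁.1 δ₂.1) :
    (b.dual δ₃).1 = DerPair.bracket (b.dual δ₁).1 (b.dual δ₂).1 := by
  have hs : δ₃.1.symb = ⁅δ₁.1.symb, δ₂.1.symb⁆ := by rw [h]; rfl
  have ho : δ₃.1.op = opComm δ₁.1.op δ₂.1.op := by rw [h]; rfl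
  refine Prod.ext hs (LinearMap.ext fun φ => b.eq_of_pair fun e => ?_)
  change b.pair ((b.dual δ₃).1.op φ) e = b.pair (opComm (b.dual δ₁).1.op (b.dual δ₂).1.op φ) e
  simp only [opComm, LinearMap.sub_apply, comp_apply, map_sub, pair_dual, hs, ho,
    commutator_apply]
  ring

lemma dual_smul {g : R} {δ δ' : modDer R W} (h : δ'.1 = DerPair.fsmul g δ.1) :
    (b.dual δ').1 = DerPair.fsmul g (b.dual δ).1 := by
  have hs : δ'.1.symb = g • δ.1.symb := by rw [h]; rfl
  have ho : δ'.1.op = g • δ.1.op := by rw [h]; rfl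
  refine Prod.ext hs (LinearMap.ext fun φ => b.eq_of_pair fun e => ?_)
  change b.pair ((b.dual δ').1.op φ) e = b.pair (g • (b.dual δ).1.op φ) e
  simp only [map_smul, LinearMap.smul_apply, pair_dual, hs, ho, Derivation.smul_apply, smul_eq_mul]
  ring

lemma dual_rank_one {φ : V} {e : W} {δ : modDer R W} (hs : δ.1.symb = 0)
    (ho : ∀ e', δ.1.op e' = b.pair φ e' • e) (ψ : V) :
    (b.dual δ).1.op ψ = - (b.pair ψ e • φ) :=
  b.eq_of_pair fun e' => by
    rw [pair_dual, hs, ho]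
    simp [mul_comm]

end DualPair

end DualDer

section Linear

/-- The functions on the total space of a vector bundle, together with the identification `ℓ` of
the functions of weight `1` with the sections of the dual bundle. -/
structure LinModel (ev : M → R →ₐ[ℝ] ℝ) (ρ : R →ₗ[ℝ] C) (h : ℝ → C →ₗ[ℝ] C) (ℓ : V →ₗ[ℝ] C) :
    Prop extends FunModel ev ρ h where
  ℓ_smul : ∀ g φ, ℓ (g • φ) = ρ g * ℓ φ
  ℓ_inj : ∀ φ, ℓ φ = 0 → φ = 0
  ℓ_mem : ∀ φ, ℓ φ ∈ wt h 1
  wt_one : ∀ u ∈ wt h 1, ∃ φ, u = ℓ φ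

/-- The action on operators by conjugation. -/
def conj {Z : Type*} [AddCommGroup Z] [Module ℝ Z] (h : ℝ → Z →ₗ[ℝ] Z) (t : ℝ) :
    End ℝ Z →ₗ[ℝ] End ℝ Z where
  toFun Δ := h t ∘ₗ Δ ∘ₗ h t⁻¹
  map_add' Δ Δ' := by rw [LinearMap.add_comp, LinearMap.comp_add]
  map_smul' c Δ := by rw [LinearMap.smul_comp, LinearMap.comp_smul, RingHom.id_apply]

lemma conj_apply {Z : Type*} [AddCommGroup Z] [Module ℝ Z] (h : ℝ → Z →ₗ[ℝ] Z) (t : ℝ)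
    (Δ : End ℝ Z) (f : Z) : conj h t Δ f = h t (Δ (h t⁻¹ f)) := rfl

namespace LinModel

variable {ℓ : V →ₗ[ℝ] C} (H : LinModel ev ρ h ℓ)

include H

lemma ℓ_eq {φ ψ : V} (e : ℓ φ = ℓ ψ) : φ = ψ :=
  sub_eq_zero.1 (H.ℓ_inj _ (by rw [map_sub, e, sub_self]))

lemma der_ext_ℓ {D D' : Derivation ℝ C C} (h0 : ∀ g, D (ρ g) = D' (ρ g))
    (h1 : ∀ φ, D (ℓ φ) = D' (ℓ φ)) : D = D' :=
  H.der_ext' h0 fun u hu => by obtain ⟨φ, rfl⟩ := H.wt_one u hu; exact h1 φ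

theorem exists_der (Y : R →ₗ[ℝ] C) (hY : ∀ f g, Y (f * g) = ρ f * Y g + ρ g * Y f)
    (θ : V →ₗ[ℝ] C) (hθ : ∀ g φ, θ (g • φ) = ρ g * θ φ + Y g * ℓ φ) :
    ∃ X : Derivation ℝ C C, (∀ g, X (ρ g) = Y g) ∧ ∀ φ, X (ℓ φ) = θ φ := by
  have hinj : Function.Injective ℓ := fun φ ψ e => H.ℓ_eq e
  let s : V ≃ₗ[ℝ] wt h 1 := LinearEquiv.ofBijective (ℓ.codRestrict _ H.ℓ_mem)
    ⟨fun φ ψ e => hinj (congrArg Subtype.val e), fun u => by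
      obtain ⟨φ, hφ⟩ := H.wt_one u u.2
      exact ⟨φ, Subtype.ext hφ.symm⟩⟩
  have hs : ∀ φ, (s φ : C) = ℓ φ := fun φ => rfl
  have hs' : ∀ v, ℓ (s.symm v) = v := fun v => by rw [← hs, s.apply_symm_apply]
  obtain ⟨X, h0, h1⟩ := H.exists_derivation Y hY (θ ∘ₗ s.symm.toLinearMap) fun g v w hw => by
    have : s.symm w = g • s.symm v := hinj (by rw [H.ℓ_smul, hs', hs', hw])
    change θ (s.symm w) = _
    rw [this, hθ, hs']; rfl
  exact ⟨X, h0, fun φ => by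
    have := h1 (s φ)
    rw [hs, comp_apply] at this
    rw [this]; simp⟩

lemma exists_vl (a : V →ₗ[R] R) :
    ∃ X : Derivation ℝ C C, (∀ g, X (ρ g) = 0) ∧ ∀ φ, X (ℓ φ) = ρ (a φ) :=
  H.exists_der 0 (by simp) (ρ ∘ₗ a.restrictScalars ℝ) fun g φ => by simp [H.ρ_mul]

/-- The vertical lift of a section. -/
def vl : (V →ₗ[R] R) →ₗ[ℝ] Derivation ℝ C C where
  toFun a := (H.exists_vl a).choose
  map_add' a a' := H.der_ext_ℓ
    (fun g => by
      rw [Derivation.add_apply, (H.exists_vl _).choose_spec.1, (H.exists_vl _).choose_spec.1,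
        (H.exists_vl _).choose_spec.1, add_zero])
    (fun φ => by
      rw [Derivation.add_apply, (H.exists_vl _).choose_spec.2, (H.exists_vl _).choose_spec.2,
        (H.exists_vl _).choose_spec.2, LinearMap.add_apply, map_add])
  map_smul' c a := H.der_ext_ℓ
    (fun g => by
      rw [RingHom.id_apply, Derivation.smul_apply, (H.exists_vl _).choose_spec.1,
        (H.exists_vl _).choose_spec.1, smul_zero])
    (fun φ => by
      rw [RingHom.id_apply, Derivation.smul_apply, (H.exists_vl _).choose_spec.2,
        (H.exists_vl _).choose_spec.2, LinearMap.smul_apply, map_smul])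

@[simp] lemma vl_ρ (a : V →ₗ[R] R) (g : R) : H.vl a (ρ g) = 0 :=
  (H.exists_vl a).choose_spec.1 g

@[simp] lemma vl_ℓ (a : V →ₗ[R] R) (φ : V) : H.vl a (ℓ φ) = ρ (a φ) :=
  (H.exists_vl a).choose_spec.2 φ

lemma exists_lin (δ : modDer R V) : ∃ X : Derivation ℝ C C,
    (∀ g, X (ρ g) = ρ (δ.1.symb g)) ∧ ∀ φ, X (ℓ φ) = ℓ (δ.1.op φ) :=
  H.exists_der (ρ ∘ₗ δ.1.symb.toLinearMap)
    (fun f g => by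
      simp only [comp_apply, Derivation.coeFn_coe, Derivation.leibniz, smul_eq_mul,
        map_add, H.ρ_mul])
    (ℓ ∘ₗ δ.1.op) fun g φ => by
      rw [comp_apply, δ.2, map_add, H.ℓ_smul, H.ℓ_smul]; rfl

/-- The linear vector field given by a derivation. -/
def lin : modDer R V →ₗ[ℝ] Derivation ℝ C C where
  toFun δ := (H.exists_lin δ).choose
  map_add' a a' := H.der_ext_ℓ
    (fun g => by
      rw [Derivation.add_apply, (H.exists_lin _).choose_spec.1, (H.exists_lin _).choose_spec.1,
        (H.exists_lin _).choose_spec.1, Submodule.coe_add, DerPair.symb_add, Derivation.add_apply,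
        map_add])
    (fun φ => by
      rw [Derivation.add_apply, (H.exists_lin _).choose_spec.2, (H.exists_lin _).choose_spec.2,
        (H.exists_lin _).choose_spec.2, Submodule.coe_add, DerPair.op_add, LinearMap.add_apply,
        map_add])
  map_smul' c a := H.der_ext_ℓ
    (fun g => by
      rw [RingHom.id_apply, Derivation.smul_apply, (H.exists_lin _).choose_spec.1,
        (H.exists_lin _).choose_spec.1, Submodule.coe_smul, DerPair.symb_smul,
        Derivation.smul_apply, map_smul])
    (fun φ => by
      rw [RingHom.id_apply, Derivation.smul_apply, (H.exists_lin _).choose_spec.2,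
        (H.exists_lin _).choose_spec.2, Submodule.coe_smul, DerPair.op_smul, LinearMap.smul_apply,
        map_smul])

@[simp] lemma lin_ρ (δ : modDer R V) (g : R) : H.lin δ (ρ g) = ρ (δ.1.symb g) :=
  (H.exists_lin δ).choose_spec.1 g

@[simp] lemma lin_ℓ (δ : modDer R V) (φ : V) : H.lin δ (ℓ φ) = ℓ (δ.1.op φ) :=
  (H.exists_lin δ).choose_spec.2 φ

lemma lin_bracket {δ₁ δ₂ δ₃ : modDer R V} (e : δ₃.1 = DerPair.bracket δ₁.1 δ₂.1) :
    H.lin δ₃ = ⁅H.lin δ₁, H.lin δ₂⁆ := by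
  have hs : δ₃.1.symb = ⁅δ₁.1.symb, δ₂.1.symb⁆ := by rw [e]; rfl
  have ho : δ₃.1.op = opComm δ₁.1.op δ₂.1.op := by rw [e]; rfl
  refine H.der_ext_ℓ (fun g => ?_) fun φ => ?_
  · simp [commutator_apply, hs]
  · simp [commutator_apply, ho, opComm]

lemma lin_smul {g : R} {δ δ' : modDer R V} (e : δ'.1 = DerPair.fsmul g δ.1) :
    H.lin δ' = ρ g • H.lin δ := by
  have hs : δ'.1.symb = g • δ.1.symb := by rw [e]; rfl
  have ho : δ'.1.op = g • δ.1.op := by rw [e]; rfl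
  refine H.der_ext_ℓ (fun g => ?_) fun φ => ?_
  · simp [hs, H.ρ_mul]
  · simp [ho, H.ℓ_smul]

lemma lin_rank_one {a : V →ₗ[R] R} {φ₀ : V} {δ : modDer R V} (hs : δ.1.symb = 0)
    (ho : ∀ φ, δ.1.op φ = a φ • φ₀) : H.lin δ = ℓ φ₀ • H.vl a := by
  refine H.der_ext_ℓ (fun g => ?_) fun φ => ?_
  · simp [hs]
  · simp [ho, H.ℓ_smul, mul_comm]

lemma vl_comm (a a' : V →ₗ[R] R) (f : C) : H.vl a (H.vl a' f) = H.vl a' (H.vl a f) := by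
  have : ⁅H.vl a, H.vl a'⁆ = 0 := H.der_ext_ℓ (fun g => by simp [commutator_apply])
    fun φ => by simp [commutator_apply]
  have := congrArg (fun D : Derivation ℝ C C => D f) this
  rw [commutator_apply] at this
  exact sub_eq_zero.1 this

lemma vl_wt (a : V →ₗ[R] R) : ((H.vl a).toLinearMap : End ℝ C) ∈ wt (conj h) (-1) :=
  fun t ht => LinearMap.ext fun f => H.derivation_weight (w := -1)
    (fun g => by rw [vl_ρ]; exact zero_mem _)
    (fun u hu => by obtain ⟨φ, rfl⟩ := H.wt_one u hu; rw [vl_ℓ]; exact H.ρ_mem _) ht f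

lemma lin_wt (δ : modDer R V) : ((H.lin δ).toLinearMap : End ℝ C) ∈ wt (conj h) 0 :=
  fun t ht => LinearMap.ext fun f => H.derivation_weight (w := 0)
    (fun g => by rw [lin_ρ]; exact H.ρ_mem _)
    (fun u hu => by obtain ⟨φ, rfl⟩ := H.wt_one u hu; rw [lin_ℓ]; exact H.ℓ_mem _) ht f

lemma mulLeft_wt {f : C} {n : ℤ} (hf : f ∈ wt h n) : mulLeft ℝ f ∈ wt (conj h) n :=
  fun t ht => LinearMap.ext fun g => by
    rw [conj_apply, LinearMap.mulLeft_apply, H.h_mul, H.h_inv ht, hf t ht, LinearMap.smul_apply,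
      LinearMap.mulLeft_apply, smul_mul_assoc]

lemma comp_wt {Δ Δ' : End ℝ C} {n m : ℤ} (hΔ : Δ ∈ wt (conj h) n)
    (hΔ' : Δ' ∈ wt (conj h) m) : Δ ∘ₗ Δ' ∈ wt (conj h) (n + m) := fun t ht => by
  have : conj h t (Δ ∘ₗ Δ') = conj h t Δ ∘ₗ conj h t Δ' := LinearMap.ext fun f => by
    simp only [conj_apply, comp_apply, H.h_comp, inv_mul_cancel₀ ht, H.h_id]
  rw [this, hΔ t ht, hΔ' t ht, LinearMap.smul_comp, LinearMap.comp_smul, smul_smul,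
    zpow_add₀ ht]

lemma apply_wt {Δ : End ℝ C} {f : C} {n m : ℤ} (hΔ : Δ ∈ wt (conj h) n)
    (hf : f ∈ wt h m) : Δ f ∈ wt h (n + m) := fun t ht => by
  have h1 := congrArg (fun D : End ℝ C => D f) (hΔ t ht)
  simp only [conj_apply] at h1
  have h2 := hf t⁻¹ (inv_ne_zero ht)
  rw [h2, map_smul, map_smul, LinearMap.smul_apply] at h1
  rw [zpow_add₀ ht, mul_comm, mul_smul, ← h1, smul_smul, inv_zpow,
    mul_inv_cancel₀ (zpow_ne_zero _ ht), one_smul]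

end LinModel

end Linear

/-- The restriction of a bilinear map to subspaces. -/
def restrict₂ {Z Z' Z'' : Type*} [AddCommGroup Z] [Module ℝ Z] [AddCommGroup Z'] [Module ℝ Z']
    [AddCommGroup Z''] [Module ℝ Z''] (B : Z →ₗ[ℝ] Z' →ₗ[ℝ] Z'') (T : Submodule ℝ Z)
    (T' : Submodule ℝ Z') (T'' : Submodule ℝ Z'') (hB : ∀ x ∈ T, ∀ y ∈ T', B x y ∈ T'') :
    T →ₗ[ℝ] T' →ₗ[ℝ] T'' :=
  LinearMap.mk₂ ℝ (fun x y => ⟨B x y, hB x x.2 y y.2⟩)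
    (fun x x' y => Subtype.ext (by simp)) (fun c x y => Subtype.ext (by simp))
    (fun x y y' => Subtype.ext (by simp)) (fun c x y => Subtype.ext (by simp))

section DiffOp

lemma opComm_eq {Z : Type*} [AddCommGroup Z] [Module ℝ Z] (Δ Δ' : End ℝ Z) :
    opComm Δ Δ' = Δ * Δ' - Δ' * Δ := rfl

lemma opComm_anti (Δ Δ' : End ℝ C) : opComm Δ Δ' = - opComm Δ' Δ := (neg_sub _ _).symm

lemma opComm_mul (x y z : End ℝ C) : opComm (x * y) z = opComm x z * y + x * opComm y z := by
  simp only [opComm_eq, mul_sub, sub_mul, mul_assoc]; abel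

lemma opComm_mul_right (x y z : End ℝ C) :
    opComm x (y * z) = opComm x y * z + y * opComm x z := by
  simp only [opComm_eq, mul_sub, sub_mul, mul_assoc]; abel

lemma opComm_opComm (x y z : End ℝ C) :
    opComm (opComm x y) z = opComm (opComm x z) y + opComm x (opComm y z) := by
  simp only [opComm_eq, mul_sub, sub_mul, mul_assoc]; abel

lemma opComm_jacobi {Z : Type*} [AddCommGroup Z] [Module ℝ Z] (x y z : End ℝ Z) :
    opComm x (opComm y z) = opComm (opComm x y) z + opComm y (opComm x z) := by
  simp only [opComm_eq, mul_sub, sub_mul, mul_assoc]; abel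

/-- The commutator as a bilinear map. -/
def commEnd {Z : Type*} [AddCommGroup Z] [Module ℝ Z] : End ℝ Z →ₗ[ℝ] End ℝ Z →ₗ[ℝ] End ℝ Z :=
  LinearMap.mk₂ ℝ opComm
    (fun x y z => by simp only [opComm_eq, add_mul, mul_add]; abel)
    (fun c x y => by simp only [opComm_eq, smul_mul_assoc, mul_smul_comm, smul_sub])
    (fun x y z => by simp only [opComm_eq, add_mul, mul_add]; abel)
    (fun c x y => by simp only [opComm_eq, smul_mul_assoc, mul_smul_comm, smul_sub])

lemma mulLeft_comm' (f g : C) : mulLeft ℝ f * mulLeft ℝ g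
    = mulLeft ℝ g * mulLeft ℝ f :=
  LinearMap.ext fun k => mul_left_comm f g k

lemma mem_diffOp_succ {q : ℕ} {Δ : End ℝ C} :
    Δ ∈ diffOp C (q + 1) ↔ ∀ f, opComm Δ (mulLeft ℝ f) ∈ diffOp C q := by
  constructor
  · exact fun h f l hl => h (f :: l) (by simp [hl])
  · intro h l hl
    cases l with
    | nil => simp at hl
    | cons f l => exact h f l (by simpa using hl)

lemma mem_diffOp_zero {Δ : End ℝ C} :
    Δ ∈ diffOp C 0 ↔ ∀ f, opComm Δ (mulLeft ℝ f) = 0 := by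
  constructor
  · exact fun h f => h [f] rfl
  · intro h l hl
    obtain ⟨f, rfl⟩ := List.length_eq_one_iff.1 hl
    exact h f

lemma eq_mulLeft {Δ : End ℝ C} (h : Δ ∈ diffOp C 0) : Δ = mulLeft ℝ (Δ 1) :=
  LinearMap.ext fun f => by
    have := congrArg (fun D : End ℝ C => D 1) (mem_diffOp_zero.1 h f)
    simp only [opComm, LinearMap.sub_apply, comp_apply, LinearMap.mulLeft_apply, mul_one,
      LinearMap.zero_apply] at this
    rw [LinearMap.mulLeft_apply, mul_comm, ← sub_eq_zero, this]

lemma mulLeft_mem_diffOp (f : C) : mulLeft ℝ f ∈ diffOp C 0 :=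
  mem_diffOp_zero.2 fun g => by rw [opComm_eq, mulLeft_comm', sub_self]

lemma diffOp_le_succ (q : ℕ) : diffOp C q ≤ diffOp C (q + 1) := by
  induction q with
  | zero =>
    intro Δ h
    exact mem_diffOp_succ.2 fun f => by rw [mem_diffOp_zero.1 h]; exact zero_mem _
  | succ q ih => exact fun Δ h => mem_diffOp_succ.2 fun f => ih (mem_diffOp_succ.1 h f)

lemma diffOp_comp {n p q : ℕ} (hn : n = p + q) {Δ Δ' : End ℝ C} (h : Δ ∈ diffOp C p)
    (h' : Δ' ∈ diffOp C q) : Δ * Δ' ∈ diffOp C n := by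
  induction n generalizing p q Δ Δ' with
  | zero =>
    obtain ⟨rfl, rfl⟩ : p = 0 ∧ q = 0 := by omega
    exact mem_diffOp_zero.2 fun f => by
      rw [opComm_mul, mem_diffOp_zero.1 h, mem_diffOp_zero.1 h', zero_mul, mul_zero, add_zero]
  | succ n ih =>
    refine mem_diffOp_succ.2 fun f => ?_
    rw [opComm_mul]
    refine add_mem ?_ ?_
    · cases p with
      | zero => rw [mem_diffOp_zero.1 h, zero_mul]; exact zero_mem _
      | succ p => exact ih (by omega) (mem_diffOp_succ.1 h f) h'
    · cases q with
      | zero => rw [mem_diffOp_zero.1 h', mul_zero]; exact zero_mem _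
      | succ q => exact ih (by omega) h (mem_diffOp_succ.1 h' f)

lemma diffOp_comm {n p q : ℕ} (hn : n + 1 = p + q) {Δ Δ' : End ℝ C} (h : Δ ∈ diffOp C p)
    (h' : Δ' ∈ diffOp C q) : opComm Δ Δ' ∈ diffOp C n := by
  induction n generalizing p q Δ Δ' with
  | zero =>
    obtain ⟨rfl, rfl⟩ | ⟨rfl, rfl⟩ : (p = 0 ∧ q = 1) ∨ (p = 1 ∧ q = 0) := by omega
    · rw [eq_mulLeft h, opComm_anti]
      exact neg_mem (mem_diffOp_succ.1 h' _)
    · rw [eq_mulLeft h']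
      exact mem_diffOp_succ.1 h _
  | succ n ih =>
    refine mem_diffOp_succ.2 fun f => ?_
    rw [opComm_opComm]
    refine add_mem ?_ ?_
    · cases p with
      | zero => rw [mem_diffOp_zero.1 h]; simp [opComm]
      | succ p => exact ih (by omega) (mem_diffOp_succ.1 h f) h'
    · cases q with
      | zero => rw [mem_diffOp_zero.1 h']; simp [opComm]
      | succ q => exact ih (by omega) h (mem_diffOp_succ.1 h' f)

lemma diffOp_zero_comm {Δ Δ' : End ℝ C} (h : Δ ∈ diffOp C 0) (h' : Δ' ∈ diffOp C 0) :
    opComm Δ Δ' = 0 := by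
  rw [eq_mulLeft h', mem_diffOp_zero.1 h]

lemma opComm_derivation_mulLeft (D : Derivation ℝ C C) (f : C) :
    opComm (D.toLinearMap : End ℝ C) (mulLeft ℝ f) = mulLeft ℝ (D f) :=
  LinearMap.ext fun g => by simp [opComm, mul_comm]

lemma derivation_mem_diffOp (D : Derivation ℝ C C) :
    (D.toLinearMap : End ℝ C) ∈ diffOp C 1 :=
  mem_diffOp_succ.2 fun f => opComm_derivation_mulLeft D f ▸ mulLeft_mem_diffOp _

lemma nestedComm_mul_left (c : C) (l : List C) (Δ : End ℝ C) :
    nestedComm (mulLeft ℝ c * Δ) l = mulLeft ℝ c * nestedComm Δ l := by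
  induction l generalizing Δ with
  | nil => rfl
  | cons f l ih =>
    have : opComm (mulLeft ℝ c * Δ) (mulLeft ℝ f)
        = mulLeft ℝ c * opComm Δ (mulLeft ℝ f) := by
      rw [opComm_eq, opComm_eq, mul_sub, ← mul_assoc (mulLeft ℝ f), mulLeft_comm' f c]
      simp only [mul_assoc]
    simp only [nestedComm, this, ih]

/-- The derivation `f ↦ [Δ, f](1)` for an operator whose commutators with functions are
functions. -/
lemma exists_symbol {Δ : End ℝ C} (h : Δ ∈ diffOp C 1) :
    ∃ D : Derivation ℝ C C, ∀ f, opComm Δ (mulLeft ℝ f) = mulLeft ℝ (D f) := by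
  have h1 : ∀ f g, Δ (f * g) - f * Δ g = (Δ f - f * Δ 1) * g := fun f g => by
    have := eq_mulLeft (mem_diffOp_succ.1 h f)
    have := congrArg (fun D : End ℝ C => D g) this
    simpa [opComm] using this
  refine ⟨Derivation.mk' (Δ - mulLeft ℝ (Δ 1)) fun f g => ?_, fun f => ?_⟩
  · simp only [LinearMap.sub_apply, LinearMap.mulLeft_apply, smul_eq_mul]
    linear_combination h1 f g
  · rw [eq_mulLeft (mem_diffOp_succ.1 h f)]
    congr 1
    simp [opComm, mul_comm]

end DiffOp

section DOModel

/-- Differential operators of order `q` and weight `w`. -/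
def DODeg (h : ℝ → C →ₗ[ℝ] C) (q : ℕ) (w : ℤ) : Submodule ℝ (End ℝ C) :=
  diffOp C q ⊓ wt (conj h) w

namespace LinModel

variable {ℓ : V →ₗ[ℝ] C} (H : LinModel ev ρ h ℓ)

include H

/-- An operator commuting with functions of weight `0` and `1` is the multiplication by a
function. -/
lemma diffOp_eq_mulLeft {q : ℕ} {Δ : End ℝ C} (hΔ : Δ ∈ diffOp C q)
    (h0 : ∀ g, opComm Δ (mulLeft ℝ (ρ g)) = 0)
    (h1 : ∀ φ, opComm Δ (mulLeft ℝ (ℓ φ)) = 0) : Δ ∈ diffOp C 0 := by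
  induction q generalizing Δ with
  | zero => exact hΔ
  | succ q ih =>
    have key : ∀ f k, opComm Δ (mulLeft ℝ k) = 0 →
        opComm (opComm Δ (mulLeft ℝ f)) (mulLeft ℝ k) = 0 := fun f k hk => by
      rw [opComm_opComm, hk, mem_diffOp_zero.1 (mulLeft_mem_diffOp f)]; simp [opComm]
    obtain ⟨D, hD⟩ := exists_symbol (mem_diffOp_succ.2 fun f =>
      ih (mem_diffOp_succ.1 hΔ f) (fun g => key f _ (h0 g)) (fun φ => key f _ (h1 φ)))
    have hD0 : D = 0 := H.der_ext_ℓ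
      (fun g => by simpa [h0 g] using (congrArg (fun D : End ℝ C => D 1) (hD (ρ g))).symm)
      (fun φ => by simpa [h1 φ] using (congrArg (fun D : End ℝ C => D 1) (hD (ℓ φ))).symm)
    refine mem_diffOp_zero.2 fun f => ?_
    rw [hD, hD0]; simp

lemma comm_wt {Δ Δ' : End ℝ C} {n m : ℤ} (hΔ : Δ ∈ wt (conj h) n)
    (hΔ' : Δ' ∈ wt (conj h) m) : opComm Δ Δ' ∈ wt (conj h) (n + m) :=
  sub_mem (H.comp_wt hΔ hΔ') (add_comm n m ▸ H.comp_wt hΔ' hΔ)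

lemma one_mem : (1 : C) ∈ wt h 0 := H.ρ_one ▸ H.ρ_mem 1

lemma apply_one_wt {Δ : End ℝ C} {n : ℤ} (hΔ : Δ ∈ wt (conj h) n) : Δ 1 ∈ wt h n := by
  simpa using H.apply_wt hΔ H.one_mem

lemma diffOp_wt_lt {q : ℕ} {Δ : End ℝ C} (hΔ : Δ ∈ diffOp C q) {w : ℤ}
    (hw : Δ ∈ wt (conj h) w) (h1 : w < -(q : ℤ)) : Δ = 0 := by
  induction q generalizing Δ w with
  | zero =>
    rw [eq_mulLeft hΔ, H.wt_neg w (by simpa using h1) _ (H.apply_one_wt hw)]; simp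
  | succ q ih =>
    push_cast at h1
    have h0 := H.diffOp_eq_mulLeft hΔ
      (fun g => ih (mem_diffOp_succ.1 hΔ _) (H.comm_wt hw (H.mulLeft_wt (H.ρ_mem g)))
        (by omega))
      (fun φ => ih (mem_diffOp_succ.1 hΔ _) (H.comm_wt hw (H.mulLeft_wt (H.ℓ_mem φ)))
        (by omega))
    rw [eq_mulLeft h0, H.wt_neg w (by omega) _ (H.apply_one_wt hw)]; simp

lemma DODeg_comp {n p q : ℕ} {k v w : ℤ} (hn : n = p + q) (hk : k = v + w)
    {Δ Δ' : End ℝ C} (hΔ : Δ ∈ DODeg h p v) (hΔ' : Δ' ∈ DODeg h q w) :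
    Δ * Δ' ∈ DODeg h n k :=
  ⟨diffOp_comp hn hΔ.1 hΔ'.1, hk ▸ H.comp_wt hΔ.2 hΔ'.2⟩

lemma DODeg_comm {n p q : ℕ} {k v w : ℤ} (hn : n + 1 = p + q) (hk : k = v + w)
    {Δ Δ' : End ℝ C} (hΔ : Δ ∈ DODeg h p v) (hΔ' : Δ' ∈ DODeg h q w) :
    opComm Δ Δ' ∈ DODeg h n k :=
  ⟨diffOp_comm hn hΔ.1 hΔ'.1, hk ▸ H.comm_wt hΔ.2 hΔ'.2⟩

lemma core_comm {p q : ℕ} {Δ Δ' : End ℝ C} (hΔ : Δ ∈ DODeg h p (-(p : ℤ)))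
    (hΔ' : Δ' ∈ DODeg h q (-(q : ℤ))) : opComm Δ Δ' = 0 := by
  by_cases hpq : p + q = 0
  · obtain ⟨rfl, rfl⟩ : p = 0 ∧ q = 0 := by omega
    exact diffOp_zero_comm hΔ.1 hΔ'.1
  · obtain ⟨n, hn⟩ : ∃ n, n + 1 = p + q := ⟨p + q - 1, by omega⟩
    have := H.DODeg_comm hn rfl hΔ hΔ'
    exact H.diffOp_wt_lt this.1 this.2 (by omega)

lemma core_comm' {T : Submodule ℝ (End ℝ C)} (hT : T = ⨆ p : ℕ, DODeg h p (-(p : ℤ)))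
    {Δ Δ' : End ℝ C} (hΔ : Δ ∈ T) (hΔ' : Δ' ∈ T) : opComm Δ Δ' = 0 := by
  subst hT
  exact iSup_bilin_mem (T := ⊥) commEnd (fun p q x y hx hy => H.core_comm hx hy) Δ hΔ Δ' hΔ'

lemma vl_mem (a : V →ₗ[R] R) :
    ((H.vl a).toLinearMap : End ℝ C) ∈ DODeg h 1 (-((1 : ℕ) : ℤ)) :=
  ⟨derivation_mem_diffOp _, H.vl_wt a⟩

lemma lin_mem (δ : modDer R V) :
    ((H.lin δ).toLinearMap : End ℝ C) ∈ DODeg h 1 (1 - ((1 : ℕ) : ℤ)) :=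
  ⟨derivation_mem_diffOp _, H.lin_wt δ⟩

lemma mulLeft_one : mulLeft ℝ (1 : C) = LinearMap.id := LinearMap.ext fun f => one_mul f

lemma id_mem : (LinearMap.id : End ℝ C) ∈ DODeg h 1 (1 - ((1 : ℕ) : ℤ)) := by
  rw [← H.mulLeft_one]
  exact ⟨diffOp_le_succ 0 (mulLeft_mem_diffOp 1), H.mulLeft_wt (by simpa using H.one_mem)⟩

lemma DODeg_zero {w : ℤ} {Δ : End ℝ C} :
    Δ ∈ DODeg h 0 w ↔ ∃ f ∈ wt h w, mulLeft ℝ f = Δ := by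
  constructor
  · exact fun hΔ => ⟨_, H.apply_one_wt hΔ.2, (eq_mulLeft hΔ.1).symm⟩
  · rintro ⟨f, hf, rfl⟩
    exact ⟨mulLeft_mem_diffOp f, H.mulLeft_wt hf⟩

lemma sep_end {χ : M → R} (hχ : ∀ x, ev x (χ x) = 1) {Δ Δ' : End ℝ C}
    (e : ∀ x, mulLeft ℝ (ρ (χ x)) * Δ = mulLeft ℝ (ρ (χ x)) * Δ') : Δ = Δ' :=
  LinearMap.ext fun f => H.sep_eq hχ fun x => congrArg (fun D : End ℝ C => D f) (e x)

lemma glue_DODeg {q : ℕ} {w : ℤ} {χ : M → R} (hχ : ∀ x, ev x (χ x) = 1)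
    (a : M → End ℝ C) (ha : ∀ x, a x ∈ DODeg h q w)
    (e : ∀ x y, mulLeft ℝ (ρ (χ y)) * a x = mulLeft ℝ (ρ (χ x)) * a y) :
    ∃ Δ ∈ DODeg h q w, ∀ x, mulLeft ℝ (ρ (χ x)) * Δ = a x := by
  choose T hT using fun f => H.glue χ hχ (fun x => a x f) fun x y =>
    congrArg (fun D : End ℝ C => D f) (e x y)
  let Δ : End ℝ C :=
    { toFun := T
      map_add' := fun f g => H.sep_eq hχ fun x => by rw [mul_add, hT, hT, hT, map_add]
      map_smul' := fun c f => H.sep_eq hχ fun x => by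
        rw [RingHom.id_apply, mul_smul_comm, hT, hT, map_smul] }
  have hΔ : ∀ x, mulLeft ℝ (ρ (χ x)) * Δ = a x := fun x => LinearMap.ext fun f => hT f x
  refine ⟨Δ, ⟨fun l hl => H.sep_end hχ fun x => ?_, fun t ht => H.sep_end hχ fun x => ?_⟩, hΔ⟩
  · rw [← nestedComm_mul_left, hΔ, (ha x).1 l hl, mul_zero]
  · have h1 : conj h t (mulLeft ℝ (ρ (χ x)) * Δ)
        = mulLeft ℝ (ρ (χ x)) * conj h t Δ := LinearMap.ext fun f => by
      simp [conj_apply, H.h_mul, H.h_ρ]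
    rw [← h1, mul_smul_comm, hΔ, (ha x).2 t ht]

end LinModel

/-- The graded Lie-Rinehart algebra of fibre-wise linear differential operators. -/
def doModel (b : DualPair M R V W) {ρ : R →ₗ[ℝ] C} {h : ℝ → C →ₗ[ℝ] C} {ℓ : V →ₗ[ℝ] C}
    (H : LinModel b.ev ρ h ℓ) (TA TL : Submodule ℝ (End ℝ C))
    (hA : TA = ⨆ p : ℕ, DODeg h p (-(p : ℤ))) (hL : TL = ⨆ q : ℕ, DODeg h q (1 - (q : ℤ))) :
    GradedModel b TA TL where
  one := ⟨LinearMap.id, hA ▸ mem_iSup_of_mem 0 (H.DODeg_zero.2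
    ⟨1, by simpa using H.one_mem, LinearMap.ext fun f => one_mul f⟩)⟩
  mul := restrict₂ (LinearMap.mul ℝ (End ℝ C)) TA TA TA (by
    subst hA
    exact iSup_bilin_mem _ fun p q x y hx hy => mem_iSup_of_mem (p + q)
        (H.DODeg_comp rfl (by push_cast; ring) hx hy))
  smul := restrict₂ (LinearMap.mul ℝ (End ℝ C)) TA TL TL (by
    subst hA hL
    exact iSup_bilin_mem _ fun p q x y hx hy => mem_iSup_of_mem (p + q)
        (H.DODeg_comp rfl (by push_cast; ring) hx hy))
  bracket := restrict₂ commEnd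
    TL TL TL (by
      subst hL
      refine iSup_bilin_mem _ fun p q x y hx hy => ?_
      change opComm x y ∈ _
      by_cases hpq : p + q = 0
      · obtain ⟨rfl, rfl⟩ : p = 0 ∧ q = 0 := by omega
        rw [diffOp_zero_comm hx.1 hy.1]; exact zero_mem _
      · exact mem_iSup_of_mem (p + q - 1) (H.DODeg_comm (by omega) (by omega) hx hy))
  anchor := restrict₂ commEnd
    TL TA TA (by
      subst hL hA
      refine iSup_bilin_mem _ fun p q x y hx hy => ?_
      change opComm x y ∈ _
      by_cases hpq : p + q = 0
      · obtain ⟨rfl, rfl⟩ : p = 0 ∧ q = 0 := by omega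
        rw [diffOp_zero_comm hx.1 hy.1]; exact zero_mem _
      · exact mem_iSup_of_mem (p + q - 1) (H.DODeg_comm (by omega) (by omega) hx hy))
  one_mul a := Subtype.ext (LinearMap.ext fun f => rfl)
  mul_comm a c := Subtype.ext (sub_eq_zero.1 (H.core_comm' hA a.2 c.2))
  mul_assoc a c d := Subtype.ext (mul_assoc a.1 c.1 d.1)
  one_smul x := Subtype.ext (LinearMap.ext fun f => rfl)
  mul_smul a c x := Subtype.ext (mul_assoc a.1 c.1 x.1)
  bracket_self x := Subtype.ext (sub_self (x.1 * x.1))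
  jacobi x y z := Subtype.ext (opComm_jacobi x.1 y.1 z.1)
  anchor_mul x a c := Subtype.ext (opComm_mul_right x.1 a.1 c.1)
  anchor_smul a x c := Subtype.ext (by
    change opComm (a.1 * x.1) c.1 = a.1 * opComm x.1 c.1
    rw [opComm_mul, H.core_comm' hA a.2 c.2, zero_mul, zero_add])
  anchor_bracket x y a := Subtype.ext (by
    change opComm (opComm x.1 y.1) a.1 = opComm x.1 (opComm y.1 a.1) - opComm y.1 (opComm x.1 a.1)
    rw [opComm_jacobi x.1]; abel)
  leibniz x a y := Subtype.ext (opComm_mul_right x.1 a.1 y.1)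
  Adeg p := (DODeg h p (-(p : ℤ))).comap TA.subtype
  Ldeg q := (DODeg h q (1 - (q : ℤ))).comap TL.subtype
  ofR := ((LinearMap.mul ℝ C) ∘ₗ ρ).codRestrict TA fun g => hA ▸ mem_iSup_of_mem 0
    (H.DODeg_zero.2 ⟨ρ g, by simpa using H.ρ_mem g, rfl⟩)
  ofW :=
    { toFun := fun e => ⟨(H.vl (b.pair.flip e)).toLinearMap,
        hA ▸ mem_iSup_of_mem 1 (H.vl_mem _)⟩
      map_add' := fun e e' => Subtype.ext (LinearMap.ext fun f => by
        change H.vl (b.pair.flip (e + e')) f = H.vl (b.pair.flip e) f + H.vl (b.pair.flip e') f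
        rw [map_add, map_add, Derivation.add_apply])
      map_smul' := fun c e => Subtype.ext (LinearMap.ext fun f => by
        change H.vl (b.pair.flip (c • e)) f = c • H.vl (b.pair.flip e) f
        rw [map_smul_of_tower, map_smul, Derivation.smul_apply]) }
  ofV := ((LinearMap.mul ℝ C) ∘ₗ ℓ).codRestrict TL fun φ => hL ▸ mem_iSup_of_mem 0
    (H.DODeg_zero.2 ⟨ℓ φ, by simpa using H.ℓ_mem φ, rfl⟩)
  ofDer :=
    { toFun := fun δ => ⟨(H.lin (b.dual δ)).toLinearMap,
        hL ▸ mem_iSup_of_mem 1 (H.lin_mem _)⟩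
      map_add' := fun e e' => Subtype.ext (LinearMap.ext fun f => by
        change H.lin (b.dual (e + e')) f = H.lin (b.dual e) f + H.lin (b.dual e') f
        rw [map_add, map_add, Derivation.add_apply])
      map_smul' := fun c e => Subtype.ext (LinearMap.ext fun f => by
        change H.lin (b.dual (c • e)) f = c • H.lin (b.dual e) f
        rw [map_smul, map_smul, Derivation.smul_apply]) }
  unit := ⟨LinearMap.id, hL ▸ mem_iSup_of_mem 1 H.id_mem⟩
  ofR_one := Subtype.ext (LinearMap.ext fun f => by
    change ρ 1 * f = f
    rw [H.ρ_one, one_mul])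
  ofR_mul g g' := Subtype.ext (LinearMap.ext fun f => by
    change ρ (g * g') * f = ρ g * (ρ g' * f)
    rw [H.ρ_mul, mul_assoc])
  ofR_inj g hg := H.ρ_inj g (by
    have := congrArg (fun D : TA => D.1 1) hg
    simpa using this)
  Adeg_zero := by
    ext a
    rw [Submodule.mem_comap, Submodule.subtype_apply, H.DODeg_zero]
    constructor
    · rintro ⟨f, hf, e⟩
      obtain ⟨g, rfl⟩ := H.wt_zero f (by simpa using hf)
      exact ⟨g, Subtype.ext e⟩
    · rintro ⟨g, rfl⟩
      exact ⟨ρ g, by simpa using H.ρ_mem g, rfl⟩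
  ofV_inj φ hφ := H.ℓ_inj φ (by
    have := congrArg (fun D : TL => D.1 1) hφ
    simpa using this)
  ofV_smul g φ := Subtype.ext (LinearMap.ext fun f => by
    change ℓ (g • φ) * f = ρ g * (ℓ φ * f)
    rw [H.ℓ_smul, mul_assoc])
  Ldeg_zero := by
    ext a
    rw [Submodule.mem_comap, Submodule.subtype_apply, H.DODeg_zero]
    constructor
    · rintro ⟨f, hf, e⟩
      obtain ⟨g, rfl⟩ := H.wt_one f (by simpa using hf)
      exact ⟨g, Subtype.ext e⟩
    · rintro ⟨g, rfl⟩
      exact ⟨ℓ g, by simpa using H.ℓ_mem g, rfl⟩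
  mul_mem ha hc := H.DODeg_comp rfl (by push_cast; ring) ha hc
  smul_mem ha hc := H.DODeg_comp rfl (by push_cast; ring) ha hc
  bracket_mem hn hx hy := H.DODeg_comm hn (by omega) hx hy
  anchor_mem hn hx hy := H.DODeg_comm hn (by omega) hx hy
  anchor_ofV_ofR φ g := Subtype.ext (sub_eq_zero.2 (mulLeft_comm' _ _))
  bracket_ofV φ g := Subtype.ext (sub_eq_zero.2 (mulLeft_comm' _ _))
  ofW_mem e := H.vl_mem _
  anchor_ofW φ e := Subtype.ext (by
    change opComm (mulLeft ℝ (ℓ φ)) (H.vl (b.pair.flip e)).toLinearMap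
      = - mulLeft ℝ (ρ (b.pair φ e))
    rw [← flip_apply b.pair, ← H.vl_ℓ, ← opComm_derivation_mulLeft]
    simp only [opComm_eq]; abel)
  ofDer_mem e := H.lin_mem _
  ofDer_ofV δ φ φ' hφ := Subtype.ext (by
    change opComm (H.lin (b.dual δ)).toLinearMap (mulLeft ℝ (ℓ φ))
      = mulLeft ℝ (ℓ φ')
    rw [opComm_derivation_mulLeft, H.lin_ℓ, b.dual_op_eq hφ])
  anchor_ofDer δ g := Subtype.ext (by
    change opComm (H.lin (b.dual δ)).toLinearMap (mulLeft ℝ (ρ g))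
      = mulLeft ℝ (ρ (δ.1.symb g))
    rw [opComm_derivation_mulLeft, H.lin_ρ, b.dual_symb])
  ofDer_bracket δ₁ δ₂ δ₃ e := Subtype.ext (LinearMap.ext fun f => by
    change _ = H.lin (b.dual δ₃) f
    rw [H.lin_bracket (b.dual_bracket e), commutator_apply]; rfl)
  ofDer_smul g δ δ' e := Subtype.ext (LinearMap.ext fun f => by
    change H.lin (b.dual δ') f = ρ g * H.lin (b.dual δ) f
    rw [H.lin_smul (b.dual_smul e)]; rfl)
  ofDer_rank_one φ e δ hs ho := Subtype.ext (LinearMap.ext fun f => by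
    change H.lin (b.dual δ) f = ρ (b.pair φ e) * f - H.vl (b.pair.flip e) (ℓ φ * f)
    rw [H.lin_rank_one (a := b.pair.flip e) (φ₀ := - φ) hs
      (fun ψ => by rw [b.dual_rank_one hs ho, smul_neg]; rfl), Derivation.leibniz, H.vl_ℓ]
    simp only [map_neg, Derivation.smul_apply, smul_eq_mul, flip_apply]
    ring)
  unit_mem := H.id_mem
  anchor_unit a := Subtype.ext (sub_self a.1)
  bracket_unit_ofV φ := Subtype.ext (sub_self _)
  bracket_unit_ofDer φ := Subtype.ext (sub_self _)
  unit_inj g hg := H.ρ_inj g (by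
    have := congrArg (fun D : TL => D.1 1) hg
    change ρ g * 1 = 0 at this
    simpa using this)
  faithful_A p a ha hφ := Subtype.ext (by
    have h1 := H.diffOp_eq_mulLeft ha.1 (fun g => H.diffOp_wt_lt (mem_diffOp_succ.1 ha.1 (ρ g))
        (H.comm_wt ha.2 (H.mulLeft_wt (H.ρ_mem g))) (by push_cast; omega)) (fun φ => by
        have h2 : opComm (mulLeft ℝ (ℓ φ)) a.1 = 0 := congrArg Subtype.val (hφ φ)
        rw [opComm_eq, sub_eq_zero] at h2
        rw [opComm_eq, sub_eq_zero]
        exact h2.symm)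
    exact H.diffOp_wt_lt h1 ha.2 (by push_cast; omega))
  faithful_one x hx h1 h2 := by
    have h3 := H.diffOp_eq_mulLeft hx.1 (fun g => congrArg Subtype.val (h2 g))
      (fun g => congrArg Subtype.val (h1 g))
    obtain ⟨f, hf, e⟩ := H.DODeg_zero.1 ⟨h3, hx.2⟩
    obtain ⟨g, rfl⟩ := H.wt_zero f (by simpa using hf)
    exact ⟨g, Subtype.ext e.symm⟩
  faithful_L q x hx h1 h2 := Subtype.ext (by
    have h3 := H.diffOp_eq_mulLeft hx.1 (fun g => congrArg Subtype.val (h2 g))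
      (fun g => congrArg Subtype.val (h1 g))
    exact H.diffOp_wt_lt h3 hx.2 (by push_cast; omega))
  sep_A χ hχ a ha := Subtype.ext (H.sep_end hχ fun x => by
    rw [ZeroMemClass.coe_zero, mul_zero]; exact congrArg Subtype.val (ha x))
  sep_L χ hχ a ha := Subtype.ext (H.sep_end hχ fun x => by
    rw [ZeroMemClass.coe_zero, mul_zero]; exact congrArg Subtype.val (ha x))
  glue_A p χ hχ a ha e := by
    obtain ⟨Δ, h1, h2⟩ := H.glue_DODeg hχ (fun x => (a x).1) ha
      fun x y => congrArg Subtype.val (e x y)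
    exact ⟨⟨Δ, hA ▸ mem_iSup_of_mem p h1⟩, h1, fun x => Subtype.ext (h2 x)⟩
  glue_L p χ hχ a ha e := by
    obtain ⟨Δ, h1, h2⟩ := H.glue_DODeg hχ (fun x => (a x).1) ha
      fun x y => congrArg Subtype.val (e x y)
    exact ⟨⟨Δ, hL ▸ mem_iSup_of_mem p h1⟩, h1, fun x => Subtype.ext (h2 x)⟩
  iSup_A := by subst hA; exact iSup_comap_subtype _
  iSup_L := by subst hL; exact iSup_comap_subtype _
  indep_A := iSupIndep_comap_subtype (((wt_iSupIndep (conj h)).comp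
    (f := fun p : ℕ => -(p : ℤ)) (fun p q e => by simpa using e)).mono fun p => inf_le_right) TA
  indep_L := iSupIndep_comap_subtype (((wt_iSupIndep (conj h)).comp
    (f := fun p : ℕ => 1 - (p : ℤ)) (fun p q e => by simpa using e)).mono fun p => inf_le_right) TL

end DOModel

section Multi

namespace MultiPair

@[simp] lemma symb_neg (D : MultiPair C S) : (-D).symb = -D.symb := rfl
@[simp] lemma symb_sub (D D' : MultiPair C S) : (D - D').symb = D.symb - D'.symb := rfl
@[simp] lemma op_sub (D D' : MultiPair C S) : (D - D').op = D.op - D'.op := rfl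

@[ext] lemma ext {D D' : MultiPair C S} (h : D.symb = D'.symb) (h' : D.op = D'.op) : D = D' :=
  Prod.ext h h'

/-- The contraction of a multivector with (the differential of) a function. -/
def contr (f : C) : MultiPair C S →ₗ[ℝ] MultiPair C S where
  toFun D := (fun m => D.symb (f ::ₘ m), fun m => D.op (f ::ₘ m))
  map_add' _ _ := rfl
  map_smul' _ _ := rfl

@[simp] lemma contr_symb (f : C) (D : MultiPair C S) (m : Multiset C) :
    (contr f D).symb m = D.symb (f ::ₘ m) := rfl
@[simp] lemma contr_op (f : C) (D : MultiPair C S) (m : Multiset C) :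
    (contr f D).op m = D.op (f ::ₘ m) := rfl

lemma contr_comm (f g : C) (D : MultiPair C S) : contr f (contr g D) = contr g (contr f D) := by
  ext m <;> simp [Multiset.cons_swap]

/-- The product of a function and a multivector. -/
def fs (f : C) : MultiPair C S →ₗ[ℝ] MultiPair C S where
  toFun D := (fun m => f * D.symb m, fun m => f • D.op m)
  map_add' _ _ := MultiPair.ext (funext fun _ => mul_add _ _ _) (funext fun _ => smul_add _ _ _)
  map_smul' c D := MultiPair.ext (funext fun _ => mul_smul_comm _ _ _)
    (funext fun m => LinearMap.ext fun v => smul_comm f c (D.op m v))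

@[simp] lemma fs_symb (f : C) (D : MultiPair C S) (m : Multiset C) :
    (fs f D).symb m = f * D.symb m := rfl
@[simp] lemma fs_op (f : C) (D : MultiPair C S) (m : Multiset C) :
    (fs f D).op m = f • D.op m := rfl

lemma contr_fs (f g : C) (D : MultiPair C S) : contr g (fs f D) = fs f (contr g D) := rfl

lemma contr_induction {κ : Type*} {X : κ → MultiPair C S} (Q : Multiset C → MultiPair C S → Prop)
    (hz : ∀ m, Q m 0) (ha : ∀ m D D', Q m D → Q m D' → Q m (D + D'))
    (hc : ∀ f m D, Q m (contr f D) → Q (f ::ₘ m) D)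
    (h : ∀ i f, ∃ l : List κ, contr f (X i) = (l.map X).sum) (h0 : ∀ i, Q 0 (X i))
    (m : Multiset C) (i : κ) : Q m (X i) := by
  induction m using Multiset.induction_on generalizing i with
  | empty => exact h0 i
  | cons f m ih =>
    obtain ⟨l, hl⟩ := h i f
    refine hc f m _ (hl ▸ List.sum_induction _ (ha m) (hz m) ?_)
    simpa using fun j _ => ih j

lemma eq_of_contr {κ : Type*} (F G : κ → MultiPair C S) (h : ∀ i f, ∃ l : List κ,
      contr f (F i) - contr f (G i) = (l.map fun j => F j - G j).sum)
    (h0 : ∀ i, (F i).symb 0 = (G i).symb 0) (h1 : ∀ i, (F i).op 0 = (G i).op 0) (i : κ) :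
    F i = G i := by
  have := fun m => contr_induction (X := fun j => F j - G j)
    (fun m D => D.symb m = 0 ∧ D.op m = 0) (by simp) (fun m D D' h h' => by simp [h, h'])
    (fun f m D => id) (by simpa only [map_sub] using h) (by simp [h0, h1]) m i
  exact MultiPair.ext (funext fun m => sub_eq_zero.1 (this m).1)
    (funext fun m => sub_eq_zero.1 (this m).2)

/-- Equality by contractions. -/
lemma ext_contr {D D' : MultiPair C S} (h : ∀ f, contr f D = contr f D')
    (h0 : D.symb 0 = D'.symb 0) (h1 : D.op 0 = D'.op 0) : D = D' :=
  eq_of_contr (fun _ : Unit => D) (fun _ => D') (fun _ f => ⟨[], by simp [h]⟩) (fun _ => h0)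
    (fun _ => h1) ()

end MultiPair

open MultiPair

lemma derMul_symb (D D' : MultiPair C S) (m : Multiset C) : (derMul D D').symb m
    = (m.antidiagonal.map fun s => D.symb s.1 * D'.symb s.2).sum := rfl

lemma derMul_op (D D' : MultiPair C S) (m : Multiset C) : (derMul D D').op m
    = (m.antidiagonal.map fun s => D.symb s.1 • D'.op s.2 + D'.symb s.1 • D.op s.2).sum := rfl

lemma derBracket_symb (D D' : MultiPair C S) (m : Multiset C) : (derBracket D D').symb m
    = (m.antidiagonal.map fun s => D.symb (D'.symb s.1 ::ₘ s.2)
      - D'.symb (D.symb s.1 ::ₘ s.2)).sum := rfl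

lemma derBracket_op (D D' : MultiPair C S) (m : Multiset C) : (derBracket D D').op m
    = derBullet D D' m - derBullet D' D m := rfl

lemma contr_derMul (f : C) (D D' : MultiPair C S) :
    contr f (derMul D D') = derMul (contr f D) D' + derMul D (contr f D') := by
  refine MultiPair.ext (funext fun m => ?_) (funext fun m => ?_)
  · simp only [contr_symb, symb_add, Pi.add_apply, derMul_symb, Multiset.antidiagonal_cons,
      Multiset.map_add, Multiset.sum_add, Multiset.map_map, Function.comp_def, Prod.map_fst,
      Prod.map_snd, id]
    exact add_comm _ _
  · simp only [contr_op, op_add, Pi.add_apply, derMul_op, Multiset.antidiagonal_cons,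
      Multiset.map_add, Multiset.sum_add, Multiset.map_map, Function.comp_def, Prod.map_fst,
      Prod.map_snd, id, contr_symb, Multiset.sum_map_add]
    abel

lemma contr_derBracket (f : C) (D D' : MultiPair C S) :
    contr f (derBracket D D') = derBracket (contr f D) D' + derBracket D (contr f D') := by
  refine MultiPair.ext (funext fun m => ?_) (funext fun m => ?_)
  · simp only [contr_symb, symb_add, Pi.add_apply, derBracket_symb, Multiset.antidiagonal_cons,
      Multiset.map_add, Multiset.sum_add, Multiset.map_map, Function.comp_def, Prod.map_fst,
      Prod.map_snd, id, ← Multiset.sum_map_add, Multiset.cons_swap _ f]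
    refine congrArg Multiset.sum (Multiset.map_congr rfl fun s _ => ?_)
    ring
  · have key : ∀ D D' : MultiPair C S, derBullet D D' (f ::ₘ m)
        = derBullet (contr f D) D' m + derBullet D (contr f D') m := fun D D' => by
      simp only [derBullet, Multiset.antidiagonal_cons, Multiset.map_add, Multiset.sum_add,
        Multiset.map_map, Function.comp_def, Prod.map_fst, Prod.map_snd, id, contr_symb, contr_op,
        Multiset.cons_swap _ f]
      exact add_comm _ _
    simp only [contr_op, op_add, Pi.add_apply, derBracket_op, key]
    abel

@[simp] lemma derMul_symb_zero (D D' : MultiPair C S) :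
    (derMul D D').symb 0 = D.symb 0 * D'.symb 0 := by
  simp [derMul_symb]

@[simp] lemma derMul_op_zero (D D' : MultiPair C S) :
    (derMul D D').op 0 = D.symb 0 • D'.op 0 + D'.symb 0 • D.op 0 := by
  simp [derMul_op]

@[simp] lemma derBracket_symb_zero (D D' : MultiPair C S) : (derBracket D D').symb 0
    = (contr (D'.symb 0) D).symb 0 - (contr (D.symb 0) D').symb 0 := by
  simp [derBracket_symb]

@[simp] lemma derBracket_op_zero (D D' : MultiPair C S) : (derBracket D D').op 0
    = D.op 0 * D'.op 0 + (contr (D'.symb 0) D).op 0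
      - (D'.op 0 * D.op 0 + (contr (D.symb 0) D').op 0) := by
  simp [derBracket_op, derBullet, End.mul_eq_comp]

lemma derMul_add (D D' D'' : MultiPair C S) :
    derMul D (D' + D'') = derMul D D' + derMul D D'' :=
  eq_of_contr (fun p : MultiPair C S × MultiPair C S × MultiPair C S => derMul p.1 (p.2.1 + p.2.2))
    (fun p => derMul p.1 p.2.1 + derMul p.1 p.2.2)
    (fun ⟨x, y, z⟩ f => ⟨[(contr f x, y, z), (x, contr f y, contr f z)], by
      simp [contr_derMul]; abel⟩)
    (fun p => by simp [mul_add]) (fun p => by simp [add_smul]; abel) (D, D', D'')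

lemma derMul_comm (D D' : MultiPair C S) : derMul D D' = derMul D' D :=
  eq_of_contr (fun p : MultiPair C S × MultiPair C S => derMul p.1 p.2) (fun p => derMul p.2 p.1)
    (fun ⟨x, y⟩ f => ⟨[(contr f x, y), (x, contr f y)], by simp [contr_derMul]; abel⟩)
    (fun p => by simp [mul_comm]) (fun p => by simp [add_comm]) (D, D')

lemma derMul_smul (c : ℝ) (D D' : MultiPair C S) : derMul D (c • D') = c • derMul D D' :=
  eq_of_contr (fun p : MultiPair C S × MultiPair C S => derMul p.1 (c • p.2))
    (fun p => c • derMul p.1 p.2)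
    (fun ⟨x, y⟩ f => ⟨[(contr f x, y), (x, contr f y)], by
      simp [contr_derMul, smul_add]; abel⟩)
    (fun p => by simp) (fun p => by ext v; simp [smul_comm c]) (D, D')

/-- The product of multivectors as a bilinear map. -/
def derMulL : MultiPair C S →ₗ[ℝ] MultiPair C S →ₗ[ℝ] MultiPair C S :=
  LinearMap.mk₂ ℝ derMul
    (fun D D' D'' => by rw [derMul_comm, derMul_add, derMul_comm D'', derMul_comm D''])
    (fun c D D' => by rw [derMul_comm, derMul_smul, derMul_comm])
    derMul_add derMul_smul

lemma add_derMul (D D' D'' : MultiPair C S) : derMul (D + D') D'' = derMul D D'' + derMul D' D'' :=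
  LinearMap.map_add₂ derMulL D D' D''

lemma smul_derMul (c : ℝ) (D D' : MultiPair C S) : derMul (c • D) D' = c • derMul D D' :=
  LinearMap.map_smul₂ derMulL c D D'

lemma derMul_assoc (D D' D'' : MultiPair C S) :
    derMul (derMul D D') D'' = derMul D (derMul D' D'') :=
  eq_of_contr (fun p : MultiPair C S × MultiPair C S × MultiPair C S =>
      derMul (derMul p.1 p.2.1) p.2.2) (fun p => derMul p.1 (derMul p.2.1 p.2.2))
    (fun ⟨x, y, z⟩ f => ⟨[(contr f x, y, z), (x, contr f y, z), (x, y, contr f z)], by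
      simp [contr_derMul, derMul_add, add_derMul]; abel⟩)
    (fun p => by simp [mul_assoc])
    (fun p => by simp [smul_smul, mul_comm (p.2.2.symb 0), add_assoc]) (D, D', D'')

lemma derMul_fs (f : C) (D D' : MultiPair C S) : derMul D (fs f D') = fs f (derMul D D') :=
  eq_of_contr (fun p : MultiPair C S × MultiPair C S => derMul p.1 (fs f p.2))
    (fun p => fs f (derMul p.1 p.2))
    (fun ⟨x, y⟩ g => ⟨[(contr g x, y), (x, contr g y)], by simp [contr_derMul, contr_fs]; abel⟩)
    (fun p => by simp [mul_left_comm]) (fun p => by simp [smul_smul, mul_comm]) (D, D')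

lemma fs_derMul (f : C) (D D' : MultiPair C S) : derMul (fs f D) D' = fs f (derMul D D') := by
  rw [derMul_comm, derMul_fs, derMul_comm]

lemma derBracket_anti (D D' : MultiPair C S) : derBracket D D' = - derBracket D' D := by
  refine MultiPair.ext (funext fun m => ?_) (funext fun m => (neg_sub _ _).symm)
  simp only [symb_neg, Pi.neg_apply, derBracket_symb, ← Multiset.sum_map_neg', Multiset.map_map,
    Function.comp_def, neg_sub]

lemma derBracket_self (D : MultiPair C S) : derBracket D D = 0 :=
  MultiPair.ext (funext fun m => by simp [derBracket_symb]) (funext fun m => sub_self _)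

/-! Properties of multivectors -/

section Mem

variable {D D' D'' : MultiPair C S}

lemma contr_add_left (h : D ∈ derMultivector C S) (f g : C) :
    contr (f + g) D = contr f D + contr g D :=
  MultiPair.ext (funext (h.1.1 · f g)) (funext fun m => LinearMap.ext (h.2.1 m f g))

lemma contr_smul_left (h : D ∈ derMultivector C S) (c : ℝ) (f : C) :
    contr (c • f) D = c • contr f D :=
  MultiPair.ext (funext (h.1.2.1 · c f)) (funext fun m => LinearMap.ext (h.2.2.1 m c f))

lemma contr_mul_left (h : D ∈ derMultivector C S) (f g : C) :
    contr (f * g) D = fs f (contr g D) + fs g (contr f D) :=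
  MultiPair.ext (funext (h.1.2.2.1 · f g)) (funext fun m => LinearMap.ext (h.2.2.2.1 m f g))

lemma contr_zero_left (h : D ∈ derMultivector C S) : contr 0 D = 0 := by
  simpa using contr_smul_left h 0 0

lemma contr_neg_left (h : D ∈ derMultivector C S) (f : C) : contr (-f) D = - contr f D := by
  simpa using contr_smul_left h (-1) f

lemma contr_sub_left (h : D ∈ derMultivector C S) (f g : C) :
    contr (f - g) D = contr f D - contr g D := by
  rw [sub_eq_add_neg, contr_add_left h, contr_neg_left h, sub_eq_add_neg]

lemma op_smul_apply (h : D ∈ derMultivector C S) (m : Multiset C) (f : C) (v : S) :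
    D.op m (f • v) = f • D.op m v + (contr f D).symb m • v := h.2.2.2.2.1 m f v

lemma mem_of_contr (h1 : ∀ f g, contr (f + g) D = contr f D + contr g D)
    (h2 : ∀ (c : ℝ) f, contr (c • f) D = c • contr f D)
    (h3 : ∀ f g, contr (f * g) D = fs f (contr g D) + fs g (contr f D))
    (h4 : ∀ m f v, D.op m (f • v) = f • D.op m v + (contr f D).symb m • v)
    (h5 : ∃ N : ℕ, ∀ m, N < m.card → D.symb m = 0 ∧ D.op m = 0) : D ∈ derMultivector C S := by
  obtain ⟨N, hN⟩ := h5
  exact ⟨⟨fun m f g => congrArg (·.symb m) (h1 f g), fun m c f => congrArg (·.symb m) (h2 c f),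
    fun m f g => congrArg (·.symb m) (h3 f g), N, fun m hm => (hN m hm).1⟩,
    fun m f g v => congrArg (·.op m v) (h1 f g), fun m c f v => congrArg (·.op m v) (h2 c f),
    fun m f g v => congrArg (·.op m v) (h3 f g), h4, N, fun m hm => (hN m hm).2⟩

lemma exists_bound (h : D ∈ derMultivector C S) :
    ∃ N : ℕ, ∀ m, N < m.card → D.symb m = 0 ∧ D.op m = 0 := by
  obtain ⟨⟨-, -, -, N, hN⟩, -, -, -, -, N', hN'⟩ := h
  exact ⟨max N N', fun m hm => ⟨hN m (lt_of_le_of_lt (le_max_left _ _) hm),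
    hN' m (lt_of_le_of_lt (le_max_right _ _) hm)⟩⟩

lemma contr_mem (h : D ∈ derMultivector C S) (f : C) : contr f D ∈ derMultivector C S := by
  obtain ⟨N, hN⟩ := exists_bound h
  refine mem_of_contr (fun g k => ?_) (fun c k => ?_) (fun g k => ?_) (fun m g v => ?_)
    ⟨N, fun m hm => hN _ (by rw [Multiset.card_cons]; omega)⟩
  · rw [contr_comm, contr_add_left h, map_add, contr_comm f, contr_comm f]
  · rw [contr_comm, contr_smul_left h, map_smul, contr_comm f]
  · rw [contr_comm, contr_mul_left h, map_add, contr_fs, contr_fs, contr_comm f, contr_comm f]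
  · rw [contr_op, op_smul_apply h, contr_comm]; rfl

lemma fs_mem (h : D ∈ derMultivector C S) (f : C) : fs f D ∈ derMultivector C S := by
  obtain ⟨N, hN⟩ := exists_bound h
  refine mem_of_contr (fun g k => ?_) (fun c k => ?_) (fun g k => ?_) (fun m g v => ?_)
    ⟨N, fun m hm => by simp [hN m hm]⟩
  · rw [contr_fs, contr_add_left h, map_add, contr_fs, contr_fs]
  · rw [contr_fs, contr_smul_left h, map_smul, contr_fs]
  · rw [contr_fs, contr_mul_left h, map_add]
    ext m v
    · simp only [symb_add, Pi.add_apply, fs_symb, contr_symb]; ring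
    · simp only [op_add, Pi.add_apply, fs_op, contr_op, LinearMap.add_apply,
        LinearMap.smul_apply, smul_comm f]
  · rw [fs_op, LinearMap.smul_apply, op_smul_apply h, contr_fs]
    simp [smul_add, smul_smul, mul_comm]

lemma derBracket_add (h : D ∈ derMultivector C S) (D' D'' : MultiPair C S) :
    derBracket D (D' + D'') = derBracket D D' + derBracket D D'' :=
  eq_of_contr (fun p : derMultivector C S × MultiPair C S × MultiPair C S =>
      derBracket p.1.1 (p.2.1 + p.2.2)) (fun p => derBracket p.1.1 p.2.1 + derBracket p.1.1 p.2.2)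
    (fun ⟨x, y, z⟩ f => ⟨[(⟨_, contr_mem x.2 f⟩, y, z), (x, contr f y, contr f z)], by
      simp [contr_derBracket]; abel⟩)
    (fun p => by simp [contr_add_left p.1.2]; ring)
    (fun p => by simp [contr_add_left p.1.2, mul_add, add_mul]; abel) (⟨D, h⟩, D', D'')

lemma derBracket_smul (h : D ∈ derMultivector C S) (c : ℝ) (D' : MultiPair C S) :
    derBracket D (c • D') = c • derBracket D D' :=
  eq_of_contr (fun p : derMultivector C S × MultiPair C S => derBracket p.1.1 (c • p.2))
    (fun p => c • derBracket p.1.1 p.2)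
    (fun ⟨x, y⟩ f => ⟨[(⟨_, contr_mem x.2 f⟩, y), (x, contr f y)], by
      simp [contr_derBracket, smul_add]; abel⟩)
    (fun p => by simp [contr_smul_left p.1.2, smul_sub])
    (fun p => by simp [contr_smul_left p.1.2, smul_sub]) (⟨D, h⟩, D')

lemma derBracket_add_left (h : D ∈ derMultivector C S) (D' D'' : MultiPair C S) :
    derBracket (D' + D'') D = derBracket D' D + derBracket D'' D := by
  rw [derBracket_anti, derBracket_add h, derBracket_anti D', derBracket_anti D'', neg_add]

lemma derBracket_smul_left (h : D ∈ derMultivector C S) (c : ℝ) (D' : MultiPair C S) :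
    derBracket (c • D') D = c • derBracket D' D := by
  rw [derBracket_anti, derBracket_smul h, derBracket_anti D', smul_neg]

lemma derBracket_fs (h : D ∈ derMultivector C S) (h' : D' ∈ derMultivector C S) (f : C) :
    derBracket D (fs f D') = fs f (derBracket D D') + derMul (contr f D) D' :=
  eq_of_contr (fun p : derMultivector C S × derMultivector C S => derBracket p.1.1 (fs f p.2.1))
    (fun p => fs f (derBracket p.1.1 p.2.1) + derMul (contr f p.1.1) p.2.1)
    (fun ⟨x, y⟩ g => ⟨[(⟨_, contr_mem x.2 g⟩, y), (x, ⟨_, contr_mem y.2 g⟩)], by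
      simp [contr_derBracket, contr_derMul, contr_fs, contr_comm g f]; abel⟩)
    (fun p => by simp [contr_mul_left p.1.2, contr_fs]; ring)
    (fun p => by
      ext v
      simp [contr_mul_left p.1.2, contr_fs, op_smul_apply p.1.2, smul_sub]
      abel) (⟨D, h⟩, ⟨D', h'⟩)

lemma derBracket_fs_left (h : D ∈ derMultivector C S) (h' : D' ∈ derMultivector C S) (f : C) :
    derBracket (fs f D) D' = fs f (derBracket D D') - derMul (contr f D') D := by
  rw [derBracket_anti, derBracket_fs h' h, derBracket_anti D' D, map_neg]; abel

lemma sum_antidiagonal_eq_zero {A : Type*} [AddCommMonoid A] {F : Multiset C × Multiset C → A}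
    {m : Multiset C} {N : ℕ} (hm : 2 * N < m.card)
    (hF : ∀ s, N < s.1.card ∨ N < s.2.card → F s = 0) : (m.antidiagonal.map F).sum = 0 := by
  refine Multiset.sum_eq_zero fun x hx => ?_
  obtain ⟨s, hs, rfl⟩ := Multiset.mem_map.1 hx
  have := congrArg Multiset.card (Multiset.mem_antidiagonal.1 hs)
  rw [Multiset.card_add] at this
  exact hF s (by omega)

lemma exists_bound₂ (h : D ∈ derMultivector C S) (h' : D' ∈ derMultivector C S) : ∃ N : ℕ,
    ∀ m, N < m.card → (D.symb m = 0 ∧ D.op m = 0) ∧ D'.symb m = 0 ∧ D'.op m = 0 := by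
  obtain ⟨N, hN⟩ := exists_bound h
  obtain ⟨N', hN'⟩ := exists_bound h'
  exact ⟨max N N', fun m hm => ⟨hN m (by omega), hN' m (by omega)⟩⟩

lemma op_smul_of_contr {κ : Type*} (X : κ → MultiPair C S)
    (h : ∀ i f, ∃ l : List κ, contr f (X i) = (l.map X).sum)
    (h0 : ∀ i f v, (X i).op 0 (f • v) = f • (X i).op 0 v + (contr f (X i)).symb 0 • v) (i : κ)
    (m : Multiset C) (f : C) (v : S) :
    (X i).op m (f • v) = f • (X i).op m v + (contr f (X i)).symb m • v :=
  contr_induction (fun m D => D.op m (f • v) = f • D.op m v + (contr f D).symb m • v) (by simp)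
    (fun m D D' h h' => by simp_all [add_smul]; abel)
    (fun g m D h => by rwa [contr_comm] at h) h (h0 · f v) m i

lemma derMul_mem (h : D ∈ derMultivector C S) (h' : D' ∈ derMultivector C S) :
    derMul D D' ∈ derMultivector C S := by
  obtain ⟨N, hN⟩ := exists_bound₂ h h'
  refine mem_of_contr (fun g k => ?_) (fun c k => ?_) (fun g k => ?_)
    (op_smul_of_contr (fun p : derMultivector C S × derMultivector C S => derMul p.1.1 p.2.1)
      (fun ⟨x, y⟩ f => ⟨[(⟨_, contr_mem x.2 f⟩, y), (x, ⟨_, contr_mem y.2 f⟩)], by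
        simp [contr_derMul]⟩) (fun ⟨x, y⟩ f v => ?_) (⟨D, h⟩, ⟨D', h'⟩))
    ⟨2 * N, fun m hm => ⟨sum_antidiagonal_eq_zero hm fun s hs => ?_,
      sum_antidiagonal_eq_zero hm fun s hs => ?_⟩⟩
  · simp only [contr_derMul, contr_add_left h, contr_add_left h', derMul_add, add_derMul]; abel
  · simp only [contr_derMul, contr_smul_left h, contr_smul_left h', derMul_smul, smul_derMul,
      smul_add]
  · simp only [contr_derMul, contr_mul_left h, contr_mul_left h', derMul_add, add_derMul, derMul_fs,
      fs_derMul, map_add]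
    abel
  · simp [contr_derMul, op_smul_apply x.2, op_smul_apply y.2, smul_smul, add_smul, mul_comm _ f,
      mul_comm (y.1.symb 0)]
    abel
  all_goals rcases hs with h | h <;> simp [hN _ h]

lemma derBracket_mem (h : D ∈ derMultivector C S) (h' : D' ∈ derMultivector C S) :
    derBracket D D' ∈ derMultivector C S := by
  obtain ⟨N, hN⟩ := exists_bound₂ h h'
  have hc (f : C) {m : Multiset C} (hm : N < m.card) :=
    hN (f ::ₘ m) (by rw [Multiset.card_cons]; omega)
  have z {D : MultiPair C S} (h : D ∈ derMultivector C S) (m) :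
      D.symb (0 ::ₘ m) = 0 ∧ D.op (0 ::ₘ m) = 0 :=
    ⟨congrArg (·.symb m) (contr_zero_left h), congrArg (·.op m) (contr_zero_left h)⟩
  refine mem_of_contr (fun g k => ?_) (fun c k => ?_) (fun g k => ?_)
    (op_smul_of_contr (fun p : derMultivector C S × derMultivector C S => derBracket p.1.1 p.2.1)
      (fun ⟨x, y⟩ f => ⟨[(⟨_, contr_mem x.2 f⟩, y), (x, ⟨_, contr_mem y.2 f⟩)], by
        simp [contr_derBracket]⟩) (fun ⟨x, y⟩ f v => ?_) (⟨D, h⟩, ⟨D', h'⟩))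
    ⟨2 * N, fun m hm => ⟨sum_antidiagonal_eq_zero hm fun s hs => ?_,
      (congrArg₂ (· - ·) (sum_antidiagonal_eq_zero hm fun s hs => ?_)
        (sum_antidiagonal_eq_zero hm fun s hs => ?_)).trans (sub_zero _)⟩⟩
  · simp only [contr_derBracket, contr_add_left h, contr_add_left h', derBracket_add h,
      derBracket_add_left h']; abel
  · simp only [contr_derBracket, contr_smul_left h, contr_smul_left h', derBracket_smul h,
      derBracket_smul_left h', smul_add]
  · simp only [contr_derBracket, contr_mul_left h, contr_mul_left h', derBracket_add h,
      derBracket_add_left h', derBracket_fs h (contr_mem h' _),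
      derBracket_fs_left (contr_mem h _) h', map_add, derMul_comm (contr _ D')]
    abel
  · simp [contr_derBracket, op_smul_apply x.2, op_smul_apply y.2, smul_sub,
      add_smul, sub_smul]
    abel
  all_goals rcases hs with hs | hs <;> simp [hN _ hs, hc _ hs, z h, z h']

end Mem


lemma derBracket_jacobi {x y z : MultiPair C S} (hx : x ∈ derMultivector C S)
    (hy : y ∈ derMultivector C S) (hz : z ∈ derMultivector C S) : derBracket x (derBracket y z)
    = derBracket (derBracket x y) z + derBracket y (derBracket x z) := by
  refine eq_of_contr (fun p : derMultivector C S × derMultivector C S × derMultivector C S =>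
      derBracket p.1.1 (derBracket p.2.1.1 p.2.2.1))
    (fun p => derBracket (derBracket p.1.1 p.2.1.1) p.2.2.1
      + derBracket p.2.1.1 (derBracket p.1.1 p.2.2.1))
    (fun ⟨x, y, z⟩ f => ⟨[(⟨_, contr_mem x.2 f⟩, y, z), (x, ⟨_, contr_mem y.2 f⟩, z),
      (x, y, ⟨_, contr_mem z.2 f⟩)], ?_⟩) (fun ⟨x, y, z⟩ => ?_) (fun ⟨x, y, z⟩ => ?_)
    (⟨x, hx⟩, ⟨y, hy⟩, ⟨z, hz⟩)
  · simp [contr_derBracket, derBracket_add x.2, derBracket_add y.2, derBracket_add_left z.2]; abel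
  · simp [contr_derBracket, contr_sub_left x.2, contr_sub_left y.2, contr_sub_left z.2,
      contr_comm (x.1.symb 0) (y.1.symb 0), contr_comm (y.1.symb 0) (z.1.symb 0),
      contr_comm (x.1.symb 0) (z.1.symb 0)]
    ring
  · simp [contr_derBracket, contr_sub_left x.2, contr_sub_left y.2, contr_sub_left z.2, mul_add,
      mul_sub, add_mul, sub_mul, mul_assoc, contr_comm (x.1.symb 0) (y.1.symb 0),
      contr_comm (y.1.symb 0) (z.1.symb 0), contr_comm (x.1.symb 0) (z.1.symb 0)]
    abel

lemma derBracket_derMul {x y z : MultiPair C S} (hx : x ∈ derMultivector C S)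
    (hy : y ∈ derMultivector C S) (hz : z ∈ derMultivector C S) :
    derBracket x (derMul y z) = derMul (derBracket x y) z + derMul y (derBracket x z) := by
  refine eq_of_contr (fun p : derMultivector C S × derMultivector C S × derMultivector C S =>
      derBracket p.1.1 (derMul p.2.1.1 p.2.2.1))
    (fun p => derMul (derBracket p.1.1 p.2.1.1) p.2.2.1
      + derMul p.2.1.1 (derBracket p.1.1 p.2.2.1))
    (fun ⟨x, y, z⟩ f => ⟨[(⟨_, contr_mem x.2 f⟩, y, z), (x, ⟨_, contr_mem y.2 f⟩, z),
      (x, y, ⟨_, contr_mem z.2 f⟩)], ?_⟩) (fun ⟨x, y, z⟩ => ?_) (fun ⟨x, y, z⟩ => ?_)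
    (⟨x, hx⟩, ⟨y, hy⟩, ⟨z, hz⟩)
  · simp [contr_derBracket, contr_derMul, derBracket_add x.2, derMul_add, add_derMul]; abel
  · simp [contr_derMul, contr_mul_left x.2]; ring
  · ext v
    simp [contr_derMul, contr_mul_left x.2, smul_sub, sub_smul, op_smul_apply x.2]
    abel

end Multi

section Scaling

open MultiPair

/-- An action of the non-zero reals on an algebra and a module. -/
structure IsScaling (h : ℝ → C →ₗ[ℝ] C) (hS : ℝ → S →ₗ[ℝ] S) : Prop where
  h_mul : ∀ t f g, h t (f * g) = h t f * h t g
  hS_smul : ∀ t (f : C) s, hS t (f • s) = h t f • hS t s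
  h_inv : ∀ t f, t ≠ 0 → h t (h t⁻¹ f) = f
  hS_inv : ∀ t s, t ≠ 0 → hS t (hS t⁻¹ s) = s

/-- The action on multivectors, twisted by the degree. -/
def tw (h : ℝ → C →ₗ[ℝ] C) (hS : ℝ → S →ₗ[ℝ] S) (t : ℝ) : MultiPair C S →ₗ[ℝ] MultiPair C S where
  toFun D := (fun m => t ^ m.card • h t (D.symb (m.map (h t⁻¹))),
    fun m => t ^ (m.card + 1) • (hS t * D.op (m.map (h t⁻¹)) * hS t⁻¹))
  map_add' _ _ := MultiPair.ext (funext fun _ => by simp; rfl) (funext fun _ => by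
    simp [mul_add, add_mul]; rfl)
  map_smul' c _ := MultiPair.ext (funext fun _ => by simp [← smul_comm c]; rfl)
    (funext fun _ => by simp [← smul_comm c]; rfl)

lemma tw_symb (t : ℝ) (D : MultiPair C S) (m : Multiset C) :
    (tw h hS t D).symb m = t ^ m.card • h t (D.symb (m.map (h t⁻¹))) := rfl

lemma tw_op (t : ℝ) (D : MultiPair C S) (m : Multiset C) :
    (tw h hS t D).op m = t ^ (m.card + 1) • (hS t * D.op (m.map (h t⁻¹)) * hS t⁻¹) := rfl

lemma contr_tw (f : C) (t : ℝ) (D : MultiPair C S) :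
    contr f (tw h hS t D) = t • tw h hS t (contr (h t⁻¹ f) D) := by
  refine MultiPair.ext (funext fun m => ?_) (funext fun m => ?_)
  · rw [contr_symb, tw_symb, symb_smul, Pi.smul_apply, tw_symb, smul_smul, Multiset.card_cons,
      Multiset.map_cons, pow_succ']; rfl
  · rw [contr_op, tw_op, op_smul, Pi.smul_apply, tw_op, smul_smul, Multiset.card_cons,
      Multiset.map_cons, pow_succ' t (m.card + 1)]; rfl

lemma IsScaling.tw_fs (K : IsScaling h hS) (f : C) (t : ℝ) (D : MultiPair C S) :
    tw h hS t (fs f D) = fs (h t f) (tw h hS t D) := by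
  refine MultiPair.ext (funext fun m => ?_) (funext fun m => ?_)
  · simp only [fs_symb, tw_symb, K.h_mul, mul_smul_comm]
  · ext v
    simp only [fs_op, tw_op, LinearMap.smul_apply, End.mul_apply, K.hS_smul,
      smul_comm (h t f)]

lemma IsScaling.tw_mem (K : IsScaling h hS) {t : ℝ} (ht : t ≠ 0) {D : MultiPair C S}
    (hD : D ∈ derMultivector C S) : tw h hS t D ∈ derMultivector C S := by
  obtain ⟨N, hN⟩ := exists_bound hD
  refine mem_of_contr (fun f g => ?_) (fun c f => ?_) (fun f g => ?_) (fun m f v => ?_)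
    ⟨N, fun m hm => ?_⟩
  · simp only [contr_tw, map_add, contr_add_left hD, smul_add]
  · simp only [contr_tw, map_smul, contr_smul_left hD, smul_comm c]
  · simp only [contr_tw, K.h_mul, contr_mul_left hD, map_add, K.tw_fs, smul_add, K.h_inv t _ ht,
      map_smul]
  · rw [contr_tw, tw_op, symb_smul, Pi.smul_apply, tw_symb]
    simp only [LinearMap.smul_apply, End.mul_apply, K.hS_smul, op_smul_apply hD, map_add,
      K.h_inv t _ ht, K.hS_inv t _ ht, smul_add, smul_smul, smul_assoc, pow_succ', smul_comm f]
  · rw [tw_symb, tw_op, (hN _ (by simpa using hm)).1, (hN _ (by simpa using hm)).2]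
    simp

lemma IsScaling.tw_derMul (K : IsScaling h hS) (t : ℝ) (D D' : MultiPair C S) :
    derMul (tw h hS t D) (tw h hS t D') = tw h hS t (derMul D D') :=
  eq_of_contr (fun p : MultiPair C S × MultiPair C S => derMul (tw h hS t p.1) (tw h hS t p.2))
    (fun p => tw h hS t (derMul p.1 p.2))
    (fun ⟨x, y⟩ f => ⟨[(t • contr (h t⁻¹ f) x, y), (x, t • contr (h t⁻¹ f) y)], by
      simp [contr_derMul, contr_tw, smul_derMul, derMul_smul]; abel⟩)
    (fun p => by simp [tw_symb, K.h_mul])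
    (fun p => by ext v; simp [tw_symb, tw_op, K.hS_smul, smul_comm _ t]) (D, D')

lemma IsScaling.tw_derBracket (K : IsScaling h hS) {t : ℝ} (ht : t ≠ 0) {D D' : MultiPair C S}
    (hD : D ∈ derMultivector C S) (hD' : D' ∈ derMultivector C S) :
    derBracket (tw h hS t D) (tw h hS t D') = t • tw h hS t (derBracket D D') := by
  have hi f : h t⁻¹ (h t f) = f := by simpa using K.h_inv t⁻¹ f (inv_ne_zero ht)
  have hi' f : hS t⁻¹ (hS t f) = f := by simpa using K.hS_inv t⁻¹ f (inv_ne_zero ht)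
  refine eq_of_contr (fun p : derMultivector C S × derMultivector C S =>
      derBracket (tw h hS t p.1.1) (tw h hS t p.2.1))
    (fun p => t • tw h hS t (derBracket p.1.1 p.2.1))
    (fun ⟨x, y⟩ f => ⟨[(t • ⟨_, contr_mem x.2 (h t⁻¹ f)⟩, y), (x, t • ⟨_, contr_mem y.2 (h t⁻¹ f)⟩)],
      ?_⟩) (fun p => ?_) (fun p => ?_) (⟨D, hD⟩, ⟨D', hD'⟩)
  · simp [contr_derBracket, contr_tw, derBracket_smul_left (K.tw_mem ht y.2),
      derBracket_smul (K.tw_mem ht x.2), derBracket_smul_left y.2, derBracket_smul x.2, smul_add]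
    abel
  · simp [contr_tw, tw_symb, hi, smul_sub]
  · ext v
    simp [contr_tw, tw_symb, tw_op, hi, hi', smul_sub, smul_add]

lemma IsScaling.derMul_wt (K : IsScaling h hS) {v w : ℤ} {D D' : MultiPair C S}
    (hD : D ∈ wt (tw h hS) v) (hD' : D' ∈ wt (tw h hS) w) : derMul D D' ∈ wt (tw h hS) (v + w) :=
  fun t ht => by
    rw [← K.tw_derMul, hD t ht, hD' t ht, smul_derMul, derMul_smul, smul_smul, zpow_add₀ ht]

lemma IsScaling.derBracket_wt (K : IsScaling h hS) {u v w : ℤ} (hu : u + 1 = v + w)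
    {D D' : MultiPair C S} (hD : D ∈ derMultivector C S) (hD' : D' ∈ derMultivector C S)
    (h1 : D ∈ wt (tw h hS) v) (h2 : D' ∈ wt (tw h hS) w) : derBracket D D' ∈ wt (tw h hS) u :=
  fun t ht => by
    have := K.tw_derBracket ht hD hD'
    rw [h1 t ht, h2 t ht, derBracket_smul_left (Submodule.smul_mem _ _ hD'),
      derBracket_smul hD, smul_smul, ← zpow_add₀ ht, ← hu,
      zpow_add₀ ht, zpow_one, mul_comm, mul_smul] at this
    exact (smul_right_injective _ ht this).symm

lemma contr_wt {u v w : ℤ} (hu : u + 1 = v + w) {f : C} {D : MultiPair C S}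
    (hD : D ∈ derMultivector C S) (hf : f ∈ wt h v) (h1 : D ∈ wt (tw h hS) w) :
    contr f D ∈ wt (tw h hS) u := fun t ht => by
  have := contr_tw (hS := hS) f t D (h := h)
  rw [h1 t ht, hf _ (inv_ne_zero ht), contr_smul_left hD, map_smul, map_smul, smul_smul] at this
  have e : t * (t⁻¹) ^ v ≠ 0 := mul_ne_zero ht (zpow_ne_zero _ (inv_ne_zero ht))
  refine smul_right_injective _ e ?_
  change (t * (t⁻¹) ^ v) • _ = (t * (t⁻¹) ^ v) • t ^ u • contr f D
  rw [← this, smul_smul]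
  congr 1
  have hw : w = u + 1 - v := by omega
  rw [hw, zpow_sub₀ ht, zpow_add₀ ht, zpow_one, inv_zpow]
  ring

lemma isScaling_id : IsScaling (C := C) (S := S) (fun _ => LinearMap.id) (fun _ => LinearMap.id) :=
  ⟨fun _ _ _ => rfl, fun _ _ _ => rfl, fun _ _ _ => rfl, fun _ _ _ => rfl⟩

variable (C S) in
/-- The grading operators. -/
abbrev gr : ℝ → MultiPair C S →ₗ[ℝ] MultiPair C S :=
  tw (fun _ => LinearMap.id) (fun _ => LinearMap.id)

lemma mem_derMultivectorDeg {k : ℕ} {D : MultiPair C S} :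
    D ∈ derMultivectorDeg C S k ↔ D ∈ derMultivector C S ∧ D ∈ wt (gr C S) k := by
  constructor
  · rintro ⟨h0, h1, h2⟩
    refine ⟨h0, fun t ht => MultiPair.ext (funext fun m => ?_) (funext fun m => ?_)⟩
    · rw [tw_symb, symb_smul, Pi.smul_apply]
      by_cases hm : m.card = k
      · simp [hm]
      · simp [h1 m hm]
    · rw [tw_op, op_smul, Pi.smul_apply]
      by_cases hm : m.card + 1 = k
      · ext v; simp [← hm, zpow_add₀ ht, pow_succ]
      · ext v; simp [h2 m hm]
  · rintro ⟨h0, h1⟩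
    have h2 := h1 2 two_ne_zero
    refine ⟨h0, fun m hm => ?_, fun m hm => ?_⟩
    · have := congrArg (·.symb m) h2
      simp only [tw_symb, symb_smul, Pi.smul_apply, LinearMap.id_apply, Multiset.map_id',
        zpow_natCast] at this
      rw [← sub_eq_zero, ← sub_smul, smul_eq_zero, sub_eq_zero] at this
      exact this.resolve_left fun e => hm (Nat.pow_right_injective le_rfl (by exact_mod_cast e))
    · have := congrArg (·.op m) h2
      simp only [tw_op, op_smul, Pi.smul_apply, Multiset.map_id', zpow_natCast, LinearMap.id_coe,
        id] at this
      have this' : (2 : ℝ) ^ (m.card + 1) • D.op m = (2 : ℝ) ^ k • D.op m := this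
      rw [← sub_eq_zero, ← sub_smul, smul_eq_zero, sub_eq_zero] at this'
      exact this'.resolve_left fun e => hm (Nat.pow_right_injective le_rfl (by exact_mod_cast e))

/-- The component of degree `k`. -/
def degPart (k : ℕ) (D : MultiPair C S) : MultiPair C S :=
  (fun m => if m.card = k then D.symb m else 0, fun m => if m.card + 1 = k then D.op m else 0)

lemma degPart_symb (k : ℕ) (D : MultiPair C S) (m : Multiset C) :
    (degPart k D).symb m = if m.card = k then D.symb m else 0 := rfl

lemma degPart_op (k : ℕ) (D : MultiPair C S) (m : Multiset C) :
    (degPart k D).op m = if m.card + 1 = k then D.op m else 0 := rfl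

lemma degPart_mem {D : MultiPair C S} (hD : D ∈ derMultivector C S) (k : ℕ) :
    degPart k D ∈ derMultivectorDeg C S k := by
  obtain ⟨⟨h1, h2, h3, -⟩, k1, k2, k3, k4, -⟩ := hD
  refine ⟨⟨⟨fun m f g => ?_, fun m c f => ?_, fun m f g => ?_, k, fun m hm => ?_⟩,
    fun m f g v => ?_, fun m c f v => ?_, fun m f g v => ?_, fun m f v => ?_, k, fun m hm => ?_⟩,
    fun m hm => ?_, fun m hm => ?_⟩
  all_goals
    simp only [degPart_symb, degPart_op, Multiset.card_cons, h1, h2, h3]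
    split_ifs <;> first | omega | simp [k1, k2, k3, k4]

lemma degPart_wt {w : ℤ} {D : MultiPair C S} (hD : D ∈ wt (tw h hS) w) (k : ℕ) :
    degPart k D ∈ wt (tw h hS) w := fun t ht => by
  refine MultiPair.ext (funext fun m => ?_) (funext fun m => ?_)
  · have := congrArg (·.symb m) (hD t ht)
    simp only [tw_symb, symb_smul, Pi.smul_apply, degPart_symb, Multiset.card_map] at this ⊢
    split_ifs <;> simp [this]
  · have := congrArg (·.op m) (hD t ht)
    simp only [tw_op, op_smul, Pi.smul_apply, degPart_op, Multiset.card_map] at this ⊢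
    split_ifs <;> simp [this]

lemma exists_sum_degPart {D : MultiPair C S} (hD : D ∈ derMultivector C S) :
    ∃ N, ∑ k ∈ Finset.range N, degPart k D = D := by
  obtain ⟨N, hN⟩ := exists_bound hD
  have hs (n : ℕ) : ∑ k ∈ Finset.range n, degPart k D
      = (fun m => ∑ k ∈ Finset.range n, (degPart k D).symb m,
        fun m => ∑ k ∈ Finset.range n, (degPart k D).op m) := by
    induction n with
    | zero => rfl
    | succ n ih => simp only [Finset.sum_range_succ, ih]; rfl
  refine ⟨N + 2, (hs _).trans (MultiPair.ext (funext fun m => ?_) (funext fun m => ?_))⟩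
  · change ∑ k ∈ .range (N + 2), (degPart k D).symb m = _
    simp only [degPart_symb, Finset.sum_ite_eq, Finset.mem_range, ite_eq_left_iff]
    exact fun hm => (hN m (by omega)).1.symm
  · change ∑ k ∈ .range (N + 2), (degPart k D).op m = _
    simp only [degPart_op, Finset.sum_ite_eq, Finset.mem_range, ite_eq_left_iff]
    exact fun hm => (hN m (by omega)).2.symm

end Scaling

open MultiPair

section Basic

variable (S) in
/-- A function as a multivector of degree `0`. -/
def cst : C →ₗ[ℝ] MultiPair C S where
  toFun f := (fun m => if m.card = 0 then f else 0, 0)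
  map_add' _ _ := MultiPair.ext (funext fun _ => ite_add_zero)
    (add_zero (0 : Multiset C → End ℝ S)).symm
  map_smul' c f := MultiPair.ext (funext fun _ => (smul_ite_zero _ c f).symm)
    (smul_zero (A := Multiset C → End ℝ S) c).symm

lemma cst_symb (f : C) (m : Multiset C) : (cst S f).symb m = if m.card = 0 then f else 0 := rfl
@[simp] lemma cst_symb_zero (f : C) : (cst S f).symb 0 = f := rfl
@[simp] lemma cst_op (f : C) (m : Multiset C) : (cst S f).op m = 0 := rfl

@[simp] lemma contr_cst (f g : C) : contr f (cst S g) = 0 :=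
  MultiPair.ext (funext fun m => by simp [cst_symb]) (funext fun m => by simp)

lemma fs_cst (f g : C) : fs f (cst S g) = cst S (f * g) :=
  MultiPair.ext (funext fun m => by simp [cst_symb]) (funext fun m => by simp)

variable (C S) in
/-- A derivation as a multivector of degree `1`. -/
def der1 : DerPair C S →ₗ[ℝ] MultiPair C S where
  toFun P := (fun m => if m.card = 1 then P.symb m.sum else 0,
    fun m => if m.card = 0 then P.op else 0)
  map_add' _ _ := MultiPair.ext (funext fun _ => ite_add_zero) (funext fun _ => ite_add_zero)
  map_smul' c P := MultiPair.ext (funext fun _ => (smul_ite_zero _ c (P.symb _)).symm)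
    (funext fun _ => (smul_ite_zero _ c P.op).symm)

lemma der1_symb (P : DerPair C S) (m : Multiset C) :
    (der1 C S P).symb m = if m.card = 1 then P.symb m.sum else 0 := rfl
lemma der1_op (P : DerPair C S) (m : Multiset C) :
    (der1 C S P).op m = if m.card = 0 then P.op else 0 := rfl
@[simp] lemma der1_symb_zero (P : DerPair C S) : (der1 C S P).symb 0 = 0 := rfl
@[simp] lemma der1_op_zero (P : DerPair C S) : (der1 C S P).op 0 = P.op := rfl

@[simp] lemma contr_der1 (f : C) (P : DerPair C S) : contr f (der1 C S P) = cst S (P.symb f) :=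
  MultiPair.ext (funext fun m => by
    simp only [contr_symb, der1_symb, cst_symb, Multiset.card_cons, Nat.add_eq_right]
    split_ifs with h
    · simp [Multiset.card_eq_zero.1 h]
    · rfl) (funext fun m => by
    rw [contr_op, der1_op, cst_op, Multiset.card_cons, if_neg (Nat.succ_ne_zero _)])

lemma cst_mem (f : C) : cst S f ∈ derMultivector C S :=
  mem_of_contr (by simp) (by simp) (by simp) (by simp)
    ⟨0, fun m hm => ⟨by rw [cst_symb, if_neg (by omega)], rfl⟩⟩

lemma der1_mem {P : DerPair C S} (hP : P ∈ modDer C S) : der1 C S P ∈ derMultivector C S :=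
  mem_of_contr (by simp) (fun c f => by rw [contr_der1, contr_der1, Derivation.map_smul, map_smul])
    (fun f g => by
      rw [contr_der1, contr_der1, contr_der1, fs_cst, fs_cst, ← map_add, Derivation.leibniz]; rfl)
    (fun m f v => by
      rw [contr_der1, cst_symb, der1_op]
      split_ifs with h
      · exact hP f v
      · simp)
    ⟨1, fun m hm => ⟨by rw [der1_symb, if_neg (by omega)], by rw [der1_op, if_neg (by omega)]⟩⟩

lemma cst_wt {w : ℤ} {f : C} (hf : f ∈ wt h w) :
    cst S f ∈ wt (tw h hS) w := fun t ht => by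
  refine ext_contr (fun g => by rw [contr_tw, map_smul, contr_cst, contr_cst]; simp) ?_ ?_
  · simp [tw_symb, hf t ht]
  · simp [tw_op]

lemma der1_wt {u w : ℤ} (hu : u + 1 = w)
    {P : DerPair C S}
    (h1 : ∀ t f, t ≠ 0 → h t (P.symb (h t⁻¹ f)) = t ^ u • P.symb f)
    (h2 : ∀ t s, t ≠ 0 → hS t (P.op (hS t⁻¹ s)) = t ^ u • P.op s) :
    der1 C S P ∈ wt (tw h hS) w := fun t ht => by
  refine ext_contr (fun g => ?_) ?_ ?_
  · have e : ∀ a : C, tw h hS t (cst S a) = cst S (h t a) := fun a => by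
      refine ext_contr (fun g => by rw [contr_tw, contr_cst, contr_cst]; simp) ?_ ?_
      · simp [tw_symb]
      · simp [tw_op]
    rw [contr_tw, map_smul, contr_der1, contr_der1, e, h1 t g ht, map_smul, smul_smul, ← hu,
      zpow_add₀ ht, zpow_one, mul_comm]
  · simp [tw_symb]
  · ext v
    simp [tw_op, h2 t v ht, smul_smul, ← hu, zpow_add₀ ht, mul_comm]

lemma derMul_cst (f : C) (D : MultiPair C S) : derMul (cst S f) D = fs f D :=
  eq_of_contr (derMul (cst S f)) (fs f) (fun D g => ⟨[contr g D], by
    simp [contr_derMul, contr_fs, show derMul 0 D = 0 from map_zero (derMulL.flip D)]⟩)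
    (fun D => by simp) (fun D => by simp) D

lemma derBracket_cst {D : MultiPair C S} (hD : D ∈ derMultivector C S) (f : C) :
    derBracket D (cst S f) = contr f D :=
  eq_of_contr (fun D : derMultivector C S => derBracket D.1 (cst S f)) (fun D => contr f D.1)
    (fun D g => ⟨[⟨_, contr_mem D.2 g⟩], by
      simp [contr_derBracket, contr_comm g f,
        show derBracket D.1 0 = 0 by simpa using derBracket_smul D.2 0 0]⟩)
    (fun D => by simp) (fun D => by simp) ⟨D, hD⟩

lemma derBracket_cst_left {D : MultiPair C S} (hD : D ∈ derMultivector C S) (f : C) :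
    derBracket (cst S f) D = - contr f D := by rw [derBracket_anti, derBracket_cst hD]

lemma fs_der1 (f : C) (P : DerPair C S) : fs f (der1 C S P) = der1 C S (DerPair.fsmul f P) :=
  ext_contr (fun g => by rw [contr_fs, contr_der1, contr_der1, fs_cst]; rfl)
    (by simp) rfl

lemma derBracket_der1 {P Q : DerPair C S} (hP : P ∈ modDer C S) (hQ : Q ∈ modDer C S) :
    derBracket (der1 C S P) (der1 C S Q) = der1 C S (DerPair.bracket P Q) :=
  ext_contr (fun g => by
      rw [contr_derBracket, contr_der1, contr_der1, contr_der1, derBracket_cst (der1_mem hP),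
        derBracket_cst_left (der1_mem hQ), contr_der1, contr_der1, neg_add_eq_sub, ← map_sub]
      congr 1)
    (by simp [contr_zero_left (der1_mem hP), contr_zero_left (der1_mem hQ)])
    (by simp [contr_zero_left (der1_mem hP), contr_zero_left (der1_mem hQ)]; rfl)

lemma exists_contr_derivation {D : MultiPair C S} (hD : D ∈ derMultivector C S)
    (m : Multiset C) : ∃ X : Derivation ℝ C C, ∀ f, X f = D.symb (f ::ₘ m) :=
  ⟨Derivation.mk'
    { toFun := fun f => D.symb (f ::ₘ m)
      map_add' := hD.1.1 m
      map_smul' := hD.1.2.1 m } fun f g => hD.1.2.2.1 m f g, fun _ => rfl⟩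

lemma fsmul_mem {P : DerPair C S} (hP : P ∈ modDer C S) (f : C) :
    DerPair.fsmul f P ∈ modDer C S := fun g v => by
  change f • P.op (g • v) = g • f • P.op v + (f * P.symb g) • v
  rw [hP, smul_add, smul_comm f g, smul_smul f]

lemma bracket_mem {P Q : DerPair C S} (hP : P ∈ modDer C S) (hQ : Q ∈ modDer C S) :
    DerPair.bracket P Q ∈ modDer C S := fun g v => by
  change P.op (Q.op (g • v)) - Q.op (P.op (g • v))
    = g • (P.op (Q.op v) - Q.op (P.op v)) + (⁅P.symb, Q.symb⁆ : Derivation ℝ C C) g • v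
  rw [hP, hQ, map_add, map_add, hP, hP, hQ, hQ, commutator_apply, smul_sub, sub_smul]
  abel

end Basic

section Lifts

variable (Λ) in
/-- The action of derivations of a bundle on its top exterior power. -/
structure TopAction (b : DualPair M R V W) where
  top : modDer R W →ₗ[ℝ] modDer R Λ
  top_symb : ∀ δ, (top δ).1.symb = δ.1.symb
  top_bracket : ∀ δ₁ δ₂ δ₃ : modDer R W, δ₃.1 = DerPair.bracket δ₁.1 δ₂.1 →
    (top δ₃).1 = DerPair.bracket (top δ₁).1 (top δ₂).1
  top_smul : ∀ (g : R) (δ δ' : modDer R W), δ'.1 = DerPair.fsmul g δ.1 →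
    (top δ').1 = DerPair.fsmul g (top δ).1
  top_rank_one : ∀ (φ : V) (e : W) (δ : modDer R W), δ.1.symb = 0 →
    (∀ e', δ.1.op e' = b.pair φ e' • e) → ∀ U, (top δ).1.op U = b.pair φ e • U

lemma TopAction.symb_eq {b : DualPair M R V W} (a : TopAction Λ b) (z : modDer R W) :
    z.1.symb = (a.top z).1.symb := (a.top_symb z).symm

lemma TopAction.dual_symb_eq {b : DualPair M R V W} (a : TopAction Λ b) (z : modDer R W) :
    (b.dual z).1.symb = (a.top z).1.symb := by rw [a.top_symb, b.dual_symb]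

variable {ℓ : V →ₗ[ℝ] C} (H : LinModel ev ρ h ℓ) (K : SecModel ev ρ h ρL hS)

lemma SecModel.isScaling (K : SecModel ev ρ h ρL hS) : IsScaling h hS :=
  ⟨K.h_mul, K.hS_smul, fun _ f ht => K.h_inv ht f, fun _ s ht => K.hS_inv ht s⟩

lemma SecModel.modDer_ext' (K : SecModel ev ρ h ρL hS) {D D' : modDer C S}
    (hs : D.1.symb = D'.1.symb) (e : ∀ U, D.1.op (ρL U) = D'.1.op (ρL U)) : D = D' :=
  Subtype.ext (K.modDer_ext D.2 D'.2 hs e)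

include H K

omit H in
lemma exists_linear_lift {Z : Type*} [AddCommGroup Z] [Module ℝ Z] (P : Z →ₗ[ℝ] Derivation ℝ C C)
    (T : Z →ₗ[ℝ] Λ →ₗ[ℝ] S) (hT : ∀ z g U, T z (g • U) = ρ g • T z U + P z (ρ g) • ρL U) :
    ∃ L : Z →ₗ[ℝ] modDer C S, ∀ z, (L z).1.symb = P z ∧ ∀ U, (L z).1.op (ρL U) = T z U := by
  choose D h0 h1 h2 using fun z => K.exists_modDer (P z) (T z) (hT z)
  exact ⟨{ toFun := fun z => ⟨D z, h0 z⟩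
           map_add' := fun z z' => K.modDer_ext' (by simp [h1]) fun U => by simp [h2]
           map_smul' := fun c z => K.modDer_ext' (by simp [h1]) fun U => by simp [h2] },
    fun z => ⟨h1 z, h2 z⟩⟩

/-- The vertical lift of a section, acting on sections of the pull-back of a line bundle. -/
def secVl : (V →ₗ[R] R) →ₗ[ℝ] modDer C S := (exists_linear_lift K H.vl 0 (by simp)).choose

@[simp] lemma secVl_symb (a : V →ₗ[R] R) : (secVl H K a).1.symb = H.vl a :=
  ((exists_linear_lift K H.vl 0 (by simp)).choose_spec a).1

@[simp] lemma secVl_op (a : V →ₗ[R] R) (U : Λ) : (secVl H K a).1.op (ρL U) = 0 :=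
  ((exists_linear_lift K H.vl 0 (by simp)).choose_spec a).2 U

section

variable {Z : Type*} [AddCommGroup Z] [Module ℝ Z] (d : Z →ₗ[ℝ] modDer R V)
    (τ : Z →ₗ[ℝ] modDer R Λ) (e : ∀ z, (d z).1.symb = (τ z).1.symb)

include e in
lemma exists_secLin : ∃ L : Z →ₗ[ℝ] modDer C S, ∀ z, (L z).1.symb = H.lin (d z) ∧
    ∀ U, (L z).1.op (ρL U) = ρL ((τ z).1.op U) :=
  exists_linear_lift K (H.lin ∘ₗ d)
    (LinearMap.compRight ℝ ρL ∘ₗ LinearMap.snd ℝ _ _ ∘ₗ (modDer R Λ).subtype ∘ₗ τ) fun z g U => by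
    change ρL ((τ z).1.op (g • U)) = ρ g • ρL ((τ z).1.op U) + H.lin (d z) (ρ g) • ρL U
    rw [(τ z).2, map_add, K.ρL_smul, K.ρL_smul, H.lin_ρ, e]

/-- The linear vector field given by a derivation, acting on sections of the pull-back of a line
bundle. -/
def secLin : Z →ₗ[ℝ] modDer C S := (exists_secLin H K d τ e).choose

@[simp] lemma secLin_symb (z : Z) : (secLin H K d τ e z).1.symb = H.lin (d z) :=
  ((exists_secLin H K d τ e).choose_spec z).1

@[simp] lemma secLin_op (z : Z) (U : Λ) :
    (secLin H K d τ e z).1.op (ρL U) = ρL ((τ z).1.op U) :=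
  ((exists_secLin H K d τ e).choose_spec z).2 U

lemma secLin_wt {t : ℝ} (ht : t ≠ 0) (z : Z) :
    (∀ f, h t ((secLin H K d τ e z).1.symb (h t⁻¹ f))
      = t ^ (0 : ℤ) • (secLin H K d τ e z).1.symb f) ∧
    ∀ s, hS t ((secLin H K d τ e z).1.op (hS t⁻¹ s))
      = t ^ (0 : ℤ) • (secLin H K d τ e z).1.op s := by
  have h1 : ∀ f, h t ((secLin H K d τ e z).1.symb (h t⁻¹ f))
      = t ^ (0 : ℤ) • (secLin H K d τ e z).1.symb f := fun f => by
    rw [secLin_symb]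
    exact congrArg (fun T : End ℝ C => T f) (H.lin_wt (d z) t ht)
  exact ⟨h1, K.modDer_weight (secLin H K d τ e z).2 ht h1
    (fun U => by rw [secLin_op]; exact K.ρL_mem _)⟩

end

lemma secVl_wt {t : ℝ} (ht : t ≠ 0) (a : V →ₗ[R] R) :
    (∀ f, h t ((secVl H K a).1.symb (h t⁻¹ f)) = t ^ (-1 : ℤ) • (secVl H K a).1.symb f) ∧
    ∀ s, hS t ((secVl H K a).1.op (hS t⁻¹ s)) = t ^ (-1 : ℤ) • (secVl H K a).1.op s := by
  have h1 : ∀ f, h t ((secVl H K a).1.symb (h t⁻¹ f))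
      = t ^ (-1 : ℤ) • (secVl H K a).1.symb f := fun f => by
    rw [secVl_symb]
    exact congrArg (fun T : End ℝ C => T f) (H.vl_wt a t ht)
  exact ⟨h1, K.modDer_weight (secVl H K a).2 ht h1
    (fun U => by rw [secVl_op]; exact zero_mem _)⟩

/-- A family of multivectors closed under contractions with functions of weight `0` and `1`, whose
components without arguments vanish on sections on the base, is zero. -/
lemma multi_ext (T : MultiPair C S → Prop) (hT : ∀ D, T D → D ∈ derMultivector C S)
    (hρ : ∀ D, T D → ∀ g, T (contr (ρ g) D)) (hℓ : ∀ D, T D → ∀ φ, T (contr (ℓ φ) D))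
    (h0 : ∀ D, T D → D.symb 0 = 0) (h1 : ∀ D, T D → ∀ U, D.op 0 (ρL U) = 0)
    (D : MultiPair C S) (hD : T D) : D = 0 := by
  have hs : ∀ m, ∀ D, T D → D.symb m = 0 := by
    intro m
    induction m using Multiset.induction_on with
    | empty => exact h0
    | cons f m ih =>
      intro D hD
      obtain ⟨X, hX⟩ := exists_contr_derivation (hT D hD) m
      have : X = 0 := H.der_ext_ℓ (fun g => (hX _).trans (ih _ (hρ D hD g)))
        fun φ => (hX _).trans (ih _ (hℓ D hD φ))
      rw [← hX, this]; rfl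
  have hlin : ∀ D, T D → ∀ m f v, D.op m (f • v) = f • D.op m v := fun D hD m f v => by
    rw [op_smul_apply (hT D hD), contr_symb, hs _ D hD, zero_smul, add_zero]
  have ho : ∀ m, ∀ D, T D → D.op m = 0 := by
    intro m
    induction m using Multiset.induction_on with
    | empty =>
      intro D hD
      have := K.linear_ext (T :=
        { toFun := D.op 0, map_add' := map_add _, map_smul' := fun f s => hlin D hD 0 f s })
        (h1 D hD)
      exact LinearMap.ext fun s => congrArg (fun T : S →ₗ[C] S => T s) this
    | cons f m ih =>
      intro D hD
      have hm := hT D hD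
      ext v
      let X : Derivation ℝ C S := Derivation.mk'
        { toFun := fun f => (contr f D).op m v
          map_add' := fun f g => by rw [contr_add_left hm]; rfl
          map_smul' := fun c f => by rw [contr_smul_left hm]; rfl } fun f g => by
        change (contr (f * g) D).op m v = f • (contr g D).op m v + g • (contr f D).op m v
        rw [contr_mul_left hm]; rfl
      have : X = 0 := K.der_extS
        (fun g => by change (contr (ρ g) D).op m v = 0; rw [ih _ (hρ D hD g)]; rfl)
        fun u hu => by
          obtain ⟨φ, rfl⟩ := H.wt_one u hu
          change (contr (ℓ φ) D).op m v = 0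
          rw [ih _ (hℓ D hD φ)]; rfl
      exact congrArg (fun X : Derivation ℝ C S => X f) this
  exact MultiPair.ext (funext fun m => hs m D hD) (funext fun m => ho m D hD)

lemma eq_zero_of_contr_eq_zero {D : MultiPair C S} (hD : D ∈ derMultivector C S)
    (hρ : ∀ g, contr (ρ g) D = 0) (hℓ : ∀ φ, contr (ℓ φ) D = 0) (h0 : D.symb 0 = 0)
    (h1 : ∀ U, D.op 0 (ρL U) = 0) : D = 0 := by
  refine multi_ext H K (fun D' => D' = D ∨ D' = 0) ?_ ?_ ?_ ?_ ?_ D (.inl rfl) <;>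
    rintro _ (rfl | rfl)
  exacts [hD, zero_mem _, fun g => .inr (hρ g), fun _ => .inr (map_zero _), fun φ => .inr (hℓ φ),
    fun _ => .inr (map_zero _), h0, rfl, h1, fun _ => rfl]

lemma symb_zero_wt {w : ℤ} {D : MultiPair C S} (hD : D ∈ wt (tw h hS) w) :
    D.symb 0 ∈ wt h w := fun t ht => by
  have := congrArg (·.symb 0) (hD t ht)
  simpa [tw_symb] using this

lemma op_zero_wt {w : ℤ} {D : MultiPair C S} (hD : D ∈ wt (tw h hS) w) (U : Λ) :
    D.op 0 (ρL U) ∈ wt hS (w - 1) := fun t ht => by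
  have := congrArg (·.op 0 (ρL U)) (hD t ht)
  simp only [tw_op, Multiset.card_zero, zero_add, pow_one, LinearMap.smul_apply,
    End.mul_apply, K.hS_ρL, op_smul, Pi.smul_apply, Multiset.map_zero] at this
  refine smul_right_injective _ ht ?_
  change t • _ = t • t ^ (w - 1) • D.op 0 (ρL U)
  rw [this, smul_smul, ← zpow_one_add₀ ht, add_sub_cancel]

lemma multi_wt_neg {w : ℤ} (hw : w < 0) {D : MultiPair C S} (hD : D ∈ derMultivector C S)
    (hD' : D ∈ wt (tw h hS) w) : D = 0 :=
  multi_ext H K (fun D => D ∈ derMultivector C S ∧ ∃ w : ℤ, w < 0 ∧ D ∈ wt (tw h hS) w)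
    (fun _ h => h.1)
    (fun D ⟨h1, w, h2, h3⟩ g => ⟨contr_mem h1 _, w - 1, by omega,
      contr_wt (by omega) h1 (H.ρ_mem g) h3⟩)
    (fun D ⟨h1, w, h2, h3⟩ φ => ⟨contr_mem h1 _, w, by omega,
      contr_wt (by omega) h1 (H.ℓ_mem φ) h3⟩)
    (fun D ⟨h1, w, h2, h3⟩ => H.wt_neg w h2 _ (symb_zero_wt H K h3))
    (fun D ⟨h1, w, h2, h3⟩ U => K.wtS_neg (by omega) (op_zero_wt H K h3 U)) D ⟨hD, w, hw, hD'⟩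

lemma fs_sep {χ : M → R} (hχ : ∀ x, ev x (χ x) = 1) {D D' : MultiPair C S}
    (e : ∀ x, fs (ρ (χ x)) D = fs (ρ (χ x)) D') : D = D' :=
  MultiPair.ext (funext fun m => H.sep_eq hχ fun x =>
      congrArg (·.symb m) (e x))
    (funext fun m => LinearMap.ext fun s => K.sepS_eq hχ fun x =>
      congrArg (·.op m s) (e x))

lemma fs_glue {χ : M → R} (hχ : ∀ x, ev x (χ x) = 1) {k : ℕ} {w : ℤ} (a : M → MultiPair C S)
    (ha : ∀ x, a x ∈ derMultivectorDeg C S k ∧ a x ∈ wt (tw h hS) w)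
    (e : ∀ x y, fs (ρ (χ y)) (a x) = fs (ρ (χ x)) (a y)) :
    ∃ D, (D ∈ derMultivectorDeg C S k ∧ D ∈ wt (tw h hS) w) ∧ ∀ x, fs (ρ (χ x)) D = a x := by
  choose P hP using fun m => H.glue χ hχ (fun x => (a x).symb m) fun x y =>
    congrArg (·.symb m) (e x y)
  choose T hT using fun m s => K.glueS χ hχ (fun x => (a x).op m s) fun x y =>
    congrArg (·.op m s) (e x y)
  let D : MultiPair C S := (P, fun m =>
    { toFun := T m
      map_add' := fun s s' => K.sepS_eq hχ fun x => by rw [smul_add, hT, hT, hT, map_add]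
      map_smul' := fun c s => K.sepS_eq hχ fun x => by
        rw [RingHom.id_apply, smul_comm, hT, hT, map_smul] })
  have hD : ∀ x, fs (ρ (χ x)) D = a x := fun x =>
    MultiPair.ext (funext fun m => hP m x) (funext fun m => LinearMap.ext fun s => hT m s x)
  have hc : ∀ x f, fs (ρ (χ x)) (contr f D) = contr f (a x) := fun x f => by rw [← hD]; rfl
  have h0 : ∀ m, m.card ≠ k → D.symb m = 0 := fun m hm => H.sep_eq hχ fun x => by
    rw [← fs_symb, hD, (ha x).1.2.1 m hm, mul_zero]
  have h1 : ∀ m, m.card + 1 ≠ k → D.op m = 0 := fun m hm => LinearMap.ext fun s =>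
    K.sepS_eq hχ fun x => by
      rw [← LinearMap.smul_apply, ← fs_op, hD, (ha x).1.2.2 m hm]; simp
  refine ⟨D, ⟨⟨mem_of_contr (fun f g => ?_) (fun c f => ?_) (fun f g => ?_) (fun m f v => ?_)
    ⟨k, fun m hm => ⟨h0 m (by omega), h1 m (by omega)⟩⟩, h0, h1⟩, fun t ht => ?_⟩, hD⟩
  · refine fs_sep H K hχ fun x => ?_
    rw [map_add, hc, hc, hc, contr_add_left (ha x).1.1]
  · refine fs_sep H K hχ fun x => ?_
    rw [map_smul, hc, hc, contr_smul_left (ha x).1.1]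
  · refine fs_sep H K hχ fun x => ?_
    have ef : ∀ (f g : C) (X : MultiPair C S), fs f (fs g X) = fs g (fs f X) := fun f g X =>
      MultiPair.ext (funext fun m => mul_left_comm _ _ _)
        (funext fun m => smul_comm (M := C) (N := C) f g (X.op m))
    rw [map_add, hc, ef, hc, ef, hc, contr_mul_left (ha x).1.1]
  · refine K.sepS_eq hχ fun x => ?_
    have e1 : ∀ s, ρ (χ x) • D.op m s = (a x).op m s := fun s => by rw [← hD]; rfl
    have e2 : ρ (χ x) * (contr f D).symb m = (contr f (a x)).symb m := by rw [← hc]; rfl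
    rw [smul_add, smul_comm _ f, e1, e1, smul_smul, e2, op_smul_apply (ha x).1.1]
  · refine fs_sep H K hχ fun x => ?_
    have := K.isScaling.tw_fs (ρ (χ x)) t D
    rw [H.h_ρ, hD, (ha x).2 t ht] at this
    rw [← this, map_smul, hD]

end Lifts

open MultiPair

section MultiModel

/-- The bracket of multivectors in subspaces. -/
def brT (T T' T'' : Submodule ℝ (MultiPair C S)) (hT : T ≤ derMultivector C S)
    (hT' : T' ≤ derMultivector C S) (hB : ∀ x ∈ T, ∀ y ∈ T', derBracket x y ∈ T'') :
    T →ₗ[ℝ] T' →ₗ[ℝ] T'' :=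
  LinearMap.mk₂ ℝ (fun D D' => ⟨derBracket D.1 D'.1, hB _ D.2 _ D'.2⟩)
    (fun x y z => Subtype.ext (derBracket_add_left (hT' z.2) x.1 y.1))
    (fun c x y => Subtype.ext (derBracket_smul_left (hT' y.2) c x.1))
    (fun x y z => Subtype.ext (derBracket_add (hT x.2) y.1 z.1))
    (fun c x y => Subtype.ext (derBracket_smul (hT x.2) c y.1))

lemma derMultivectorDeg_derMul {p q : ℕ} {D D' : MultiPair C S}
    (h : D ∈ derMultivectorDeg C S p) (h' : D' ∈ derMultivectorDeg C S q) :
    derMul D D' ∈ derMultivectorDeg C S (p + q) := by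
  rw [mem_derMultivectorDeg] at *
  exact ⟨derMul_mem h.1 h'.1, by rw [Nat.cast_add]; exact isScaling_id.derMul_wt h.2 h'.2⟩

lemma derMultivectorDeg_derBracket {n p q : ℕ} (hn : n + 1 = p + q) {D D' : MultiPair C S}
    (h : D ∈ derMultivectorDeg C S p) (h' : D' ∈ derMultivectorDeg C S q) :
    derBracket D D' ∈ derMultivectorDeg C S n := by
  rw [mem_derMultivectorDeg] at *
  exact ⟨derBracket_mem h.1 h'.1, isScaling_id.derBracket_wt (by omega) h.1 h'.1 h.2 h'.2⟩

lemma cst_deg (f : C) : cst S f ∈ derMultivectorDeg C S 0 :=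
  ⟨cst_mem f, fun _ hm => if_neg hm, fun _ _ => rfl⟩

lemma der1_deg {P : DerPair C S} (hP : P ∈ modDer C S) : der1 C S P ∈ derMultivectorDeg C S 1 :=
  ⟨der1_mem hP, fun m hm => if_neg hm, fun m hm => if_neg fun e => hm (by omega)⟩

lemma eq_cst {D : MultiPair C S} (h : D ∈ derMultivectorDeg C S 0) : D = cst S (D.symb 0) :=
  MultiPair.ext (funext fun m => by
    rw [cst_symb]
    split_ifs with hm
    · rw [Multiset.card_eq_zero.1 hm]
    · exact h.2.1 m hm) (funext fun m => h.2.2 m (by omega))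

variable {ℓ : V →ₗ[ℝ] C}

variable (C S) in
/-- The identity derivation. -/
def unitDer : modDer C S := ⟨(0, LinearMap.id), fun f v => by
  change f • v = f • v + (0 : Derivation ℝ C C) f • v
  simp⟩

lemma iSup_degPart {w : ℤ} {T : Submodule ℝ (MultiPair C S)}
    (hT : T = derMultivector C S ⊓ wt (tw h hS) w) :
    ⨆ k, (derMultivectorDeg C S k).comap T.subtype = ⊤ := by
  rw [eq_top_iff]
  rintro ⟨D, hD⟩ -
  have h2 : D ∈ derMultivector C S ⊓ wt (tw h hS) w := hT ▸ hD
  obtain ⟨N, hN⟩ := exists_sum_degPart h2.1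
  have hk : ∀ k, degPart k D ∈ T := fun k => by
    rw [hT]; exact ⟨(degPart_mem h2.1 k).1, degPart_wt h2.2 k⟩
  have : (⟨D, hD⟩ : T) = ∑ k ∈ Finset.range N, ⟨degPart k D, hk k⟩ := Subtype.ext (by
    rw [AddSubmonoidClass.coe_finsetSum]; exact hN.symm)
  rw [this]
  exact sum_mem fun k _ => mem_iSup_of_mem k (degPart_mem h2.1 k)

lemma iSupIndep_deg (T : Submodule ℝ (MultiPair C S)) :
    iSupIndep fun k => (derMultivectorDeg C S k).comap T.subtype :=
  iSupIndep_comap_subtype (((wt_iSupIndep (gr C S)).comp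
    (f := fun k : ℕ => (k : ℤ)) (fun p q e => by simpa using e)).mono
      fun k D hD => (mem_derMultivectorDeg.1 hD).2) T

lemma derBracket_core (H : LinModel ev ρ h ℓ) (K : SecModel ev ρ h ρL hS) {D D' : MultiPair C S}
    (hD : D ∈ derMultivector C S ⊓ wt (tw h hS) 0)
    (hD' : D' ∈ derMultivector C S ⊓ wt (tw h hS) 0) : derBracket D D' = 0 :=
  multi_wt_neg H K (w := -1) (by omega) (derBracket_mem hD.1 hD'.1)
    (K.isScaling.derBracket_wt (by omega) hD.1 hD'.1 hD.2 hD'.2)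

variable (b : DualPair M R V W) (a : TopAction Λ b) (H : LinModel b.ev ρ h ℓ)
  (K : SecModel b.ev ρ h ρL hS)

local notation "𝓋" e:max => Subtype.val (secVl H K (DFunLike.coe (LinearMap.flip (DualPair.pair b)) e))
local notation "𝓁" δ:max => Subtype.val
  (secLin H K (DualPair.dual b) (TopAction.top a) (TopAction.dual_symb_eq a) δ)

/-- The graded Lie-Rinehart algebra of fibre-wise linear multivectors. -/
def multiModel (TA TL : Submodule ℝ (MultiPair C S))
    (hA : TA = derMultivector C S ⊓ wt (tw h hS) 0)
    (hL : TL = derMultivector C S ⊓ wt (tw h hS) 1) :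
    GradedModel b TA TL :=
  have hA' : ∀ {D}, D ∈ TA ↔ D ∈ derMultivector C S ∧ D ∈ wt (tw h hS) 0 := fun {D} => by
    rw [hA]; rfl
  have hL' : ∀ {D}, D ∈ TL ↔ D ∈ derMultivector C S ∧ D ∈ wt (tw h hS) 1 := fun {D} => by
    rw [hL]; rfl
  have hAm : TA ≤ derMultivector C S := fun D hD => (hA'.1 hD).1
  have hLm : TL ≤ derMultivector C S := fun D hD => (hL'.1 hD).1
  have h0 : ∀ g, cst S (ρ g) ∈ TA := fun g => hA'.2 ⟨cst_mem _, cst_wt (H.ρ_mem g)⟩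
  have hcomm : ∀ x : TA, ∀ y : TA, derBracket x.1 y.1 = 0 := fun x y =>
    derBracket_core H K (hA'.1 x.2) (hA'.1 y.2)
  have hu (f) : (unitDer C S).1.symb f = 0 := rfl
  have hu' (v) : (unitDer C S).1.op v = v := rfl
  { one := ⟨cst S 1, H.ρ_one ▸ h0 1⟩
    mul := restrict₂ derMulL TA TA TA fun x hx y hy => hA'.2 ⟨derMul_mem (hAm hx) (hAm hy),
      K.isScaling.derMul_wt (hA'.1 hx).2 (hA'.1 hy).2⟩
    smul := restrict₂ derMulL TA TL TL fun x hx y hy => hL'.2 ⟨derMul_mem (hAm hx) (hLm hy),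
      K.isScaling.derMul_wt (hA'.1 hx).2 (hL'.1 hy).2⟩
    bracket := brT TL TL TL hLm hLm fun x hx y hy => hL'.2 ⟨derBracket_mem (hLm hx) (hLm hy),
      K.isScaling.derBracket_wt (by omega) (hLm hx) (hLm hy) (hL'.1 hx).2 (hL'.1 hy).2⟩
    anchor := brT TL TA TA hLm hAm fun x hx y hy => hA'.2 ⟨derBracket_mem (hLm hx) (hAm hy),
      K.isScaling.derBracket_wt (by omega) (hLm hx) (hAm hy) (hL'.1 hx).2 (hA'.1 hy).2⟩
    one_mul := fun x => Subtype.ext ((derMul_cst 1 x.1).trans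
      (MultiPair.ext (funext fun m => one_mul _) (funext fun m => one_smul C _)))
    mul_comm := fun x y => Subtype.ext (derMul_comm x.1 y.1)
    mul_assoc := fun x y z => Subtype.ext (derMul_assoc x.1 y.1 z.1)
    one_smul := fun x => Subtype.ext ((derMul_cst 1 x.1).trans
      (MultiPair.ext (funext fun m => one_mul _) (funext fun m => one_smul C _)))
    mul_smul := fun x y z => Subtype.ext (derMul_assoc x.1 y.1 z.1)
    bracket_self := fun x => Subtype.ext (derBracket_self x.1)
    jacobi := fun x y z => Subtype.ext (derBracket_jacobi (hLm x.2) (hLm y.2) (hLm z.2))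
    anchor_mul := fun x y z => Subtype.ext (derBracket_derMul (hLm x.2) (hAm y.2) (hAm z.2))
    anchor_smul := fun y x z => Subtype.ext (by
      change derBracket (derMul y.1 x.1) z.1 = derMul y.1 (derBracket x.1 z.1)
      rw [derBracket_anti, derBracket_derMul (hAm z.2) (hAm y.2) (hLm x.2), hcomm, derMul_comm 0,
        derBracket_anti z.1 x.1, show derMul x.1 0 = 0 from map_zero (derMulL x.1), zero_add,
        show derMul y.1 (- derBracket x.1 z.1) = - derMul y.1 (derBracket x.1 z.1) from
          map_neg (derMulL y.1) _, neg_neg])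
    anchor_bracket := fun x y z => Subtype.ext
      (sub_eq_of_eq_add (derBracket_jacobi (hLm x.2) (hLm y.2) (hAm z.2))).symm
    leibniz := fun x y z => Subtype.ext (derBracket_derMul (hLm x.2) (hAm y.2) (hLm z.2))
    Adeg := fun k => (derMultivectorDeg C S k).comap TA.subtype
    Ldeg := fun k => (derMultivectorDeg C S k).comap TL.subtype
    ofR := (cst S ∘ₗ ρ).codRestrict TA h0
    ofW :=
      { toFun := fun e => ⟨der1 C S (𝓋 e), hA'.2 ⟨der1_mem (Subtype.prop _),
          der1_wt (u := -1) (by omega) (fun t f ht => (secVl_wt H K ht _).1 f)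
            (fun t f ht => (secVl_wt H K ht _).2 f)⟩⟩
        map_add' := fun e e' => Subtype.ext (by
          change der1 C S (𝓋 (e + e'))
            = der1 C S (𝓋 e) + der1 C S (𝓋 e')
          rw [map_add, map_add, Submodule.coe_add, map_add])
        map_smul' := fun c e => Subtype.ext (by
          change der1 C S (𝓋 (c • e))
            = c • der1 C S (𝓋 e)
          rw [map_smul_of_tower, map_smul, Submodule.coe_smul, map_smul]) }
    ofV := (cst S ∘ₗ ℓ).codRestrict TL fun φ => hL'.2 ⟨cst_mem _, cst_wt (H.ℓ_mem φ)⟩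
    ofDer := (der1 C S ∘ₗ (modDer C S).subtype ∘ₗ secLin H K b.dual a.top a.dual_symb_eq).codRestrict TL
      fun δ => hL'.2 ⟨der1_mem (Subtype.prop _), der1_wt (u := 0) (by omega)
        (fun t f ht => (secLin_wt H K _ _ _ ht _).1 f)
            (fun t f ht => (secLin_wt H K _ _ _ ht _).2 f)⟩
    unit := ⟨der1 C S (unitDer C S).1, hL'.2 ⟨der1_mem (Subtype.prop _), der1_wt (u := 0)
      (by omega) (fun t f ht => by
        change h t 0 = t ^ (0 : ℤ) • (0 : C)
        simp) (fun t s ht => by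
        change hS t (hS t⁻¹ s) = t ^ (0 : ℤ) • s
        rw [K.hS_inv ht]; simp)⟩⟩
    ofR_one := Subtype.ext (congrArg (cst S) H.ρ_one)
    ofR_mul := fun g g' => Subtype.ext (by
      change cst S (ρ (g * g')) = derMul (cst S (ρ g)) (cst S (ρ g'))
      rw [derMul_cst, fs_cst, H.ρ_mul])
    ofR_inj := fun g hg => H.ρ_inj g (by
      exact congrArg (·.1.symb 0) hg)
    Adeg_zero := by
      ext D
      constructor
      · intro hD
        have e := eq_cst hD
        obtain ⟨g, hg⟩ := H.wt_zero _ (symb_zero_wt H K (hA'.1 D.2).2)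
        exact ⟨g, Subtype.ext ((congrArg (cst S) hg.symm).trans e.symm)⟩
      · rintro ⟨g, rfl⟩
        exact cst_deg _
    ofV_inj := fun g hg => H.ℓ_inj g (by
      exact congrArg (·.1.symb 0) hg)
    ofV_smul := fun g φ => Subtype.ext (by
      change cst S (ℓ (g • φ)) = derMul (cst S (ρ g)) (cst S (ℓ φ))
      rw [derMul_cst, fs_cst, H.ℓ_smul])
    Ldeg_zero := by
      ext D
      constructor
      · intro hD
        have e := eq_cst hD
        obtain ⟨g, hg⟩ := H.wt_one _ (symb_zero_wt H K (hL'.1 D.2).2)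
        exact ⟨g, Subtype.ext ((congrArg (cst S) hg.symm).trans e.symm)⟩
      · rintro ⟨g, rfl⟩
        exact cst_deg _
    mul_mem := fun hx hy => derMultivectorDeg_derMul hx hy
    smul_mem := fun hx hy => derMultivectorDeg_derMul hx hy
    bracket_mem := fun hn hx hy => derMultivectorDeg_derBracket hn hx hy
    anchor_mem := fun hn hx hy => derMultivectorDeg_derBracket hn hx hy
    anchor_ofV_ofR := fun φ g => Subtype.ext (by
      change derBracket (cst S (ℓ φ)) (cst S (ρ g)) = 0
      rw [derBracket_cst (cst_mem _), contr_cst])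
    bracket_ofV := fun φ g => Subtype.ext (by
      change derBracket (cst S (ℓ φ)) (cst S (ℓ g)) = 0
      rw [derBracket_cst (cst_mem _), contr_cst])
    ofW_mem := fun e => der1_deg (Subtype.prop _)
    anchor_ofW := fun φ e => Subtype.ext (by
      change derBracket (cst S (ℓ φ)) (der1 C S (𝓋 e))
        = - cst S (ρ (b.pair φ e))
      rw [derBracket_cst_left (der1_mem (Subtype.prop _)), contr_der1, secVl_symb, H.vl_ℓ,
        flip_apply])
    ofDer_mem := fun δ => der1_deg (Subtype.prop _)
    ofDer_ofV := fun δ φ φ' e => Subtype.ext (by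
      change derBracket (der1 C S (𝓁 δ)) (cst S (ℓ φ)) = cst S (ℓ φ')
      rw [derBracket_cst (der1_mem (Subtype.prop _)), contr_der1, secLin_symb, H.lin_ℓ,
        b.dual_op_eq e])
    anchor_ofDer := fun δ g => Subtype.ext (by
      change derBracket (der1 C S (𝓁 δ)) (cst S (ρ g))
        = cst S (ρ (δ.1.symb g))
      rw [derBracket_cst (der1_mem (Subtype.prop _)), contr_der1, secLin_symb, H.lin_ρ,
        b.dual_symb])
    ofDer_bracket := fun δ₁ δ₂ δ₃ e => Subtype.ext (by
      change derBracket (der1 C S (𝓁 δ₁))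
        (der1 C S (𝓁 δ₂)) = der1 C S (𝓁 δ₃)
      rw [derBracket_der1 (Subtype.prop _) (Subtype.prop _)]
      congr 1
      refine K.modDer_ext (bracket_mem (Subtype.prop _) (Subtype.prop _))
        (Subtype.prop _) ?_ fun U => ?_
      · rw [secLin_symb, H.lin_bracket (b.dual_bracket e), ← secLin_symb H K b.dual a.top a.dual_symb_eq,
          ← secLin_symb H K b.dual a.top a.dual_symb_eq]; rfl
      · change (𝓁 δ₁).op ((𝓁 δ₂).op (ρL U))
          - (𝓁 δ₂).op ((𝓁 δ₁).op (ρL U)) = _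
        simp only [secLin_op]
        rw [a.top_bracket δ₁ δ₂ δ₃ e, ← map_sub]; rfl)
    ofDer_smul := fun g δ δ' e => Subtype.ext (by
      change der1 C S (𝓁 δ')
        = derMul (cst S (ρ g)) (der1 C S (𝓁 δ))
      rw [derMul_cst, fs_der1]
      congr 1
      refine K.modDer_ext (Subtype.prop _) (fsmul_mem (Subtype.prop _) _) ?_ fun U => ?_
      · rw [secLin_symb, H.lin_smul (b.dual_smul e), ← secLin_symb H K b.dual a.top a.dual_symb_eq]; rfl
      · change _ = ρ g • (𝓁 δ).op (ρL U)
        rw [secLin_op, secLin_op, a.top_smul g δ δ' e, ← K.ρL_smul]; rfl)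
    ofDer_rank_one := fun φ e δ hs ho => Subtype.ext (by
      change der1 C S (𝓁 δ)
        = derMul (cst S (ρ (b.pair φ e))) (der1 C S (unitDer C S).1)
          - derMul (der1 C S (𝓋 e)) (cst S (ℓ φ))
      rw [derMul_cst, derMul_comm, derMul_cst, fs_der1, fs_der1, ← map_sub]
      congr 1
      refine K.modDer_ext (Subtype.prop _) (sub_mem (fsmul_mem (Subtype.prop _) _)
        (fsmul_mem (Subtype.prop _) _)) ?_ fun U => ?_
      · rw [secLin_symb, H.lin_rank_one (a := b.pair.flip e) (φ₀ := - φ) hs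
          (fun ψ => by rw [b.dual_rank_one hs ho, smul_neg]; rfl)]
        change _ = ρ (b.pair φ e) • (0 : Derivation ℝ C C)
          - ℓ φ • (𝓋 e).symb
        rw [secVl_symb, smul_zero, zero_sub, map_neg, neg_smul]
      · change _ = ρ (b.pair φ e) • ρL U - ℓ φ • (𝓋 e).op (ρL U)
        rw [secLin_op, secVl_op, smul_zero, sub_zero, a.top_rank_one φ e δ hs ho, K.ρL_smul])
    unit_mem := der1_deg (Subtype.prop _)
    anchor_unit := fun x => Subtype.ext (by
      change derBracket (der1 C S (unitDer C S).1) x.1 = 0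
      refine eq_of_contr (fun D : derMultivector C S => derBracket (der1 C S (unitDer C S).1) D.1)
        (fun _ => 0) (fun D f => ⟨[⟨_, contr_mem D.2 f⟩], ?_⟩) (fun D => ?_) (fun D => ?_)
        ⟨x.1, hAm x.2⟩
      · simp [contr_derBracket, hu,
          show derBracket 0 D.1 = 0 by simpa using derBracket_smul_left D.2 0 0]
      · simp [hu, contr_zero_left D.2]
      · ext v
        simp [hu, contr_zero_left D.2, hu'])
    bracket_unit_ofV := fun φ => Subtype.ext (by
      change derBracket (der1 C S (unitDer C S).1) (cst S (ℓ φ)) = 0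
      rw [derBracket_cst (der1_mem (Subtype.prop _)), contr_der1]
      exact map_zero (cst S))
    bracket_unit_ofDer := fun δ => Subtype.ext (by
      change derBracket (der1 C S (unitDer C S).1) (der1 C S (𝓁 δ)) = 0
      rw [derBracket_der1 (Subtype.prop _) (Subtype.prop _)]
      convert map_zero (der1 C S) using 2
      refine Prod.ext ?_ ?_
      · exact zero_lie (𝓁 δ).symb
      · exact sub_self _)
    unit_inj := fun g hg => H.ρ_inj g (by
      have h1 : derMul (cst S (ρ g)) (der1 C S (unitDer C S).1) = 0 := congrArg Subtype.val hg
      rw [derMul_cst, fs_der1] at h1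
      have h2 : ∀ s : S, ρ g • s = 0 := fun s =>
        congrArg (·.op 0 s) h1
      rw [K.faithful (g := g) fun U => K.ρL_inj _ (by rw [K.ρL_smul, h2]), map_zero])
    faithful_A := fun p x hx hφ => Subtype.ext (eq_zero_of_contr_eq_zero H K (hAm x.2)
      (fun g => multi_wt_neg H K (w := -1) (by omega) (contr_mem (hAm x.2) _)
        (contr_wt (by omega) (hAm x.2) (H.ρ_mem g) (hA'.1 x.2).2))
      (fun φ => by
        rw [← neg_eq_zero, ← derBracket_cst_left (hAm x.2)]; exact congrArg Subtype.val (hφ φ))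
      (hx.2.1 0 (by simp)) fun U => K.wtS_neg (by omega) (op_zero_wt H K (hA'.1 x.2).2 U))
    faithful_one := fun x hx h1 h2 => by
      have h1' : ∀ φ, contr (ℓ φ) x.1 = 0 := fun φ => by
        rw [← derBracket_cst (hLm x.2)]; exact congrArg Subtype.val (h1 φ)
      have h2' : ∀ g, contr (ρ g) x.1 = 0 := fun g => by
        rw [← derBracket_cst (hLm x.2)]; exact congrArg Subtype.val (h2 g)
      obtain ⟨X, hX⟩ := exists_contr_derivation (hLm x.2) 0
      have hX0 : X = 0 := H.der_ext_ℓ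
        (fun g => (hX _).trans (congrArg (·.symb 0) (h2' g)))
        fun φ => (hX _).trans (congrArg (·.symb 0) (h1' φ))
      obtain ⟨g, hg⟩ := K.exists_eq_smul (A := x.1.op 0)
        (fun f s => by
          rw [op_smul_apply (hLm x.2), contr_symb, ← hX, hX0, Derivation.zero_apply, zero_smul,
            add_zero])
        fun U => by simpa using op_zero_wt H K (hL'.1 x.2).2 U
      refine ⟨g, Subtype.ext ?_⟩
      change x.1 = derMul (cst S (ρ g)) (der1 C S (unitDer C S).1)
      have hu : ∀ f, contr f (der1 C S (unitDer C S).1) = 0 := fun f => by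
        rw [contr_der1]; exact map_zero (cst S)
      rw [derMul_cst]
      refine sub_eq_zero.1 (eq_zero_of_contr_eq_zero H K
        (sub_mem (hLm x.2) (fs_mem (der1_mem (Subtype.prop _)) _)) (fun k => ?_) (fun k => ?_)
        ?_ fun U => ?_)
      · rw [map_sub, h2', contr_fs, hu, map_zero, sub_zero]
      · rw [map_sub, h1', contr_fs, hu, map_zero, sub_zero]
      · rw [symb_sub, Pi.sub_apply, show x.1.symb 0 = 0 from hx.2.1 0 (by simp), fs_symb, der1_symb_zero]; simp
      · rw [op_sub, Pi.sub_apply, LinearMap.sub_apply, hg, fs_op, der1_op_zero]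
        exact sub_self _
    faithful_L := fun q x hx h1 h2 => Subtype.ext (eq_zero_of_contr_eq_zero H K (hLm x.2)
      (fun g => by rw [← derBracket_cst (hLm x.2)]; exact congrArg Subtype.val (h2 g))
      (fun φ => by rw [← derBracket_cst (hLm x.2)]; exact congrArg Subtype.val (h1 φ))
      (hx.2.1 0 (by simp)) fun U => by rw [show x.1.op 0 = 0 from hx.2.2 0 (by simp)]; rfl)
    sep_A := fun χ hχ x hx => Subtype.ext (fs_sep H K hχ fun y => by
      rw [← derMul_cst, ← derMul_cst]
      exact (congrArg Subtype.val (hx y)).trans (map_zero (derMulL _)).symm)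
    sep_L := fun χ hχ x hx => Subtype.ext (fs_sep H K hχ fun y => by
      rw [← derMul_cst, ← derMul_cst]
      exact (congrArg Subtype.val (hx y)).trans (map_zero (derMulL _)).symm)
    glue_A := fun p χ hχ x hx e => by
      obtain ⟨D, hD, hD'⟩ := fs_glue H K (w := 0) hχ (fun y => (x y).1)
        (fun y => ⟨hx y, (hA'.1 (x y).2).2⟩) fun y z => by
          rw [← derMul_cst, ← derMul_cst]; exact congrArg Subtype.val (e y z)
      exact ⟨⟨D, hA'.2 ⟨hD.1.1, hD.2⟩⟩, hD.1, fun y => Subtype.ext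
        ((derMul_cst _ _).trans (hD' y))⟩
    glue_L := fun p χ hχ x hx e => by
      obtain ⟨D, hD, hD'⟩ := fs_glue H K (w := 1) hχ (fun y => (x y).1)
        (fun y => ⟨hx y, (hL'.1 (x y).2).2⟩) fun y z => by
          rw [← derMul_cst, ← derMul_cst]; exact congrArg Subtype.val (e y z)
      exact ⟨⟨D, hL'.2 ⟨hD.1.1, hD.2⟩⟩, hD.1, fun y => Subtype.ext
        ((derMul_cst _ _).trans (hD' y))⟩
    iSup_A := iSup_degPart hA
    iSup_L := iSup_degPart hL
    indep_A := iSupIndep_deg TA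
    indep_L := iSupIndep_deg TL }

end MultiModel

section Operations

variable (C)
variable (S)

/-- The action of pairs on functions. -/
def actL : DerPair C S →ₗ[ℝ] C →ₗ[ℝ] C where
  toFun D := D.symb.toLinearMap
  map_add' _ _ := rfl
  map_smul' _ _ := rfl

/-- The bilinear product of functions and pairs. -/
def fsmulL : C →ₗ[ℝ] DerPair C S →ₗ[ℝ] DerPair C S :=
  LinearMap.mk₂ ℝ DerPair.fsmul
    (fun f g D => Prod.ext (add_smul f g D.symb) (add_smul f g D.op))
    (fun c f D => Prod.ext (smul_assoc c f D.symb) (smul_assoc c f D.op))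
    (fun f D D' => Prod.ext (smul_add f D.symb D'.symb) (smul_add f D.op D'.op))
    (fun c f D => Prod.ext (smul_comm f c D.symb) (smul_comm f c D.op))

/-- The bilinear commutator of pairs. -/
def brL : DerPair C S →ₗ[ℝ] DerPair C S →ₗ[ℝ] DerPair C S :=
  LinearMap.mk₂ ℝ DerPair.bracket
    (fun D D' D'' => Prod.ext (add_lie D.symb D'.symb D''.symb)
      (LinearMap.map_add₂ commEnd D.op D'.op D''.op))
    (fun c D D' => Prod.ext (smul_lie c D.symb D'.symb) (LinearMap.map_smul₂ commEnd c D.op D'.op))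
    (fun D D' D'' => Prod.ext (lie_add D.symb D'.symb D''.symb)
      (map_add (commEnd D.op) D'.op D''.op))
    (fun c D D' => Prod.ext (lie_smul c D.symb D'.symb) (map_smul (commEnd D.op) c D'.op))

variable {C S}

/-- Derivations which are homogeneous of degree `k` with respect to scalings. -/
def derDeg (h : ℝ → C →ₗ[ℝ] C) (hS : ℝ → S →ₗ[ℝ] S) (k : ℤ) : Submodule ℝ (DerPair C S) where
  carrier := {D | D ∈ modDer C S ∧ ∀ t : ℝ, t ≠ 0 →
      (∀ f, h t (D.symb (h t⁻¹ f)) = t ^ k • D.symb f) ∧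
      ∀ s, hS t (D.op (hS t⁻¹ s)) = t ^ k • D.op s}
  zero_mem' := ⟨zero_mem _, by simp⟩
  add_mem' := fun {D D'} h h' => ⟨add_mem h.1 h'.1, fun t ht =>
    ⟨fun f => by
      simp [(h.2 t ht).1, (h'.2 t ht).1,
        smul_add],
    fun s => by
      simp [(h.2 t ht).2, (h'.2 t ht).2,
        smul_add]⟩⟩
  smul_mem' := fun c D h => ⟨Submodule.smul_mem _ c h.1, fun t ht =>
    ⟨fun f => by
      simp [(h.2 t ht).1, smul_comm c],
    fun s => by
      simp [(h.2 t ht).2, smul_comm c]⟩⟩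

lemma op_wt_of_conj {Z : Type*} [AddCommGroup Z] [Module ℝ Z] {h : ℝ → Z →ₗ[ℝ] Z}
    {Δ : End ℝ Z} {k n m : ℤ} (hm : m = k + n)
    (hΔ : ∀ t : ℝ, t ≠ 0 → ∀ s, h t (Δ (h t⁻¹ s)) = t ^ k • Δ s) {s : Z} (hs : s ∈ wt h n) :
    Δ s ∈ wt h m := fun t ht => by
  have h1 := hΔ t ht s
  rw [hs t⁻¹ (inv_ne_zero ht), map_smul, map_smul, inv_zpow] at h1
  rw [hm, zpow_add₀ ht, mul_comm, mul_smul, ← h1, smul_smul, mul_inv_cancel₀ (zpow_ne_zero n ht),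
    one_smul]

lemma derDeg_symb {k n m : ℤ} (hm : m = k + n) {D : DerPair C S} (hD : D ∈ derDeg h hS k) {f : C}
    (hf : f ∈ wt h n) : D.symb f ∈ wt h m :=
  op_wt_of_conj (Δ := D.symb.toLinearMap) hm (fun t ht => (hD.2 t ht).1) hf

lemma derDeg_op {k n m : ℤ} (hm : m = k + n) {D : DerPair C S} (hD : D ∈ derDeg h hS k) {s : S}
    (hs : s ∈ wt hS n) : D.op s ∈ wt hS m :=
  op_wt_of_conj hm (fun t ht => (hD.2 t ht).2) hs

lemma iSupIndep_derDeg : iSupIndep (derDeg h hS) := by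
  let N : DerPair C S →ₗ[ℝ] End ℝ C × End ℝ S :=
    { toFun := fun D => (D.symb.toLinearMap, D.op), map_add' := fun _ _ => rfl,
      map_smul' := fun _ _ => rfl }
  have hN : Function.Injective N := fun D D' e =>
    Prod.ext (Derivation.ext fun f => congrArg (fun X => X.1 f) e) (congrArg (fun X => X.2) e)
  intro k
  rw [Submodule.disjoint_def]
  intro D hD hD'
  refine hN ((Submodule.disjoint_def.1
    (wt_iSupIndep (fun t => (conj h t).prodMap (conj hS t)) k)) (N D) ?_ ?_)
  · exact fun t ht => Prod.ext (LinearMap.ext (hD.2 t ht).1) (LinearMap.ext (hD.2 t ht).2)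
  · have : (⨆ j, ⨆ (_ : j ≠ k), derDeg h hS j)
        ≤ (⨆ j, ⨆ (_ : j ≠ k), wt (fun t => (conj h t).prodMap (conj hS t)) j).comap N :=
      iSup₂_le fun j hj D hD => Submodule.mem_comap.2 (mem_iSup_of_mem j
        (mem_iSup_of_mem hj fun t ht =>
          Prod.ext (LinearMap.ext (hD.2 t ht).1) (LinearMap.ext (hD.2 t ht).2)))
    exact this hD'

lemma der_sum_apply {κ : Type*} {s : Finset κ} (D : κ → Derivation ℝ C C) (f : C) :
    (∑ i ∈ s, D i) f = ∑ i ∈ s, D i f :=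
  map_sum (AddMonoidHom.mk' (fun D : Derivation ℝ C C => D f) fun _ _ => rfl) D s

end Operations

section Euler

variable {b : DualPair M R V W} {ℓ : W →ₗ[ℝ] C} (H : LinModel b.ev ρ h ℓ)
  (K : SecModel b.ev ρ h ρL hS)

lemma DualPair.eq_of_pair' (b : DualPair M R V W) {e e' : W}
    (h : ∀ φ, b.pair φ e = b.pair φ e') : e = e' :=
  sub_eq_zero.1 (b.nondeg _ fun φ => by rw [map_sub, h, sub_self])

/-- Dual local frames, with a cut-off function. -/
def DualPair.IsFrame (b : DualPair M R V W) {n : ℕ} (χ : R) (e : Fin n → W) (ε : Fin n → V) :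
    Prop := ∀ φ, χ • φ = ∑ i, b.pair φ (e i) • ε i

lemma DualPair.IsFrame.expand {n : ℕ} {χ : R} {e : Fin n → W} {ε : Fin n → V}
    (hf : b.IsFrame χ e ε) (w : W) : χ • w = ∑ i, b.pair (ε i) w • e i :=
  b.eq_of_pair' fun φ => by
    have := congrArg (fun ψ => b.pair ψ w) (hf φ)
    simp at this ⊢
    rw [this]
    exact Finset.sum_congr rfl fun i _ => mul_comm _ _

section

variable {n : ℕ} {χ : R} {e : Fin n → W} {ε : Fin n → V} (hf : b.IsFrame χ e ε)

include hf

lemma lin_unit_eq : ρ χ • H.lin (unitDer R W) = ∑ i, ℓ (e i) • H.vl (b.pair (ε i)) := by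
  refine H.der_ext_ℓ (fun g => ?_) fun w => ?_
  · rw [Derivation.smul_apply, H.lin_ρ, show (unitDer R W).1.symb g = 0 from rfl, map_zero,
      smul_zero, der_sum_apply]
    exact (Finset.sum_eq_zero fun i _ => by rw [Derivation.smul_apply, H.vl_ρ, smul_zero]).symm
  · rw [Derivation.smul_apply, H.lin_ℓ, show (unitDer R W).1.op w = w from rfl, smul_eq_mul,
      ← H.ℓ_smul, hf.expand, map_sum, der_sum_apply]
    exact Finset.sum_congr rfl fun i _ => by
      rw [Derivation.smul_apply, H.vl_ℓ, H.ℓ_smul, smul_eq_mul, mul_comm]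

lemma vl_eq (φ : V) :
    ρ χ • H.vl (b.pair φ) = ∑ i, ρ (b.pair φ (e i)) • H.vl (b.pair (ε i)) := by
  refine H.der_ext_ℓ (fun g => ?_) fun w => ?_
  · rw [Derivation.smul_apply, H.vl_ρ, smul_zero, der_sum_apply]
    exact (Finset.sum_eq_zero fun i _ => by rw [Derivation.smul_apply, H.vl_ρ, smul_zero]).symm
  · have := congrArg (fun ψ => b.pair ψ w) (hf φ)
    simp at this
    rw [Derivation.smul_apply, H.vl_ℓ, smul_eq_mul, ← H.ρ_mul, this, map_sum, der_sum_apply]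
    exact Finset.sum_congr rfl fun i _ => by
      rw [Derivation.smul_apply, H.vl_ℓ, H.ρ_mul, smul_eq_mul]

include K in
lemma secVl_eq (φ : V) (s : S) : ρ χ • (secVl H K (b.pair φ)).1.op s
    = ∑ i, ρ (b.pair φ (e i)) • (secVl H K (b.pair (ε i))).1.op s := by
  have := K.modDer_ext (D := DerPair.fsmul (ρ χ) (secVl H K (b.pair φ)).1)
    (D' := ∑ i, DerPair.fsmul (ρ (b.pair φ (e i))) (secVl H K (b.pair (ε i))).1)
    (fsmul_mem (Subtype.prop _) _)
    (sum_mem fun i _ => fsmul_mem (Subtype.prop _) _)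
    (by
      have e1 : ∀ X : Fin n → DerPair C S, (∑ i, X i).symb = ∑ i, (X i).symb := fun X =>
        map_sum (LinearMap.fst ℝ (Derivation ℝ C C) (End ℝ S)) X Finset.univ
      rw [e1]
      change ρ χ • (secVl H K (b.pair φ)).1.symb
        = ∑ i, ρ (b.pair φ (e i)) • (secVl H K (b.pair (ε i))).1.symb
      simp
      exact vl_eq H hf φ)
    (fun U => by
      have e1 : ∀ X : Fin n → DerPair C S, (∑ i, X i).op = ∑ i, (X i).op := fun X =>
        map_sum (LinearMap.snd ℝ (Derivation ℝ C C) (End ℝ S)) X Finset.univ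
      rw [e1, LinearMap.sum_apply]
      change ρ χ • (secVl H K (b.pair φ)).1.op (ρL U)
        = ∑ i, ρ (b.pair φ (e i)) • (secVl H K (b.pair (ε i))).1.op (ρL U)
      simp)
  have e1 : ∀ X : Fin n → DerPair C S, (∑ i, X i).op = ∑ i, (X i).op := fun X =>
        map_sum (LinearMap.snd ℝ (Derivation ℝ C C) (End ℝ S)) X Finset.univ
  have e2 := congrArg (fun D => D.op s) this
  simp [e1] at e2
  exact e2

variable (hE : ∀ k : ℤ, ∀ f ∈ wt h k, H.lin (unitDer R W) f = (k : ℝ) • f)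

include hE

lemma euler_fun {k : ℤ} {f : C} (hk : f ∈ wt h k) :
    ∑ i, ℓ (e i) * H.vl (b.pair (ε i)) f = (k : ℝ) • ρ χ * f := by
  have := congrArg (fun X => X f) (lin_unit_eq H hf)
  simp [der_sum_apply] at this
  rw [← this, hE k f hk, mul_smul_comm, smul_mul_assoc]

lemma euler_sec {k : ℤ} {s : S} (hs : s ∈ wt hS k) :
    ∑ i, ℓ (e i) • (secVl H K (b.pair (ε i))).1.op s = (k : ℝ) • ρ χ • s := by
  choose χ' hχ U₀ κ κL e1 e2 e3 e4 using K.locS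
  refine K.sepS_eq hχ fun x => ?_
  have h1 : ∀ i, ρ (χ' x) • (secVl H K (b.pair (ε i))).1.op s
      = H.vl (b.pair (ε i)) (κ x s) • ρL (U₀ x) := fun i => by
    have := (secVl H K (b.pair (ε i))).2 (ρ (χ' x)) s
    rw [e1, (secVl H K (b.pair (ε i))).2, secVl_op, secVl_symb, H.vl_ρ, smul_zero, zero_add,
      zero_smul, add_zero] at this
    exact this.symm
  have h2 : κ x s ∈ wt h k := fun t ht => by rw [← e3, hs t ht, map_smul_of_tower]
  simp [Finset.smul_sum, smul_comm (ρ (χ' x)), h1]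
  simp [smul_smul, ← Finset.sum_smul]
  rw [euler_fun H hf hE h2, smul_mul_assoc, smul_assoc, mul_smul, ← e1, smul_smul]

end

variable (hE : ∀ k : ℤ, ∀ f ∈ wt h k, H.lin (unitDer R W) f = (k : ℝ) • f)

include hE

lemma eq_zero_of_vl {k : ℤ} (hk : k ≠ 0) {f : C} (hf : f ∈ wt h k)
    (h0 : ∀ φ, H.vl (b.pair φ) f = 0) : f = 0 := by
  choose χ hχ hl using b.loc
  refine H.sep χ hχ f fun x => ?_
  obtain ⟨⟨n, e, ε, hfr⟩, -⟩ := hl x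
  have := euler_fun H (b := b) (e := e) (ε := ε) hfr hE hf
  simp [h0] at this
  exact (smul_eq_zero.1 this.symm).resolve_left (by exact_mod_cast hk)

lemma eq_zero_of_secVl {k : ℤ} (hk : k ≠ 0) {s : S} (hs : s ∈ wt hS k)
    (h0 : ∀ φ, (secVl H K (b.pair φ)).1.op s = 0) : s = 0 := by
  choose χ hχ hl using b.loc
  refine K.sepS χ hχ s fun x => ?_
  obtain ⟨⟨n, e, ε, hfr⟩, -⟩ := hl x
  have := euler_sec H K (b := b) (e := e) (ε := ε) hfr hE hs
  simp [h0] at this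
  exact (smul_eq_zero.1 this.symm).resolve_left (by exact_mod_cast hk)

lemma euler_eval {x : M} {φ : V} (q : C →ₐ[ℝ] ℝ) (hq : ∀ g, q (ρ g) = b.ev x g)
    (hq' : ∀ e, q (ℓ e) = b.ev x (b.pair φ e)) {k : ℤ} {f : C} (hf : f ∈ wt h k) :
    q (H.vl (b.pair φ) f) = k * q f := by
  obtain ⟨χ, hχ, ⟨n, e, ε, hfr⟩, -⟩ := b.loc x
  have h1 := congrArg q (euler_fun H (b := b) (e := e) (ε := ε) hfr hE hf)
  have h2 := congrArg (fun X => q (X f)) (vl_eq H (b := b) (e := e) (ε := ε) hfr φ)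
  simp [der_sum_apply, hq, hq', hχ] at h1 h2
  rw [h2, h1]

lemma euler_evalS {Y : Type*} [AddCommGroup Y] [Module ℝ Y] {x : M} {φ : V} (q : C →ₐ[ℝ] ℝ)
    (hq : ∀ g, q (ρ g) = b.ev x g) (hq' : ∀ e, q (ℓ e) = b.ev x (b.pair φ e))
    (qS : S →ₗ[ℝ] Y) (hqS : ∀ f s, qS (f • s) = q f • qS s) {k : ℤ} {s : S}
    (hs : s ∈ wt hS k) : qS ((secVl H K (b.pair φ)).1.op s) = (k : ℝ) • qS s := by
  obtain ⟨χ, hχ, ⟨n, e, ε, hfr⟩, -⟩ := b.loc x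
  have h1 := congrArg qS (euler_sec H K (b := b) (e := e) (ε := ε) hfr hE hs)
  have h2 := congrArg qS (secVl_eq H K (b := b) (e := e) (ε := ε) hfr φ s)
  simp [hqS, hq, hq', hχ] at h1 h2
  rw [h2, h1]

end Euler

section DerModel

variable {b : DualPair M R V W} {ℓ : W →ₗ[ℝ] C}

lemma bracket_jacobi (P Q N : DerPair C S) : DerPair.bracket P (DerPair.bracket Q N)
    = DerPair.bracket (DerPair.bracket P Q) N + DerPair.bracket Q (DerPair.bracket P N) :=
  Prod.ext (leibniz_lie P.symb Q.symb N.symb) (opComm_jacobi P.op Q.op N.op)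

lemma bracket_fsmul {P Q : DerPair C S} (hP : P ∈ modDer C S) (f : C) :
    DerPair.bracket P (DerPair.fsmul f Q)
      = DerPair.fsmul (P.symb f) Q + DerPair.fsmul f (DerPair.bracket P Q) :=
  Prod.ext (Derivation.ext fun g => by
      change P.symb (f * Q.symb g) - f * Q.symb (P.symb g)
        = P.symb f * Q.symb g + f * (⁅P.symb, Q.symb⁆ : Derivation ℝ C C) g
      rw [commutator_apply, Derivation.leibniz, smul_eq_mul, smul_eq_mul]; ring)
    (LinearMap.ext fun s => by
      change P.op (f • Q.op s) - f • Q.op (P.op s)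
        = P.symb f • Q.op s + f • (P.op (Q.op s) - Q.op (P.op s))
      rw [hP, smul_sub]; abel)

lemma comm_conj {Z : Type*} [AddCommGroup Z] [Module ℝ Z] {n k m : ℤ} (hm : m = n + k)
    {a : ℝ → Z →ₗ[ℝ] Z} {A B : End ℝ Z} {t : ℝ} (ht : t ≠ 0) (ha : ∀ x, a t⁻¹ (a t x) = x)
    (hA : ∀ x, a t (A (a t⁻¹ x)) = t ^ n • A x) (hB : ∀ x, a t (B (a t⁻¹ x)) = t ^ k • B x)
    (x : Z) : a t (A (B (a t⁻¹ x)) - B (A (a t⁻¹ x))) = t ^ m • (A (B x) - B (A x)) := by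
  have hA' := hA (a t (B (a t⁻¹ x)))
  have hB' := hB (a t (A (a t⁻¹ x)))
  rw [ha, hB, map_smul] at hA'
  rw [ha, hA, map_smul] at hB'
  rw [map_sub, hA', hB', smul_comm (t ^ k), ← smul_sub, ← smul_sub, smul_smul, hm, zpow_add₀ ht]

section Sec

variable (K : SecModel b.ev ρ h ρL hS)

include K

lemma derDeg_fsmul {n k m : ℤ} (hm : m = n + k) {f : C} {D : DerPair C S} (hf : f ∈ wt h n)
    (hD : D ∈ derDeg h hS k) : DerPair.fsmul f D ∈ derDeg h hS m :=
  ⟨fsmul_mem hD.1 f, fun t ht => ⟨fun g => by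
    change h t (f * D.symb (h t⁻¹ g)) = t ^ m • (f * D.symb g)
    rw [K.h_mul, hf t ht, (hD.2 t ht).1, smul_mul_smul_comm, hm, zpow_add₀ ht], fun s => by
    change hS t (f • D.op (hS t⁻¹ s)) = t ^ m • f • D.op s
    rw [K.hS_smul, hf t ht, (hD.2 t ht).2, smul_assoc, smul_comm f, smul_smul, hm,
      zpow_add₀ ht]⟩⟩

lemma derDeg_bracket {n k m : ℤ} (hm : m = n + k) {D D' : DerPair C S} (hD : D ∈ derDeg h hS n)
    (hD' : D' ∈ derDeg h hS k) : DerPair.bracket D D' ∈ derDeg h hS m := by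
  refine ⟨bracket_mem hD.1 hD'.1, fun t ht => ⟨fun g => ?_, fun s => ?_⟩⟩
  · exact comm_conj hm (a := h) (A := D.symb.toLinearMap) (B := D'.symb.toLinearMap) ht
      (fun x => by rw [K.h_comp, inv_mul_cancel₀ ht, K.h_id]) (hD.2 t ht).1 (hD'.2 t ht).1 g
  · exact comm_conj hm (a := hS) (A := D.op) (B := D'.op) ht
      (fun x => by rw [K.hS_comp, inv_mul_cancel₀ ht, K.hS_id]) (hD.2 t ht).2 (hD'.2 t ht).2 s

lemma glue_derDeg {χ : M → R} (hχ : ∀ x, b.ev x (χ x) = 1) {k : ℤ} (D : M → DerPair C S)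
    (hD : ∀ x, D x ∈ derDeg h hS k)
    (e : ∀ x y, DerPair.fsmul (ρ (χ y)) (D x) = DerPair.fsmul (ρ (χ x)) (D y)) :
    ∃ D' ∈ derDeg h hS k, ∀ x, DerPair.fsmul (ρ (χ x)) D' = D x := by
  obtain ⟨X, hX⟩ := K.glue_der χ hχ (fun x => (D x).symb) fun x y f =>
    congrArg (fun D => D.symb f) (e x y)
  choose T hT using fun s => K.glueS χ hχ (fun x => (D x).op s) fun x y =>
    congrArg (fun D => D.op s) (e x y)
  refine ⟨(X,
    { toFun := T
      map_add' := fun s s' => K.sepS_eq hχ fun x => by rw [smul_add, hT, hT, hT, map_add]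
      map_smul' := fun c s => K.sepS_eq hχ fun x => by
        rw [RingHom.id_apply, smul_comm, hT, hT, map_smul] }),
    ⟨fun f s => K.sepS_eq hχ fun x => ?_, fun t ht => ⟨fun f => K.sep_eq hχ fun x => ?_,
      fun s => K.sepS_eq hχ fun x => ?_⟩⟩, fun x =>
    Prod.ext (Derivation.ext (hX x)) (LinearMap.ext fun s => hT s x)⟩
  · change ρ (χ x) • T (f • s) = ρ (χ x) • (f • T s + X f • s)
    rw [smul_add, smul_comm _ f, hT, hT, smul_smul, hX, (hD x).1]
  · change ρ (χ x) * h t (X (h t⁻¹ f)) = ρ (χ x) * t ^ k • X f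
    rw [← K.h_ρ t, ← K.h_mul, hX, K.h_ρ, mul_smul_comm, hX, ((hD x).2 t ht).1]
  · change ρ (χ x) • hS t (T (hS t⁻¹ s)) = ρ (χ x) • t ^ k • T s
    rw [← K.h_ρ t, ← K.hS_smul, hT, K.h_ρ, smul_comm, hT, ((hD x).2 t ht).2]

end Sec

variable (H : LinModel b.ev ρ h ℓ) (K : SecModel b.ev ρ h ρL hS)

include H K in
lemma derDeg_eq_zero {k : ℤ} (hk : k < -1) {D : DerPair C S} (hD : D ∈ derDeg h hS k) : D = 0 :=
  K.modDer_ext hD.1 (zero_mem _)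
    (H.der_ext_ℓ (fun g => H.wt_neg k (by omega) _ (derDeg_symb (by ring) hD (H.ρ_mem g)))
      (fun e => H.wt_neg (k + 1) (by omega) _ (derDeg_symb rfl hD (H.ℓ_mem e))))
    fun U => K.wtS_neg (n := k) (by omega) (derDeg_op (by ring) hD (K.ρL_mem U))

lemma unitDer_derDeg (K : SecModel b.ev ρ h ρL hS) : (unitDer C S).1 ∈ derDeg h hS 0 :=
  ⟨(unitDer C S).2, fun t ht => ⟨fun f => by
    change h t 0 = t ^ (0 : ℤ) • (0 : C)
    simp, fun s => by
    change hS t (hS t⁻¹ s) = t ^ (0 : ℤ) • s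
    rw [K.hS_inv ht]; simp⟩⟩

variable (a : TopAction Λ b)

local notation "𝓋" φ:max => Subtype.val (secVl H K (DFunLike.coe (DualPair.pair b) φ))
local notation "𝓁" δ:max => Subtype.val
  (secLin H K LinearMap.id (TopAction.top a) (TopAction.symb_eq a) δ)

/-- The Lie-Rinehart algebra of polynomial derivations, with the grading by degree shifted by
one. -/
def derModel
    (hE : ∀ k : ℤ, ∀ f ∈ wt h k, H.lin (unitDer R W) f = (k : ℝ) • f)
    (TA : Submodule ℝ C) (TL : Submodule ℝ (DerPair C S))
    (hA : TA = ⨆ p : ℕ, wt h (p : ℤ)) (hL : TL = ⨆ k : ℤ, derDeg h hS k) : GradedModel b TA TL :=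
  have hAp : ∀ {p : ℕ} {f : C}, f ∈ wt h (p : ℤ) → f ∈ TA := fun {p _} hf =>
    hA ▸ mem_iSup_of_mem p hf
  have hLk : ∀ {k : ℤ} {D : DerPair C S}, D ∈ derDeg h hS k → D ∈ TL := fun {k _} hD =>
    hL ▸ mem_iSup_of_mem k hD
  have hLm : TL ≤ modDer C S := hL ▸ iSup_le fun k D hD => hD.1
  have h0 : ∀ g, ρ g ∈ TA := fun g => hAp (p := 0) (by simpa using H.ρ_mem g)
  have hv : ∀ φ : V, (𝓋 φ) ∈ derDeg h hS (-1) := fun φ =>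
    ⟨Subtype.prop _, fun t ht => secVl_wt H K ht _⟩
  have hl : ∀ δ, (𝓁 δ) ∈ derDeg h hS 0 := fun δ =>
    ⟨Subtype.prop _, fun t ht => secLin_wt H K _ _ _ ht δ⟩
  { one := ⟨1, H.ρ_one ▸ h0 1⟩
    mul := restrict₂ (LinearMap.mul ℝ C) TA TA TA (by
      subst hA
      exact iSup_bilin_mem _ fun p q x y hx hy => mem_iSup_of_mem (p + q)
          (by rw [Nat.cast_add]; exact H.mul_mem hx hy))
    smul := restrict₂ (fsmulL C S) TA TL TL (by
      subst hA hL
      exact iSup_bilin_mem _ fun p q x y hx hy => mem_iSup_of_mem (p + q) (derDeg_fsmul K rfl hx hy))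
    bracket := restrict₂ (brL C S) TL TL TL (by
      subst hL
      exact iSup_bilin_mem _ fun p q x y hx hy => mem_iSup_of_mem (p + q) (derDeg_bracket K rfl hx hy))
    anchor := restrict₂ (actL C S) TL TA TA (by
      subst hL hA
      refine iSup_bilin_mem _ fun p q x y hx hy => ?_
      have h1 : x.symb y ∈ wt h (p + q) := derDeg_symb rfl hx hy
      change x.symb y ∈ _
      rcases lt_or_ge (p + q) 0 with h2 | h2
      · rw [H.wt_neg _ h2 _ h1]; exact zero_mem _
      · obtain ⟨n, hn⟩ := Int.eq_ofNat_of_zero_le h2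
        exact mem_iSup_of_mem n (hn ▸ h1))
    one_mul := fun x => Subtype.ext (_root_.one_mul x.1)
    mul_comm := fun x y => Subtype.ext (_root_.mul_comm x.1 y.1)
    mul_assoc := fun x y z => Subtype.ext (_root_.mul_assoc x.1 y.1 z.1)
    one_smul := fun x => Subtype.ext (Prod.ext (_root_.one_smul C x.1.symb)
      (by exact _root_.one_smul C x.1.op))
    mul_smul := fun f g x => Subtype.ext (Prod.ext (SemigroupAction.mul_smul f.1 g.1 x.1.symb)
      (by exact SemigroupAction.mul_smul f.1 g.1 x.1.op))
    bracket_self := fun x => Subtype.ext (Prod.ext (lie_self x.1.symb) (sub_self _))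
    jacobi := fun x y z => Subtype.ext (bracket_jacobi x.1 y.1 z.1)
    anchor_mul := fun x f g => Subtype.ext (by
      change x.1.symb (f.1 * g.1) = x.1.symb f.1 * g.1 + f.1 * x.1.symb g.1
      rw [Derivation.leibniz, smul_eq_mul, smul_eq_mul]; ring)
    anchor_smul := fun f x g => rfl
    anchor_bracket := fun x y g => Subtype.ext (by
      change (⁅x.1.symb, y.1.symb⁆ : Derivation ℝ C C) g.1 = _
      rw [commutator_apply]; rfl)
    leibniz := fun x f y => Subtype.ext (bracket_fsmul (hLm x.2) f.1)
    Adeg := fun p => (wt h (p : ℤ)).comap TA.subtype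
    Ldeg := fun q => (derDeg h hS ((q : ℤ) - 1)).comap TL.subtype
    ofR := ρ.codRestrict TA h0
    ofW := ℓ.codRestrict TA fun e => hAp (p := 1) (by simpa using H.ℓ_mem e)
    ofV :=
      { toFun := fun φ => - ⟨(𝓋 φ), hLk (hv φ)⟩
        map_add' := fun φ ψ => Subtype.ext (by
          change - (𝓋 (φ + ψ)) = - 𝓋 φ
            + - 𝓋 ψ
          rw [map_add, map_add, Submodule.coe_add, neg_add])
        map_smul' := fun c φ => Subtype.ext (by
          change - (𝓋 (c • φ)) = c • - 𝓋 φ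
          rw [map_smul_of_tower, map_smul, Submodule.coe_smul, smul_neg]) }
    ofDer := ((modDer C S).subtype ∘ₗ secLin H K LinearMap.id a.top a.symb_eq).codRestrict TL
      fun δ => hLk (hl δ)
    unit := ⟨(unitDer C S).1, hLk (unitDer_derDeg K)⟩
    ofR_one := Subtype.ext H.ρ_one
    ofR_mul := fun g g' => Subtype.ext (H.ρ_mul g g')
    ofR_inj := fun g hg => H.ρ_inj g (by exact congrArg Subtype.val hg)
    Adeg_zero := by
      ext f
      constructor
      · intro hf
        obtain ⟨g, hg⟩ := H.wt_zero f.1 (by simpa using hf)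
        exact ⟨g, Subtype.ext hg.symm⟩
      · rintro ⟨g, rfl⟩
        exact (by simpa using H.ρ_mem g : ρ g ∈ wt h ((0 : ℕ) : ℤ))
    ofV_inj := fun φ hφ => b.nondeg' φ fun e => H.ρ_inj _ (by
      have h1 : (𝓋 φ) = 0 := neg_eq_zero.1 (congrArg Subtype.val hφ)
      rw [← H.vl_ℓ, ← secVl_symb H K, h1]; rfl)
    ofV_smul := fun g φ => Subtype.ext (by
      change - (𝓋 (g • φ))
        = DerPair.fsmul (ρ g) (- 𝓋 φ)
      rw [show DerPair.fsmul (ρ g) (- 𝓋 φ)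
        = - DerPair.fsmul (ρ g) (𝓋 φ) from map_neg (fsmulL C S (ρ g)) _]
      congr 1
      refine K.modDer_ext (Subtype.prop _) (fsmul_mem (Subtype.prop _) _) ?_ fun U => ?_
      · change (𝓋 (g • φ)).symb = ρ g • (𝓋 φ).symb
        rw [secVl_symb, secVl_symb]
        exact H.der_ext_ℓ (fun k => by simp) fun e => by simp [H.ρ_mul]
      · change _ = ρ g • (𝓋 φ).op (ρL U)
        rw [secVl_op, secVl_op, smul_zero])
    Ldeg_zero := by
      ext D
      constructor
      · intro hD
        have hD' : D.1 ∈ derDeg h hS (-1) := by simpa using hD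
        choose α hα using fun e => H.wt_zero (D.1.symb (ℓ e))
          (derDeg_symb (by norm_num) hD' (H.ℓ_mem e))
        have hρ : ∀ g, D.1.symb (ρ g) = 0 := fun g =>
          H.wt_neg (-1) (by omega) _ (derDeg_symb (by norm_num) hD' (H.ρ_mem g))
        obtain ⟨φ, hφ⟩ := b.refl'
          { toFun := α
            map_add' := fun e e' => H.ρ_eq (by
              rw [map_add, ← hα, ← hα, ← hα, map_add, map_add])
            map_smul' := fun g e => H.ρ_eq (by
              rw [RingHom.id_apply, smul_eq_mul, H.ρ_mul, ← hα, ← hα, H.ℓ_smul,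
                Derivation.leibniz, hρ, smul_zero, add_zero, smul_eq_mul]) }
        refine ⟨-φ, Subtype.ext ?_⟩
        change - 𝓋 (-φ) = D.1
        rw [map_neg, map_neg, Submodule.coe_neg, neg_neg]
        refine K.modDer_ext (Subtype.prop _) hD'.1 ?_ fun U => ?_
        · rw [secVl_symb]
          exact H.der_ext_ℓ (fun k => by simp [hρ]) fun e => by
            rw [H.vl_ℓ, ← hφ, hα]; rfl
        · rw [secVl_op, K.wtS_neg (n := -1) (by omega)
            (derDeg_op (by norm_num) hD' (K.ρL_mem U))]
      · rintro ⟨φ, rfl⟩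
        have : - 𝓋 φ ∈ derDeg h hS (((0 : ℕ) : ℤ) - 1) :=
          neg_mem (by simpa using hv φ)
        exact this
    mul_mem := fun {p q x y} hx hy => by
      have : x.1 * y.1 ∈ wt h ((p + q : ℕ) : ℤ) := by
        rw [Nat.cast_add]; exact H.mul_mem hx hy
      exact this
    smul_mem := fun hx hy => derDeg_fsmul K (by push_cast; ring) hx hy
    bracket_mem := fun hn hx hy => derDeg_bracket K (by omega) hx hy
    anchor_mem := fun {n q p x f} hn hx hf => by
      have : x.1.symb f.1 ∈ wt h (n : ℤ) := derDeg_symb (by omega) hx hf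
      exact this
    anchor_ofV_ofR := fun φ g => Subtype.ext (by
      change - ((𝓋 φ).symb (ρ g)) = 0
      rw [secVl_symb, H.vl_ρ, neg_zero])
    bracket_ofV := fun φ ψ => Subtype.ext (by
      change brL C S (- 𝓋 φ) (- 𝓋 ψ) = 0
      rw [map_neg, map_neg, LinearMap.neg_apply, neg_neg]
      refine K.modDer_ext (bracket_mem (Subtype.prop _) (Subtype.prop _)) (zero_mem _)
        (Derivation.ext fun f => ?_) fun U => ?_
      · change (⁅(𝓋 φ).symb, (𝓋 ψ).symb⁆
          : Derivation ℝ C C) f = 0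
        rw [secVl_symb, secVl_symb, commutator_apply, H.vl_comm, sub_self]
      · change (𝓋 φ).op ((𝓋 ψ).op (ρL U))
          - (𝓋 ψ).op ((𝓋 φ).op (ρL U)) = 0
        rw [secVl_op, secVl_op, map_zero, map_zero, sub_zero])
    ofW_mem := fun e => by
      have : ℓ e ∈ wt h ((1 : ℕ) : ℤ) := by simpa using H.ℓ_mem e
      exact this
    anchor_ofW := fun φ e => Subtype.ext (by
      change - ((𝓋 φ).symb (ℓ e)) = - ρ (b.pair φ e)
      rw [secVl_symb, H.vl_ℓ])
    ofDer_mem := fun δ => by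
      have : (𝓁 δ) ∈ derDeg h hS (((1 : ℕ) : ℤ) - 1) := by
        simpa using hl δ
      exact this
    ofDer_ofV := fun δ φ φ' e => Subtype.ext (by
      change brL C S (𝓁 δ) (- 𝓋 φ)
        = - 𝓋 φ'
      rw [map_neg]
      congr 1
      refine K.modDer_ext (bracket_mem (Subtype.prop _) (Subtype.prop _))
        (Subtype.prop _) ?_ fun U => ?_
      · change ⁅(𝓁 δ).symb, (𝓋 φ).symb⁆ = _
        rw [secVl_symb, secVl_symb, secLin_symb]
        refine H.der_ext_ℓ (fun g => ?_) fun w => ?_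
        · simp [commutator_apply]
        · rw [commutator_apply, H.vl_ℓ, H.lin_ℓ, H.lin_ρ, H.vl_ℓ, H.vl_ℓ, e w, map_sub]
          rfl
      · change (𝓁 δ).op ((𝓋 φ).op (ρL U))
          - (𝓋 φ).op ((𝓁 δ).op (ρL U)) = _
        rw [secVl_op, secVl_op, secLin_op, secVl_op, map_zero, sub_zero])
    anchor_ofDer := fun δ g => Subtype.ext (by
      change (𝓁 δ).symb (ρ g) = ρ (δ.1.symb g)
      rw [secLin_symb, H.lin_ρ]; rfl)
    ofDer_bracket := fun δ₁ δ₂ δ₃ e => Subtype.ext (by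
      change DerPair.bracket (𝓁 δ₁)
        (𝓁 δ₂) = (𝓁 δ₃)
      refine K.modDer_ext (bracket_mem (Subtype.prop _) (Subtype.prop _))
        (Subtype.prop _) ?_ fun U => ?_
      · rw [secLin_symb, LinearMap.id_apply, H.lin_bracket e]
        change ⁅(𝓁 δ₁).symb,
          (𝓁 δ₂).symb⁆ = _
        rw [secLin_symb, secLin_symb]; rfl
      · change (𝓁 δ₁).op
          ((𝓁 δ₂).op (ρL U))
          - (𝓁 δ₂).op
            ((𝓁 δ₁).op (ρL U)) = _
        simp only [secLin_op]
        rw [a.top_bracket δ₁ δ₂ δ₃ e, ← map_sub]; rfl)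
    ofDer_smul := fun g δ δ' e => Subtype.ext (by
      change (𝓁 δ')
        = DerPair.fsmul (ρ g) (𝓁 δ)
      refine K.modDer_ext (Subtype.prop _) (fsmul_mem (Subtype.prop _) _) ?_ fun U => ?_
      · change _ = ρ g • (𝓁 δ).symb
        rw [secLin_symb, LinearMap.id_apply, H.lin_smul e, secLin_symb]; rfl
      · change _ = ρ g • (𝓁 δ).op (ρL U)
        rw [secLin_op, secLin_op, a.top_smul g δ δ' e, ← K.ρL_smul]; rfl)
    ofDer_rank_one := fun φ e δ hs ho => Subtype.ext (by
      change (𝓁 δ)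
        = DerPair.fsmul (ρ (b.pair φ e)) (unitDer C S).1
          - fsmulL C S (ℓ e) (- 𝓋 φ)
      rw [map_neg, sub_neg_eq_add]
      refine K.modDer_ext (Subtype.prop _) (add_mem (fsmul_mem (Subtype.prop _) _)
        (fsmul_mem (Subtype.prop _) _)) ?_ fun U => ?_
      · change _ = ρ (b.pair φ e) • (0 : Derivation ℝ C C)
          + ℓ e • (𝓋 φ).symb
        rw [secLin_symb, LinearMap.id_apply, H.lin_rank_one (a := b.pair φ) (φ₀ := e) hs ho,
          secVl_symb, smul_zero, zero_add]
      · change _ = ρ (b.pair φ e) • ρL U + ℓ e • (𝓋 φ).op (ρL U)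
        rw [secLin_op, secVl_op, smul_zero, add_zero, a.top_rank_one φ e δ hs ho, K.ρL_smul])
    unit_mem := by
      have : (unitDer C S).1 ∈ derDeg h hS (((1 : ℕ) : ℤ) - 1) := by
        simpa using unitDer_derDeg K
      exact this
    anchor_unit := fun x => rfl
    bracket_unit_ofV := fun φ => Subtype.ext (Prod.ext (zero_lie (- secVl H K (b.pair φ)).1.symb)
      (sub_self _))
    bracket_unit_ofDer := fun δ => Subtype.ext (Prod.ext
      (zero_lie (𝓁 δ).symb) (sub_self _))
    unit_inj := fun g hg => H.ρ_inj g (by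
      have h2 : ∀ s : S, ρ g • s = 0 := fun s =>
        congrArg (fun D => D.1.op s) hg
      rw [K.faithful (g := g) fun U => K.ρL_inj _ (by rw [K.ρL_smul, h2]), map_zero])
    faithful_A := fun p f hf h0 => Subtype.ext (eq_zero_of_vl H hE (k := ((p + 1 : ℕ) : ℤ))
      (by omega) hf fun φ => by
        have h1 : - ((𝓋 φ).symb f.1) = 0 := congrArg Subtype.val (h0 φ)
        rwa [secVl_symb, neg_eq_zero] at h1)
    faithful_one := fun D hD h1 h2 => by
      have hD' : D.1 ∈ derDeg h hS 0 := by simpa using hD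
      have hρ : ∀ g, D.1.symb (ρ g) = 0 := fun g => congrArg Subtype.val (h2 g)
      have hs : D.1.symb = 0 := H.der_ext_ℓ hρ fun e =>
        eq_zero_of_vl H hE (k := 1) (by omega) (derDeg_symb (by norm_num) hD' (H.ℓ_mem e))
          fun φ => by
            have h3 : - DerPair.bracket D.1 (𝓋 φ) = 0 :=
              (map_neg (brL C S D.1) _).symm.trans (congrArg Subtype.val (h1 φ))
            have h4 : (⁅D.1.symb, (𝓋 φ).symb⁆ : Derivation ℝ C C) (ℓ e) = 0 :=
              congrArg (fun D => D.symb (ℓ e)) (neg_eq_zero.1 h3)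
            rw [secVl_symb, commutator_apply, H.vl_ℓ, hρ, zero_sub, neg_eq_zero] at h4
            exact h4
      obtain ⟨g, hg⟩ := K.exists_eq_smul (A := D.1.op) (fun f s => by rw [hD'.1, hs]; simp)
        fun U => derDeg_op (by norm_num) hD' (K.ρL_mem U)
      refine ⟨g, Subtype.ext (K.modDer_ext hD'.1 (fsmul_mem (unitDer C S).2 _) ?_ fun U => ?_)⟩
      · change D.1.symb = ρ g • (0 : Derivation ℝ C C)
        rw [hs, smul_zero]
      · exact hg U
    faithful_L := fun q D hD h1 h2 => Subtype.ext (by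
      have hD' : D.1 ∈ derDeg h hS (q + 1) := by
        have h3 : D.1 ∈ derDeg h hS (((q + 2 : ℕ) : ℤ) - 1) := hD
        rwa [show ((q + 2 : ℕ) : ℤ) - 1 = q + 1 by push_cast; ring] at h3
      have hρ : ∀ g, D.1.symb (ρ g) = 0 := fun g => congrArg Subtype.val (h2 g)
      have h3 : ∀ φ, DerPair.bracket D.1 (𝓋 φ) = 0 := fun φ =>
        neg_eq_zero.1 ((map_neg (brL C S D.1) _).symm.trans (congrArg Subtype.val (h1 φ)))
      refine K.modDer_ext hD'.1 (zero_mem _) (H.der_ext_ℓ hρ fun e =>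
        eq_zero_of_vl H hE (k := q + 1 + 1) (by omega) (derDeg_symb rfl hD' (H.ℓ_mem e))
          fun φ => ?_) fun U => eq_zero_of_secVl H K hE (k := q + 1) (by omega)
            (derDeg_op (by ring) hD' (K.ρL_mem U)) fun φ => ?_
      · have h4 : (⁅D.1.symb, (𝓋 φ).symb⁆ : Derivation ℝ C C) (ℓ e) = 0 :=
          congrArg (fun D : DerPair C S => D.symb (ℓ e)) (h3 φ)
        rw [secVl_symb, commutator_apply, H.vl_ℓ, hρ, zero_sub, neg_eq_zero] at h4
        exact h4
      · have h4 : D.1.op ((𝓋 φ).op (ρL U))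
            - (𝓋 φ).op (D.1.op (ρL U)) = 0 :=
          congrArg (fun D : DerPair C S => D.op (ρL U)) (h3 φ)
        rwa [secVl_op, map_zero, zero_sub, neg_eq_zero] at h4)
    sep_A := fun χ hχ x hx => Subtype.ext (H.sep χ hχ _ fun y => congrArg Subtype.val (hx y))
    sep_L := fun χ hχ x hx => Subtype.ext (Prod.ext
      (Derivation.ext fun f => H.sep χ hχ _ fun y => congrArg (fun D : TL => D.1.symb f) (hx y))
      (LinearMap.ext fun s => K.sepS χ hχ _ fun y => congrArg (fun D : TL => D.1.op s) (hx y)))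
    glue_A := fun p χ hχ f hf e => by
      obtain ⟨g, hg⟩ := H.glue χ hχ (fun x => (f x).1) fun x y => congrArg Subtype.val (e x y)
      have : g ∈ wt h (p : ℤ) := fun t ht => H.sep_eq hχ fun x => by
        rw [← H.h_ρ t, ← H.h_mul, hg, H.h_ρ, mul_smul_comm, hg]
        exact hf x t ht
      exact ⟨⟨g, hAp this⟩, this, fun x => Subtype.ext (hg x)⟩
    glue_L := fun p χ hχ x hx e => by
      obtain ⟨D, hD, hD'⟩ := glue_derDeg K hχ (fun y => (x y).1) hx
        fun y z => congrArg Subtype.val (e y z)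
      exact ⟨⟨D, hLk hD⟩, hD, fun y => Subtype.ext (hD' y)⟩
    iSup_A := by subst hA; exact iSup_comap_subtype _
    iSup_L := by
      subst hL
      rw [eq_top_iff, ← iSup_comap_subtype]
      refine iSup_le fun k => ?_
      by_cases hk : k < -1
      · intro D hD
        rw [show D = 0 from Subtype.ext (derDeg_eq_zero H K hk hD)]
        exact zero_mem _
      · refine le_iSup_of_le (k + 1).toNat ?_
        rw [show (((k + 1).toNat : ℕ) : ℤ) - 1 = k by omega]
    indep_A := iSupIndep_comap_subtype ((wt_iSupIndep h).comp
      (f := fun p : ℕ => (p : ℤ)) (fun p q e => by simpa using e)) TA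
    indep_L := iSupIndep_comap_subtype (iSupIndep_derDeg.comp
      (f := fun p : ℕ => (p : ℤ) - 1) (fun p q e => by simpa using e)) TL }

end DerModel

section Alternating

variable {n : ℕ}

lemma alternating_frame (Θ : W [⋀^Fin n]→ₗ[R] Λ) (f : Fin n → W) (s : R) (e : Fin n → W)
    (m : Fin n → Fin n → R) (he : ∀ i, s • e i = ∑ j, m i j • f j) :
    ∃ g : R, s ^ n • Θ e = g • Θ f := by
  suffices h : s ^ n • Θ e ∈ Submodule.span R {Θ f} by
    obtain ⟨g, hg⟩ := Submodule.mem_span_singleton.1 h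
    exact ⟨g, hg.symm⟩
  have h1 := Θ.toMultilinearMap.map_smul_univ (fun _ => s) e
  simp only [Finset.prod_const, Finset.card_univ, Fintype.card_fin, he] at h1
  change _ = s ^ n • Θ e at h1
  rw [← h1, MultilinearMap.map_sum]
  refine Submodule.sum_mem _ fun r _ => ?_
  rw [MultilinearMap.map_smul_univ]
  refine Submodule.smul_mem _ _ ?_
  change Θ (f ∘ r) ∈ _
  by_cases hr : Function.Injective r
  · have := Θ.map_perm f (Equiv.ofBijective r (Finite.injective_iff_bijective.1 hr))
    change Θ (f ∘ r) = _ at this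
    rw [this]
    exact Submodule.smul_of_tower_mem _ _ (Submodule.mem_span_singleton_self _)
  · rw [Θ.map_eq_zero_of_not_injective _ fun h => hr (Function.Injective.of_comp h)]
    exact zero_mem _

/-- The derivative `∑ᵢ w(e₁, …, δ eᵢ, …, eₙ)`. -/
def wedgeDer (w : W [⋀^Fin n]→ₗ[R] Λ) (δ : W → W) (e : Fin n → W) : Λ :=
  ∑ i, w (Function.update e i (δ (e i)))

lemma wedgeDer_update (w : W [⋀^Fin n]→ₗ[R] Λ) (δ : W → W) (e : Fin n → W) (i : Fin n) (v : W) :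
    wedgeDer w δ (Function.update e i v) = w (Function.update e i (δ v))
      + ∑ k ∈ Finset.univ.erase i,
        w (Function.update (Function.update e k (δ (e k))) i v) := by
  rw [wedgeDer, ← Finset.add_sum_erase _ _ (Finset.mem_univ i)]
  congr 1
  · simp
  · refine Finset.sum_congr rfl fun k hk => ?_
    have hki := Finset.ne_of_mem_erase hk
    rw [Function.update_of_ne hki, Function.update_comm hki]

lemma wedgeDer_eq_zero (w : W [⋀^Fin n]→ₗ[R] Λ) (δ : W → W) (e : Fin n → W) {i j : Fin n}
    (h : e i = e j) (hij : i ≠ j) : wedgeDer w δ e = 0 := by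
  rw [wedgeDer, ← Finset.sum_subset (Finset.subset_univ {i, j}) fun k _ hk => by
    simp only [Finset.mem_insert, Finset.mem_singleton, not_or] at hk
    refine w.map_eq_zero_of_eq _ ?_ hij
    rw [Function.update_of_ne (Ne.symm hk.1), Function.update_of_ne (Ne.symm hk.2), h],
    Finset.sum_pair hij]
  have h1 : Function.update e j (δ (e j)) = Function.update e i (δ (e i)) ∘ Equiv.swap i j := by
    funext k
    rcases eq_or_ne k i with rfl | hki
    · simp [Function.update_of_ne hij, Function.update_of_ne hij.symm, h]
    rcases eq_or_ne k j with rfl | hkj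
    · simp [h]
    · simp [Equiv.swap_apply_of_ne_of_ne hki hkj, Function.update_of_ne hki,
        Function.update_of_ne hkj]
  rw [h1, w.map_swap _ hij, add_neg_cancel]

/-- The difference of two ways to extend a derivation to exterior products. -/
def wedgeDefect (w : W [⋀^Fin n]→ₗ[R] Λ) (δ : modDer R W) (c : R) (D : Λ →ₗ[ℝ] Λ)
    (hD : ∀ (g : R) U, D (g • U) = g • D U + (c * δ.1.symb g) • U) : W [⋀^Fin n]→ₗ[R] Λ where
  toFun e := c • wedgeDer w δ.1.op e - D (w e)
  map_update_add' {inst} e i v v' := by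
    rw [Subsingleton.elim inst (instDecidableEqFin n)]
    simp only [wedgeDer_update, map_add, w.map_update_add, Finset.sum_add_distrib, smul_add]
    abel
  map_update_smul' {inst} e i g v := by
    rw [Subsingleton.elim inst (instDecidableEqFin n)]
    simp only [wedgeDer_update, δ.2 g v, w.map_update_add, w.map_update_smul, ← Finset.smul_sum,
      smul_add, hD, mul_smul, smul_sub, smul_comm c g]
    abel
  map_eq_zero_of_eq' e i j h hij := by
    rw [wedgeDer_eq_zero w _ e h hij, w.map_eq_zero_of_eq e h hij]; simp

lemma wedgeDer_bracket (w : W [⋀^Fin n]→ₗ[R] Λ) (δ₁ δ₂ : End ℝ W) (e : Fin n → W) :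
    ∑ i, wedgeDer w δ₁ (Function.update e i (δ₂ (e i)))
      - ∑ i, wedgeDer w δ₂ (Function.update e i (δ₁ (e i))) = wedgeDer w (opComm δ₁ δ₂) e := by
  simp only [wedgeDer_update, Finset.sum_add_distrib]
  have h : ∑ i, ∑ k ∈ Finset.univ.erase i,
        w (Function.update (Function.update e k (δ₁ (e k))) i (δ₂ (e i)))
      = ∑ i, ∑ k ∈ Finset.univ.erase i,
        w (Function.update (Function.update e k (δ₂ (e k))) i (δ₁ (e i))) := by
    rw [Finset.sum_sigma', Finset.sum_sigma']
    refine Finset.sum_bij' (fun a _ => ⟨a.2, a.1⟩) (fun a _ => ⟨a.2, a.1⟩) ?_ ?_ ?_ ?_ ?_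
    · simp only [Finset.mem_sigma, Finset.mem_univ, Finset.mem_erase, true_and, and_true]
      exact fun a ha => Ne.symm ha
    · simp only [Finset.mem_sigma, Finset.mem_univ, Finset.mem_erase, true_and, and_true]
      exact fun a ha => Ne.symm ha
    · intro a _; rfl
    · intro a _; rfl
    · intro a ha
      simp only [Finset.mem_sigma, Finset.mem_univ, Finset.mem_erase, true_and, and_true] at ha
      rw [Function.update_comm ha]
  rw [h, add_sub_add_right_eq_sub, ← Finset.sum_sub_distrib, wedgeDer]
  refine Finset.sum_congr rfl fun i _ => ?_
  rw [← w.map_update_sub]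
  rfl

end Alternating

open MultiPair

section Symbol

lemma nestedComm_mem_diffOp {Δ : End ℝ C} {q : ℕ} (l : List C)
    (h : Δ ∈ diffOp C (l.length + q)) : nestedComm Δ l ∈ diffOp C q := by
  induction l generalizing Δ with
  | nil => simpa [nestedComm] using h
  | cons f l ih =>
    exact ih (mem_diffOp_succ.1 (by rwa [List.length_cons, add_right_comm] at h) f)

lemma nestedComm_mul_right (c : C) (l : List C) (Δ : End ℝ C) :
    nestedComm (Δ * mulLeft ℝ c) l = nestedComm Δ l * mulLeft ℝ c := by
  induction l generalizing Δ with
  | nil => rfl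
  | cons f l ih =>
    have : opComm (Δ * mulLeft ℝ c) (mulLeft ℝ f)
        = opComm Δ (mulLeft ℝ f) * mulLeft ℝ c := by
      rw [opComm_eq, opComm_eq, sub_mul, mul_assoc, mulLeft_comm' c f, mul_assoc, mul_assoc]
    simp only [nestedComm, this, ih]

/-- The symbol of an operator is a derivation in its first argument. -/
lemma exists_symbol_derivation {Δ : End ℝ C} (l : List C)
    (h : Δ ∈ diffOp C (l.length + 1)) :
    ∃ X : Derivation ℝ C C, ∀ f, X f = nestedCommOne Δ (f :: l) := by
  refine ⟨Derivation.mk'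
    { toFun := fun f => nestedCommOne Δ (f :: l)
      map_add' := fun f g => ?_
      map_smul' := fun c f => ?_ } fun f g => ?_, fun f => rfl⟩
  · change nestedComm (commEnd Δ (LinearMap.mul ℝ C (f + g))) l 1 = _
    rw [map_add, map_add, nestedComm_add]; rfl
  · change nestedComm (commEnd Δ (LinearMap.mul ℝ C (c • f))) l 1 = _
    rw [map_smul, map_smul, nestedComm_smul]; rfl
  · change nestedComm (opComm Δ (mulLeft ℝ (f * g))) l 1
      = f * nestedComm (opComm Δ (mulLeft ℝ g)) l 1
        + g * nestedComm (opComm Δ (mulLeft ℝ f)) l 1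
    have e : mulLeft ℝ (f * g) = mulLeft ℝ f * mulLeft ℝ g :=
      LinearMap.ext fun k => mul_assoc f g k
    have h0 : nestedComm (opComm Δ (mulLeft ℝ f)) l ∈ diffOp C 0 :=
      nestedComm_mem_diffOp l (mem_diffOp_succ.1 h f)
    rw [e, opComm_mul_right, nestedComm_add, nestedComm_mul_left, nestedComm_mul_right,
      eq_mulLeft h0]
    simp only [LinearMap.add_apply, End.mul_apply, LinearMap.mulLeft_apply, mul_one]
    ring

end Symbol

section Correspondence

variable {b : DualPair M R V W} {ℓ : V →ₗ[ℝ] C} (a : TopAction Λ b) (H : LinModel b.ev ρ h ℓ)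
  (K : SecModel b.ev ρ h ρL hS)

include H in
/-- A multivector and a differential operator have the same symbol, if this is true after
insertion of functions of weight `0` and `1`. -/
lemma symb_eq_of_contr {Δ : End ℝ C} {D : MultiPair C S} (hD : D ∈ derMultivector C S)
    {l : List C} (hΔ : Δ ∈ diffOp C (l.length + 1))
    (h0 : ∀ g, (contr (ρ g) D).symb l = nestedCommOne (opComm Δ (mulLeft ℝ (ρ g))) l)
    (h1 : ∀ φ, (contr (ℓ φ) D).symb l = nestedCommOne (opComm Δ (mulLeft ℝ (ℓ φ))) l)
    (f : C) : D.symb ((f :: l : List C) : Multiset C) = nestedCommOne Δ (f :: l) := by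
  obtain ⟨X, hX⟩ := exists_symbol_derivation l hΔ
  obtain ⟨Y, hY⟩ := exists_contr_derivation hD l
  have : Y = X := H.der_ext_ℓ (fun g => by rw [hX, hY]; exact h0 g)
    fun φ => by rw [hX, hY]; exact h1 φ
  rw [← hX, ← this, hY]; rfl

include H K in
/-- Multivectors of weight `1` are determined by their symbol and their values on linear functions
and sections on the base. -/
lemma multi_ext_ℓ {D D' : MultiPair C S} (hD : D ∈ derMultivector C S ⊓ wt (tw h hS) 1)
    (hD' : D' ∈ derMultivector C S ⊓ wt (tw h hS) 1) (hs : D.symb = D'.symb)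
    (ho : ∀ (φs : List V) U, D.op ((φs.map ℓ : List C) : Multiset C) (ρL U)
      = D'.op ((φs.map ℓ : List C) : Multiset C) (ρL U)) : D = D' := by
  refine sub_eq_zero.1 (multi_ext H K (fun D => (D ∈ derMultivector C S ∧ D.symb = 0) ∧
    ∃ w : ℤ, D ∈ wt (tw h hS) w ∧ (w ≤ 0 ∨ w = 1 ∧ ∀ (φs : List V) U,
      D.op ((φs.map ℓ : List C) : Multiset C) (ρL U) = 0))
    (fun D hD => hD.1.1) ?_ ?_ (fun D hD => by rw [hD.1.2]; rfl) ?_ (D - D') ?_)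
  · rintro D ⟨⟨h1, h2⟩, w, h3, h4⟩ g
    exact ⟨⟨contr_mem h1 _, funext fun m => by rw [contr_symb, h2]; rfl⟩, w - 1,
      contr_wt (by omega) h1 (H.ρ_mem g) h3, Or.inl (by omega)⟩
  · rintro D ⟨⟨h1, h2⟩, w, h3, h4⟩ φ
    exact ⟨⟨contr_mem h1 _, funext fun m => by rw [contr_symb, h2]; rfl⟩, w,
      contr_wt (by omega) h1 (H.ℓ_mem φ) h3,
      h4.imp_right fun h => ⟨h.1, fun φs U => h.2 (φ :: φs) U⟩⟩
  · rintro D ⟨⟨h1, h2⟩, w, h3, h4 | ⟨-, h4⟩⟩ U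
    · exact K.wtS_neg (by omega) (op_zero_wt H K h3 U)
    · exact h4 [] U
  · exact ⟨⟨sub_mem hD.1 hD'.1, by rw [symb_sub, hs, sub_self]⟩, 1, sub_mem hD.2 hD'.2,
      Or.inr ⟨rfl, fun φs U => by
        rw [op_sub, Pi.sub_apply, LinearMap.sub_apply, ho, sub_self]⟩⟩

variable {TA TL : Submodule ℝ (End ℝ C)}
    {hA : TA = ⨆ p : ℕ, DODeg h p (-(p : ℤ))} {hL : TL = ⨆ q : ℕ, DODeg h q (1 - (q : ℤ))}
    {TA' TL' : Submodule ℝ (MultiPair C S)}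
    {hA' : TA' = derMultivector C S ⊓ wt (tw h hS) 0}
    {hL' : TL' = derMultivector C S ⊓ wt (tw h hS) 1}

open GradedModel

lemma relA_symb {p : ℕ} {G : TA} {P : TA'}
    (hr : (G, P) ∈ relA (doModel b H TA TL hA hL) (multiModel b a H K TA' TL' hA' hL') p)
    (l : List C) (hl : l.length = p) : P.1.symb l = nestedCommOne G.1 l := by
  induction p generalizing G P l with
  | zero =>
    obtain ⟨g, rfl, rfl⟩ := mem_relA_zero.1 hr
    obtain rfl := List.length_eq_zero_iff.1 hl
    exact (mul_one (ρ g)).symm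
  | succ p ih =>
    obtain ⟨hG, hP⟩ := relA_mem hr
    obtain _ | ⟨f, l⟩ := l
    · simp at hl
    have hl' : l.length = p := by simpa using hl
    subst hl'
    have hP' : P.1 ∈ derMultivector C S ⊓ wt (tw h hS) 0 := hA' ▸ P.2
    refine symb_eq_of_contr H hP'.1 hG.1 (fun g => ?_) (fun φ => ?_) f
    · rw [multi_wt_neg H K (w := -1) (by omega) (contr_mem hP'.1 _)
        (contr_wt (by omega) hP'.1 (H.ρ_mem g) hP'.2),
        H.diffOp_wt_lt (mem_diffOp_succ.1 hG.1 (ρ g))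
          (H.comm_wt hG.2 (H.mulLeft_wt (H.ρ_mem g))) (by push_cast; omega), nestedCommOne,
        nestedComm_zero]; rfl
    · have h1 := ih (relA_D hr φ) l rfl
      change (derBracket (cst S (ℓ φ)) P.1).symb l
        = nestedCommOne (opComm (mulLeft ℝ (ℓ φ)) G.1) l at h1
      rw [derBracket_cst_left hP'.1, opComm_anti, nestedCommOne, ← neg_one_smul ℝ (opComm _ _),
        nestedComm_smul] at h1
      exact neg_injective (h1.trans (neg_one_smul ℝ _))

lemma relL_symb {q : ℕ} {Δ : TL} {D : TL'}
    (hr : (Δ, D) ∈ relL (doModel b H TA TL hA hL) (multiModel b a H K TA' TL' hA' hL') q)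
    (l : List C) (hl : l.length = q) : D.1.symb l = nestedCommOne Δ.1 l := by
  induction q generalizing Δ D l with
  | zero =>
    obtain ⟨φ, rfl, rfl⟩ := mem_relL_zero.1 hr
    obtain rfl := List.length_eq_zero_iff.1 hl
    exact (mul_one (ℓ φ)).symm
  | succ q ih =>
    obtain ⟨hΔ, hD⟩ := relL_mem hr
    obtain _ | ⟨f, l⟩ := l
    · simp at hl
    have hl' : l.length = q := by simpa using hl
    subst hl'
    have hD' : D.1 ∈ derMultivector C S ⊓ wt (tw h hS) 1 := hL' ▸ D.2
    refine symb_eq_of_contr H hD'.1 hΔ.1 (fun g => ?_) (fun φ => ?_) f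
    · rw [← derBracket_cst hD'.1]
      exact relA_symb a H K (relL_anchor_ofR hr g) l rfl
    · rw [← derBracket_cst hD'.1]
      exact ih (relL_ad hr φ) l rfl

lemma relL_op {q : ℕ} {Δ : TL} {D : TL'}
    (hr : (Δ, D) ∈ relL (doModel b H TA TL hA hL) (multiModel b a H K TA' TL' hA' hL') (q + 1))
    (φs : List V) (hφ : φs.length = q) : ∃ (δ : modDer R W) (g : R),
      (∀ φ, ℓ ((b.dual δ).1.op φ) = nestedCommOne Δ.1 (φs.map ℓ ++ [ℓ φ])) ∧
      (∀ f, ρ (δ.1.symb f) = nestedCommOne Δ.1 (φs.map ℓ ++ [ρ f])) ∧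
      ρ g = nestedCommOne Δ.1 (φs.map ℓ) ∧
      ∀ U, D.1.op ((φs.map ℓ : List C) : Multiset C) (ρL U) = ρL ((a.top δ).1.op U + g • U) := by
  induction q generalizing Δ D φs with
  | zero =>
    obtain ⟨δ, g, rfl, rfl⟩ := mem_relL_one.1 hr
    obtain rfl := List.length_eq_zero_iff.1 hφ
    refine ⟨δ, g, fun φ => ?_, fun f => ?_, ?_, fun U => ?_⟩
    · change _ = (H.lin (b.dual δ) (ℓ φ * 1) + ρ g * (ℓ φ * 1))
        - ℓ φ * (H.lin (b.dual δ) 1 + ρ g * 1)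
      rw [Derivation.map_one_eq_zero, mul_one, H.lin_ℓ]; ring
    · change _ = (H.lin (b.dual δ) (ρ f * 1) + ρ g * (ρ f * 1))
        - ρ f * (H.lin (b.dual δ) 1 + ρ g * 1)
      rw [Derivation.map_one_eq_zero, mul_one, H.lin_ρ, b.dual_symb]; ring
    · change _ = H.lin (b.dual δ) 1 + ρ g * 1
      rw [Derivation.map_one_eq_zero, zero_add, mul_one]
    · have hdl : ∀ z : modDer R W, (b.dual z).1.symb = (a.top z).1.symb := fun z => by
        rw [a.top_symb, b.dual_symb]
      change ((der1 C S (secLin H K b.dual a.top hdl δ).1).op 0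
        + (derMul (cst S (ρ g)) (der1 C S (unitDer C S).1)).op 0) (ρL U) = _
      rw [derMul_cst, LinearMap.add_apply, der1_op_zero, secLin_op, map_add, K.ρL_smul]; rfl
  | succ q ih =>
    obtain _ | ⟨φ, φs⟩ := φs
    · simp at hφ
    have hD' : D.1 ∈ derMultivector C S ⊓ wt (tw h hS) 1 := hL' ▸ D.2
    obtain ⟨δ, g, h1, h2, h3, h4⟩ := ih (relL_ad hr φ) φs (by simpa using hφ)
    refine ⟨δ, g, h1, h2, h3, fun U => ?_⟩
    have h5 := h4 U
    change (derBracket D.1 (cst S (ℓ φ))).op _ _ = _ at h5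
    rw [derBracket_cst hD'.1] at h5
    exact h5

end Correspondence

open MultiPair GradedModel

section Correspondence

variable {C' S' : Type*} [CommRing C'] [Algebra ℝ C'] [AddCommGroup S'] [Module ℝ S']
  [Module C' S'] [IsScalarTower ℝ C' S'] {b : DualPair M R V W} {ℓ : V →ₗ[ℝ] C}
  {ρ' : R →ₗ[ℝ] C'} {h' : ℝ → C' →ₗ[ℝ] C'} {ℓ' : W →ₗ[ℝ] C'} {ρL' : Λ →ₗ[ℝ] S'}
  {hS' : ℝ → S' →ₗ[ℝ] S'} (a : TopAction Λ b) (H : LinModel b.ev ρ h ℓ)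
  (K : SecModel b.ev ρ h ρL hS) (H' : LinModel b.ev ρ' h' ℓ')
  (K' : SecModel b.ev ρ' h' ρL' hS')
  (hE : ∀ k : ℤ, ∀ f ∈ wt h' k, H'.lin (unitDer R W) f = (k : ℝ) • f)
  {TA TL : Submodule ℝ (MultiPair C S)} {hA : TA = derMultivector C S ⊓ wt (tw h hS) 0}
  {hL : TL = derMultivector C S ⊓ wt (tw h hS) 1} {TA' : Submodule ℝ C'}
  {TL' : Submodule ℝ (DerPair C' S')} {hA' : TA' = ⨆ p : ℕ, wt h' (p : ℤ)}
  {hL' : TL' = ⨆ k : ℤ, derDeg h' hS' k} {x : M} {φ : V} (q : C' →ₐ[ℝ] ℝ)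
  (hq : ∀ g, q (ρ' g) = b.ev x g) (hq' : ∀ e, q (ℓ' e) = b.ev x (b.pair φ e))

include hq hq'

lemma relA_eval (q₀ : C →ₗ[ℝ] ℝ) (h0 : ∀ g, q₀ (ρ g) = b.ev x g) {k : ℕ} {P : TA} {f : TA'}
    (hr : (P, f) ∈ relA (multiModel b a H K TA TL hA hL)
      (derModel H' K' a hE TA' TL' hA' hL') k) :
    (k.factorial : ℝ) * q f.1 = q₀ (P.1.symb (Multiset.replicate k (ℓ φ))) := by
  induction k generalizing P f with
  | zero =>
    obtain ⟨g, rfl, rfl⟩ := mem_relA_zero.1 hr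
    rw [Nat.factorial_zero, Nat.cast_one, one_mul]
    exact (hq g).trans (h0 g).symm
  | succ k ih =>
    have hP : P.1 ∈ derMultivector C S ⊓ wt (tw h hS) 0 := hA ▸ P.2
    have hf : f.1 ∈ wt h' ((k + 1 : ℕ) : ℤ) := (relA_mem hr).2
    have h1 := ih (relA_D hr φ)
    change _ * q (- ((secVl H' K' (b.pair φ)).1.symb f.1))
      = q₀ ((derBracket (cst S (ℓ φ)) P.1).symb (Multiset.replicate k (ℓ φ))) at h1
    rw [derBracket_cst_left hP.1, secVl_symb, map_neg,
      euler_eval H' hE q hq hq' hf, Int.cast_natCast] at h1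
    have h2 : (k.factorial : ℝ) * (((k + 1 : ℕ) : ℝ) * q f.1)
        = q₀ ((contr (ℓ φ) P.1).symb (Multiset.replicate k (ℓ φ))) := by
      rw [← neg_inj, ← mul_neg, ← map_neg]; exact h1
    rw [Multiset.replicate_succ, ← contr_symb, ← h2, Nat.factorial_succ]
    push_cast; ring

lemma relL_eval {Y : Type*} [AddCommGroup Y] [Module ℝ Y] (q₀ : S →ₗ[ℝ] Y) (q' : S' →ₗ[ℝ] Y)
    (hqS : ∀ f s, q' (f • s) = q f • q' s) (h0 : ∀ U, q₀ (ρL U) = q' (ρL' U)) {k : ℕ}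
    {D : TL} {D' : TL'} (hr : (D, D') ∈ relL (multiModel b a H K TA TL hA hL)
      (derModel H' K' a hE TA' TL' hA' hL') (k + 1)) (U : Λ) :
    (k.factorial : ℝ) • q' (D'.1.op (ρL' U))
      = q₀ (D.1.op (Multiset.replicate k (ℓ φ)) (ρL U)) := by
  induction k generalizing D D' with
  | zero =>
    obtain ⟨δ, g, rfl, rfl⟩ := mem_relL_one.1 hr
    have hdl : ∀ z : modDer R W, (b.dual z).1.symb = (a.top z).1.symb := fun z => by
      rw [a.top_symb, b.dual_symb]
    have hdl' : ∀ z : modDer R W, z.1.symb = (a.top z).1.symb := fun z => (a.top_symb z).symm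
    change _ • q' ((secLin H' K' LinearMap.id a.top hdl' δ).1.op (ρL' U) + ρ' g • ρL' U)
      = q₀ (((der1 C S (secLin H K b.dual a.top hdl δ).1).op 0
        + (derMul (cst S (ρ g)) (der1 C S (unitDer C S).1)).op 0) (ρL U))
    rw [derMul_cst, LinearMap.add_apply, der1_op_zero, secLin_op, secLin_op, ← K'.ρL_smul,
      ← map_add, ← h0, map_add, K.ρL_smul, Nat.factorial_zero, Nat.cast_one, one_smul]; rfl
  | succ k ih =>
    have hD : D.1 ∈ derMultivector C S ⊓ wt (tw h hS) 1 := hL ▸ D.2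
    have hD' : D'.1 ∈ derDeg h' hS' (((k + 1 + 1 : ℕ) : ℤ) - 1) := (relL_mem hr).2
    have h1 := ih (relL_ad hr φ)
    change _ • q' (D'.1.op (- (secVl H' K' (b.pair φ)).1.op (ρL' U))
        - - (secVl H' K' (b.pair φ)).1.op (D'.1.op (ρL' U)))
      = q₀ ((derBracket D.1 (cst S (ℓ φ))).op (Multiset.replicate k (ℓ φ)) (ρL U)) at h1
    rw [derBracket_cst hD.1, secVl_op, neg_zero, map_zero, zero_sub, neg_neg,
      euler_evalS H' K' hE q hq hq' q' hqS (k := ((k + 1 : ℕ) : ℤ))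
        (derDeg_op (by push_cast; ring) hD' (K'.ρL_mem U)), smul_smul] at h1
    rw [Multiset.replicate_succ, ← contr_op, ← h1, Nat.factorial_succ]
    congr 1
    push_cast; ring

omit hq hq' in
lemma relL_op_zero {D : TL} {D' : TL'} (hr : (D, D') ∈ relL (multiModel b a H K TA TL hA hL)
      (derModel H' K' a hE TA' TL' hA' hL') 0) (U : Λ) : D'.1.op (ρL' U) = 0 := by
  obtain ⟨φ, rfl, rfl⟩ := mem_relL_zero.1 hr
  change - (secVl H' K' (b.pair φ)).1.op (ρL' U) = 0
  rw [secVl_op, neg_zero]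

end Correspondence

end Algebra

section Hadamard

open MeasureTheory Set

variable {V : Type*} [NormedAddCommGroup V] [NormedSpace ℝ V]

/-- Hadamard's lemma on a convex open set. -/
theorem hadamard {U : Set V} (hU : IsOpen U) (hc : Convex ℝ U) {F : V → ℝ}
    (hF : ContDiffOn ℝ ∞ F U) {p : V} (hp : p ∈ U) :
    ∃ H : V → V →L[ℝ] ℝ, ContDiffOn ℝ ∞ H U ∧ H p = fderiv ℝ F p ∧
      ∀ z ∈ U, F z = F p + H z (z - p) := by
  let κ : ℝ → ℝ := Real.smoothTransition
  have hκ : ContDiff ℝ ∞ κ := Real.smoothTransition.contDiff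
  have hκd : ∀ s, HasDerivAt κ (deriv κ s) s := fun s =>
    (hκ.differentiable (by simp) s).hasDerivAt
  have hκc : ContDiff ℝ ∞ (deriv κ) := by
    have h := (contDiff_succ_iff_deriv (n := ∞)).1 (by simpa using hκ)
    exact h.2.2
  have hκ0 : ∀ s, s ∉ Icc (0 : ℝ) 1 → deriv κ s = 0 := fun s hs => by
    rcases not_and_or.1 hs with h | h
    · have : κ =ᶠ[nhds s] fun _ => 0 := by
        filter_upwards [Iio_mem_nhds (not_le.1 h)] with r hr
        exact Real.smoothTransition.zero_of_nonpos (le_of_lt hr)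
      rw [this.deriv_eq]; simp
    · have : κ =ᶠ[nhds s] fun _ => 1 := by
        filter_upwards [Ioi_mem_nhds (not_le.1 h)] with r hr
        exact Real.smoothTransition.one_of_one_le (le_of_lt hr)
      rw [this.deriv_eq]; simp
  have hm : ∀ z ∈ U, ∀ s, p + κ s • (z - p) ∈ U := fun z hz s =>
    hc.add_smul_sub_mem hp hz ⟨Real.smoothTransition.nonneg s, Real.smoothTransition.le_one s⟩
  have hF' : ContDiffOn ℝ ∞ (fderiv ℝ F) U := hF.fderiv_of_isOpen hU (by simp)
  let H : V → V →L[ℝ] ℝ := fun z => ∫ s, deriv κ s • fderiv ℝ F (p + κ s • (z - p))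
  have hint : ∀ z ∈ U, Continuous fun s => deriv κ s • fderiv ℝ F (p + κ s • (z - p)) :=
    fun z hz => hκc.continuous.smul (hF'.continuousOn.comp_continuous
      (continuous_const.add (hκ.continuous.smul continuous_const)) (hm z hz))
  have hsupp : ∀ z, HasCompactSupport fun s => deriv κ s • fderiv ℝ F (p + κ s • (z - p)) :=
    fun z => HasCompactSupport.intro (isCompact_Icc (a := (0 : ℝ)) (b := 1)) fun s hs => by
      rw [hκ0 s hs, zero_smul]
  have hI : ∀ z ∈ U, Integrable fun s => deriv κ s • fderiv ℝ F (p + κ s • (z - p)) :=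
    fun z hz => (hint z hz).integrable_of_hasCompactSupport (hsupp z)
  have hset : ∀ (g : ℝ → ℝ), (∀ s, s ∉ Icc (0 : ℝ) 1 → g s = 0) →
      ∫ s, g s = ∫ s in (0 : ℝ)..1, g s := fun g hg => by
    rw [intervalIntegral.integral_of_le zero_le_one, ← integral_Icc_eq_integral_Ioc,
      setIntegral_eq_integral_of_forall_compl_eq_zero hg]
  refine ⟨H, ?_, ?_, fun z hz => ?_⟩
  · have h1 := contDiffOn_convolution_right_with_param (n := ⊤) (μ := volume) (f := fun _ : ℝ => (1 : ℝ))
      (ContinuousLinearMap.lsmul ℝ ℝ : ℝ →L[ℝ] (V →L[ℝ] ℝ) →L[ℝ] V →L[ℝ] ℝ)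
      (g := fun z s => deriv κ (-s) • fderiv ℝ F (p + κ (-s) • (z - p))) (s := U)
      (k := Icc (-1) 0) hU isCompact_Icc (fun z s _ hs => by
        rw [hκ0 (-s) (fun h => hs ⟨by linarith [h.2], by linarith [h.1]⟩), zero_smul])
      (locallyIntegrable_const 1) (by
        have e1 : ContDiffOn ℝ ∞ (fun q : V × ℝ => -q.2) (U ×ˢ univ) :=
          contDiff_snd.neg.contDiffOn
        refine (hκc.comp_contDiffOn e1).smul (hF'.comp ?_ fun q hq => hm _ hq.1 _)
        exact contDiffOn_const.add ((hκ.comp_contDiffOn e1).smul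
          (contDiff_fst.contDiffOn.sub contDiffOn_const)))
    have h2 := h1.comp (contDiffOn_id.prodMk (contDiffOn_const (c := (0 : ℝ)))) (s := U)
      fun z hz => ⟨hz, mem_univ _⟩
    refine h2.congr fun z hz => ?_
    simp [H, convolution]
  · have h1 : ∫ s, deriv κ s = 1 := by
      rw [hset _ hκ0, intervalIntegral.integral_eq_sub_of_hasDerivAt (fun s _ => hκd s)
        (hκc.continuous.intervalIntegrable 0 1), show κ 1 = 1 from Real.smoothTransition.one,
        show κ 0 = 0 from Real.smoothTransition.zero, sub_zero]
    simp only [H, sub_self, smul_zero, add_zero]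
    rw [integral_smul_const, h1, one_smul]
  · have h1 : H z (z - p) = ∫ s, deriv κ s * fderiv ℝ F (p + κ s • (z - p)) (z - p) := by
      exact ContinuousLinearMap.integral_apply (hI z hz) (z - p)
    have h2 : ∀ s, HasDerivAt (fun s => F (p + κ s • (z - p)))
        (deriv κ s * fderiv ℝ F (p + κ s • (z - p)) (z - p)) s := fun s => by
      have h3 : HasDerivAt (fun s => p + κ s • (z - p)) (deriv κ s • (z - p)) s :=
        ((hκd s).smul_const (z - p)).const_add p
      have h4 := ((hF.contDiffAt (hU.mem_nhds (hm z hz s))).differentiableAt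
        (by simp)).hasFDerivAt.comp_hasDerivAt s h3
      rw [map_smul] at h4
      exact h4
    rw [h1, hset _ fun s hs => by rw [hκ0 s hs, zero_mul],
      intervalIntegral.integral_eq_sub_of_hasDerivAt (fun s _ => h2 s), show κ 1 = 1 from
        Real.smoothTransition.one, show κ 0 = 0 from Real.smoothTransition.zero]
    · simp
    · have h5 : Continuous fun s => deriv κ s * fderiv ℝ F (p + κ s • (z - p)) (z - p) :=
        hκc.continuous.mul ((hF'.continuousOn.comp_continuous
          (continuous_const.add (hκ.continuous.smul continuous_const)) (hm z hz)).clm_apply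
            continuous_const)
      exact h5.intervalIntegrable 0 1

end Hadamard

section Chart

variable {EN : Type*} [NormedAddCommGroup EN] [NormedSpace ℝ EN] {HN : Type*}
  [TopologicalSpace HN] (J : ModelWithCorners ℝ EN HN) (N : Type*) [TopologicalSpace N]
  [ChartedSpace HN N]

/-- A chart of a manifold with convex image. -/
structure ConvexChart where
  φ : N → EN
  ψ : EN → N
  O : Set N
  U : Set EN
  isOpen_O : IsOpen O
  isOpen_U : IsOpen U
  convex_U : Convex ℝ U
  mapsTo : Set.MapsTo φ O U
  mapsTo' : Set.MapsTo ψ U O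
  left_inv : ∀ p ∈ O, ψ (φ p) = p
  right_inv : ∀ z ∈ U, φ (ψ z) = z
  smooth : ContMDiffOn J 𝓘(ℝ, EN) ∞ φ O
  smooth' : ContMDiffOn 𝓘(ℝ, EN) J ∞ ψ U

variable {J N}

namespace ConvexChart

variable (c : ConvexChart J N)

lemma contDiffOn (f : Smooth J N) : ContDiffOn ℝ ∞ (f ∘ c.ψ) c.U :=
  contMDiffOn_iff_contDiffOn.1 (f.contMDiff.comp_contMDiffOn c.smooth')

lemma contDiffOn_fderiv (f : Smooth J N) (w : EN) :
    ContDiffOn ℝ ∞ (fun z => fderiv ℝ (f ∘ c.ψ) z w) c.U :=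
  ((c.contDiffOn f).fderiv_of_isOpen c.isOpen_U (by simp)).clm_apply contDiffOn_const

/-- Functions given in a chart, with a cut-off function. -/
def fn (χ : Smooth J N) (hχ : tsupport χ ⊆ c.O) (g : EN → ℝ) (hg : ContDiffOn ℝ ∞ g c.U) :
    Smooth J N :=
  ⟨fun p => χ p * g (c.φ p), contMDiff_of_tsupport fun p hp =>
    have hO : c.O ∈ nhds p := c.isOpen_O.mem_nhds (hχ (tsupport_mul_subset_left hp))
    χ.contMDiff.contMDiffAt.mul
      ((hg.contMDiffOn.comp c.smooth c.mapsTo).contMDiffAt hO)⟩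

lemma eq_zero_of_notMem {χ : Smooth J N} (hχ : tsupport χ ⊆ c.O) {p : N} (hp : p ∉ c.O) :
    χ p = 0 := image_eq_zero_of_notMem_tsupport fun h => hp (hχ h)

lemma differentiableAt (f : Smooth J N) {p : N} (hp : p ∈ c.O) :
    DifferentiableAt ℝ (f ∘ c.ψ) (c.φ p) :=
  ((c.contDiffOn f).contDiffAt (c.isOpen_U.mem_nhds (c.mapsTo hp))).differentiableAt (by simp)

/-- The derivative in the direction of a vector, with a cut-off function. -/
def der (χ : Smooth J N) (hχ : tsupport χ ⊆ c.O) (w : EN) :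
    Derivation ℝ (Smooth J N) (Smooth J N) :=
  Derivation.mk'
    { toFun := fun f => c.fn χ hχ (fun z => fderiv ℝ (f ∘ c.ψ) z w) (c.contDiffOn_fderiv f w)
      map_add' := fun f g => by
        ext p
        change χ p * fderiv ℝ (f ∘ c.ψ + g ∘ c.ψ) (c.φ p) w
          = χ p * fderiv ℝ (f ∘ c.ψ) (c.φ p) w + χ p * fderiv ℝ (g ∘ c.ψ) (c.φ p) w
        by_cases hp : p ∈ c.O
        · rw [fderiv_add (c.differentiableAt f hp) (c.differentiableAt g hp)]
          simp [mul_add]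
        · simp [c.eq_zero_of_notMem hχ hp]
      map_smul' := fun r f => by
        ext p
        change χ p * fderiv ℝ (r • (f ∘ c.ψ)) (c.φ p) w = r * (χ p * fderiv ℝ (f ∘ c.ψ) (c.φ p) w)
        by_cases hp : p ∈ c.O
        · rw [fderiv_const_smul (c.differentiableAt f hp)]
          simp; ring
        · simp [c.eq_zero_of_notMem hχ hp] }
    fun f g => by
      ext p
      change χ p * fderiv ℝ ((f ∘ c.ψ) * (g ∘ c.ψ)) (c.φ p) w
        = f p * (χ p * fderiv ℝ (g ∘ c.ψ) (c.φ p) w) + g p * (χ p * fderiv ℝ (f ∘ c.ψ) (c.φ p) w)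
      by_cases hp : p ∈ c.O
      · rw [fderiv_mul (c.differentiableAt f hp) (c.differentiableAt g hp)]
        simp [c.left_inv p hp]; ring
      · simp [c.eq_zero_of_notMem hχ hp]

lemma der_apply {χ : Smooth J N} (hχ : tsupport χ ⊆ c.O) (w : EN) (f : Smooth J N) (p : N) :
    c.der χ hχ w f p = χ p * fderiv ℝ (f ∘ c.ψ) (c.φ p) w := rfl

variable [FiniteDimensional ℝ EN]

/-- The coordinate functions, with a cut-off function. -/
def coord (χ : Smooth J N) (hχ : tsupport χ ⊆ c.O) (l : EN →ₗ[ℝ] ℝ) : Smooth J N :=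
  c.fn χ hχ l (LinearMap.toContinuousLinearMap l).contDiff.contDiffOn

/-- A derivation at a point is determined by its values on coordinate functions. -/
theorem point_der {χ : Smooth J N} (hχ : tsupport χ ⊆ c.O) {ι : Type*} [Fintype ι]
    (b : Module.Basis ι ℝ EN) {p : N} (hp : p ∈ c.O) (h1 : χ p = 1) (d : Smooth J N →ₗ[ℝ] ℝ)
    (hd : ∀ f g, d (f * g) = f p * d g + g p * d f) (h0 : d χ = 0) (f : Smooth J N) :
    d f = ∑ A, d (c.coord χ hχ (b.coord A)) * fderiv ℝ (f ∘ c.ψ) (c.φ p) (b A) := by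
  obtain ⟨H, hH, hHp, hF⟩ := hadamard c.isOpen_U c.convex_U (c.contDiffOn f) (c.mapsTo hp)
  let k : ι → Smooth J N := fun A => c.fn χ hχ (fun z => H z (b A)) (hH.clm_apply contDiffOn_const)
  have key : χ * χ * f = f p • (χ * χ)
      + ∑ A, (c.coord χ hχ (b.coord A) - b.coord A (c.φ p) • χ) * k A := by
    ext q
    have e1 : ∀ X : ι → Smooth J N, (∑ A, X A) q = ∑ A, X A q := fun X =>
      map_sum (AddMonoidHom.mk' (fun f : Smooth J N => f q) fun _ _ => rfl) X Finset.univ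
    change χ q * χ q * f q = f p * (χ q * χ q) + (∑ A, (c.coord χ hχ (b.coord A)
      - b.coord A (c.φ p) • χ) * k A) q
    rw [e1]
    change χ q * χ q * f q = f p * (χ q * χ q) + ∑ A, (χ q * b.coord A (c.φ q)
      - b.coord A (c.φ p) * χ q) * (χ q * H (c.φ q) (b A))
    by_cases hq : q ∈ c.O
    · have e2 := hF _ (c.mapsTo hq)
      simp only [Function.comp_apply, c.left_inv q hq, c.left_inv p hp] at e2
      have e3 : H (c.φ q) (c.φ q - c.φ p)
          = ∑ A, b.coord A (c.φ q - c.φ p) * H (c.φ q) (b A) := by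
        conv_lhs => rw [← b.sum_repr (c.φ q - c.φ p)]
        simp
      rw [e2, e3, mul_add, Finset.mul_sum, mul_comm (f p)]
      congr 1
      exact Finset.sum_congr rfl fun A _ => by rw [map_sub]; ring
    · simp [c.eq_zero_of_notMem hχ hq]
  have e := congrArg d key
  have hχ2 : d (χ * χ) = 0 := by rw [hd, h0]; simp
  rw [map_add, map_smul, hχ2, smul_zero, zero_add, map_sum, hd, hχ2, mul_zero, add_zero] at e
  have e4 : (χ * χ) p = 1 := by change χ p * χ p = 1; rw [h1, one_mul]
  rw [e4, one_mul] at e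
  rw [e]
  refine Finset.sum_congr rfl fun A _ => ?_
  have e5 : (c.coord χ hχ (b.coord A) - b.coord A (c.φ p) • χ) p = 0 := by
    change χ p * b.coord A (c.φ p) - b.coord A (c.φ p) * χ p = 0
    ring
  have e6 : k A p = fderiv ℝ (f ∘ c.ψ) (c.φ p) (b A) := by
    change χ p * H (c.φ p) (b A) = _
    rw [h1, one_mul, hHp]
  rw [hd, e5, e6, zero_mul, zero_add, map_sub, map_smul, h0, smul_zero, sub_zero, mul_comm]

end ConvexChart

end Chart

section Geometry

open Module (finrank finBasis)
open Bundle (TotalSpace)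

variable {EM : Type*} [NormedAddCommGroup EM] [NormedSpace ℝ EM] [FiniteDimensional ℝ EM]
  {M : Type*} [TopologicalSpace M] [ChartedSpace EM M] [IsManifold 𝓘(ℝ, EM) ∞ M] [T2Space M]
  {F : Type*} [NormedAddCommGroup F] [NormedSpace ℝ F] [FiniteDimensional ℝ F] {E : M → Type*}
  [∀ x, AddCommGroup (E x)] [∀ x, Module ℝ (E x)] [∀ x, TopologicalSpace (E x)]
  [TopologicalSpace (Bundle.TotalSpace F E)] [FiberBundle F E] [VectorBundle ℝ F E]
  [ContMDiffVectorBundle ∞ F E 𝓘(ℝ, EM)]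
  {G : Type*} [NormedAddCommGroup G] [NormedSpace ℝ G] [FiniteDimensional ℝ G] {B : M → Type*}
  [∀ x, AddCommGroup (B x)] [∀ x, Module ℝ (B x)] [∀ x, TopologicalSpace (B x)]
  [TopologicalSpace (Bundle.TotalSpace G B)] [FiberBundle G B] [VectorBundle ℝ G B]
  [ContMDiffVectorBundle ∞ G B 𝓘(ℝ, EM)]

local notation "𝒮" => Smooth 𝓘(ℝ, EM) M
local notation "Γ" => Sec (EM := EM)
local notation "ΓL" => SecL (EM := EM)
local notation "𝒯" => TotFun (EM := EM)

section BaseChart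

lemma exists_cutoff {O : Set M} (hO : IsOpen O) {x₀ : M} (hx : x₀ ∈ O) :
    ∃ η χ : 𝒮, tsupport η ⊆ O ∧ χ * η = χ ∧ χ x₀ = 1 := by
  obtain ⟨f, -, hf⟩ := (SmoothBumpFunction.nhds_basis_tsupport (I := 𝓘(ℝ, EM)) x₀).mem_iff.1
    (hO.mem_nhds hx)
  obtain ⟨g, -, hg⟩ := (SmoothBumpFunction.nhds_basis_tsupport (I := 𝓘(ℝ, EM)) x₀).mem_iff.1
    f.eventuallyEq_one
  refine ⟨⟨f, f.contMDiff⟩, ⟨g, g.contMDiff⟩, hf, ?_, g.eq_one⟩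
  ext p
  change g p * f p = g p
  by_cases hp : p ∈ tsupport g
  · have : f p = 1 := hg hp
    rw [this, mul_one]
  · rw [image_eq_zero_of_notMem_tsupport hp, zero_mul]

lemma exists_convexChart {O : Set M} (hO : IsOpen O) {x₀ : M} (hx : x₀ ∈ O) :
    ∃ c : ConvexChart 𝓘(ℝ, EM) M, x₀ ∈ c.O ∧ c.O ⊆ O := by
  have h1 : (extChartAt 𝓘(ℝ, EM) x₀).target ∩ (extChartAt 𝓘(ℝ, EM) x₀).symm ⁻¹' O
      ∈ nhds (extChartAt 𝓘(ℝ, EM) x₀ x₀) := by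
    refine Filter.inter_mem ((isOpen_extChartAt_target x₀).mem_nhds (mem_extChartAt_target x₀)) ?_
    refine (continuousAt_extChartAt_symm x₀).preimage_mem_nhds (hO.mem_nhds ?_)
    rwa [extChartAt_to_inv]
  obtain ⟨r, hr, hU⟩ := Metric.mem_nhds_iff.1 h1
  refine ⟨{
    φ := extChartAt 𝓘(ℝ, EM) x₀
    ψ := (extChartAt 𝓘(ℝ, EM) x₀).symm
    U := Metric.ball (extChartAt 𝓘(ℝ, EM) x₀ x₀) r
    O := (extChartAt 𝓘(ℝ, EM) x₀).source ∩
      extChartAt 𝓘(ℝ, EM) x₀ ⁻¹' Metric.ball (extChartAt 𝓘(ℝ, EM) x₀ x₀) r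
    isOpen_O := (continuousOn_extChartAt x₀).isOpen_inter_preimage (isOpen_extChartAt_source x₀)
      Metric.isOpen_ball
    isOpen_U := Metric.isOpen_ball
    convex_U := convex_ball _ _
    mapsTo := fun p hp => hp.2
    mapsTo' := fun z hz => ⟨(extChartAt 𝓘(ℝ, EM) x₀).map_target (hU hz).1, by
      rw [Set.mem_preimage, (extChartAt 𝓘(ℝ, EM) x₀).right_inv (hU hz).1]; exact hz⟩
    left_inv := fun p hp => (extChartAt 𝓘(ℝ, EM) x₀).left_inv hp.1
    right_inv := fun z hz => (extChartAt 𝓘(ℝ, EM) x₀).right_inv (hU hz).1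
    smooth := (contMDiffOn_extChartAt (x := x₀)).mono fun p hp => by
      rw [← extChartAt_source 𝓘(ℝ, EM)]; exact hp.1
    smooth' := (contMDiffOn_extChartAt_symm x₀).mono fun z hz => (hU hz).1 },
    ⟨mem_extChartAt_source x₀, Metric.mem_ball_self hr⟩, fun p hp => ?_⟩
  have := (hU hp.2).2
  rwa [Set.mem_preimage, (extChartAt 𝓘(ℝ, EM) x₀).left_inv hp.1] at this

end BaseChart

section BundleChart

variable (G) (B)

/-- A chart of the base over which a vector bundle is trivialized, with two cut-off functions. -/
structure BundleChart (x₀ : M) where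
  base : ConvexChart 𝓘(ℝ, EM) M
  subset : base.O ⊆ (trivializationAt G B x₀).baseSet
  η : 𝒮
  χ : 𝒮
  hη : tsupport η ⊆ base.O
  χ_mul_η : χ * η = χ
  χ_one : χ x₀ = 1

lemma exists_bundleChart (x₀ : M) :
    Nonempty (BundleChart (EM := EM) G B x₀) := by
  obtain ⟨c, hx, hc⟩ := exists_convexChart (EM := EM) (trivializationAt G B x₀).open_baseSet
    (FiberBundle.mem_baseSet_trivializationAt' x₀)
  obtain ⟨η, χ, h1, h2, h3⟩ := exists_cutoff (EM := EM) c.isOpen_O hx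
  exact ⟨⟨c, hc, η, χ, h1, h2, h3⟩⟩

variable {G B}

namespace BundleChart

variable {x₀ : M} (c : BundleChart (EM := EM) G B x₀)

lemma χ_mul_η_apply (p : M) : c.χ p * c.η p = c.χ p :=
  congrArg (fun f : 𝒮 => f p) c.χ_mul_η

lemma η_eq_one {p : M} (hp : c.χ p ≠ 0) : c.η p = 1 :=
  mul_left_cancel₀ hp (by rw [c.χ_mul_η_apply, mul_one])

lemma mem_of_η {p : M} (hp : c.η p ≠ 0) : p ∈ c.base.O := by
  by_contra h
  exact hp (c.base.eq_zero_of_notMem c.hη h)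

lemma mem_of_χ {p : M} (hp : c.χ p ≠ 0) : p ∈ c.base.O :=
  c.mem_of_η (by rw [c.η_eq_one hp]; exact one_ne_zero)

lemma hχ : tsupport c.χ ⊆ c.base.O := by
  refine Set.Subset.trans ?_ c.hη
  refine closure_mono fun p hp => ?_
  rw [Function.mem_support, c.η_eq_one hp]; exact one_ne_zero

/-- The cut-off function `η` is annihilated by derivations at points where it is locally `1`. -/
lemma der_η {p : M} (hp : c.χ p ≠ 0) (d : 𝒮 →ₗ[ℝ] ℝ)
    (hd : ∀ f g, d (f * g) = f p * d g + g p * d f) : d c.η = 0 := by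
  have h := congrArg d c.χ_mul_η
  rw [hd, c.η_eq_one hp, one_mul] at h
  exact (mul_eq_zero.1 (add_eq_right.1 h)).resolve_left hp

/-- The trivialization of the bundle over the chart. -/
abbrev T (_ : BundleChart (EM := EM) G B x₀) :
    Bundle.Trivialization G (TotalSpace.proj : TotalSpace G B → M) :=
  trivializationAt G B x₀

/-- The chart of the total space. -/
def tot : ConvexChart (𝓘(ℝ, EM).prod 𝓘(ℝ, G)) (TotalSpace G B) where
  φ e := (c.base.φ e.proj, (c.T e).2)
  ψ z := c.T.toOpenPartialHomeomorph.symm (c.base.ψ z.1, z.2)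
  O := TotalSpace.proj ⁻¹' c.base.O
  U := c.base.U ×ˢ Set.univ
  isOpen_O := c.base.isOpen_O.preimage (FiberBundle.continuous_proj G B)
  isOpen_U := c.base.isOpen_U.prod isOpen_univ
  convex_U := c.base.convex_U.prod convex_univ
  mapsTo := fun e he => ⟨c.base.mapsTo he, Set.mem_univ _⟩
  mapsTo' := fun z hz => by
    rw [Set.mem_preimage, c.T.proj_symm_apply' (c.subset (c.base.mapsTo' hz.1))]
    exact c.base.mapsTo' hz.1
  left_inv := fun e he => by
    change c.T.toOpenPartialHomeomorph.symm (c.base.ψ (c.base.φ e.proj), (c.T e).2) = e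
    rw [c.base.left_inv _ he]
    exact c.T.symm_apply_mk_proj (c.T.mem_source.2 (c.subset he))
  right_inv := fun z hz => by
    have h := c.subset (c.base.mapsTo' hz.1)
    rw [c.T.proj_symm_apply' h, c.T.apply_symm_apply' h, c.base.right_inv _ hz.1]
  smooth := by
    refine ContMDiffOn.prodMk_space (c.base.smooth.comp (t := c.base.O)
      (Bundle.contMDiff_proj B).contMDiffOn fun e he => he) ?_
    exact contMDiffOn_snd.comp (t := Set.univ) ((c.T.contMDiffOn (n := ∞)).mono fun e he =>
      c.T.mem_source.2 (c.subset he)) fun _ _ => Set.mem_univ _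
  smooth' := by
    refine (c.T.contMDiffOn_symm (n := ∞)).comp (t := c.T.target) ?_ fun z hz =>
      c.T.mem_target.2 (c.subset (c.base.mapsTo' hz.1))
    refine ContMDiffOn.prodMk (c.base.smooth'.comp (t := c.base.U) contDiff_fst.contMDiff.contMDiffOn
      fun z hz => hz.1) contDiff_snd.contMDiff.contMDiffOn

end BundleChart

end BundleChart

/-- Evaluation of smooth functions at a point. -/
def evalAt {EN : Type*} [NormedAddCommGroup EN] [NormedSpace ℝ EN] {HN : Type*}
    [TopologicalSpace HN] {J : ModelWithCorners ℝ EN HN} {N : Type*} [TopologicalSpace N]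
    [ChartedSpace HN N] (p : N) : Smooth J N →ₐ[ℝ] ℝ where
  toFun f := f p
  map_one' := rfl
  map_mul' _ _ := rfl
  map_zero' := rfl
  map_add' _ _ := rfl
  commutes' _ := rfl

section TotalSpace

@[simp] lemma scaleFun_apply (t : ℝ) (f : 𝒯 G B) (e : TotalSpace G B) :
    scaleFun G B t f e = f ⟨e.proj, t • e.2⟩ := rfl

namespace BundleChart

variable {x₀ : M} (c : BundleChart (EM := EM) G B x₀)

lemma tsupport_projFun {g : 𝒮} (hg : tsupport g ⊆ c.base.O) :
    tsupport (projFun G B g) ⊆ c.tot.O :=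
  (tsupport_comp_subset_preimage g (FiberBundle.continuous_proj G B)).trans
    (Set.preimage_mono hg)

lemma proj_ψ {y : EM} (hy : y ∈ c.base.U) (v : G) : (c.tot.ψ (y, v)).proj = c.base.ψ y :=
  c.T.proj_symm_apply' (c.subset (c.base.mapsTo' hy))

lemma φ_ψ {y : EM} (hy : y ∈ c.base.U) (v : G) : c.tot.φ (c.tot.ψ (y, v)) = (y, v) :=
  c.tot.right_inv _ ⟨hy, Set.mem_univ _⟩

lemma φ_scale {e : TotalSpace G B} (he : e.proj ∈ c.base.O) (t : ℝ) :
    c.tot.φ ⟨e.proj, t • e.2⟩ = (c.base.φ e.proj, t • (c.tot.φ e).2) := by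
  refine Prod.ext rfl ?_
  exact (c.T.linear ℝ (c.subset he)).map_smul t e.2

lemma φ_add {x : M} (hx : x ∈ c.base.O) (v w : B x) :
    (c.tot.φ ⟨x, v + w⟩).2 = (c.tot.φ ⟨x, v⟩).2 + (c.tot.φ ⟨x, w⟩).2 :=
  (c.T.linear ℝ (c.subset hx)).map_add v w

lemma scale_ψ {y : EM} (hy : y ∈ c.base.U) (t : ℝ) (v : G) :
    (⟨(c.tot.ψ (y, v)).proj, t • (c.tot.ψ (y, v)).2⟩ : TotalSpace G B)
      = c.tot.ψ (y, t • v) := by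
  have h : (c.tot.ψ (y, v)).proj ∈ c.base.O := by
    rw [c.proj_ψ hy]; exact c.base.mapsTo' hy
  rw [← c.tot.left_inv ⟨(c.tot.ψ (y, v)).proj, t • (c.tot.ψ (y, v)).2⟩ h, c.φ_scale h,
    c.φ_ψ hy, c.proj_ψ hy, c.base.right_inv _ hy]

lemma apply_scale (f : 𝒯 G B) {e : TotalSpace G B}
    (he : e.proj ∈ c.base.O) (t : ℝ) :
    f ⟨e.proj, t • e.2⟩ = (f ∘ c.tot.ψ) (c.base.φ e.proj, t • (c.tot.φ e).2) := by
  rw [← c.φ_scale he, Function.comp_apply, c.tot.left_inv ⟨e.proj, t • e.2⟩ he]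

lemma differentiableAt_tot (f : 𝒯 G B) {y : EM} (hy : y ∈ c.base.U) (v : G) :
    DifferentiableAt ℝ (f ∘ c.tot.ψ) (y, v) := by
  have h := c.tot.differentiableAt f (p := c.tot.ψ (y, v)) (c.tot.mapsTo' ⟨hy, Set.mem_univ _⟩)
  rwa [c.φ_ψ hy] at h

lemma hasDerivAt_scale (f : 𝒯 G B) {e : TotalSpace G B}
    (he : e.proj ∈ c.base.O) (t : ℝ) :
    HasDerivAt (fun t => f ⟨e.proj, t • e.2⟩) (fderiv ℝ (f ∘ c.tot.ψ)
      (c.base.φ e.proj, t • (c.tot.φ e).2) (0, (c.tot.φ e).2)) t := by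
  simp only [c.apply_scale f he]
  have h1 : HasDerivAt (fun t : ℝ => (c.base.φ e.proj, t • (c.tot.φ e).2))
      ((0 : EM), (c.tot.φ e).2) t :=
    (hasDerivAt_const _ _).prodMk (by simpa using (hasDerivAt_id t).smul_const (c.tot.φ e).2)
  exact (c.differentiableAt_tot f (c.base.mapsTo he) _).hasFDerivAt.comp_hasDerivAt t h1

end BundleChart

lemma differentiable_scale (f : 𝒯 G B) (e : TotalSpace G B) :
    Differentiable ℝ fun t : ℝ => f ⟨e.proj, t • e.2⟩ := fun t => by
  obtain ⟨c⟩ := exists_bundleChart (EM := EM) G B e.proj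
  exact (c.hasDerivAt_scale f (c.mem_of_χ (by rw [c.χ_one]; exact one_ne_zero)) t).differentiableAt

lemma wt_apply {n : ℤ} {f : 𝒯 G B} (hf : f ∈ wt (scaleFun G B) n) {t : ℝ}
    (ht : t ≠ 0) (e : TotalSpace G B) : f ⟨e.proj, t • e.2⟩ = t ^ n * f e :=
  congrArg (fun f : 𝒯 G B => f e) (hf t ht)

lemma eq_of_eq_of_ne {a b : ℝ → ℝ} (ha : Continuous a) (hb : Continuous b)
    (h : ∀ t, t ≠ 0 → a t = b t) : a = b :=
  Continuous.ext_on (dense_compl_singleton 0) ha hb fun t ht => h t ht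

lemma wt_neg_eq_zero {n : ℤ} (hn : n < 0) {f : 𝒯 G B}
    (hf : f ∈ wt (scaleFun G B) n) : f = 0 := by
  ext e
  obtain ⟨k, hk⟩ := Int.eq_ofNat_of_zero_le (by omega : 0 ≤ -n - 1)
  have h := congrFun (eq_of_eq_of_ne (a := fun t => t ^ (k + 1) * f ⟨e.proj, t • e.2⟩)
    (b := fun _ => f e) ((continuous_pow _).mul (differentiable_scale f e).continuous)
    continuous_const fun t ht => by
      rw [wt_apply hf ht, ← mul_assoc, ← zpow_natCast, ← zpow_add₀ ht,
        show ((k + 1 : ℕ) : ℤ) + n = 0 by push_cast; omega, zpow_zero, one_mul]) 0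
  simpa using h.symm

lemma wt_zero_eq {f : 𝒯 G B} (hf : f ∈ wt (scaleFun G B) 0) :
    ∃ g, f = projFun G B g := by
  refine ⟨⟨fun x => f ⟨x, 0⟩, f.contMDiff.comp (Bundle.contMDiff_zeroSection ℝ B)⟩, ?_⟩
  ext e
  have h := congrFun (eq_of_eq_of_ne (a := fun t => f ⟨e.proj, t • e.2⟩)
    (b := fun _ => f e) (differentiable_scale f e).continuous
    continuous_const fun t ht => by
      rw [wt_apply hf ht, zpow_zero, one_mul]) 0
  simp only [zero_smul] at h
  exact h.symm

lemma wt_one_smul {f : 𝒯 G B} (hf : f ∈ wt (scaleFun G B) 1) (t : ℝ)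
    (e : TotalSpace G B) : f ⟨e.proj, t • e.2⟩ = t * f e :=
  congrFun (eq_of_eq_of_ne (differentiable_scale f e).continuous (continuous_mul_const _)
    fun t ht => by rw [wt_apply hf ht, zpow_one]) t

lemma wt_one_eq_fderiv {x₀ : M} (c : BundleChart (EM := EM) G B x₀) {f : 𝒯 G B}
    (hf : f ∈ wt (scaleFun G B) 1) {e : TotalSpace G B} (he : e.proj ∈ c.base.O) :
    f e = fderiv ℝ (f ∘ c.tot.ψ) (c.base.φ e.proj, 0) (0, (c.tot.φ e).2) := by
  have h := c.hasDerivAt_scale f he 0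
  simp only [wt_one_smul hf, zero_smul] at h
  exact (hasDerivAt_mul_const (f e)).unique h

lemma wt_one_add {f : 𝒯 G B} (hf : f ∈ wt (scaleFun G B) 1) {x : M}
    (v w : B x) : f ⟨x, v + w⟩ = f ⟨x, v⟩ + f ⟨x, w⟩ := by
  obtain ⟨c⟩ := exists_bundleChart (EM := EM) G B x
  have hx : x ∈ c.base.O := c.mem_of_χ (by rw [c.χ_one]; exact one_ne_zero)
  rw [wt_one_eq_fderiv c hf hx, wt_one_eq_fderiv c hf (e := ⟨x, v⟩) hx,
    wt_one_eq_fderiv c hf (e := ⟨x, w⟩) hx, c.φ_add hx, ← map_add]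
  simp

/-- The fibre-wise linear map given by a function of weight `1`. -/
def wtOneLin {f : 𝒯 G B} (hf : f ∈ wt (scaleFun G B) 1) (x : M) : B x →ₗ[ℝ] ℝ where
  toFun v := f ⟨x, v⟩
  map_add' v w := wt_one_add hf v w
  map_smul' t v := wt_one_smul hf t ⟨x, v⟩

namespace BundleChart

variable {x₀ : M} (c : BundleChart (EM := EM) G B x₀)

lemma wt_one_ψ {f : 𝒯 G B}
    (hf : f ∈ wt (scaleFun G B) 1) {ι : Type*} [Fintype ι] (b : Module.Basis ι ℝ G) {y : EM}
    (hy : y ∈ c.base.U) (v : G) :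
    f (c.tot.ψ (y, v)) = ∑ j, b.coord j v * f (c.tot.ψ (y, b j)) := by
  have h : ∀ v, f (c.tot.ψ (y, v)) = fderiv ℝ (f ∘ c.tot.ψ) (y, 0) (0, v) := fun v => by
    have hO : (c.tot.ψ (y, v)).proj ∈ c.base.O := by
      rw [c.proj_ψ hy]; exact c.base.mapsTo' hy
    rw [wt_one_eq_fderiv c hf hO, c.φ_ψ hy, c.proj_ψ hy, c.base.right_inv _ hy]
  rw [h, Finset.sum_congr rfl fun j _ => by rw [h (b j)]]
  have e : ((0 : EM), v) = ∑ j, b.coord j v • ((0 : EM), b j) := by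
    refine Prod.ext ?_ ?_
    · simp [Prod.fst_sum]
    · simp [Prod.snd_sum, b.sum_repr]
  rw [e, map_sum]
  exact Finset.sum_congr rfl fun j _ => by rw [map_smul, smul_eq_mul]

end BundleChart

end TotalSpace

section TotalSpace

namespace BundleChart

variable {x₀ : M} (c : BundleChart (EM := EM) G B x₀)
  {ι κ : Type*} [Fintype ι] [Fintype κ] (b : Module.Basis ι ℝ EM) (b' : Module.Basis κ ℝ G)

/-- Local coordinates of the base, with a cut-off function. -/
def baseCoord (l : EM →ₗ[ℝ] ℝ) : 𝒮 := c.base.coord c.η c.hη l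

/-- Local coordinates of the fibre, with a cut-off function. -/
def fibreCoord (l : G →ₗ[ℝ] ℝ) : 𝒯 G B :=
  c.tot.coord (projFun G B c.η) (c.tsupport_projFun c.hη) (l ∘ₗ LinearMap.snd ℝ EM G)

lemma fibreCoord_apply (l : G →ₗ[ℝ] ℝ) (e : TotalSpace G B) :
    c.fibreCoord l e = c.η e.proj * l (c.tot.φ e).2 := rfl

lemma fibreCoord_mem (l : G →ₗ[ℝ] ℝ) : c.fibreCoord l ∈ wt (scaleFun G B) 1 := fun t ht => by
  ext e
  change c.fibreCoord l ⟨e.proj, t • e.2⟩ = t ^ (1 : ℤ) * c.fibreCoord l e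
  rw [fibreCoord_apply, fibreCoord_apply, zpow_one]
  by_cases he : e.proj ∈ c.base.O
  · rw [c.φ_scale he, map_smul, smul_eq_mul]; ring
  · change c.η e.proj * _ = _
    rw [c.base.eq_zero_of_notMem c.hη he]; ring

lemma coord_inl (l : EM →ₗ[ℝ] ℝ) :
    c.tot.coord (projFun G B c.η) (c.tsupport_projFun c.hη) (l ∘ₗ LinearMap.fst ℝ EM G)
      = projFun G B (c.baseCoord l) := rfl

lemma projFun_comp_ψ (g : 𝒮) {z : EM × G} (hz : z.1 ∈ c.base.U) :
    (projFun G B g ∘ c.tot.ψ) z = (g ∘ c.base.ψ) z.1 := by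
  change g (c.tot.ψ (z.1, z.2)).proj = _
  rw [c.proj_ψ hz]; rfl

lemma fderiv_projFun (g : 𝒮) {y : EM} (hy : y ∈ c.base.U) (v : G) (w : EM × G) :
    fderiv ℝ (projFun G B g ∘ c.tot.ψ) (y, v) w = fderiv ℝ (g ∘ c.base.ψ) y w.1 := by
  have h1 : projFun G B g ∘ c.tot.ψ =ᶠ[nhds (y, v)] (g ∘ c.base.ψ) ∘ Prod.fst := by
    filter_upwards [(c.base.isOpen_U.preimage continuous_fst).mem_nhds hy] with z hz
    exact c.projFun_comp_ψ g hz
  rw [h1.fderiv_eq]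
  have h2 : DifferentiableAt ℝ (g ∘ c.base.ψ) y :=
    ((c.base.contDiffOn g).contDiffAt (c.base.isOpen_U.mem_nhds hy)).differentiableAt (by simp)
  rw [HasFDerivAt.fderiv (h2.hasFDerivAt.comp (y, v) hasFDerivAt_fst)]
  rfl

/-- The horizontal and vertical vector fields of a chart, with a cut-off function. -/
def totDer (w : EM × G) : Derivation ℝ (𝒯 G B) (𝒯 G B) :=
  c.tot.der (projFun G B c.χ) (c.tsupport_projFun c.hχ) w

lemma totDer_apply (w : EM × G) (f : 𝒯 G B) (e : TotalSpace G B) :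
    c.totDer w f e = c.χ e.proj * fderiv ℝ (f ∘ c.tot.ψ) (c.tot.φ e) w := rfl

lemma totDer_projFun (w : EM × G) (g : 𝒮) (e : TotalSpace G B) :
    c.totDer w (projFun G B g) e
      = c.χ e.proj * fderiv ℝ (g ∘ c.base.ψ) (c.base.φ e.proj) w.1 := by
  rw [totDer_apply]
  by_cases he : e.proj ∈ c.base.O
  · have := c.fderiv_projFun g (c.base.mapsTo he) (c.tot.φ e).2 w
    rw [← this]; rfl
  · rw [c.base.eq_zero_of_notMem c.hχ he, zero_mul, zero_mul]

/-- Sections of the trivial frame applied to a function of weight one. -/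
def comp (f : 𝒯 G B) (v : G) : 𝒮 :=
  c.base.fn c.η c.hη (fun y => (f ∘ c.tot.ψ) (y, v)) ((c.tot.contDiffOn f).comp
    (contDiff_id.prodMk contDiff_const).contDiffOn fun _ hy => ⟨hy, Set.mem_univ _⟩)

lemma comp_apply (f : 𝒯 G B) (v : G) (p : M) :
    c.comp f v p = c.η p * f (c.tot.ψ (c.base.φ p, v)) := rfl

lemma smooth_sum_apply {EN : Type*} [NormedAddCommGroup EN] [NormedSpace ℝ EN] {HN : Type*}
    [TopologicalSpace HN] {J : ModelWithCorners ℝ EN HN} {N : Type*} [TopologicalSpace N]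
    [ChartedSpace HN N] {ι : Type*} (s : Finset ι) (X : ι → Smooth J N) (p : N) :
    (∑ i ∈ s, X i) p = ∑ i ∈ s, X i p := map_sum (evalAt (J := J) p) X s

lemma wt_one_expand {f : 𝒯 G B} (hf : f ∈ wt (scaleFun G B) 1) :
    projFun G B (c.η * c.η) * f
      = ∑ j, projFun G B (c.comp f (b' j)) * c.fibreCoord (b'.coord j) := by
  ext e
  rw [smooth_sum_apply]
  change (c.η e.proj * c.η e.proj) * f e = ∑ j, (c.η e.proj * f (c.tot.ψ (c.base.φ e.proj, b' j)))
    * (c.η e.proj * b'.coord j (c.tot.φ e).2)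
  by_cases he : e.proj ∈ c.base.O
  · have h := c.wt_one_ψ hf b' (c.base.mapsTo he) (c.tot.φ e).2
    have h2 : c.tot.ψ (c.base.φ e.proj, (c.tot.φ e).2) = e := c.tot.left_inv e he
    rw [h2] at h
    rw [h, Finset.mul_sum]
    exact Finset.sum_congr rfl fun j _ => by ring
  · simp [c.base.eq_zero_of_notMem c.hη he]

lemma fderiv_wt_one {f : 𝒯 G B} (hf : f ∈ wt (scaleFun G B) 1) {y : EM}
    (hy : y ∈ c.base.U) (v : G) (w : EM × G) :
    fderiv ℝ (f ∘ c.tot.ψ) (y, v) w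
      = ∑ j, (b'.coord j v * fderiv ℝ (fun y => (f ∘ c.tot.ψ) (y, b' j)) y w.1
        + b'.coord j w.2 * (f ∘ c.tot.ψ) (y, b' j)) := by
  have h1 : f ∘ c.tot.ψ =ᶠ[nhds (y, v)]
      fun z => ∑ j, b'.coord j z.2 * (f ∘ c.tot.ψ) (z.1, b' j) := by
    filter_upwards [(c.base.isOpen_U.preimage continuous_fst).mem_nhds hy] with z hz
    exact c.wt_one_ψ hf b' hz z.2
  have h2 : ∀ j, DifferentiableAt ℝ (fun y => (f ∘ c.tot.ψ) (y, b' j)) y := fun j =>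
    DifferentiableAt.comp (g := f ∘ c.tot.ψ) y (c.differentiableAt_tot f hy (b' j))
      (differentiableAt_id.prodMk (differentiableAt_const _))
  have h3 : ∀ j, HasFDerivAt (fun z : EM × G => b'.coord j z.2 * (f ∘ c.tot.ψ) (z.1, b' j))
      (b'.coord j v • (fderiv ℝ (fun y => (f ∘ c.tot.ψ) (y, b' j)) y ∘L
        ContinuousLinearMap.fst ℝ EM G) + (f ∘ c.tot.ψ) (y, b' j) •
        (LinearMap.toContinuousLinearMap (b'.coord j) ∘L ContinuousLinearMap.snd ℝ EM G))
        (y, v) := fun j =>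
    HasFDerivAt.mul (c := fun z : EM × G => b'.coord j z.2)
      (d := fun z : EM × G => (f ∘ c.tot.ψ) (z.1, b' j)) (x := (y, v))
      ((LinearMap.toContinuousLinearMap (b'.coord j) ∘L
        ContinuousLinearMap.snd ℝ EM G).hasFDerivAt)
      (HasFDerivAt.comp (g := fun y => (f ∘ c.tot.ψ) (y, b' j)) (f := Prod.fst) (y, v)
        (h2 j).hasFDerivAt hasFDerivAt_fst)
  rw [h1.fderiv_eq, (HasFDerivAt.fun_sum fun j _ => h3 j).fderiv, _root_.sum_apply]
  refine Finset.sum_congr rfl fun j _ => ?_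
  simp [mul_comm]

end BundleChart

end TotalSpace

section TotalSpace

lemma exists_bundleChart_mem (B) [∀ x, AddCommGroup (B x)] [∀ x, Module ℝ (B x)]
    [∀ x, TopologicalSpace (B x)] [TopologicalSpace (TotalSpace G B)] [FiberBundle G B]
    [VectorBundle ℝ G B] [ContMDiffVectorBundle ∞ G B 𝓘(ℝ, EM)] (x : M) :
    ∃ c : BundleChart (EM := EM) G B x, x ∈ c.base.O ∧ c.χ x ≠ 0 := by
  obtain ⟨c⟩ := exists_bundleChart (EM := EM) G B x
  have h : c.χ x ≠ 0 := by rw [c.χ_one]; exact one_ne_zero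
  exact ⟨c, c.mem_of_χ h, h⟩

/-- A derivation at a point of the total space which vanishes on functions of weight `0` and `1`
is zero. -/
theorem point_der_tot {e : TotalSpace G B} (d : 𝒯 G B →ₗ[ℝ] ℝ)
    (hd : ∀ f g, d (f * g) = f e * d g + g e * d f) (h0 : ∀ g, d (projFun G B g) = 0)
    (h1 : ∀ u ∈ wt (scaleFun G B) 1, d u = 0) : d = 0 := by
  obtain ⟨c, hO, hχ⟩ := exists_bundleChart_mem (EM := EM) (G := G) B e.proj
  let b := finBasis ℝ EM
  let b' := finBasis ℝ G
  refine LinearMap.ext fun f => ?_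
  rw [c.tot.point_der (c.tsupport_projFun c.hη) (b.prod b') hO (c.η_eq_one hχ) d hd (h0 _) f]
  refine Finset.sum_eq_zero fun A _ => ?_
  rcases A with a | j
  · have : (b.prod b').coord (Sum.inl a) = b.coord a ∘ₗ LinearMap.fst ℝ EM G := by
      ext z <;> simp
    rw [this, c.coord_inl, h0, zero_mul]
  · have : (b.prod b').coord (Sum.inr j) = b'.coord j ∘ₗ LinearMap.snd ℝ EM G := by
      ext z <;> simp
    rw [this]; exact mul_eq_zero_of_left (h1 _ (c.fibreCoord_mem (b'.coord j))) _

/-- Smoothness of functions given locally. -/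
lemma exists_glue {EN : Type*} [NormedAddCommGroup EN] [NormedSpace ℝ EN] {HN : Type*}
    [TopologicalSpace HN] {J : ModelWithCorners ℝ EN HN} {N : Type*} [TopologicalSpace N]
    [ChartedSpace HN N] (p : N → M) (χ : M → Smooth J N) (a : M → Smooth J N)
    (hχ : ∀ q, χ (p q) q = 1) (ha : ∀ x y q, χ y q * a x q = χ x q * a y q) :
    ∃ f : Smooth J N, ∀ x q, χ x q * f q = a x q := by
  have key : ∀ x q, χ x q * a (p q) q = a x q := fun x q => by rw [← ha, hχ, one_mul]
  refine ⟨⟨fun q => a (p q) q, fun q₀ => ?_⟩, key⟩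
  have h1 : ContMDiffAt J 𝓘(ℝ, ℝ) ∞ (fun q => a (p q₀) q / χ (p q₀) q) q₀ :=
    (a (p q₀)).contMDiff.contMDiffAt.div₀ (χ (p q₀)).contMDiff.contMDiffAt
      (by rw [hχ]; exact one_ne_zero)
  refine h1.congr_of_eventuallyEq ?_
  have h2 : ∀ᶠ q in nhds q₀, χ (p q₀) q ≠ 0 :=
    (χ (p q₀)).contMDiff.continuous.continuousAt.eventually_ne (by rw [hχ]; exact one_ne_zero)
  filter_upwards [h2] with q hq
  rw [eq_div_iff hq, mul_comm, key]

lemma tot_loc (x : M) : ∃ χ : 𝒮, evalAt x χ = 1 ∧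
    ∃ (n m : ℕ) (y : Fin n → 𝒮)
    (D : Fin n → Derivation ℝ (𝒯 G B) (𝒯 G B))
    (u : Fin m → wt (scaleFun (EM := EM) G B) 1)
    (D' : Fin m → Derivation ℝ (𝒯 G B) (𝒯 G B)),
    (∀ i t f, t ≠ 0 → scaleFun G B t (D i f) = D i (scaleFun G B t f)) ∧
    (∀ i g, D' i (projFun G B g) = 0) ∧
    ∀ Y : 𝒮 →ₗ[ℝ] 𝒯 G B,
      (∀ f g, Y (f * g) = projFun G B f * Y g + projFun G B g * Y f) →
      (∀ g, projFun G B χ * Y g = ∑ a, Y (y a) * D a (projFun G B g)) ∧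
      ∀ θ : wt (scaleFun (EM := EM) G B) 1 →ₗ[ℝ] 𝒯 G B,
        (∀ (g : 𝒮) (v w : wt (scaleFun (EM := EM) G B) 1),
          (w : 𝒯 G B) = projFun G B g * v →
          θ w = projFun G B g * θ v + Y g * v) →
        ∀ v, projFun G B χ * θ v = ∑ a, Y (y a) * D a v + ∑ i, θ (u i) * D' i v := by
  obtain ⟨c, hO, hχ⟩ := exists_bundleChart_mem (EM := EM) (G := G) B x
  let b := finBasis ℝ EM
  let b' := finBasis ℝ G
  refine ⟨c.χ, c.χ_one, _, _, fun a => c.baseCoord (b.coord a), fun a => c.totDer (b a, 0),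
    fun j => ⟨c.fibreCoord (b'.coord j), c.fibreCoord_mem _⟩, fun j => c.totDer (0, b' j),
    fun a t f ht => ?_, fun j g => ?_, fun Y hY => ?_⟩
  · ext e
    change c.totDer (b a, 0) f ⟨e.proj, t • e.2⟩ = _
    rw [c.totDer_apply, c.totDer_apply]
    change c.χ e.proj * _ = _
    by_cases he : e.proj ∈ c.base.O
    · rw [c.φ_scale he]
      congr 1
      have h1 : scaleFun G B t f ∘ c.tot.ψ =ᶠ[nhds (c.tot.φ e)]
          (f ∘ c.tot.ψ) ∘ fun z : EM × G => (z.1, t • z.2) := by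
        filter_upwards [(c.base.isOpen_U.preimage continuous_fst).mem_nhds
          (show (c.tot.φ e).1 ∈ c.base.U from c.base.mapsTo he)] with z hz
        change f ⟨_, t • (c.tot.ψ (z.1, z.2)).2⟩ = _
        rw [c.scale_ψ hz]; rfl
      have h2 : HasFDerivAt (fun z : EM × G => (z.1, t • z.2))
          ((ContinuousLinearMap.fst ℝ EM G).prod (t • ContinuousLinearMap.snd ℝ EM G))
          (c.tot.φ e) :=
        ((ContinuousLinearMap.fst ℝ EM G).prod (t • ContinuousLinearMap.snd ℝ EM G)).hasFDerivAt
      have h3 := (c.differentiableAt_tot f (c.base.mapsTo he) (t • (c.tot.φ e).2)).hasFDerivAt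
      have h4 : HasFDerivAt ((f ∘ c.tot.ψ) ∘ fun z : EM × G => (z.1, t • z.2)) _ (c.tot.φ e) :=
        HasFDerivAt.comp (g := f ∘ c.tot.ψ) (f := fun z : EM × G => (z.1, t • z.2)) (c.tot.φ e)
          h3 h2
      rw [h1.fderiv_eq, h4.fderiv]
      simp
    · rw [c.base.eq_zero_of_notMem c.hχ he, zero_mul, zero_mul]
  · ext e
    rw [c.totDer_projFun]
    simp
  · have hpt : ∀ e : TotalSpace G B, c.χ e.proj ≠ 0 → ∀ g, Y g e
        = ∑ a, Y (c.baseCoord (b.coord a)) e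
          * fderiv ℝ (g ∘ c.base.ψ) (c.base.φ e.proj) (b a) := fun e he g => by
      let d : 𝒮 →ₗ[ℝ] ℝ := (evalAt e).toLinearMap ∘ₗ Y
      have hd : ∀ f g, d (f * g) = f e.proj * d g + g e.proj * d f := fun f g =>
        congrArg (fun f : 𝒯 G B => f e) (hY f g)
      exact c.base.point_der c.hη b (c.mem_of_χ he) (c.η_eq_one he) d hd (c.der_η he d hd) g
    refine ⟨fun g => ?_, fun θ hθ v => ?_⟩
    · ext e
      rw [BundleChart.smooth_sum_apply]
      change c.χ e.proj * Y g e = ∑ a, Y (c.baseCoord (b.coord a)) e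
        * c.totDer (b a, 0) (projFun G B g) e
      by_cases he : c.χ e.proj = 0
      · simp [c.totDer_projFun, he]
      · rw [hpt e he g, Finset.mul_sum]
        refine Finset.sum_congr rfl fun a _ => ?_
        rw [c.totDer_projFun]; ring
    · ext e
      change c.χ e.proj * θ v e = (∑ a, Y (c.baseCoord (b.coord a)) * c.totDer (b a, 0) v.1) e
        + (∑ i, θ ⟨c.fibreCoord (b'.coord i), c.fibreCoord_mem _⟩ * c.totDer (0, b' i) v.1) e
      rw [BundleChart.smooth_sum_apply, BundleChart.smooth_sum_apply]
      change c.χ e.proj * θ v e = ∑ a, Y (c.baseCoord (b.coord a)) e * c.totDer (b a, 0) v.1 e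
        + ∑ i, θ ⟨c.fibreCoord (b'.coord i), c.fibreCoord_mem _⟩ e * c.totDer (0, b' i) v.1 e
      by_cases he : c.χ e.proj = 0
      · simp [c.totDer_apply, he]
      have hp := c.mem_of_χ he
      have hy := c.base.mapsTo hp
      have hη := c.η_eq_one he
      let w : Fin (finrank ℝ G) → wt (scaleFun (EM := EM) G B) 1 := fun j =>
        ⟨c.fibreCoord (b'.coord j), c.fibreCoord_mem _⟩
      let z : Fin (finrank ℝ G) → wt (scaleFun (EM := EM) G B) 1 := fun j =>
        ⟨projFun G B (c.comp v.1 (b' j)) * c.fibreCoord (b'.coord j), fun t ht => by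
          have h1 := c.fibreCoord_mem (b'.coord j) t ht
          rw [← mul_smul_comm, ← h1]; rfl⟩
      let z₀ : wt (scaleFun (EM := EM) G B) 1 :=
        ⟨projFun G B (c.η * c.η) * v, fun t ht => by
          have h1 := v.2 t ht
          rw [← mul_smul_comm, ← h1]; rfl⟩
      have hz : z₀ = ∑ j, z j := Subtype.ext (by
        rw [AddSubmonoidClass.coe_finsetSum]; exact c.wt_one_expand b' v.2)
      have h1 := congrArg (fun f : 𝒯 G B => f e) (hθ (c.η * c.η) v z₀ rfl)
      have h2 : ∀ j, θ (z j) e = _ := fun j =>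
        congrArg (fun f : 𝒯 G B => f e) (hθ (c.comp v.1 (b' j)) (w j) (z j) rfl)
      change θ z₀ e = (c.η e.proj * c.η e.proj) * θ v e + Y (c.η * c.η) e * v.1 e at h1
      have hYη : Y c.η e = 0 := c.der_η he ((evalAt e).toLinearMap ∘ₗ Y) fun f g =>
        congrArg (fun f : 𝒯 G B => f e) (hY f g)
      have hYη2 : Y (c.η * c.η) e = 0 := by
        rw [hY]
        change c.η e.proj * Y c.η e + c.η e.proj * Y c.η e = 0
        rw [hYη]; ring
      rw [hYη2, hη, one_mul, one_mul, zero_mul, add_zero, hz, map_sum,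
        BundleChart.smooth_sum_apply] at h1
      have h3 : ∀ j, θ (z j) e = (v.1 ∘ c.tot.ψ) (c.base.φ e.proj, b' j) * θ (w j) e
          + Y (c.comp v.1 (b' j)) e * b'.coord j (c.tot.φ e).2 := fun j => by
        rw [h2 j]
        change (c.comp v.1 (b' j)) e.proj * θ (w j) e + Y (c.comp v.1 (b' j)) e
          * (c.η e.proj * b'.coord j (c.tot.φ e).2) = _
        rw [c.comp_apply, hη, one_mul, one_mul]; rfl
      have h4 : ∀ j a, fderiv ℝ (c.comp v.1 (b' j) ∘ c.base.ψ) (c.base.φ e.proj) (b a)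
          = fderiv ℝ (fun y => (v.1 ∘ c.tot.ψ) (y, b' j)) (c.base.φ e.proj) (b a) := fun j a => by
        congr 1
        refine Filter.EventuallyEq.fderiv_eq ?_
        have hc : ContinuousAt (c.χ ∘ c.base.ψ) (c.base.φ e.proj) :=
          ((c.base.contDiffOn c.χ).contDiffAt (c.base.isOpen_U.mem_nhds hy)).continuousAt
        have hne : ∀ᶠ y in nhds (c.base.φ e.proj), (c.χ ∘ c.base.ψ) y ≠ 0 :=
          hc.eventually_ne (by rw [Function.comp_apply, c.base.left_inv _ hp]; exact he)
        filter_upwards [hne, c.base.isOpen_U.mem_nhds hy] with y hy1 hy2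
        rw [Function.comp_apply, c.comp_apply, c.η_eq_one hy1, one_mul, c.base.right_inv _ hy2]
        rfl
      have h5 : ∀ w : EM × G, c.totDer w v.1 e = c.χ e.proj * ∑ j, (b'.coord j (c.tot.φ e).2
          * fderiv ℝ (fun y => (v.1 ∘ c.tot.ψ) (y, b' j)) (c.base.φ e.proj) w.1
          + b'.coord j w.2 * (v.1 ∘ c.tot.ψ) (c.base.φ e.proj, b' j)) := fun w => by
        rw [c.totDer_apply]
        exact congrArg _ (c.fderiv_wt_one b' v.2 hy (c.tot.φ e).2 w)
      rw [← h1]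
      simp only [h3, h5, hpt e he (c.comp v.1 (b' _)), h4]
      simp only [map_zero, zero_mul, mul_zero, add_zero, zero_add, Finset.sum_add_distrib,
        Finset.mul_sum, mul_add, Finset.sum_mul]
      rw [add_comm]
      congr 1
      · rw [Finset.sum_comm]
        exact Finset.sum_congr rfl fun a _ => Finset.sum_congr rfl fun j _ => by ring
      · refine Finset.sum_congr rfl fun j _ => ?_
        rw [Finset.sum_eq_single j (fun i _ hi => by simp [hi]) (by simp)]
        simp [w]; ring

variable (EM G B) in
/-- The functions on the total space of a vector bundle. -/
theorem funModel : FunModel (M := M) (fun x => evalAt x) (projFun (EM := EM) G B)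
    (scaleFun G B) where
  ρ_one := rfl
  ρ_mul _ _ := rfl
  ρ_inj g hg := by
    ext x
    exact congrArg (fun f : 𝒯 G B => f ⟨x, 0⟩) hg
  h_mul _ _ _ := rfl
  h_comp s t f := by ext e; simp [smul_smul, mul_comm]
  h_id f := by ext e; simp
  h_ρ _ _ := rfl
  wt_neg n hn f hf := wt_neg_eq_zero hn hf
  wt_zero f hf := wt_zero_eq hf
  sep χ hχ f hf := by
    ext e
    have h := congrArg (fun f : 𝒯 G B => f e) (hf e.proj)
    change (χ e.proj) e.proj * f e = 0 at h
    have h1 : (χ e.proj) e.proj = 1 := hχ e.proj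
    rwa [h1, one_mul] at h
  glue χ hχ a ha := by
    obtain ⟨f, hf⟩ := exists_glue (J := 𝓘(ℝ, EM).prod 𝓘(ℝ, G)) TotalSpace.proj
      (fun x => projFun G B (χ x)) a (fun e => hχ e.proj) fun x y e =>
        congrArg (fun f : 𝒯 G B => f e) (ha x y)
    exact ⟨f, fun x => by ext e; exact hf x e⟩
  der_ext D h0 h1 := by
    ext f e
    let d : 𝒯 G B →ₗ[ℝ] ℝ := (evalAt e).toLinearMap ∘ₗ D.toLinearMap
    have hd := point_der_tot (e := e) d (fun f g => by
      change (D (f * g)) e = _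
      rw [D.leibniz]; rfl) (fun g => by
      change (D (projFun G B g)) e = 0
      rw [h0]; rfl) fun u hu => by
      change (D u) e = 0
      rw [h1 u hu]; rfl
    exact LinearMap.congr_fun hd f
  loc := tot_loc

end TotalSpace

section Frames

@[simp] lemma sec_smul_apply (g : 𝒮) (s : Γ F E) (x : M) :
    (g • s) x = g x • s x := rfl

lemma sec_sum_apply {ι : Type*} (t : Finset ι) (s : ι → Γ F E) (x : M) :
    (∑ i ∈ t, s i) x = ∑ i ∈ t, s i x :=
  map_sum (AddMonoidHom.mk' (fun s : Γ F E => s x) fun _ _ => rfl) s t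

/-- Gluing of sections. -/
lemma exists_glue_sec (χ : M → 𝒮) (a : M → Γ F E)
    (hχ : ∀ x, χ x x = 1) (ha : ∀ x y, χ y • a x = χ x • a y) :
    ∃ s : Γ F E, ∀ x, χ x • s = a x := by
  have key : ∀ x q, χ x q • a q q = a x q := fun x q => by
    have h : χ q q • a x q = χ x q • a q q :=
      congrArg (fun s : Γ F E => s q) (ha x q)
    rw [← h, hχ, one_smul]
  refine ⟨⟨fun q => a q q, fun q₀ => ?_⟩, fun x => by ext q; exact key x q⟩
  have h1 : ContMDiffAt 𝓘(ℝ, EM) 𝓘(ℝ, ℝ) ∞ (fun q => (χ q₀ q)⁻¹) q₀ :=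
    (χ q₀).contMDiff.contMDiffAt.inv₀ (by rw [hχ]; exact one_ne_zero)
  refine (h1.smul_section ((a q₀).contMDiff q₀)).congr_of_eventuallyEq ?_
  have h2 : ∀ᶠ q in nhds q₀, χ q₀ q ≠ 0 :=
    (χ q₀).contMDiff.continuous.continuousAt.eventually_ne (by rw [hχ]; exact one_ne_zero)
  filter_upwards [h2] with q hq
  have h3 : a q q = (χ q₀ q)⁻¹ • a q₀ q := by
    rw [← key q₀ q, smul_smul, inv_mul_cancel₀ hq, one_smul]
  exact congrArg (fun v => (⟨q, v⟩ : TotalSpace F E)) h3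

namespace BundleChart

variable {x₀ : M} (c : BundleChart (EM := EM) F E x₀)

/-- Sections with constant coordinates in a chart, with a cut-off function. -/
def frame (v : F) : Γ F E :=
  ⟨(c.η : M → ℝ) • fun x => c.T.symm x v, by
    refine ContMDiffOn.smul_section_of_tsupport c.η.contMDiff.contMDiffOn c.base.isOpen_O c.hη ?_
    refine (c.T.contMDiffOn_section_iff c.base.isOpen_O c.subset).2 ?_
    refine (contMDiffOn_const (c := v)).congr fun x hx => ?_
    exact congrArg Prod.snd (c.T.apply_mk_symm (c.subset hx) v)⟩

lemma frame_apply (v : F) (x : M) : c.frame v x = c.η x • c.T.symm x v := rfl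

lemma φ_frame (v : F) {x : M} (hx : x ∈ c.base.O) :
    (c.tot.φ ⟨x, c.frame v x⟩).2 = c.η x • v := by
  have h := congrArg Prod.snd (c.φ_scale (e := ⟨x, c.T.symm x v⟩) hx (c.η x))
  refine h.trans ?_
  exact congrArg (fun v => c.η x • v) (congrArg Prod.snd (c.T.apply_mk_symm (c.subset hx) v))

end BundleChart

lemma fibre_continuous {u : 𝒯 F E} (x : M) :
    Continuous fun v : E x => u ⟨x, v⟩ :=
  u.contMDiff.continuous.comp (FiberBundle.continuous_totalSpaceMk F E x)

variable [∀ x, IsTopologicalAddGroup (E x)] [∀ x, ContinuousSMul ℝ (E x)]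

/-- The section of the dual bundle corresponding to a function of weight `1`. -/
def ofWtOne {u : 𝒯 F E} (hu : u ∈ wt (scaleFun F E) 1) :
    Γ (DualModel F) (Dual E) :=
  ⟨fun x => ⟨wtOneLin hu x, fibre_continuous x⟩, fun x₀ => by
    refine (contMDiffAt_hom_bundle _).2 ⟨contMDiffAt_id, ?_⟩
    let b := finBasis ℝ F
    let T := trivializationAt F E x₀
    have hb := T.open_baseSet.mem_nhds (FiberBundle.mem_baseSet_trivializationAt' x₀)
    have h1 : ∀ j, ContMDiffAt 𝓘(ℝ, EM) 𝓘(ℝ, ℝ) ∞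
        (fun x => u (T.toOpenPartialHomeomorph.symm (x, b j))) x₀ := fun j => by
      refine u.contMDiff.contMDiffAt.comp x₀ ?_
      have h2 := (T.contMDiffOn_symm (n := ∞) (IB := 𝓘(ℝ, EM))).contMDiffAt (x := (x₀, b j))
        (T.open_target.mem_nhds (T.mem_target.2 (FiberBundle.mem_baseSet_trivializationAt' x₀)))
      exact h2.comp x₀ (contMDiffAt_id.prodMk contMDiffAt_const)
    have h3 : ContMDiffAt 𝓘(ℝ, EM) 𝓘(ℝ, F →L[ℝ] ℝ) ∞ (fun x => ∑ j,
        u (T.toOpenPartialHomeomorph.symm (x, b j)) •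
          LinearMap.toContinuousLinearMap (b.coord j)) x₀ :=
      contMDiffAt_finsetSum fun j _ => (h1 j).smul contMDiffAt_const
    refine h3.congr_of_eventuallyEq ?_
    filter_upwards [hb] with x hx
    rw [ContinuousLinearMap.inCoordinates_eq hx (Set.mem_univ _)]
    refine ContinuousLinearMap.ext fun v => ?_
    have h4 : T.symm x v = ∑ j, b.coord j v • T.symm x (b j) := by
      conv_lhs => rw [← b.sum_repr v]
      simp only [← T.symmₗ_apply (R := ℝ) hx, map_sum, map_smul, b.coord_apply]
    change wtOneLin hu x (T.symm x v) = _
    rw [h4, map_sum, _root_.sum_apply]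
    refine Finset.sum_congr rfl fun j _ => ?_
    rw [map_smul, smul_eq_mul, mul_comm]
    change u ⟨x, T.symm x (b j)⟩ * _ = u _ * _
    rw [T.mk_symm hx]
    rfl⟩

lemma ell_mem (φ : Γ (DualModel F) (Dual E)) :
    (ell φ : 𝒯 F E) ∈ wt (scaleFun F E) 1 := fun t ht => by
  ext e
  change φ e.proj (t • e.2) = t ^ (1 : ℤ) * φ e.proj e.2
  rw [map_smul, zpow_one]; rfl

variable (EM F E) in
/-- The identification of sections of the dual bundle with fibre-wise linear functions. -/
def ellLin : Γ (DualModel F) (Dual E) →ₗ[ℝ] 𝒯 F E where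
  toFun := ell
  map_add' _ _ := rfl
  map_smul' _ _ := rfl

variable (EM F E) in
/-- The pairing, as a bilinear map. -/
def pairLin : Γ (DualModel F) (Dual E) →ₗ[𝒮]
    Γ F E →ₗ[𝒮] 𝒮 :=
  LinearMap.mk₂ _ pairing (fun _ _ _ => rfl) (fun _ _ _ => rfl)
    (fun φ e e' => by ext x; exact map_add (φ x) _ _)
    (fun g φ e => by ext x; exact map_smul (φ x) _ _)

variable (EM F E) in
/-- The fibre-wise linear function on the dual bundle given by a section. -/
def ellDual : Γ F E →ₗ[ℝ] 𝒯 (DualModel F) (Dual E) where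
  toFun e := ⟨fun w => w.2 (e w.proj), by
    have h := ContMDiff.clm_bundle_apply (F₁ := F) (F₂ := ℝ) (E₁ := E) (E₂ := Bundle.Trivial M ℝ)
      (b := fun w : TotalSpace (DualModel F) (Dual E) => w.proj) (v := fun w => e w.proj)
      (ϕ := fun w => w.2) contMDiff_id
      (e.contMDiff.comp (Bundle.contMDiff_proj (IB := 𝓘(ℝ, EM)) (n := ∞) (Dual E)))
    intro x
    exact ((Bundle.contMDiffAt_totalSpace (F := ℝ) (E := Bundle.Trivial M ℝ)).1 (h x)).2⟩
  map_add' e e' := by ext w; exact map_add w.2 _ _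
  map_smul' t e := by ext w; exact map_smul w.2 _ _

namespace BundleChart

variable {x₀ : M} (c : BundleChart (EM := EM) F E x₀)

/-- The coordinate sections of the dual bundle, with a cut-off function. -/
def coframe (l : F →ₗ[ℝ] ℝ) : Γ (DualModel F) (Dual E) :=
  ofWtOne (c.fibreCoord_mem l)

lemma coframe_apply (l : F →ₗ[ℝ] ℝ) (x : M) (v : E x) :
    c.coframe l x v = c.η x * l (c.tot.φ ⟨x, v⟩).2 := rfl

lemma sum_coframe_smul_frame {κ : Type*} [Fintype κ] (b : Module.Basis κ ℝ F) (x : M) (v : E x) :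
    ∑ j, c.coframe (b.coord j) x v • c.frame (b j) x = (c.η x * c.η x) • v := by
  by_cases hx : x ∈ c.base.O
  · have h1 : c.T.symm x (c.tot.φ ⟨x, v⟩).2 = v := c.T.symm_apply_apply_mk (c.subset hx) v
    conv_rhs => rw [← h1, ← b.sum_repr (c.tot.φ ⟨x, v⟩).2]
    rw [← c.T.symmₗ_apply (R := ℝ) (c.subset hx), map_sum, Finset.smul_sum]
    refine Finset.sum_congr rfl fun j _ => ?_
    rw [map_smul, coframe_apply, frame_apply, c.T.symmₗ_apply (R := ℝ) (c.subset hx), smul_smul,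
      smul_smul]
    congr 1
    change c.η x * b.repr _ j * c.η x = _
    ring
  · simp [coframe_apply, c.base.eq_zero_of_notMem c.hη hx]

lemma sum_frame_smul_coframe {κ : Type*} [Fintype κ] (b : Module.Basis κ ℝ F) (x : M)
    (φ : Dual E x) :
    ∑ j, φ (c.frame (b j) x) • c.coframe (b.coord j) x = (c.η x * c.η x) • φ := by
  refine ContinuousLinearMap.ext fun v => ?_
  have h := congrArg φ (c.sum_coframe_smul_frame b x v)
  rw [map_sum, map_smul] at h
  refine Eq.trans ?_ h
  rw [_root_.sum_apply]
  refine Finset.sum_congr rfl fun j _ => ?_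
  rw [map_smul]
  exact mul_comm _ _

end BundleChart

end Frames

section Frames

variable [∀ x, IsTopologicalAddGroup (E x)] [∀ x, ContinuousSMul ℝ (E x)]

namespace BundleChart

variable {x₀ : M} (c : BundleChart (EM := EM) F E x₀) {κ : Type*} [Fintype κ]
  (b' : Module.Basis κ ℝ F)

lemma χ_η_η : c.χ * (c.η * c.η) = c.χ := by rw [← mul_assoc, c.χ_mul_η, c.χ_mul_η]

lemma sum_pairing_coframe_smul (e : Γ F E) :
    ∑ j, pairing (c.coframe (b'.coord j)) e • c.frame (b' j) = (c.η * c.η) • e := by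
  ext x
  rw [sec_sum_apply]
  exact c.sum_coframe_smul_frame b' x (e x)

lemma sum_pairing_frame_smul (φ : Γ (DualModel F) (Dual E)) :
    ∑ j, pairing φ (c.frame (b' j)) • c.coframe (b'.coord j) = (c.η * c.η) • φ := by
  ext1 x
  rw [sec_sum_apply]
  exact c.sum_frame_smul_coframe b' x (φ x)

/-- The coordinate vector fields of the base, with a cut-off function. -/
def baseDer (w : EM) : Derivation ℝ 𝒮 𝒮 :=
  c.base.der c.χ c.hχ w

lemma χ_mul_derivation {ι : Type*} [Fintype ι] (b : Module.Basis ι ℝ EM)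
    (Y : Derivation ℝ 𝒮 𝒮) (g : 𝒮) :
    c.χ * Y g = ∑ a, Y (c.baseCoord (b.coord a)) * c.baseDer (b a) g := by
  ext p
  rw [smooth_sum_apply]
  change c.χ p * Y g p = ∑ a, Y (c.baseCoord (b.coord a)) p * c.baseDer (b a) g p
  by_cases hp : c.χ p = 0
  · simp [baseDer, c.base.der_apply, hp]
  · let d : 𝒮 →ₗ[ℝ] ℝ := (evalAt p).toLinearMap ∘ₗ Y.toLinearMap
    have hd : ∀ f g, d (f * g) = f p * d g + g p * d f := fun f g => by
      change (Y (f * g)) p = _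
      rw [Y.leibniz]; rfl
    have h : Y g p = ∑ a, Y (c.baseCoord (b.coord a)) p
        * fderiv ℝ (g ∘ c.base.ψ) (c.base.φ p) (b a) :=
      c.base.point_der c.hη b (c.mem_of_χ hp) (c.η_eq_one hp) d hd (c.der_η hp d hd) g
    rw [h, Finset.mul_sum]
    refine Finset.sum_congr rfl fun a _ => ?_
    change _ = _ * (c.χ p * _)
    ring

lemma baseDer_mul_η (w : EM) (g : 𝒮) :
    (c.η * c.η) * c.baseDer w g = c.baseDer w g := by
  ext p
  change (c.η p * c.η p) * (c.χ p * _) = c.χ p * _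
  rw [← mul_assoc, mul_assoc (c.η p), mul_comm (c.η p) (c.χ p), c.χ_mul_η_apply,
    mul_comm (c.η p), c.χ_mul_η_apply]

/-- A derivation of the bundle with a given coordinate vector field as its symbol. -/
def secDer (w : EM) : modDer 𝒮 (Γ F E) :=
  ⟨(c.baseDer w,
    { toFun := fun e => ∑ j, c.baseDer w (pairing (c.coframe (b'.coord j)) e) • c.frame (b' j)
      map_add' := fun e e' => by
        rw [← Finset.sum_add_distrib]
        refine Finset.sum_congr rfl fun j _ => ?_
        rw [← add_smul, ← map_add, show pairing (c.coframe (b'.coord j)) (e + e') = _ from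
          map_add (pairLin EM F E _) e e']; rfl
      map_smul' := fun t e => by
        rw [RingHom.id_apply, Finset.smul_sum]
        refine Finset.sum_congr rfl fun j _ => ?_
        rw [← smul_assoc, ← Derivation.map_smul, show pairing (c.coframe (b'.coord j)) (t • e) = _
          from LinearMap.map_smul_of_tower (pairLin EM F E _) t e]; rfl }), fun g e => by
    change ∑ j, c.baseDer w (pairing (c.coframe (b'.coord j)) (g • e)) • c.frame (b' j)
      = g • ∑ j, c.baseDer w (pairing (c.coframe (b'.coord j)) e) • c.frame (b' j)
        + c.baseDer w g • e
    have h : ∀ j, pairing (c.coframe (b'.coord j)) (g • e)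
        = g * pairing (c.coframe (b'.coord j)) e := fun j => map_smul (pairLin EM F E _) g e
    simp only [h, Derivation.leibniz, smul_eq_mul, add_smul, Finset.sum_add_distrib, mul_smul,
      ← Finset.smul_sum]
    congr 1
    have h2 : c.baseDer w g • e = c.baseDer w g • ((c.η * c.η) • e) := by
      rw [smul_smul, mul_comm, c.baseDer_mul_η]
    rw [h2, ← c.sum_pairing_coframe_smul b', Finset.smul_sum]
    refine Finset.sum_congr rfl fun j _ => ?_
    rw [smul_smul, smul_smul, mul_comm]⟩

end BundleChart

variable (EM F E) in
/-- The duality between sections of a vector bundle and of its dual. -/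
def bundlePair : DualPair M 𝒮 (Γ (DualModel F) (Dual E))
    (Γ F E) where
  ev := fun x => evalAt x
  pair := pairLin EM F E
  refl f := by
    choose c hc hχ using exists_bundleChart_mem (EM := EM) (G := F) E
    let b' := finBasis ℝ F
    have h : ∀ x φ, pairing φ (∑ j, f ((c x).coframe (b'.coord j)) • (c x).frame (b' j))
        = ((c x).η * (c x).η) * f φ := fun x φ => by
      have h1 := congrArg f ((c x).sum_pairing_frame_smul b' φ)
      rw [map_sum, map_smul, smul_eq_mul] at h1
      rw [← h1]
      change pairLin EM F E φ _ = _
      rw [map_sum]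
      refine Finset.sum_congr rfl fun j _ => ?_
      rw [map_smul, map_smul, smul_eq_mul, smul_eq_mul, mul_comm]; rfl
    have hnd : ∀ e e' : Γ F E, (∀ φ, pairing φ e = pairing φ e') → e = e' :=
      fun e e' hee => by
        ext x
        have h1 := (c x).sum_coframe_smul_frame b' x (e x)
        have h2 := (c x).sum_coframe_smul_frame b' x (e' x)
        rw [(c x).η_eq_one (hχ x), mul_one, one_smul] at h1 h2
        rw [← h1, ← h2]
        refine Finset.sum_congr rfl fun j _ => ?_
        exact congrArg (fun r => r • _)
          (congrArg (fun f : 𝒮 => f x) (hee ((c x).coframe (b'.coord j))))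
    obtain ⟨e, he⟩ := exists_glue_sec (fun x => (c x).η * (c x).η)
      (fun x => ∑ j, f ((c x).coframe (b'.coord j)) • (c x).frame (b' j))
      (fun x => by
        change (c x).η x * (c x).η x = 1
        rw [(c x).η_eq_one (hχ x), mul_one]) fun x y => hnd _ _ fun φ => by
      change pairLin EM F E φ _ = pairLin EM F E φ _
      rw [map_smul, map_smul]
      change _ • pairing φ _ = _ • pairing φ _
      rw [h, h, smul_eq_mul, smul_eq_mul]; ring
    refine ⟨e, fun φ => ?_⟩
    ext x
    have h1 := congrArg (fun g : 𝒮 => g x) (h x φ)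
    rw [← he x] at h1
    change φ x (((c x).η x * (c x).η x) • e x) = ((c x).η x * (c x).η x) * f φ x at h1
    rw [(c x).η_eq_one (hχ x), mul_one, one_smul, one_mul] at h1
    exact h1.symm
  refl' f := by
    choose c hc hχ using exists_bundleChart_mem (EM := EM) (G := F) E
    let b' := finBasis ℝ F
    have h : ∀ x e, pairing (∑ j, f ((c x).frame (b' j)) • (c x).coframe (b'.coord j)) e
        = ((c x).η * (c x).η) * f e := fun x e => by
      have h1 := congrArg f ((c x).sum_pairing_coframe_smul b' e)
      rw [map_sum, map_smul, smul_eq_mul] at h1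
      rw [← h1]
      change (pairLin EM F E).flip e _ = _
      rw [map_sum]
      refine Finset.sum_congr rfl fun j _ => ?_
      rw [map_smul, map_smul, smul_eq_mul, smul_eq_mul, mul_comm]; rfl
    obtain ⟨φ, hφ⟩ := exists_glue_sec (fun x => (c x).η * (c x).η)
      (fun x => ∑ j, f ((c x).frame (b' j)) • (c x).coframe (b'.coord j))
      (fun x => by
        change (c x).η x * (c x).η x = 1
        rw [(c x).η_eq_one (hχ x), mul_one]) fun x y => by
      refine ContMDiffSection.ext fun z => ContinuousLinearMap.ext fun v => ?_
      have hz : v = (((c z).η * (c z).η) • (∑ j, (c z).coframe (b'.coord j) z v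
          • (c z).frame (b' j)) : Γ F E) z := by
        rw [sec_smul_apply, sec_sum_apply]
        have h1 := (c z).sum_coframe_smul_frame b' z v
        change v = ((c z).η z * (c z).η z) • ∑ j, (c z).coframe (b'.coord j) z v
          • (c z).frame (b' j) z
        rw [h1, (c z).η_eq_one (hχ z), mul_one, one_smul, one_smul]
      rw [hz]
      generalize (((c z).η * (c z).η) • (∑ j, (c z).coframe (b'.coord j) z v
          • (c z).frame (b' j)) : Γ F E) = w
      have h2 : (c y).η * (c y).η * pairing (∑ j, f ((c x).frame (b' j))
          • (c x).coframe (b'.coord j)) w = (c x).η * (c x).η * pairing (∑ j, f ((c y).frame (b' j))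
          • (c y).coframe (b'.coord j)) w := by rw [h, h]; ring
      exact congrArg (fun g : 𝒮 => g z) h2
    refine ⟨φ, fun e => ?_⟩
    ext x
    have h1 := congrArg (fun g : 𝒮 => g x) (h x e)
    rw [← hφ x] at h1
    change ((c x).η x * (c x).η x) * φ x (e x) = ((c x).η x * (c x).η x) * f e x at h1
    rw [(c x).η_eq_one (hχ x), mul_one, one_mul, one_mul] at h1
    exact h1.symm
  nondeg e he := by
    ext x
    obtain ⟨c, hc, hχ⟩ := exists_bundleChart_mem (EM := EM) (G := F) E x
    have h := c.sum_coframe_smul_frame (finBasis ℝ F) x (e x)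
    rw [c.η_eq_one hχ, mul_one, one_smul] at h
    rw [← h]
    refine Finset.sum_eq_zero fun j _ => ?_
    have h1 : c.coframe ((finBasis ℝ F).coord j) x (e x) = 0 :=
      congrArg (fun f : 𝒮 => f x) (he (c.coframe ((finBasis ℝ F).coord j)))
    rw [h1, zero_smul]
  nondeg' φ hφ := by
    ext1 x
    obtain ⟨c, hc, hχ⟩ := exists_bundleChart_mem (EM := EM) (G := F) E x
    have h := c.sum_frame_smul_coframe (finBasis ℝ F) x (φ x)
    rw [c.η_eq_one hχ, mul_one, one_smul] at h
    rw [← h]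
    refine Finset.sum_eq_zero fun j _ => ?_
    have h1 : φ x (c.frame (finBasis ℝ F j) x) = 0 :=
      congrArg (fun f : 𝒮 => f x) (hφ (c.frame (finBasis ℝ F j)))
    rw [h1, zero_smul]
  loc x := by
    obtain ⟨c, hc, hχ⟩ := exists_bundleChart_mem (EM := EM) (G := F) E x
    let b := finBasis ℝ EM
    let b' := finBasis ℝ F
    refine ⟨c.χ, c.χ_one, ⟨_, fun j => c.frame (b' j), fun j => c.χ • c.coframe (b'.coord j),
      fun φ => ?_⟩, _, fun a => c.baseCoord (b.coord a), fun a => c.secDer b' (b a),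
      fun Y g => c.χ_mul_derivation b Y g⟩
    simp only [smul_comm _ c.χ, ← Finset.smul_sum]
    have h := c.sum_pairing_frame_smul b' φ
    change _ = c.χ • ∑ j, pairing φ (c.frame (b' j)) • c.coframe (b'.coord j)
    rw [h, smul_smul, c.χ_η_η]

variable (EM F E) in
/-- Functions on the total space of a vector bundle. -/
theorem linModel : LinModel (bundlePair EM F E).ev (projFun F E) (scaleFun F E)
    (ellLin EM F E) where
  toFunModel := funModel EM F E
  ℓ_smul _ _ := rfl
  ℓ_inj φ hφ := by
    refine ContMDiffSection.ext fun x => ContinuousLinearMap.ext fun v => ?_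
    exact congrArg (fun f : 𝒯 F E => f ⟨x, v⟩) hφ
  ℓ_mem := ell_mem
  wt_one u hu := ⟨ofWtOne hu, rfl⟩

lemma ellDual_mem (e : Γ F E) :
    ellDual EM F E e ∈ wt (scaleFun (DualModel F) (Dual E)) 1 := fun t ht => by
  ext w
  change (t • w.2) (e w.proj) = t ^ (1 : ℤ) * w.2 (e w.proj)
  rw [zpow_one]; rfl

lemma exists_ellDual {u : 𝒯 (DualModel F) (Dual E)}
    (hu : u ∈ wt (scaleFun (DualModel F) (Dual E)) 1) : ∃ e, u = ellDual EM F E e := by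
  let f : Γ (DualModel F) (Dual E) →ₗ[𝒮] 𝒮 :=
    { toFun := fun φ => ⟨fun x => u ⟨x, φ x⟩, u.contMDiff.comp φ.contMDiff⟩
      map_add' := fun φ ψ => by ext x; exact (wtOneLin hu x).map_add (φ x) (ψ x)
      map_smul' := fun g φ => by ext x; exact (wtOneLin hu x).map_smul (g x) (φ x) }
  obtain ⟨e, he⟩ := (bundlePair EM F E).refl f
  refine ⟨e, ?_⟩
  ext w
  obtain ⟨c, hc, hχ⟩ := exists_bundleChart_mem (EM := EM) (G := F) E w.proj
  let b' := finBasis ℝ F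
  have h1 := c.sum_frame_smul_coframe b' w.proj w.2
  rw [c.η_eq_one hχ, mul_one, one_smul] at h1
  have h2 : ∀ j, wtOneLin hu w.proj (c.coframe (b'.coord j) w.proj)
      = c.coframe (b'.coord j) w.proj (e w.proj) := fun j =>
    congrArg (fun g : 𝒮 => g w.proj) (he (c.coframe (b'.coord j)))
  change wtOneLin hu w.proj w.2 = w.2 (e w.proj)
  rw [← h1, map_sum, _root_.sum_apply]
  refine Finset.sum_congr rfl fun j _ => ?_
  rw [map_smul, h2]; rfl

variable (EM F E) in
/-- Functions on the total space of the dual of a vector bundle. -/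
theorem linModelDual : LinModel (bundlePair EM F E).ev (projFun (DualModel F) (Dual E))
    (scaleFun (DualModel F) (Dual E)) (ellDual EM F E) where
  toFunModel := funModel EM (DualModel F) (Dual E)
  ℓ_smul g e := by
    ext w
    exact map_smul w.2 _ _
  ℓ_inj e he := (bundlePair EM F E).nondeg e fun φ => by
    ext x
    exact congrArg (fun f : 𝒯 (DualModel F) (Dual E) => f ⟨x, φ x⟩) he
  ℓ_mem := ellDual_mem
  wt_one u hu := exists_ellDual hu

end Frames

section TopPower

variable (F) in
/-- The coordinate on the top exterior power of a vector space. -/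
def topForm : ⋀[ℝ]^(finrank ℝ F) F →ₗ[ℝ] ℝ :=
  exteriorPower.alternatingMapLinearEquiv (finBasis ℝ F).det

lemma topForm_ιMulti (v : Fin (finrank ℝ F) → F) :
    topForm F (exteriorPower.ιMulti ℝ _ v) = (finBasis ℝ F).det v :=
  exteriorPower.alternatingMapLinearEquiv_apply_ιMulti _ _

lemma topForm_smul (τ : ⋀[ℝ]^(finrank ℝ F) F) :
    topForm F τ • exteriorPower.ιMulti ℝ _ (finBasis ℝ F) = τ := by
  have h : (LinearMap.toSpanSingleton ℝ _ (exteriorPower.ιMulti ℝ _ (finBasis ℝ F)))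
      ∘ₗ topForm F = LinearMap.id := by
    refine exteriorPower.linearMap_ext ?_
    refine Module.Basis.ext_alternating (finBasis ℝ F) fun v hv => ?_
    obtain ⟨σ, rfl⟩ : ∃ σ : Equiv.Perm (Fin (finrank ℝ F)), v = σ :=
      ⟨Equiv.ofBijective v (Finite.injective_iff_bijective.1 hv), rfl⟩
    change topForm F (exteriorPower.ιMulti ℝ _ fun i => finBasis ℝ F (σ i)) • _
      = exteriorPower.ιMulti ℝ _ fun i => finBasis ℝ F (σ i)
    rw [topForm_ιMulti, show (fun i => finBasis ℝ F (σ i)) = finBasis ℝ F ∘ σ from rfl,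
      AlternatingMap.map_perm, AlternatingMap.map_perm, Module.Basis.det_self]
    simp
  exact LinearMap.congr_fun h τ

end TopPower

section TopSections

variable {EN : Type*} [NormedAddCommGroup EN] [NormedSpace ℝ EN] {HN : Type*} [TopologicalSpace HN]
  {J : ModelWithCorners ℝ EN HN} {N : Type*} [TopologicalSpace N] [ChartedSpace HN N]

lemma topTriv_symm {x₀ x : M} (hx : x ∈ (trivializationAt F E x₀).baseSet) (u : TopFib F E x) :
    exteriorPower.map _ ((trivializationAt F E x₀).symmₗ ℝ x) (topTriv F E x₀ x u) = u := by
  have h : (trivializationAt F E x₀).symmₗ ℝ x ∘ₗ (trivializationAt F E x₀).linearMapAt ℝ x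
      = LinearMap.id :=
    LinearMap.ext fun v => (trivializationAt F E x₀).symmₗ_linearMapAt hx v
  rw [topTriv, ← LinearMap.comp_apply, ← exteriorPower.map_comp, h, exteriorPower.map_id]
  rfl

/-- The coordinate of a section of the top exterior power in a trivialization. -/
lemma contMDiffAt_topForm {g : N → M} (hg : ContMDiff J 𝓘(ℝ, EM) ∞ g) (s : TopSec F E J g)
    {x₀ : M} {p₀ : N} (hp : g p₀ ∈ (trivializationAt F E x₀).baseSet) :
    ContMDiffAt J 𝓘(ℝ, ℝ) ∞ (fun p => topForm F (topTriv F E x₀ (g p) (s.1 p))) p₀ := by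
  let T₀ := trivializationAt F E x₀
  let T₁ := trivializationAt F E (g p₀)
  let b := finBasis ℝ F
  have h₁ : g p₀ ∈ T₁.baseSet := FiberBundle.mem_baseSet_trivializationAt' _
  have hv : ∀ i, ContMDiffAt J 𝓘(ℝ, F) ∞
      (fun p => (T₀ (T₁.toOpenPartialHomeomorph.symm (g p, b i))).2) p₀ := fun i => by
    have a1 : ContMDiffAt J (𝓘(ℝ, EM).prod 𝓘(ℝ, F)) ∞ (fun p => (g p, b i)) p₀ :=
      hg.contMDiffAt.prodMk contMDiffAt_const
    have a2 := (T₁.contMDiffOn_symm (n := ∞) (IB := 𝓘(ℝ, EM))).contMDiffAt (x := (g p₀, b i))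
      (T₁.open_target.mem_nhds (T₁.mem_target.2 h₁))
    have hs : T₁.toOpenPartialHomeomorph.symm (g p₀, b i) ∈ T₀.source := by
      rw [T₀.mem_source, T₁.proj_symm_apply' h₁]; exact hp
    have a3 := (T₀.contMDiffOn (n := ∞) (IB := 𝓘(ℝ, EM))).contMDiffAt
      (T₀.open_source.mem_nhds hs)
    exact contMDiffAt_snd.comp p₀ (a3.comp p₀ (a2.comp p₀ a1))
  have h2 : ContMDiffAt J 𝓘(ℝ, ℝ) ∞ (fun p => topForm F (topTriv F E (g p₀) (g p) (s.1 p))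
      * b.det fun i => (T₀ (T₁.toOpenPartialHomeomorph.symm (g p, b i))).2) p₀ :=
    (s.2 p₀ (topForm F)).mul (contMDiffAt_alternating b.det _ p₀ hv)
  refine h2.congr_of_eventuallyEq ?_
  have e0 : ∀ᶠ p in nhds p₀, g p ∈ T₀.baseSet :=
    hg.continuous.continuousAt.eventually (T₀.open_baseSet.mem_nhds hp)
  have e1 : ∀ᶠ p in nhds p₀, g p ∈ T₁.baseSet :=
    hg.continuous.continuousAt.eventually (T₁.open_baseSet.mem_nhds h₁)
  filter_upwards [e0, e1] with p hp0 hp1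
  conv_lhs => rw [← topTriv_symm hp1 (s.1 p), ← topForm_smul (topTriv F E (g p₀) (g p) (s.1 p))]
  rw [map_smul, map_smul, map_smul, smul_eq_mul]
  congr 1
  rw [exteriorPower.map_apply_ιMulti, topTriv, exteriorPower.map_apply_ιMulti, topForm_ιMulti]
  congr 1
  funext i
  change T₀.linearMapAt ℝ (g p) (T₁.symmₗ ℝ (g p) (b i)) = _
  rw [T₁.symmₗ_apply (R := ℝ) hp1, T₀.coe_linearMapAt_of_mem hp0]
  exact congrArg (fun z => (T₀ z).2) (T₁.mk_symm hp1 (b i))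

namespace BundleChart

variable {x₀ : M} (c : BundleChart (EM := EM) F E x₀)

/-- The coordinate of a section of the top exterior power, with a cut-off function. -/
def topCoord {g : N → M} (hg : ContMDiff J 𝓘(ℝ, EM) ∞ g) :
    TopSec F E J g →ₗ[Smooth J N] Smooth J N where
  toFun s := ⟨fun p => c.η (g p) * topForm F (topTriv F E x₀ (g p) (s.1 p)),
    contMDiff_of_tsupport fun p hp => by
      have h1 : tsupport (fun p => c.η (g p)) ⊆ g ⁻¹' tsupport c.η :=
        tsupport_comp_subset_preimage c.η hg.continuous
      exact (c.η.contMDiff.comp hg).contMDiffAt.mul (contMDiffAt_topForm hg s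
        (c.subset (c.hη (h1 (tsupport_mul_subset_left hp)))))⟩
  map_add' s s' := by
    ext p
    change c.η (g p) * topForm F (topTriv F E x₀ (g p) (s.1 p + s'.1 p)) = _
    rw [map_add, map_add, mul_add]; rfl
  map_smul' f s := by
    ext p
    change c.η (g p) * topForm F (topTriv F E x₀ (g p) (f p • s.1 p)) = f p * (_ * _)
    rw [map_smul, map_smul, smul_eq_mul]; ring

lemma topCoord_apply {g : N → M} (hg : ContMDiff J 𝓘(ℝ, EM) ∞ g) (s : TopSec F E J g) (p : N) :
    c.topCoord hg s p = c.η (g p) * topForm F (topTriv F E x₀ (g p) (s.1 p)) := rfl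

/-- The exterior product of the local frame. -/
def topFrame : ΓL F E := wedge fun i => c.frame (finBasis ℝ F i)

lemma topTriv_wedge {x : M} (hx : x ∈ c.base.O)
    (e : Fin (finrank ℝ F) → Γ F E) :
    topTriv F E x₀ x ((wedge e).1 x) = exteriorPower.ιMulti ℝ _ fun i => (c.tot.φ ⟨x, e i x⟩).2 := by
  change exteriorPower.map _ _ (exteriorPower.ιMulti ℝ _ fun i => e i x) = _
  rw [exteriorPower.map_apply_ιMulti]
  congr 1
  funext i
  exact congrFun (c.T.coe_linearMapAt_of_mem (R := ℝ) (c.subset hx)) _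

lemma topTriv_topFrame {x : M} (hx : x ∈ c.base.O) :
    topTriv F E x₀ x (c.topFrame.1 x)
      = c.η x ^ finrank ℝ F • exteriorPower.ιMulti ℝ _ (finBasis ℝ F) := by
  rw [topFrame, c.topTriv_wedge hx]
  simp only [c.φ_frame _ hx]
  have := (exteriorPower.ιMulti ℝ (finrank ℝ F) (M := F)).toMultilinearMap.map_smul_univ
    (fun _ => c.η x) (finBasis ℝ F)
  simpa using this

lemma topCoord_smul_topFrame {g : N → M} (hg : ContMDiff J 𝓘(ℝ, EM) ∞ g) (s : TopSec F E J g)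
    (p : N) : c.topCoord hg s p • c.topFrame.1 (g p)
      = (c.η (g p) ^ (finrank ℝ F + 1)) • s.1 p := by
  by_cases hx : g p ∈ c.base.O
  · rw [← topTriv_symm (c.subset hx) (c.topFrame.1 (g p)), c.topTriv_topFrame hx, topCoord_apply,
      map_smul, smul_smul]
    conv_rhs => rw [← topTriv_symm (c.subset hx) (s.1 p),
      ← topForm_smul (topTriv F E x₀ (g p) (s.1 p)), map_smul, smul_smul]
    congr 1; ring
  · rw [topCoord_apply, c.base.eq_zero_of_notMem c.hη hx, zero_mul, zero_smul,
      zero_pow (Nat.succ_ne_zero _), zero_smul]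

lemma topCoord_topFrame (x : M) : c.topCoord contMDiff_id c.topFrame x
    = c.η x ^ (finrank ℝ F + 1) := by
  rw [topCoord_apply]
  by_cases hx : x ∈ c.base.O
  · change c.η x * topForm F (topTriv F E x₀ x (c.topFrame.1 x)) = _
    rw [c.topTriv_topFrame hx, map_smul, topForm_ιMulti, Module.Basis.det_self]
    simp; ring
  · change c.η x * _ = _
    rw [c.base.eq_zero_of_notMem c.hη hx, zero_mul, zero_pow (Nat.succ_ne_zero _)]

end BundleChart

/-- Gluing of sections of the top exterior power. -/
lemma exists_glue_top {g : N → M} (χ : M → Smooth J N) (a : M → TopSec F E J g)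
    (hχ : ∀ q, χ (g q) q = 1) (ha : ∀ x y, χ y • a x = χ x • a y) :
    ∃ s : TopSec F E J g, ∀ x, χ x • s = a x := by
  have key : ∀ x q, χ x q • (a (g q)).1 q = (a x).1 q := fun x q => by
    have h : χ (g q) q • (a x).1 q = χ x q • (a (g q)).1 q :=
      congrArg (fun s : TopSec F E J g => s.1 q) (ha x (g q))
    rw [← h, hχ, one_smul]
  refine ⟨⟨fun q => (a (g q)).1 q, fun q₀ ξ => ?_⟩, fun x => Subtype.ext (funext fun q => key x q)⟩
  have h1 := (((a (g q₀)).2 q₀ ξ).div₀ (χ (g q₀)).contMDiff.contMDiffAt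
    (by rw [hχ]; exact one_ne_zero))
  refine h1.congr_of_eventuallyEq ?_
  have h2 : ∀ᶠ q in nhds q₀, χ (g q₀) q ≠ 0 :=
    (χ (g q₀)).contMDiff.continuous.continuousAt.eventually_ne (by rw [hχ]; exact one_ne_zero)
  filter_upwards [h2] with q hq
  have e : ξ (topTriv F E (g q₀) (g q) (χ (g q₀) q • (a (g q)).1 q)) = _ :=
    congrArg (fun u => ξ (topTriv F E (g q₀) (g q) u)) (key (g q₀) q)
  rw [map_smul, map_smul, smul_eq_mul, mul_comm] at e
  exact (eq_div_iff hq).2 e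

variable (EM F E G B) in
/-- Sections of the pull-back of the top exterior power to the total space of a bundle. -/
theorem secModel : SecModel (M := M) (fun x => evalAt x) (projFun (EM := EM) G B) (scaleFun G B)
    (projSec (EM := EM) F E G B) (scaleSec (EM := EM) F E G B) where
  toFunModel := funModel EM G B
  hS_smul _ _ _ := rfl
  hS_comp s t f := Subtype.ext (funext fun e => by
    change f.1 ⟨e.proj, t • s • e.2⟩ = f.1 ⟨e.proj, (s * t) • e.2⟩
    rw [smul_smul, mul_comm])
  hS_id f := Subtype.ext (funext fun e => by
    change f.1 ⟨e.proj, (1 : ℝ) • e.2⟩ = f.1 e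
    rw [one_smul])
  hS_ρL _ _ := rfl
  ρL_smul _ _ := rfl
  ρL_inj U hU := Subtype.ext (funext fun x =>
    congrFun (congrArg Subtype.val hU) (⟨x, 0⟩ : TotalSpace G B))
  sepS χ hχ s hs := Subtype.ext (funext fun e => by
    have h : (χ e.proj) e.proj • s.1 e = 0 := congrFun (congrArg Subtype.val (hs e.proj)) e
    have h1 : (χ e.proj) e.proj = 1 := hχ e.proj
    rw [h1, one_smul] at h
    exact h)
  glueS χ hχ a ha := exists_glue_top (fun x => projFun G B (χ x)) a (fun e => hχ e.proj) ha
  glueL χ hχ a ha := exists_glue_top χ a hχ ha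
  locS x := by
    obtain ⟨c, hO, hχ⟩ := exists_bundleChart_mem (EM := EM) (G := F) E x
    refine ⟨c.η ^ (finrank ℝ F + 1), ?_, c.topFrame,
      c.topCoord (Bundle.contMDiff_proj B), c.topCoord contMDiff_id, fun s => ?_, fun U => rfl,
      fun t s => rfl, ?_⟩
    · rw [map_pow]
      change (c.η x) ^ _ = 1
      rw [c.η_eq_one hχ, one_pow]
    · refine Subtype.ext (funext fun e => ?_)
      change (c.η ^ (finrank ℝ F + 1)) e.proj • s.1 e = _ • c.topFrame.1 e.proj
      exact (congrArg (fun r => r • s.1 e) (map_pow (evalAt e.proj) c.η _)).trans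
        (c.topCoord_smul_topFrame (Bundle.contMDiff_proj B) s e).symm
    · ext x
      rw [c.topCoord_topFrame]
      exact (map_pow (evalAt x) c.η _).symm

end TopSections

section TopDer

lemma update_sec_apply {n : ℕ} (e : Fin n → Γ F E) (i : Fin n)
    (v : Γ F E) (x : M) :
    (fun j => (Function.update e i v) j x) = Function.update (fun j => e j x) i (v x) := by
  funext j
  rcases eq_or_ne j i with rfl | h
  · simp
  · simp [Function.update_of_ne h]

variable (EM F E) in
/-- The exterior product of sections, as an alternating map. -/
def wedgeAlt : Γ F E [⋀^Fin (finrank ℝ F)]→ₗ[𝒮]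
    ΓL F E where
  toFun := wedge
  map_update_add' {inst} e i v v' := by
    obtain rfl := Subsingleton.elim inst (instDecidableEqFin _)
    refine Subtype.ext (funext fun x => ?_)
    change exteriorPower.ιMulti ℝ _ (fun j => _) = exteriorPower.ιMulti ℝ _ (fun j => _)
      + exteriorPower.ιMulti ℝ _ (fun j => _)
    rw [update_sec_apply, update_sec_apply, update_sec_apply]
    exact AlternatingMap.map_update_add _ _ _ _ _
  map_update_smul' {inst} e i g v := by
    obtain rfl := Subsingleton.elim inst (instDecidableEqFin _)
    refine Subtype.ext (funext fun x => ?_)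
    change exteriorPower.ιMulti ℝ _ (fun j => _) = g x • exteriorPower.ιMulti ℝ _ (fun j => _)
    rw [update_sec_apply, update_sec_apply]
    exact AlternatingMap.map_update_smul _ _ _ _ _
  map_eq_zero_of_eq' e i j h hij := Subtype.ext (funext fun x =>
    AlternatingMap.map_eq_zero_of_eq _ _ (congrFun (congrArg DFunLike.coe h) x) hij)

namespace BundleChart

variable {x₀ : M} (c : BundleChart (EM := EM) F E x₀)

lemma topCoord_smul_topFrame' (U : ΓL F E) :
    c.topCoord contMDiff_id U • c.topFrame = c.η ^ (finrank ℝ F + 1) • U :=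
  Subtype.ext (funext fun x => (c.topCoord_smul_topFrame contMDiff_id U x).trans
    (congrArg (fun r => r • U.1 x) (map_pow (evalAt x) c.η _)).symm)

lemma topCoord_topFrame' :
    c.topCoord contMDiff_id c.topFrame = c.η ^ (finrank ℝ F + 1) := by
  ext x
  rw [c.topCoord_topFrame]
  exact (map_pow (evalAt x) c.η _).symm

lemma pow_η_eq_one {x : M} (hx : c.χ x ≠ 0) (k : ℕ) : (c.η ^ k) x = 1 :=
  (map_pow (evalAt x) c.η k).trans (by
    change c.η x ^ k = 1
    rw [c.η_eq_one hx, one_pow])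

end BundleChart

/-- Maps of the top exterior power are determined on exterior products of sections. -/
lemma top_ext {T : ΓL F E →ₗ[𝒮] ΓL F E}
    (hT : ∀ e, T (wedge e) = 0) : T = 0 := by
  refine LinearMap.ext fun U => Subtype.ext (funext fun x => ?_)
  obtain ⟨c, hO, hχ⟩ := exists_bundleChart_mem (EM := EM) (G := F) E x
  have h := congrArg T (c.topCoord_smul_topFrame' U)
  rw [map_smul, map_smul, show T c.topFrame = 0 from hT _, smul_zero] at h
  have h1 : (c.η ^ (finrank ℝ F + 1)) x • (T U).1 x = 0 :=
    (congrFun (congrArg Subtype.val h) x).symm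
  rwa [c.pow_η_eq_one hχ, one_smul] at h1

lemma topDer_ext {D D' : modDer 𝒮 (ΓL F E)}
    (hs : D.1.symb = D'.1.symb) (h : ∀ e, D.1.op (wedge e) = D'.1.op (wedge e)) : D = D' := by
  let T : ΓL F E →ₗ[𝒮] ΓL F E :=
    { toFun := fun U => D.1.op U - D'.1.op U
      map_add' := fun U U' => by rw [map_add, map_add]; abel
      map_smul' := fun g U => by
        rw [D.2 g U, D'.2 g U, hs, RingHom.id_apply, smul_sub]; abel }
  have hT : T = 0 := top_ext fun e => sub_eq_zero.2 (h e)
  exact Subtype.ext (Prod.ext hs (LinearMap.ext fun U => sub_eq_zero.1 (LinearMap.congr_fun hT U)))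

namespace BundleChart

variable {x₀ : M} (c : BundleChart (EM := EM) F E x₀)
  (δ : modDer (Smooth 𝓘(ℝ, EM) M) (Sec (EM := EM) F E))

/-- The local formula for the induced derivation of the top exterior power. -/
def topDer : ΓL F E →ₗ[ℝ] ΓL F E where
  toFun U := (c.η ^ (finrank ℝ F + 1) * c.topCoord contMDiff_id U)
      • wedgeDer (wedgeAlt EM F E) δ.1.op (fun i => c.frame (finBasis ℝ F i))
    + (c.η ^ (finrank ℝ F + 1) * δ.1.symb (c.topCoord contMDiff_id U)
      - δ.1.symb (c.η ^ (finrank ℝ F + 1)) * c.topCoord contMDiff_id U) • c.topFrame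
  map_add' U U' := by
    simp only [map_add, mul_add, add_smul, sub_smul]; abel
  map_smul' t U := by
    simp only [LinearMap.map_smul_of_tower, Derivation.map_smul, mul_smul_comm, ← smul_sub,
      smul_assoc, RingHom.id_apply, smul_add]

lemma topDer_apply (U : ΓL F E) : c.topDer δ U
    = (c.η ^ (finrank ℝ F + 1) * c.topCoord contMDiff_id U)
      • wedgeDer (wedgeAlt EM F E) δ.1.op (fun i => c.frame (finBasis ℝ F i))
    + (c.η ^ (finrank ℝ F + 1) * δ.1.symb (c.topCoord contMDiff_id U)
      - δ.1.symb (c.η ^ (finrank ℝ F + 1)) * c.topCoord contMDiff_id U) • c.topFrame := rfl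

lemma topDer_smul (g : 𝒮) (U : ΓL F E) :
    c.topDer δ (g • U) = g • c.topDer δ U
      + (c.η ^ (finrank ℝ F + 1) * c.η ^ (finrank ℝ F + 1) * δ.1.symb g) • U := by
  have h := c.topCoord_smul_topFrame' U
  have h2 : (c.η ^ (finrank ℝ F + 1) * c.η ^ (finrank ℝ F + 1) * δ.1.symb g) • U
      = (c.η ^ (finrank ℝ F + 1) * δ.1.symb g * c.topCoord contMDiff_id U)
        • c.topFrame := by
    rw [mul_smul _ (c.topCoord _ _), h, smul_smul]; congr 1; ring
  rw [h2]
  simp only [topDer_apply, map_smul, smul_eq_mul, Derivation.leibniz,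
    smul_add, smul_smul]
  rw [add_assoc, ← add_smul]
  congr 2 <;> ring

lemma topDer_wedge (e : Fin (finrank ℝ F) → Γ F E)
    [∀ x, IsTopologicalAddGroup (E x)] [∀ x, ContinuousSMul ℝ (E x)] :
    c.topDer δ (wedge e) = (c.η ^ (finrank ℝ F + 1) * c.η ^ (finrank ℝ F + 1))
      • wedgeDer (wedgeAlt EM F E) δ.1.op e := by
  let Θ := wedgeDefect (wedgeAlt EM F E) δ _ (c.topDer δ) (c.topDer_smul δ)
  have h0 : Θ (fun i => c.frame (finBasis ℝ F i)) = 0 := by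
    change _ • wedgeDer _ _ _ - c.topDer δ c.topFrame = 0
    rw [topDer_apply, c.topCoord_topFrame']
    rw [show ∀ a b : 𝒮, a * b - b * a = 0 from fun a b => by ring, zero_smul,
      add_zero, sub_self]
  obtain ⟨g, hg⟩ := alternating_frame Θ (fun i => c.frame (finBasis ℝ F i)) (c.η * c.η) e
    (fun i j => pairing (c.coframe ((finBasis ℝ F).coord j)) (e i)) fun i =>
      (c.sum_pairing_coframe_smul (finBasis ℝ F) (e i)).symm
  rw [h0, smul_zero] at hg
  refine Subtype.ext (funext fun x => ?_)
  by_cases hx : c.η x = 0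
  · have h1 : (c.η ^ (finrank ℝ F + 1)) x = 0 :=
      (map_pow (evalAt x) c.η _).trans (by
        change c.η x ^ _ = 0
        rw [hx, zero_pow (Nat.succ_ne_zero _)])
    have h2 : c.topCoord contMDiff_id (wedge e) x = 0 := by
      rw [topCoord_apply]
      change c.η x * _ = 0
      rw [hx, zero_mul]
    rw [topDer_apply]
    change ((c.η ^ (finrank ℝ F + 1)) x * c.topCoord contMDiff_id (wedge e) x)
        • (wedgeDer (wedgeAlt EM F E) δ.1.op fun i => c.frame (finBasis ℝ F i)).1 x
      + ((c.η ^ (finrank ℝ F + 1)) x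
          * (δ.1.symb (c.topCoord contMDiff_id (wedge e))) x
        - (δ.1.symb (c.η ^ (finrank ℝ F + 1))) x
          * c.topCoord contMDiff_id (wedge e) x) • c.topFrame.1 x
      = ((c.η ^ (finrank ℝ F + 1)) x * (c.η ^ (finrank ℝ F + 1)) x)
        • (wedgeDer (wedgeAlt EM F E) δ.1.op e).1 x
    rw [h1, h2]
    simp only [zero_mul, mul_zero, sub_zero, zero_smul, add_zero]
  · have h1 : ((c.η * c.η) ^ finrank ℝ F) x • (Θ e).1 x = 0 :=
      congrFun (congrArg Subtype.val hg) x
    have h2 : ((c.η * c.η) ^ finrank ℝ F) x ≠ 0 := by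
      rw [show ((c.η * c.η) ^ finrank ℝ F) x = (c.η x * c.η x) ^ finrank ℝ F from
        map_pow (evalAt x) (c.η * c.η) _]
      exact pow_ne_zero _ (mul_ne_zero hx hx)
    exact (sub_eq_zero.1 ((smul_eq_zero.1 h1).resolve_left h2)).symm

end BundleChart

variable [∀ x, IsTopologicalAddGroup (E x)] [∀ x, ContinuousSMul ℝ (E x)]

lemma exists_topDer (δ : modDer 𝒮 (Γ F E)) :
    ∃ D : modDer 𝒮 (ΓL F E), D.1.symb = δ.1.symb ∧
      ∀ e, D.1.op (wedge e) = wedgeDer (wedgeAlt EM F E) δ.1.op e := by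
  choose c hc hχ using exists_bundleChart_mem (EM := EM) (G := F) E
  let ζ : M → 𝒮 := fun x =>
    (c x).η ^ (finrank ℝ F + 1) * (c x).η ^ (finrank ℝ F + 1)
  have hζ : ∀ x, ζ x x = 1 := fun x => by
    change ((c x).η ^ (finrank ℝ F + 1)) x * ((c x).η ^ (finrank ℝ F + 1)) x = 1
    rw [(c x).pow_η_eq_one (hχ x), mul_one]
  have hcompat : ∀ U x y, ζ y • (c x).topDer δ U = ζ x • (c y).topDer δ U := fun U x y => by
    let T : ΓL F E →ₗ[𝒮] ΓL F E :=
      { toFun := fun U => ζ y • (c x).topDer δ U - ζ x • (c y).topDer δ U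
        map_add' := fun U U' => by simp only [map_add, smul_add]; abel
        map_smul' := fun g U => by
          rw [(c x).topDer_smul, (c y).topDer_smul, RingHom.id_apply]
          simp only [smul_add, smul_sub, smul_smul]
          rw [mul_comm (ζ y) g, mul_comm (ζ x) g, show ζ y * ((c x).η ^ (finrank ℝ F + 1)
            * (c x).η ^ (finrank ℝ F + 1) * δ.1.symb g) = ζ x * (ζ y * δ.1.symb g) by
              change ζ y * (ζ x * _) = _; ring]
          change _ - (_ + (ζ x * (ζ y * δ.1.symb g)) • U) = _
          abel }
    have hT : T = 0 := top_ext fun e => by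
      change ζ y • (c x).topDer δ _ - ζ x • (c y).topDer δ _ = 0
      rw [(c x).topDer_wedge, (c y).topDer_wedge, smul_smul, smul_smul]
      change (ζ y * ζ x) • _ - (ζ x * ζ y) • _ = 0
      rw [mul_comm, sub_self]
    exact sub_eq_zero.1 (LinearMap.congr_fun hT U)
  choose D hD using fun U => exists_glue_top (J := 𝓘(ℝ, EM)) (g := fun x : M => x) ζ
    (fun x => (c x).topDer δ U) hζ (hcompat U)
  have hsep : ∀ U U' : ΓL F E, (∀ x, ζ x • U = ζ x • U') → U = U' :=
    fun U U' h => Subtype.ext (funext fun x => by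
      have h1 : ζ x x • U.1 x = ζ x x • U'.1 x := congrFun (congrArg Subtype.val (h x)) x
      rwa [hζ, one_smul, one_smul] at h1)
  refine ⟨⟨(δ.1.symb,
    { toFun := D
      map_add' := fun U U' => hsep _ _ fun x => by rw [smul_add, hD, hD, hD, map_add]
      map_smul' := fun t U => hsep _ _ fun x => by
        rw [RingHom.id_apply, smul_comm, hD, hD, map_smul] }),
    fun g U => hsep _ _ fun x => by
      change ζ x • D (g • U) = ζ x • (g • D U + δ.1.symb g • U)
      rw [smul_add, smul_comm (ζ x) g, hD, hD, (c x).topDer_smul, smul_smul]⟩, rfl,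
    fun e => hsep _ _ fun x => ?_⟩
  change ζ x • D (wedge e) = _
  rw [hD, (c x).topDer_wedge]

/-- The derivation of the top exterior power induced by a derivation of a vector bundle. -/
def topOf (δ : modDer 𝒮 (Γ F E)) :
    modDer 𝒮 (ΓL F E) := (exists_topDer δ).choose

lemma topOf_symb (δ : modDer 𝒮 (Γ F E)) :
    (topOf δ).1.symb = δ.1.symb := (exists_topDer δ).choose_spec.1

lemma topOf_wedge (δ : modDer 𝒮 (Γ F E))
    (e : Fin (finrank ℝ F) → Γ F E) :
    (topOf δ).1.op (wedge e) = wedgeDer (wedgeAlt EM F E) δ.1.op e :=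
  (exists_topDer δ).choose_spec.2 e

lemma topOf_wedgeDer (δ δ' : modDer 𝒮 (Γ F E))
    (e : Fin (finrank ℝ F) → Γ F E) :
    (topOf δ).1.op (wedgeDer (wedgeAlt EM F E) δ'.1.op e)
      = ∑ i, wedgeDer (wedgeAlt EM F E) δ.1.op (Function.update e i (δ'.1.op (e i))) := by
  rw [wedgeDer, map_sum]
  exact Finset.sum_congr rfl fun i _ => topOf_wedge δ _

lemma isTopDer_topOf (δ : modDer 𝒮 (Γ F E)) :
    IsTopDer δ (topOf δ) := ⟨topOf_symb δ, topOf_wedge δ⟩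

lemma IsTopDer.eq_topOf {δ : modDer 𝒮 (Γ F E)}
    {δL : modDer 𝒮 (ΓL F E)} (h : IsTopDer δ δL) :
    δL = topOf δ :=
  topDer_ext (h.1.trans (topOf_symb δ).symm) fun e => (h.2 e).trans (topOf_wedge δ e).symm

lemma wedge_rank_one (φ : Γ (DualModel F) (Dual E)) (e : Γ F E)
    (δ : modDer 𝒮 (Γ F E)) (hs : δ.1.symb = 0)
    (ho : ∀ e', δ.1.op e' = pairing φ e' • e)
    (v : Fin (finrank ℝ F) → Γ F E) :
    wedgeDer (wedgeAlt EM F E) δ.1.op v = pairing φ e • wedge v := by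
  let D : ΓL F E →ₗ[ℝ] ΓL F E :=
    { toFun := fun U => pairing φ e • U
      map_add' := fun U U' => smul_add _ _ _
      map_smul' := fun t U => by rw [RingHom.id_apply, smul_comm] }
  have hD : ∀ (g : 𝒮) U, D (g • U) = g • D U + (1 * δ.1.symb g) • U :=
    fun g U => by
      rw [hs, Derivation.zero_apply, mul_zero, zero_smul, add_zero]
      exact smul_comm (pairing φ e) g U
  let Θ := wedgeDefect (wedgeAlt EM F E) δ 1 D hD
  have hΘ : ∀ v, Θ v = wedgeDer (wedgeAlt EM F E) δ.1.op v - pairing φ e • wedge v := fun v => by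
    change (1 : 𝒮) • wedgeDer (wedgeAlt EM F E) δ.1.op v - _ = _
    rw [one_smul]; rfl
  refine sub_eq_zero.1 ((hΘ v).symm.trans (Subtype.ext (funext fun x => ?_)))
  obtain ⟨c, hO, hχ⟩ := exists_bundleChart_mem (EM := EM) (G := F) E x
  let f : Fin (finrank ℝ F) → Γ F E := fun i => c.frame (finBasis ℝ F i)
  have h0 : (c.η * c.η) • Θ f = 0 := by
    rw [hΘ, wedgeDer, smul_sub, Finset.smul_sum, smul_smul, sub_eq_zero]
    have h1 : ∀ i, (c.η * c.η) • wedgeAlt EM F E (Function.update f i (δ.1.op (f i)))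
        = (pairing φ (f i) * pairing (c.coframe ((finBasis ℝ F).coord i)) e)
          • wedge f := fun i => by
      rw [ho, (wedgeAlt EM F E).map_update_smul, smul_comm, ← (wedgeAlt EM F E).map_update_smul,
        ← c.sum_pairing_coframe_smul (finBasis ℝ F) e, mul_smul]
      congr 1
      rw [AlternatingMap.map_update_sum, Finset.sum_eq_single i]
      · rw [(wedgeAlt EM F E).map_update_smul]
        congr 1
        change wedgeAlt EM F E (Function.update f i (f i)) = _
        rw [Function.update_eq_self]; rfl
      · intro j _ hji
        rw [(wedgeAlt EM F E).map_update_smul]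
        change _ • wedgeAlt EM F E (Function.update f i (f j)) = 0
        rw [(wedgeAlt EM F E).map_eq_zero_of_eq _ (i := i) (j := j)
          (by rw [Function.update_self, Function.update_of_ne hji]) hji.symm, smul_zero]
      · simp
    simp only [h1, ← Finset.sum_smul]
    congr 1
    have h2 := congrArg (pairLin EM F E φ) (c.sum_pairing_coframe_smul (finBasis ℝ F) e)
    rw [map_sum, map_smul, smul_eq_mul] at h2
    change _ = _ * pairLin EM F E φ e
    rw [← h2]
    refine Finset.sum_congr rfl fun i _ => ?_
    rw [map_smul, smul_eq_mul, mul_comm]; rfl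
  obtain ⟨g, hg⟩ := alternating_frame Θ f (c.η * c.η) v
    (fun i j => pairing (c.coframe ((finBasis ℝ F).coord j)) (v i)) fun i =>
      (c.sum_pairing_coframe_smul (finBasis ℝ F) (v i)).symm
  have h3 : (c.η * c.η) x = 1 := by
    change c.η x * c.η x = 1
    rw [c.η_eq_one hχ, mul_one]
  have h4 : (Θ f).1 x = 0 := by
    have : (c.η * c.η) x • (Θ f).1 x = 0 := congrFun (congrArg Subtype.val h0) x
    rwa [h3, one_smul] at this
  have h5 : ((c.η * c.η) ^ finrank ℝ F) x • (Θ v).1 x = g x • (Θ f).1 x :=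
    congrFun (congrArg Subtype.val hg) x
  rw [h4, smul_zero, show ((c.η * c.η) ^ finrank ℝ F) x = 1 from
    (map_pow (evalAt x) (c.η * c.η) _).trans (by
      change (c.η * c.η) x ^ _ = 1
      rw [h3, one_pow]), one_smul] at h5
  exact h5

variable (EM F E) in
/-- The action of derivations of a vector bundle on its top exterior power. -/
def topAction : TopAction (ΓL F E) (bundlePair EM F E) where
  top :=
    { toFun := topOf
      map_add' := fun δ δ' => topDer_ext (by
        rw [topOf_symb]
        change _ = (topOf δ).1.symb + (topOf δ').1.symb
        rw [topOf_symb, topOf_symb]; rfl) fun e => by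
        rw [topOf_wedge]
        change _ = (topOf δ).1.op (wedge e) + (topOf δ').1.op (wedge e)
        rw [topOf_wedge, topOf_wedge, wedgeDer, wedgeDer, wedgeDer, ← Finset.sum_add_distrib]
        exact Finset.sum_congr rfl fun i _ => (wedgeAlt EM F E).map_update_add _ _ _ _
      map_smul' := fun t δ => topDer_ext (by
        rw [topOf_symb]
        change _ = t • (topOf δ).1.symb
        rw [topOf_symb]; rfl) fun e => by
        rw [topOf_wedge]
        change _ = t • (topOf δ).1.op (wedge e)
        rw [topOf_wedge, wedgeDer, wedgeDer, Finset.smul_sum]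
        refine Finset.sum_congr rfl fun i _ => ?_
        have h := (wedgeAlt EM F E).map_update_smul e i (algebraMap ℝ 𝒮 t)
          (δ.1.op (e i))
        rwa [algebraMap_smul, algebraMap_smul] at h }
  top_symb := topOf_symb
  top_bracket δ₁ δ₂ δ₃ h := by
    have hs : δ₃.1.symb = ⁅δ₁.1.symb, δ₂.1.symb⁆ := by rw [h]; rfl
    have ho : δ₃.1.op = opComm δ₁.1.op δ₂.1.op := by rw [h]; rfl
    have hmem : DerPair.bracket (topOf δ₁).1 (topOf δ₂).1
        ∈ modDer 𝒮 (ΓL F E) := fun g U => by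
      change (topOf δ₁).1.op ((topOf δ₂).1.op (g • U)) - (topOf δ₂).1.op ((topOf δ₁).1.op (g • U))
        = g • ((topOf δ₁).1.op ((topOf δ₂).1.op U) - (topOf δ₂).1.op ((topOf δ₁).1.op U))
          + ⁅(topOf δ₁).1.symb, (topOf δ₂).1.symb⁆ g • U
      rw [(topOf δ₂).2 g U, (topOf δ₁).2 g U, map_add, map_add, (topOf δ₁).2, (topOf δ₁).2,
        (topOf δ₂).2, (topOf δ₂).2, Derivation.commutator_apply, sub_smul, smul_sub]
      abel
    refine congrArg Subtype.val (topDer_ext (D := topOf δ₃) (D' := ⟨_, hmem⟩) ?_ fun e => ?_)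
    · rw [topOf_symb, hs]
      change _ = ⁅(topOf δ₁).1.symb, (topOf δ₂).1.symb⁆
      rw [topOf_symb, topOf_symb]
    · change _ = (topOf δ₁).1.op ((topOf δ₂).1.op (wedge e))
        - (topOf δ₂).1.op ((topOf δ₁).1.op (wedge e))
      rw [topOf_wedge, topOf_wedge, topOf_wedge, topOf_wedgeDer, topOf_wedgeDer, ho,
        ← wedgeDer_bracket]
  top_smul g δ δ' h := by
    have hs : δ'.1.symb = g • δ.1.symb := by rw [h]; rfl
    have ho : δ'.1.op = g • δ.1.op := by rw [h]; rfl
    have hmem : DerPair.fsmul g (topOf δ).1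
        ∈ modDer 𝒮 (ΓL F E) := fun f U => by
      change g • (topOf δ).1.op (f • U) = f • g • (topOf δ).1.op U + (g * (topOf δ).1.symb f) • U
      rw [(topOf δ).2 f U, smul_add, smul_comm g f, smul_smul g]
    refine congrArg Subtype.val (topDer_ext (D := topOf δ') (D' := ⟨_, hmem⟩) ?_ fun e => ?_)
    · rw [topOf_symb, hs]
      change _ = g • (topOf δ).1.symb
      rw [topOf_symb]
    · change _ = g • (topOf δ).1.op (wedge e)
      rw [topOf_wedge, topOf_wedge, wedgeDer, wedgeDer, Finset.smul_sum, ho]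
      exact Finset.sum_congr rfl fun i _ => (wedgeAlt EM F E).map_update_smul _ _ _ _
  top_rank_one φ e δ hs ho U := by
    let T : ΓL F E →ₗ[𝒮] ΓL F E :=
      { toFun := fun U => (topOf δ).1.op U - pairing φ e • U
        map_add' := fun U U' => by rw [map_add, smul_add]; abel
        map_smul' := fun g U => by
          rw [(topOf δ).2 g U, topOf_symb, hs, Derivation.zero_apply, zero_smul, add_zero,
            RingHom.id_apply, smul_sub, smul_comm (pairing φ e) g] }
    have hT : T = 0 := top_ext fun v => by
      change (topOf δ).1.op (wedge v) - pairing φ e • wedge v = 0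
      rw [topOf_wedge, wedge_rank_one φ e δ hs ho, sub_self]
    exact sub_eq_zero.1 (LinearMap.congr_fun hT U)

end TopDer

section Identifications

lemma polyFunDeg_eq_wt (k : ℕ) : polyFunDeg (EM := EM) F E k = wt (scaleFun F E) (k : ℤ) := by
  ext f
  refine ⟨fun hf t _ => by rw [hf t, zpow_natCast], fun hf t => ?_⟩
  ext e
  exact congrFun (eq_of_eq_of_ne (a := fun t => f ⟨e.proj, t • e.2⟩) (b := fun t => t ^ k * f e)
    (differentiable_scale f e).continuous ((continuous_pow k).mul continuous_const) fun t ht => by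
      rw [wt_apply hf ht, zpow_natCast]) t

lemma scaledMultivector_eq (w : ℤ) : scaledMultivector (EM := EM) F E F E w
    = derMultivector _ _ ⊓ wt (tw (scaleFun F E) (scaleSec F E F E)) w := by
  have key : ∀ {Z : Type _} [AddCommGroup Z] [Module ℝ Z] {t : ℝ} (_ : t ≠ 0) (n : ℕ) (x y : Z),
      x = t ^ (w - (n : ℤ)) • y ↔ t ^ n • x = t ^ w • y := fun {Z} _ _ {t} ht n x y => by
    rw [zpow_sub₀ ht, div_eq_inv_mul, mul_smul, zpow_natCast, eq_inv_smul_iff₀ (pow_ne_zero n ht)]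
  ext D
  refine and_congr_right fun _ => forall₂_congr fun t ht => ?_
  refine ⟨fun h => MultiPair.ext (funext fun m => (key ht _ _ _).1 (h.1 m))
    (funext fun m => LinearMap.ext fun s => (key ht (m.card + 1) _ _).1 (by
      push_cast; exact h.2 m s)), fun h => ⟨fun m => (key ht _ _ _).2
        (congrArg (fun D : MultiPair _ _ => D.symb m) h), fun m s => ?_⟩⟩
  have h1 := (key ht (m.card + 1) _ _).2 (congrArg (fun D : MultiPair _ _ => D.op m s) h)
  push_cast at h1
  exact h1

variable [∀ x, IsTopologicalAddGroup (E x)] [∀ x, ContinuousSMul ℝ (E x)]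

/-- The Euler vector field. -/
lemma linModelDual_lin_unit (k : ℤ) (f : 𝒯 (DualModel F) (Dual E))
    (hf : f ∈ wt (scaleFun (DualModel F) (Dual E)) k) :
    (linModelDual EM F E).lin (unitDer _ _) f = (k : ℝ) • f := by
  ext w
  let X := (linModelDual EM F E).lin (unitDer 𝒮 (Γ F E))
  let d : 𝒯 (DualModel F) (Dual E) →ₗ[ℝ] ℝ :=
    { toFun := fun f => X f w - deriv (fun t : ℝ => f ⟨w.proj, t • w.2⟩) 1
      map_add' := fun f g => by
        have h1 : deriv (fun t : ℝ => (f + g) ⟨w.proj, t • w.2⟩) 1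
            = deriv (fun t : ℝ => f ⟨w.proj, t • w.2⟩) 1
              + deriv (fun t : ℝ => g ⟨w.proj, t • w.2⟩) 1 :=
          deriv_add (differentiable_scale f w 1) (differentiable_scale g w 1)
        rw [h1, Derivation.map_add]
        change X f w + X g w - _ = _
        ring
      map_smul' := fun c f => by
        have h1 : deriv (fun t : ℝ => (c • f) ⟨w.proj, t • w.2⟩) 1
            = c * deriv (fun t : ℝ => f ⟨w.proj, t • w.2⟩) 1 :=
          deriv_const_mul c (differentiable_scale f w 1)
        rw [h1, Derivation.map_smul]
        change c * X f w - _ = c * (_ - _)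
        ring }
  have hd : d = 0 := point_der_tot (e := w) d (fun f g => by
      have h1 : deriv (fun t : ℝ => (f * g) ⟨w.proj, t • w.2⟩) 1
          = deriv (fun t : ℝ => f ⟨w.proj, t • w.2⟩) 1 * g ⟨w.proj, (1 : ℝ) • w.2⟩
            + f ⟨w.proj, (1 : ℝ) • w.2⟩ * deriv (fun t : ℝ => g ⟨w.proj, t • w.2⟩) 1 :=
        deriv_mul (differentiable_scale f w 1) (differentiable_scale g w 1)
      change X (f * g) w - _ = f w * (X g w - _) + g w * (X f w - _)
      rw [h1, Derivation.leibniz, one_smul]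
      change f w * X g w + g w * X f w - _ = _
      ring)
    (fun g => by
      change X (projFun _ _ g) w - deriv (fun _ : ℝ => g w.proj) 1 = 0
      rw [(linModelDual EM F E).lin_ρ, deriv_const, sub_zero]
      exact congrArg (fun g : 𝒮 => projFun (DualModel F) (Dual E) g w)
        (Derivation.zero_apply g))
    (fun u hu => by
      obtain ⟨e, rfl⟩ := exists_ellDual hu
      change X (ellDual EM F E e) w - deriv (fun t : ℝ => ellDual EM F E e ⟨w.proj, t • w.2⟩) 1 = 0
      have h1 : (fun t : ℝ => ellDual EM F E e ⟨w.proj, t • w.2⟩)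
          = fun t => t * ellDual EM F E e w := funext fun t => wt_one_smul hu t w
      rw [(linModelDual EM F E).lin_ℓ, h1, deriv_mul_const_field, deriv_id'', one_mul]
      exact sub_self _)
  have h1 : X f w = deriv (fun t : ℝ => f ⟨w.proj, t • w.2⟩) 1 :=
    sub_eq_zero.1 (LinearMap.congr_fun hd f)
  have h2 : (fun t : ℝ => f ⟨w.proj, t • w.2⟩) =ᶠ[nhds 1] fun t => t ^ k * f w := by
    filter_upwards [isOpen_ne.mem_nhds (one_ne_zero (α := ℝ))] with t ht
    exact wt_apply hf ht w
  change _ = k * f w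
  rw [h1, h2.deriv_eq, deriv_mul_const_field, deriv_zpow, one_zpow, mul_one]

lemma dualPolyFun_eq : dualPolyFun (EM := EM) F E
    = ⨆ p : ℕ, wt (scaleFun (DualModel F) (Dual E)) (p : ℤ) :=
  iSup_congr fun p => polyFunDeg_eq_wt p

lemma dualPolyDer_eq : dualPolyDer (EM := EM) F E
    = ⨆ k : ℤ, derDeg (scaleFun (DualModel F) (Dual E)) (scaleSec F E (DualModel F) (Dual E)) k :=
  rfl

/-- The derivation `Φ_Δ` is determined by `Δ`. -/
lemma IsPhi.eq {Δ : Module.End ℝ (𝒯 F E)}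
    {φs : List (Γ (DualModel F) (Dual E))}
    {Φ : modDer 𝒮 (ΓL F E)} (hΦ : IsPhi Δ φs Φ)
    {δ : modDer 𝒮 (Γ F E)} {g : 𝒮}
    (h1 : ∀ φ, ell (((bundlePair EM F E).dual δ).1.op φ)
      = nestedCommOne Δ (φs.map ell ++ [ell φ]))
    (h2 : ∀ f, projFun F E (δ.1.symb f) = nestedCommOne Δ (φs.map ell ++ [projFun F E f]))
    (h3 : projFun F E g = nestedCommOne Δ (φs.map ell)) (U : ΓL F E) :
    Φ.1.op U = (topOf δ).1.op U + g • U := by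
  obtain ⟨δ', δ'', δL, ψ, k1, k2, k3, k4, k5, -, k6⟩ := hΦ
  have H := linModel EM F E
  have e1 : ψ = g := H.ρ_eq (k5.trans h3.symm)
  have e2 : δ'.1.symb = δ.1.symb := Derivation.ext fun f => H.ρ_eq ((k2 f).trans (h2 f).symm)
  have e3 : ∀ φ, δ'.1.op φ = ((bundlePair EM F E).dual δ).1.op φ := fun φ =>
    H.ℓ_eq ((k1 φ).trans (h1 φ).symm)
  have e4 : δ'' = δ := by
    refine Subtype.ext (Prod.ext (k3.1.symm.trans e2) (LinearMap.ext fun e =>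
      (bundlePair EM F E).eq_of_pair' fun φ => ?_))
    have h4 := (bundlePair EM F E).pair_dual δ φ e
    rw [← e3] at h4
    have h5 := (k3.2 φ e).symm.trans h4
    rw [← k3.1, e2] at h5
    exact sub_right_injective h5
  rw [k6, k4.eq_topOf, e1, e4]

lemma exists_isPhi {Δ : Module.End ℝ (𝒯 F E)}
    {φs : List (Γ (DualModel F) (Dual E))}
    {δ : modDer 𝒮 (Γ F E)} {g : 𝒮}
    (h1 : ∀ φ, ell (((bundlePair EM F E).dual δ).1.op φ)
      = nestedCommOne Δ (φs.map ell ++ [ell φ]))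
    (h2 : ∀ f, projFun F E (δ.1.symb f) = nestedCommOne Δ (φs.map ell ++ [projFun F E f]))
    (h3 : projFun F E g = nestedCommOne Δ (φs.map ell)) :
    ∃ Φ : modDer 𝒮 (ΓL F E), IsPhi Δ φs Φ ∧
      ∀ U, Φ.1.op U = (topOf δ).1.op U + g • U := by
  let D := fsmulL _ (ΓL F E) g (unitDer 𝒮 _).1
  have hD : D ∈ modDer _ _ := fsmul_mem (Subtype.property _) g
  refine ⟨topOf δ + ⟨D, hD⟩, ⟨(bundlePair EM F E).dual δ, δ, topOf δ, g, h1, h2,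
    ⟨rfl, (bundlePair EM F E).pair_dual δ⟩, isTopDer_topOf δ, h3, ?_, fun U => rfl⟩, fun U => rfl⟩
  change (topOf δ).1.symb + g • (0 : Derivation ℝ _ _) = _
  rw [smul_zero, add_zero]

variable (EM F E) in
/-- The Lie-Rinehart algebra of fibre-wise linear differential operators. -/
def bundleDO : GradedModel (bundlePair EM F E) (coreDO (EM := EM) F E) (linDO (EM := EM) F E) :=
  doModel _ (linModel EM F E) _ _ rfl rfl

variable (EM F E) in
/-- The Lie-Rinehart algebra of fibre-wise linear multivectors. -/
def bundleMulti : GradedModel (bundlePair EM F E) (coreMultivector (EM := EM) F E)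
    (linMultivector (EM := EM) F E) :=
  multiModel _ (topAction EM F E) (linModel EM F E) (secModel EM F E F E) _ _
    (scaledMultivector_eq 0) (scaledMultivector_eq 1)

variable (EM F E) in
/-- The Lie-Rinehart algebra of polynomial derivations on the dual bundle. -/
def bundleDer : GradedModel (bundlePair EM F E) (dualPolyFun (EM := EM) F E)
    (dualPolyDer (EM := EM) F E) :=
  derModel (linModelDual EM F E) (secModel EM F E (DualModel F) (Dual E)) (topAction EM F E)
    linModelDual_lin_unit _ _ dualPolyFun_eq dualPolyDer_eq

lemma isDOStructure_bundleDO : IsDOStructure (bundleDO EM F E).toLieRinehart :=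
  ⟨rfl, fun _ _ => rfl, fun _ _ => rfl, fun _ _ => rfl, fun _ _ => rfl⟩

lemma isMultivectorStructure_bundleMulti :
    IsMultivectorStructure (bundleMulti EM F E).toLieRinehart :=
  ⟨funext fun m => by
    by_cases hm : m = 0
    · subst hm; exact (if_pos rfl).symm
    · exact (if_neg (by simpa using hm)).trans (if_neg hm).symm, rfl, fun _ _ => rfl, fun _ _ => rfl,
    fun _ _ => rfl, fun _ _ => rfl⟩

lemma isDerStructure_bundleDer : IsDerStructure (bundleDer EM F E).toLieRinehart :=
  ⟨rfl, fun _ _ => rfl, fun _ _ => rfl, fun _ _ => rfl, fun _ _ => rfl⟩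

open GradedModel

lemma isSymbolPair_of_relL {q : ℕ} {Δ : linDO (EM := EM) F E}
    {D : linMultivector (EM := EM) F E}
    (hr : (Δ, D) ∈ relL (bundleDO EM F E) (bundleMulti EM F E) q) : IsSymbolPair q Δ.1 D.1 := by
  refine ⟨fun l hl => relL_symb _ _ _ hr l hl, fun φs hφ => ?_⟩
  subst hφ
  obtain ⟨δ, g, h1, h2, h3, h4⟩ := relL_op _ _ _ hr φs rfl
  obtain ⟨Φ, hΦ, hU⟩ := exists_isPhi h1 h2 h3
  exact ⟨Φ, hΦ, fun U => by rw [hU]; exact h4 U⟩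

lemma IsSymbolPair.eq {q : ℕ} {Δ : linDO (EM := EM) F E} {D D' : linMultivector (EM := EM) F E}
    (hr : (Δ, D') ∈ relL (bundleDO EM F E) (bundleMulti EM F E) q)
    (hD : D.1 ∈ multivectorDeg F E q) (h : IsSymbolPair q Δ.1 D.1) : D' = D := by
  have hD' : D'.1 ∈ multivectorDeg F E q := (relL_mem hr).2
  refine Subtype.ext (multi_ext_ℓ (linModel EM F E) (secModel EM F E F E)
    (scaledMultivector_eq (EM := EM) (F := F) (E := E) 1 ▸ D'.2)
    (scaledMultivector_eq (EM := EM) (F := F) (E := E) 1 ▸ D.2) (funext fun m => ?_) fun φs U => ?_)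
  · induction m using Quotient.inductionOn with | _ l => ?_
    by_cases hl : l.length = q
    · exact (relL_symb _ _ _ hr l hl).trans (h.1 l hl).symm
    · exact (hD'.2.1 (Multiset.ofList l) hl).trans (hD.2.1 (Multiset.ofList l) hl).symm
  · by_cases hl : φs.length + 1 = q
    · subst hl
      obtain ⟨δ, g, h1, h2, h3, h4⟩ := relL_op _ _ _ hr φs rfl
      obtain ⟨Φ, hΦ, hU⟩ := h.2 φs rfl
      exact (h4 U).trans ((congrArg _ (hΦ.eq h1 h2 h3 U).symm).trans (hU U).symm)
    · have hl' : Multiset.card (Multiset.ofList (φs.map (ellLin EM F E))) + 1 ≠ q := by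
        simpa using hl
      rw [hD.2.2 (Multiset.ofList _) hl', hD'.2.2 (Multiset.ofList _) hl']

/-- The value of a section at a point of the total space. -/
def evalSec (w : TotalSpace G B) : SecLOn (EM := EM) F E G B →ₗ[ℝ] TopFib F E w.proj where
  toFun s := s.1 w
  map_add' _ _ := rfl
  map_smul' _ _ := rfl

lemma bundle_relA_eval {k : ℕ} {P : coreMultivector (EM := EM) F E}
    {f : dualPolyFun (EM := EM) F E} (hr : (P, f) ∈ relA (bundleMulti EM F E) (bundleDer EM F E) k)
    (φ : Γ (DualModel F) (Dual E)) (x : M) : f.1 (dualPt φ x)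
      = (k.factorial : ℝ)⁻¹ * P.1.symb (Multiset.replicate k (ell φ)) (zeroPt x) := by
  rw [eq_inv_mul_iff_mul_eq₀ (by exact_mod_cast k.factorial_ne_zero)]
  exact relA_eval _ _ _ _ _ _ (evalAt (dualPt φ x)) (fun _ => rfl) (fun _ => rfl)
    (evalAt (zeroPt x)).toLinearMap (fun _ => rfl) hr

lemma bundle_relL_eval {k : ℕ} {D : linMultivector (EM := EM) F E}
    {D' : dualPolyDer (EM := EM) F E}
    (hr : (D, D') ∈ relL (bundleMulti EM F E) (bundleDer EM F E) (k + 1))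
    (U : ΓL F E) (φ : Γ (DualModel F) (Dual E)) (x : M) :
    (D'.1.op (projSec F E (DualModel F) (Dual E) U)).1 (dualPt φ x) = (k.factorial : ℝ)⁻¹ •
      (D.1.op (Multiset.replicate k (ell φ)) (projSec F E F E U)).1 (zeroPt x) := by
  refine (eq_inv_smul_iff₀ (β := TopFib F E x) (by exact_mod_cast k.factorial_ne_zero)).2 ?_
  exact relL_eval _ _ _ _ _ _ (evalAt (dualPt φ x)) (fun _ => rfl) (fun _ => rfl)
    (evalSec (zeroPt x)) (evalSec (dualPt φ x)) (fun f s => rfl) (fun U => rfl) hr U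

end Identifications

end Geometry

end FWL

end

open FWL in
theorem mainTheorem1
    {EM : Type*} [NormedAddCommGroup EM] [NormedSpace ℝ EM] [FiniteDimensional ℝ EM]
    {M : Type*} [TopologicalSpace M] [ChartedSpace EM M] [IsManifold 𝓘(ℝ, EM) ∞ M]
    [T2Space M] [SecondCountableTopology M]
    {F : Type*} [NormedAddCommGroup F] [NormedSpace ℝ F] [FiniteDimensional ℝ F]
    {E : M → Type*} [∀ x, AddCommGroup (E x)] [∀ x, Module ℝ (E x)]
    [∀ x, TopologicalSpace (E x)] [∀ x, IsTopologicalAddGroup (E x)]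
    [∀ x, ContinuousSMul ℝ (E x)] [TopologicalSpace (Bundle.TotalSpace F E)]
    [FiberBundle F E] [VectorBundle ℝ F E] [ContMDiffVectorBundle ∞ F E 𝓘(ℝ, EM)] :
    ∃ (S₁ : LieRinehart (coreDO (EM := EM) F E) (linDO (EM := EM) F E))
      (S₂ : LieRinehart (coreMultivector (EM := EM) F E) (linMultivector (EM := EM) F E))
      (S₃ : LieRinehart (dualPolyFun (EM := EM) F E) (dualPolyDer (EM := EM) F E))
      (A : S₁.Iso S₂) (B : S₂.Iso S₃),
      IsDOStructure S₁ ∧ IsMultivectorStructure S₂ ∧ IsDerStructure S₃ ∧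
      -- the identification of core differential operators with core multivectors
      (∀ (p : ℕ) (G : coreDO (EM := EM) F E), G.1 ∈ coreDODeg F E p →
        (A.base G).1 ∈ multivectorDeg F E p ∧
        ∀ l : List (TotFun (EM := EM) F E), l.length = p →
          (A.base G).1.symb l = nestedCommOne G.1 l) ∧
      -- the map `Δ ↦ (σ(Δ), Φ_Δ)`
      (∀ (q : ℕ) (Δ : linDO (EM := EM) F E),
        Δ.1 ∈ linDODeg F E q ↔ (A.equiv Δ).1 ∈ multivectorDeg F E q) ∧
      (∀ (q : ℕ) (Δ : linDO (EM := EM) F E) (D : linMultivector (EM := EM) F E),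
        Δ.1 ∈ linDODeg F E q → D.1 ∈ multivectorDeg F E q →
        (A.equiv Δ = D ↔ IsSymbolPair q Δ.1 D.1)) ∧
      -- the identification of core multivectors with polynomial functions on the dual
      (∀ (k : ℕ) (P : coreMultivector (EM := EM) F E), P.1 ∈ multivectorDeg F E k →
        (B.base P).1 ∈ polyFunDeg (DualModel F) (Dual E) k ∧
        ∀ (φ : Sec (EM := EM) (DualModel F) (Dual E)) (x : M),
          (B.base P).1 (dualPt φ x)
            = (k.factorial : ℝ)⁻¹ * P.1.symb (Multiset.replicate k (ell φ)) (zeroPt x)) ∧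
      -- the map `D ↦ D^*`
      (∀ (k : ℕ) (D : linMultivector (EM := EM) F E), D.1 ∈ multivectorDeg F E k ↔
        (B.equiv D).1 ∈ polyDerDeg F E (DualModel F) (Dual E) ((k : ℤ) - 1)) ∧
      (∀ (D : linMultivector (EM := EM) F E) (U : SecL (EM := EM) F E),
        D.1 ∈ multivectorDeg F E 0 →
        (B.equiv D).1.op (projSec F E (DualModel F) (Dual E) U) = 0) ∧
      (∀ (k : ℕ) (D : linMultivector (EM := EM) F E) (U : SecL (EM := EM) F E)
        (φ : Sec (EM := EM) (DualModel F) (Dual E)) (x : M),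
        D.1 ∈ multivectorDeg F E (k + 1) →
        ((B.equiv D).1.op (projSec F E (DualModel F) (Dual E) U)).1 (dualPt φ x)
          = (k.factorial : ℝ)⁻¹ •
            (D.1.op (Multiset.replicate k (ell φ)) (projSec F E F E U)).1 (zeroPt x)) := by
  obtain ⟨A, hA, hA', hA''⟩ := GradedModel.exists_iso (bundleDO EM F E) (bundleMulti EM F E)
  obtain ⟨B, hB, hB', hB''⟩ := GradedModel.exists_iso (bundleMulti EM F E) (bundleDer EM F E)
  refine ⟨_, _, _, A, B, isDOStructure_bundleDO, isMultivectorStructure_bundleMulti,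
    isDerStructure_bundleDer, fun p G hG => ⟨(GradedModel.relA_mem (hA p G hG)).2,
      relA_symb _ _ _ (hA p G hG)⟩,
    fun q Δ => ⟨fun h => (GradedModel.relL_mem (hA' q Δ h)).2, hA'' q Δ⟩,
    fun q Δ D hΔ hD => ⟨fun h => h ▸ isSymbolPair_of_relL (hA' q Δ hΔ),
      IsSymbolPair.eq (hA' q Δ hΔ) hD⟩, fun k P hP => ⟨?_, bundle_relA_eval (hB k P hP)⟩,
    fun k D => ⟨fun h => (GradedModel.relL_mem (hB' k D h)).2, hB'' k D⟩,
    fun D U hD => relL_op_zero _ _ _ _ _ _ (hB' 0 D hD) U,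
    fun k D U φ x hD => bundle_relL_eval (hB' (k + 1) D hD) U φ x⟩
  rw [polyFunDeg_eq_wt]
  exact (GradedModel.relA_mem (hB k P hP)).2
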